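/- **Notation.** $p(x)=\tfrac12 e^{-|x|}$, $x\in\mathbb R$, and $*$ is convolution on $\mathbb R$. All functions are real-valued, and $\|w\|_{W^{1,\infty}}=\|w\|_{L^\infty(\mathbb R)}+\|w_x\|_{L^\infty(\mathbb R)}$. Let $\chi\in C_c^\infty(\mathbb R)$ be an even function with values in $[0,1]$, equal to $1$ for $|\xi|\le\frac34$ and supported in $|\xi|\le\frac43$; put $\varphi(\xi)=\chi(\xi/2)-\chi(\xi)$, $\Delta_{-1}=\chi(D)$, $\Delta_j=\varphi(2^{-j}D)$ for $j\ge0$, and $\Delta_j=0$ for $j\le-2$. The Besov space $B^2_{2,1}(\mathbb R)$ consists of the tempered distributions $f$ with $\|f\|_{B^2_{2,1}}=\sum_{j\in\mathbb Z}2^{2j}\|\Delta_j f\|_{L^2(\mathbb R)}<\infty$ (its elements are identified with their continuous representatives). For a differential expression $F(u,v)$ consider the Cauchy problem $$ \begin{cases} u_t+uvu_x+p*F(u,v)=0,\\ v_t+vuv_x+p*F(v,u)=0,\\ u(0,x)=u_0(x),\quad v(0,x)=v_0(x). \end{cases} \tag{P} $$ The Geng–Xue system is (P) with $$F(u,v)=3uvu_x+2uv_xu_{xx}+2u_x^2v_x+uv_{xx}u_x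 ,$$ and the two-component $b$-family system with cubic nonlinearity, $b\in\mathbb R$, is (P) with $$F(u,v)=b\,uvu_x+(3-b)\,u_xvu_{xx}+2uv_xu_{xx}+2u_x^2v_x+uv_{xx}u_x .$$ A solution of (P) on $[0,T)$ is a pair $(u,v)\in C\big([0,T);B^2_{2,1}(\mathbb R)\times B^2_{2,1}(\mathbb R)\big)$ that satisfies (P) for all $(t,x)\in[0,T)\times\mathbb R$. We say that $T\in(0,\infty]$ is the maximal existence time of the solution $(u,v)$ if $(u,v)$ is a solution on $[0,T)$ that does not extend to a solution on $[0,T')$ for any $T'>T$. **Theorem 1.1.** Let $(u_0,v_0)\in B^2_{2,1}(\mathbb R)\times B^2_{2,1}(\mathbb R)$, and let $T$ be the maximal existence time of the solution $(u,v)$ of the Geng–Xue system with initial data $(u_0,v_0)$. If $T<\infty$, then $$\int_0^T\|u(t)\|_{W^{1,\infty}}\,\|v(t)\|_{W^{1,\infty}}\,dt=\infty .$$ Moreover, for every $b\in\mathbb R$, the same statement holds for the two-component $b$-family system in place of the Geng–Xue system. -/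

import Mathlib

open MeasureTheory Filter Topology
open scoped ENNReal SchwartzMap Convolution

/-! ### Littlewood–Paley decomposition and nonhomogeneous Besov spaces on the real line -/

namespace Besov

/-- The bump function behind the low-frequency cut-off. -/
noncomputable def lowBump : ContDiffBump (0 : ℝ) where
  rIn := 3 / 4
  rOut := 4 / 3
  rIn_pos := by norm_num
  rIn_lt_rOut := by norm_num

/-- The low-frequency cut-off `χ`: smooth, even, with values in `[0, 1]`, equal to `1` for
`|ξ| ≤ 3/4` and supported in `|ξ| ≤ 4/3`. -/
noncomputable def chi (ξ : ℝ) : ℝ := lowBump ξ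

/-- The annular cut-off `φ(ξ) = χ(ξ/2) - χ(ξ)`: smooth, even, with values in `[0, 1]`, supported in
`3/4 ≤ |ξ| ≤ 8/3`. -/
noncomputable def phi (ξ : ℝ) : ℝ := chi (ξ / 2) - chi ξ

/-- The symbol of `Δ_j` in the angular frequency `η`: it is `χ(η)` for `j = -1`, `φ(2^{-j} η)` for
`j ≥ 0`, and `0` for `j ≤ -2`. -/
noncomputable def dyadicSymbol (j : ℤ) (η : ℝ) : ℝ :=
  if j = -1 then chi η else if 0 ≤ j then phi ((2 : ℝ) ^ (-j) * η) else 0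

/-- The block `Δ_j` as a Fourier multiplier on tempered distributions. Mathlib's Fourier transform
uses the kernel `exp (-2π i x ξ)`, so that the angular frequency is `2π ξ`. -/
noncomputable def block (j : ℤ) : 𝓢'(ℝ, ℂ) →L[ℂ] 𝓢'(ℝ, ℂ) :=
  TemperedDistribution.fourierMultiplierCLM ℂ
    (fun ξ : ℝ => ((dyadicSymbol j (2 * Real.pi * ξ) : ℝ) : ℂ))

/-- The `L^p` norm of a tempered distribution (`∞` if it is not given by an `L^p` function). -/
noncomputable def distLpNorm (p : ℝ≥0∞) [Fact (1 ≤ p)] (S : 𝓢'(ℝ, ℂ)) : ℝ≥0∞ :=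
  ⨅ (g : Lp ℂ p (volume : Measure ℝ)) (_ : Lp.toTemperedDistribution g = S), ‖g‖ₑ

/-- The norm of the nonhomogeneous Besov space `B^s_{p,r}(ℝ)` on tempered distributions: the
`ℓ^r(ℤ)` norm of the sequence `2^{js} ‖Δ_j S‖_{L^p}`. -/
noncomputable def distNorm (s : ℝ) (p : ℝ≥0∞) [Fact (1 ≤ p)] (r : ℝ≥0∞) (S : 𝓢'(ℝ, ℂ)) : ℝ≥0∞ :=
  eLpNorm (fun j : ℤ => (2 : ℝ≥0∞) ^ ((j : ℝ) * s) * distLpNorm p (block j S)) r Measure.count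

/-- The function `f` defines the tempered distribution `S`. -/
def Represents (f : ℝ → ℝ) (S : 𝓢'(ℝ, ℂ)) : Prop :=
  ∀ θ : 𝓢(ℝ, ℂ), Integrable (fun x => θ x * (f x : ℂ)) ∧ S θ = ∫ x, θ x * (f x : ℂ)

/-- The `B^s_{p,r}(ℝ)` norm of a real function (`∞` if the function does not define a tempered
distribution). -/
noncomputable def fnNorm (s : ℝ) (p : ℝ≥0∞) [Fact (1 ≤ p)] (r : ℝ≥0∞) (f : ℝ → ℝ) : ℝ≥0∞ :=
  ⨅ (S : 𝓢'(ℝ, ℂ)) (_ : Represents f S), distNorm s p r S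

/-- The real function `f` belongs to `B^s_{p,r}(ℝ)`. -/
def Mem (s : ℝ) (p : ℝ≥0∞) [Fact (1 ≤ p)] (r : ℝ≥0∞) (f : ℝ → ℝ) : Prop :=
  fnNorm s p r f < ∞

/-- The cut-offs form a dyadic partition of unity: the partial sums telescope to a function that
is `1` on `|η| ≤ (3/4) 2^N`. -/
theorem chi_add_sum_phi (N : ℕ) (η : ℝ) :
    chi η + ∑ j ∈ Finset.range N, phi ((2 : ℝ) ^ (-(j : ℤ)) * η)
      = chi ((2 : ℝ) ^ (-(N : ℤ)) * η) := by
  induction N with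
  | zero => simp
  | succ k ih =>
    have h : (2 : ℝ) ^ (-(k : ℤ)) * η / 2 = (2 : ℝ) ^ (-((k + 1 : ℕ) : ℤ)) * η := by
      push_cast
      rw [neg_add, zpow_add₀ two_ne_zero]
      norm_num
      ring
    rw [Finset.sum_range_succ, ← add_assoc, ih, phi, h]
    ring

theorem contDiff_chi {n : ℕ∞} : ContDiff ℝ n chi := lowBump.contDiff

theorem hasCompactSupport_chi : HasCompactSupport chi := lowBump.hasCompactSupport

theorem hasCompactSupport_phi : HasCompactSupport phi := by
  have h : HasCompactSupport (fun ξ : ℝ => chi (ξ / 2)) := by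
    simpa [div_eq_inv_mul] using
      hasCompactSupport_chi.comp_smul (c := (2⁻¹ : ℝ)) (by norm_num)
  exact h.sub hasCompactSupport_chi

/-- The symbol of every block is smooth with compact support, hence a genuine Fourier multiplier. -/
theorem dyadicSymbol_hasTemperateGrowth (j : ℤ) :
    (fun ξ : ℝ => ((dyadicSymbol j (2 * Real.pi * ξ) : ℝ) : ℂ)).HasTemperateGrowth := by
  have hphi : ContDiff ℝ ((⊤ : ℕ∞) : WithTop ℕ∞) phi := by
    unfold phi
    exact (contDiff_chi.comp (contDiff_id.div_const 2)).sub contDiff_chi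
  have key : ∀ (g : ℝ → ℝ) (c : ℝ), ContDiff ℝ ((⊤ : ℕ∞) : WithTop ℕ∞) g → HasCompactSupport g →
      c ≠ 0 → (fun ξ : ℝ => ((g (c * ξ) : ℝ) : ℂ)).HasTemperateGrowth := by
    intro g c hg hs hc
    have h1 : HasCompactSupport (fun ξ : ℝ => g (c * ξ)) := by
      simpa using hs.comp_smul hc
    have h2 : HasCompactSupport (fun ξ : ℝ => ((g (c * ξ) : ℝ) : ℂ)) :=
      h1.comp_left (g := ((↑) : ℝ → ℂ)) (by simp)
    have h3 : ContDiff ℝ ((⊤ : ℕ∞) : WithTop ℕ∞) (fun ξ : ℝ => ((g (c * ξ) : ℝ) : ℂ)) :=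
      Complex.ofRealCLM.contDiff.comp (hg.comp (contDiff_const.mul contDiff_id))
    exact h2.hasTemperateGrowth h3
  unfold dyadicSymbol
  split_ifs with h0 h1
  · exact key chi _ contDiff_chi hasCompactSupport_chi (by positivity)
  · have := key phi ((2 : ℝ) ^ (-j) * (2 * Real.pi)) hphi hasCompactSupport_phi (by positivity)
    simpa [mul_assoc] using this
  · simp

end Besov

/-! ### The Geng–Xue system and the two-component `b`-family -/

namespace GengXue

/-- The Green function `p(x) = e^{-|x|} / 2` of `1 - ∂_x²`. -/
noncomputable def green (x : ℝ) : ℝ := Real.exp (-|x|) / 2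

/-- The local expression under the convolution in the first equation of the Geng–Xue system,
`3 u v u_x + 2 u v_x u_xx + 2 u_x² v_x + u v_xx u_x`; the second equation has the same expression
with `u` and `v` exchanged. It is used for `u`, `v` in `H²(ℝ)`: then `u_x`, `v_x` are absolutely
continuous, and `deriv (deriv u)` is the weak second derivative, almost everywhere. -/
noncomputable def forcing (u v : ℝ → ℝ) (x : ℝ) : ℝ :=
  3 * u x * v x * deriv u x + 2 * u x * deriv v x * deriv (deriv u) x
    + 2 * deriv u x ^ 2 * deriv v x + u x * deriv (deriv v) x * deriv u x

/-- The corresponding expression of the two-component `b`-family,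
`b u v u_x + (3 - b) u_x v u_xx + 2 u v_x u_xx + 2 u_x² v_x + u v_xx u_x`. -/
noncomputable def bForcing (b : ℝ) (u v : ℝ → ℝ) (x : ℝ) : ℝ :=
  b * u x * v x * deriv u x + (3 - b) * deriv u x * v x * deriv (deriv u) x
    + 2 * u x * deriv v x * deriv (deriv u) x
    + 2 * deriv u x ^ 2 * deriv v x + u x * deriv (deriv v) x * deriv u x

/-- The time interval `[0, T)`, for `0 < T ≤ ∞`. -/
def timeInterval (T : ℝ≥0∞) : Set ℝ := {t | 0 ≤ t ∧ ENNReal.ofReal t < T}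

/-- `w` belongs to `C([0, T); B^2_{2,1}(ℝ))`; each `w t` is the continuous representative. -/
structure IsBesovCurve (T : ℝ≥0∞) (w : ℝ → ℝ → ℝ) : Prop where
  continuous_space : ∀ t ∈ timeInterval T, Continuous (w t)
  mem : ∀ t ∈ timeInterval T, Besov.Mem 2 2 1 (w t)
  continuous_time : ∀ t ∈ timeInterval T,
    Tendsto (fun s => Besov.fnNorm 2 2 1 (fun x => w s x - w t x)) (𝓝[timeInterval T] t) (𝓝 0)

/-- `(u, v)` is a solution on `[0, T)`, of class `C([0, T); B^2_{2,1} × B^2_{2,1})`, of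

`u_t + u v u_x + p * F(u, v) = 0`, `v_t + v u v_x + p * F(v, u) = 0`

with the initial data `(u₀, v₀)`. For curves of this class `u v u_x` and `p * F(u, v)` are
continuous in time with values in `B^1_{2,1}(ℝ)`, which consists of continuous functions; so the
equations hold for every `(t, x)`, with a classical time derivative (one-sided at `t = 0`). -/
structure IsSolution (F : (ℝ → ℝ) → (ℝ → ℝ) → ℝ → ℝ) (u₀ v₀ : ℝ → ℝ) (T : ℝ≥0∞)
    (u v : ℝ → ℝ → ℝ) : Prop where
  curve_u : IsBesovCurve T u
  curve_v : IsBesovCurve T v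
  initial_u : u 0 =ᵐ[volume] u₀
  initial_v : v 0 =ᵐ[volume] v₀
  eq_u : ∀ t ∈ timeInterval T, ∀ x : ℝ, HasDerivWithinAt (fun s => u s x)
    (-(u t x * v t x * deriv (u t) x
      + (green ⋆[ContinuousLinearMap.mul ℝ ℝ] F (u t) (v t)) x)) (timeInterval T) t
  eq_v : ∀ t ∈ timeInterval T, ∀ x : ℝ, HasDerivWithinAt (fun s => v s x)
    (-(v t x * u t x * deriv (v t) x
      + (green ⋆[ContinuousLinearMap.mul ℝ ℝ] F (v t) (u t)) x)) (timeInterval T) t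

/-- `T ∈ (0, ∞]` is the maximal existence time of the solution `(u, v)`: the pair solves the Cauchy
problem on `[0, T)` and does not extend to a solution on a longer interval. -/
structure IsMaximalSolution (F : (ℝ → ℝ) → (ℝ → ℝ) → ℝ → ℝ) (u₀ v₀ : ℝ → ℝ) (T : ℝ≥0∞)
    (u v : ℝ → ℝ → ℝ) : Prop where
  pos : 0 < T
  isSolution : IsSolution F u₀ v₀ T u v
  maximal : ∀ (T' : ℝ≥0∞) (u' v' : ℝ → ℝ → ℝ), IsSolution F u₀ v₀ T' u' v' →
    (∀ t ∈ timeInterval T, u' t = u t ∧ v' t = v t) → T' ≤ T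

/-- The `W^{1,∞}(ℝ)` norm `‖w‖_{L^∞} + ‖w_x‖_{L^∞}` (used for `w` of class `C¹`). -/
noncomputable def W1InftyNorm (w : ℝ → ℝ) : ℝ≥0∞ :=
  eLpNorm w ∞ volume + eLpNorm (deriv w) ∞ volume

end GengXue

/-! Write `m = u - u_xx` and `n = v - v_xx`, so that `u = p * m` and `v = p * n`; then `u, v` lie in
`B^2_{2,1}` exactly when `m, n` lie in `B^0_{2,1}`. In these unknowns the `b`-family is `m_t + u v
m_x + b v u_x m = 0` together with the equation obtained by exchanging the two components, and
Geng–Xue is the case `b = 3`. `bForcing_identity` gives the weak form of this statement, in which no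
derivative falls on `m`.

The momenta are transported along the characteristics `X_t = (u v)(X)`, with zeroth order
coefficients that are products of one of `u, u_x` and one of `v, v_x`. Hence the growth rate of
`‖m‖² + ‖n‖²` in `L²` is at most a constant times `‖u‖_{W^{1,∞}} ‖v‖_{W^{1,∞}}`
(`LagFlow.exists_hasDerivAt_integral_sq`). If the integral in the theorem were finite, Gronwall's
inequality would bound the `L²` norms of the momenta on `[0, T)` (`IsMomentumCurve.l2norm_sq_le`).
It then suffices that the lifespan is bounded below by the `L²` norms of the momenta alone: a
restart shortly before `T` passes `T`, against maximality (`eq_top_of_l2norm_le`).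

The lifespan bound comes from Lagrangian coordinates. With `X = ξ + ζ`, `X_ξ = e^k` and `m(X) e^k =
e^θ m₀`, the potentials `u ∘ X` and `u_x ∘ X` are integrals of `m₀` against exponentially decaying
kernels that are Lipschitz on each half-line. The system for `ζ, k, θ` and the exponent `κ` of `n`
is therefore an ordinary differential equation with Lipschitz right-hand side in bounded continuous
functions, with constants depending only on `b` and the `L²` norms of `m₀, n₀` (`exists_lagFlow`).

Besov regularity of this solution is a separate matter. The map `m₀ ↦ m(t)` is a weighted
composition operator; it and its adjoint are bounded on `L²` and on functions with an `L²` upper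
gradient (that is, on `H¹`). Such an operator has blocks `Δ_j L Δ_k` of size `2^{-|j-k|}`
(`PreservesUG.norm_blk_le`), so it acts on `B^0_{2,1}`, and strong continuity in `L²` becomes
continuity in `B^0_{2,1}` (`tendsto_besovSum`).

A given solution must finally be identified with the one built from characteristics. This is
uniqueness (`IsMomentumCurve.unique`), an energy estimate for the `H¹` norm of the difference of two
solutions, written as the pairing of `p * μ` with the difference `μ` of the momenta. -/

open FourierTransform ComplexInnerProductSpace
open GengXue

/-! ### Absolutely continuous functions on the line with a prescribed derivative -/

/-- `f` is absolutely continuous on every bounded interval, with derivative `g` almost everywhere. -/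
structure IsPrim (f g : ℝ → ℝ) : Prop where
  ac : ∀ a b, AbsolutelyContinuousOnInterval f a b
  ae : ∀ᵐ x, HasDerivAt f (g x) x

namespace IsPrim

variable {f g f' g' h : ℝ → ℝ}

theorem integral_eq (hf : IsPrim f f') (a b : ℝ) : ∫ x in a..b, f' x = f b - f a := by
  rw [← (hf.ac a b).integral_deriv_eq_sub]
  exact intervalIntegral.integral_congr_ae (hf.ae.mono fun x hx _ => hx.deriv.symm)

theorem continuous (hf : IsPrim f f') : Continuous f := by
  rw [continuous_iff_continuousAt]
  intro x
  have := (hf.ac (x - 1) (x + 1)).continuousOn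
  refine this.continuousAt ?_
  rw [Set.uIcc_of_le (by linarith)]
  exact Icc_mem_nhds (by linarith) (by linarith)

theorem add (hf : IsPrim f f') (hg : IsPrim g g') :
    IsPrim (fun x => f x + g x) (fun x => f' x + g' x) :=
  ⟨fun a b => (hf.ac a b).fun_add (hg.ac a b), by
    filter_upwards [hf.ae, hg.ae] with x h1 h2 using h1.add h2⟩

theorem sub (hf : IsPrim f f') (hg : IsPrim g g') :
    IsPrim (fun x => f x - g x) (fun x => f' x - g' x) :=
  ⟨fun a b => (hf.ac a b).fun_sub (hg.ac a b), by
    filter_upwards [hf.ae, hg.ae] with x h1 h2 using h1.sub h2⟩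

theorem mul (hf : IsPrim f f') (hg : IsPrim g g') :
    IsPrim (fun x => f x * g x) (fun x => f' x * g x + f x * g' x) :=
  ⟨fun a b => (hf.ac a b).fun_mul (hg.ac a b), by
    filter_upwards [hf.ae, hg.ae] with x h1 h2 using h1.mul h2⟩

theorem congr (hf : IsPrim f f') (h : f' =ᵐ[volume] g') : IsPrim f g' :=
  ⟨hf.ac, by filter_upwards [hf.ae, h] with x h1 h2 using h2 ▸ h1⟩

theorem of_hasDerivAt (hf : ∀ x, HasDerivAt f (f' x) x) (hc : Continuous f') : IsPrim f f' := by
  refine ⟨fun a b => ?_, Eventually.of_forall hf⟩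
  have : ContDiff ℝ 1 f := by
    rw [contDiff_one_iff_deriv]
    refine ⟨fun x => (hf x).differentiableAt, ?_⟩
    rwa [funext fun x => (hf x).deriv]
  exact this.contDiffOn.absolutelyContinuousOnInterval

theorem const (c : ℝ) : IsPrim (fun _ => c) (fun _ => 0) :=
  of_hasDerivAt (fun x => hasDerivAt_const x c) continuous_const

theorem const_mul (c : ℝ) (hf : IsPrim f f') : IsPrim (fun x => c * f x) (fun x => c * f' x) := by
  simpa using (const c).mul hf

theorem of_integral (hg : LocallyIntegrable g volume) (c : ℝ) :
    IsPrim (fun x => c + ∫ t in (0 : ℝ)..x, g t) g := by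
  have hi : ∀ a b, IntervalIntegrable g volume a b := fun a b =>
    (hg.integrableOn_isCompact isCompact_uIcc).intervalIntegrable
  refine ⟨fun a b => ?_, ?_⟩
  · have h0 := (const c).ac a b
    refine h0.fun_add ?_
    have h1 : AbsolutelyContinuousOnInterval (fun x => ∫ t in a..x, g t) a b :=
      (hi a b).absolutelyContinuousOnInterval_intervalIntegral Set.left_mem_uIcc
    have h2 := ((const (∫ t in (0 : ℝ)..a, g t)).ac a b).fun_add h1
    have e : (fun x => (∫ t in (0 : ℝ)..a, g t) + ∫ t in a..x, g t) =
        fun x => ∫ t in (0 : ℝ)..x, g t := by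
      funext x
      exact intervalIntegral.integral_add_adjacent_intervals (hi _ _) (hi _ _)
    rwa [e] at h2
  · filter_upwards [_root_.LocallyIntegrable.ae_hasDerivAt_integral hg] with x hx
    exact (hx 0).const_add c

/-- A `C¹` function with continuous a.e. derivative is differentiable everywhere. -/
theorem hasDerivAt (hf : IsPrim f f') (hc : Continuous f') (x : ℝ) : HasDerivAt f (f' x) x := by
  have h := intervalIntegral.integral_hasDerivAt_right (hc.intervalIntegrable 0 x)
    (hc.stronglyMeasurableAtFilter _ _) hc.continuousAt
  have e : f = fun x => f 0 + ∫ t in (0 : ℝ)..x, f' t := by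
    funext y; rw [hf.integral_eq]; ring
  rw [e]
  exact h.const_add _

end IsPrim

/-! ### Integral operators with an exponentially decaying kernel -/

/-- The kernel `e^{-a|x-y|}`. -/
noncomputable def expKer (a x y : ℝ) : ℝ := Real.exp (-(a * |x - y|))

theorem expKer_pos (a x y : ℝ) : 0 < expKer a x y := Real.exp_pos _

theorem expKer_le_one {a : ℝ} (ha : 0 < a) (x y : ℝ) : expKer a x y ≤ 1 := by
  unfold expKer
  rw [Real.exp_le_one_iff]
  have : 0 ≤ a * |x - y| := by positivity
  linarith

@[fun_prop]
theorem continuous_expKer (a : ℝ) : Continuous (fun z : ℝ × ℝ => expKer a z.1 z.2) := by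
  unfold expKer; fun_prop

@[fun_prop]
theorem continuous_expKer_right (a x : ℝ) : Continuous (expKer a x) := by
  unfold expKer; fun_prop

theorem expKer_comm (a x y : ℝ) : expKer a x y = expKer a y x := by
  unfold expKer; rw [abs_sub_comm]

theorem integrable_expKer_zero {a : ℝ} (ha : 0 < a) :
    Integrable (fun y => Real.exp (-(a * |y|))) := by
  have h1 : IntegrableOn (fun y => Real.exp (-a * y)) (Set.Ioi 0) := by
    simpa using exp_neg_integrableOn_Ioi 0 ha
  have h2 : IntegrableOn (fun y => Real.exp (-(a * |y|))) (Set.Ioi 0) :=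
    h1.congr_fun (fun y hy => by simp [abs_of_pos (Set.mem_Ioi.1 hy)]) measurableSet_Ioi
  have h3 : IntegrableOn (fun y => Real.exp (-(a * |y|))) (Set.Iic 0) := by
    refine (integrableOn_exp_mul_Iic ha 0).congr_fun (fun y hy => ?_) measurableSet_Iic
    simp [abs_of_nonpos (Set.mem_Iic.1 hy)]
  have := h3.union h2
  rwa [Set.Iic_union_Ioi, integrableOn_univ] at this

theorem integrable_expKer {a : ℝ} (ha : 0 < a) (x : ℝ) : Integrable (expKer a x) := by
  have := (integrable_expKer_zero ha).comp_sub_left x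
  exact this

theorem integral_expKer {a : ℝ} (ha : 0 < a) (x : ℝ) : ∫ y, expKer a x y = 2 / a := by
  unfold expKer
  rw [integral_sub_left_eq_self (fun y => Real.exp (-(a * |y|))) volume x]
  rw [integral_comp_abs (f := fun y => Real.exp (-(a * y)))]
  have := integral_exp_neg_mul_rpow (p := 1) (b := a) one_pos ha
  have h2 := integral_exp_mul_Ioi (a := -a) (by linarith) 0
  simp only [neg_mul] at h2
  rw [h2]
  field_simp
  simp

theorem lintegral_expKer {a : ℝ} (ha : 0 < a) (x : ℝ) :
    ∫⁻ y, ENNReal.ofReal (expKer a x y) = ENNReal.ofReal (2 / a) := by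
  rw [← integral_expKer ha x, ofReal_integral_eq_lintegral_ofReal (integrable_expKer ha x)]
  exact Eventually.of_forall fun y => (expKer_pos a x y).le

/-- Cauchy–Schwarz after the splitting `k F = k^{1/2} · k^{1/2} F`. It lets a kernel of finite mass
act on `L²`, both in norm and pointwise. -/
theorem lintegral_sq_le {α : Type*} [MeasurableSpace α] {μ : Measure α} {k F : α → ℝ≥0∞}
    (hk : AEMeasurable k μ) (hF : AEMeasurable F μ) :
    (∫⁻ y, k y * F y ∂μ) ^ 2 ≤ (∫⁻ y, k y ∂μ) * ∫⁻ y, k y * F y ^ 2 ∂μ := by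
  have h := ENNReal.lintegral_mul_le_Lp_mul_Lq μ Real.HolderConjugate.two_two
    (f := fun y => k y ^ (1 / 2 : ℝ)) (g := fun y => k y ^ (1 / 2 : ℝ) * F y)
    (hk.pow_const _) ((hk.pow_const _).mul hF)
  have e1 : ∀ y, k y ^ (1 / 2 : ℝ) * (k y ^ (1 / 2 : ℝ) * F y) = k y * F y := fun y => by
    rw [← mul_assoc, ← ENNReal.rpow_add_of_nonneg _ _ (by norm_num) (by norm_num)]; norm_num
  have e2 : ∀ y, (k y ^ (1 / 2 : ℝ)) ^ (2 : ℝ) = k y := fun y => by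
    rw [← ENNReal.rpow_mul]; norm_num
  have e3 : ∀ y, (k y ^ (1 / 2 : ℝ) * F y) ^ (2 : ℝ) = k y * F y ^ 2 := fun y => by
    rw [ENNReal.mul_rpow_of_nonneg _ _ (by norm_num), e2]; norm_num
  simp only [Pi.mul_apply, e1, e2, e3] at h
  calc _ ≤ _ := pow_le_pow_left' h 2
    _ = _ := by
      rw [mul_pow, ← ENNReal.rpow_natCast, ← ENNReal.rpow_natCast, ← ENNReal.rpow_mul,
        ← ENNReal.rpow_mul]
      norm_num

section kernel

variable {E : Type*} [NormedAddCommGroup E]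

theorem eLpNorm_two_sq (f : ℝ → E) :
    eLpNorm f 2 volume ^ 2 = ∫⁻ x, ‖f x‖ₑ ^ 2 := by
  rw [eLpNorm_eq_lintegral_rpow_enorm_toReal (by norm_num) (by norm_num), ← ENNReal.rpow_natCast,
    ← ENNReal.rpow_mul]
  norm_num

/-- Young's inequality for the exponential kernel, in `L²`. -/
theorem eLpNorm_expKer_le {a : ℝ} (ha : 0 < a) {f : ℝ → E} (hf : AEStronglyMeasurable f)
    {F : Type*} [NormedAddCommGroup F] {T : ℝ → F}
    (hT : ∀ x, ‖T x‖ₑ ≤ ∫⁻ y, ENNReal.ofReal (expKer a x y) * ‖f y‖ₑ) :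
    eLpNorm T 2 volume ≤ ENNReal.ofReal (2 / a) * eLpNorm f 2 volume := by
  have hk : Measurable fun z : ℝ × ℝ => ENNReal.ofReal (expKer a z.1 z.2) :=
    (continuous_expKer a).measurable.ennreal_ofReal
  have key : eLpNorm T 2 volume ^ 2 ≤ (ENNReal.ofReal (2 / a) * eLpNorm f 2 volume) ^ 2 := by
    rw [mul_pow, eLpNorm_two_sq, eLpNorm_two_sq]
    -- Schur test: one factor `2 / a` is the mass of a row, from Cauchy–Schwarz in `y`; the other is
    -- the mass of a column, from the integral in `x` after Tonelli.
    calc ∫⁻ x, ‖T x‖ₑ ^ 2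
        ≤ ∫⁻ x, ENNReal.ofReal (2 / a) * ∫⁻ y, ENNReal.ofReal (expKer a x y) * ‖f y‖ₑ ^ 2 := by
          refine lintegral_mono fun x => (pow_le_pow_left' (hT x) 2).trans ?_
          rw [← lintegral_expKer ha x]
          exact lintegral_sq_le (by fun_prop) hf.enorm
      _ = ENNReal.ofReal (2 / a) * ∫⁻ x, ∫⁻ y, ENNReal.ofReal (expKer a x y) * ‖f y‖ₑ ^ 2 := by
          rw [lintegral_const_mul' _ _ ENNReal.ofReal_ne_top]
      _ = ENNReal.ofReal (2 / a) * ∫⁻ y, ∫⁻ x, ENNReal.ofReal (expKer a x y) * ‖f y‖ₑ ^ 2 := by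
          rw [lintegral_lintegral_swap]
          refine hk.aemeasurable.mul ?_
          exact (hf.enorm.pow_const 2).comp_quasiMeasurePreserving Measure.quasiMeasurePreserving_snd
      _ = ENNReal.ofReal (2 / a) * ∫⁻ y, ENNReal.ofReal (2 / a) * ‖f y‖ₑ ^ 2 := by
          congr 1
          refine lintegral_congr fun y => ?_
          rw [lintegral_mul_const' _ _ (by simp)]
          congr 1
          rw [← lintegral_expKer ha y]
          exact lintegral_congr fun x => by rw [expKer_comm]
      _ = _ := by rw [lintegral_const_mul' _ _ ENNReal.ofReal_ne_top, ← mul_assoc, sq]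
  exact (ENNReal.pow_le_pow_left_iff two_ne_zero).1 key

theorem memLp_expKer {a : ℝ} (ha : 0 < a) (x : ℝ) : MemLp (expKer a x) 2 := by
  rw [memLp_two_iff_integrable_sq (by fun_prop)]
  have : (fun y => expKer a x y ^ 2) = expKer (2 * a) x := by
    funext y; unfold expKer; rw [← Real.exp_nat_mul]; congr 1; push_cast; ring
  rw [this]
  exact integrable_expKer (by positivity) x

theorem integrable_expKer_mul {a : ℝ} (ha : 0 < a) (x : ℝ) {f : ℝ → ℝ} (hf : MemLp f 2) :
    Integrable (fun y => expKer a x y * f y) :=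
  (memLp_expKer ha x).integrable_mul hf

/-- Since the kernel is at most `1`, the square of the left side is at most `2 / a` times the
squared `L²` norm, and `2 / a ≤ (1 + 1 / a)²`. -/
theorem lintegral_expKer_mul_le {a : ℝ} (ha : 0 < a) (x : ℝ) {f : ℝ → E}
    (hf : AEStronglyMeasurable f) :
    ∫⁻ y, ENNReal.ofReal (expKer a x y) * ‖f y‖ₑ
      ≤ ENNReal.ofReal (1 + 1 / a) * eLpNorm f 2 volume := by
  have h := lintegral_sq_le (μ := volume) (k := fun y => ENNReal.ofReal (expKer a x y))
    (F := fun y => ‖f y‖ₑ) (by fun_prop) hf.enorm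
  rw [lintegral_expKer ha] at h
  refine (ENNReal.pow_le_pow_left_iff two_ne_zero).1 (h.trans ?_)
  rw [mul_pow, eLpNorm_two_sq, ← ENNReal.ofReal_pow (by positivity)]
  gcongr
  · have : 0 < 1 / a := by positivity
    have e : 2 / a = 2 * (1 / a) := by ring
    nlinarith
  · calc _ ≤ 1 * ‖f _‖ₑ ^ 2 := by
          gcongr
          rw [← ENNReal.ofReal_one]
          exact ENNReal.ofReal_le_ofReal (expKer_le_one ha _ _)
      _ = _ := one_mul _

end kernel

/-! ### Integrals of derivatives over half-lines and over the line. -/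

namespace IsPrim

variable {F F' : ℝ → ℝ}

theorem integral_Iic (h : IsPrim F F') {x : ℝ} (hF' : IntegrableOn F' (Set.Iic x)) {l : ℝ}
    (h0 : Tendsto F atBot (𝓝 l)) : ∫ y in Set.Iic x, F' y = F x - l := by
  refine tendsto_nhds_unique (intervalIntegral_tendsto_integral_Iic x hF'
    (tendsto_id (x := atBot))) ?_
  exact (h0.const_sub (F x)).congr fun y => by rw [id, h.integral_eq]

theorem integral_Ioi (h : IsPrim F F') {x : ℝ} (hF' : IntegrableOn F' (Set.Ioi x)) {l : ℝ}
    (h0 : Tendsto F atTop (𝓝 l)) : ∫ y in Set.Ioi x, F' y = l - F x := by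
  refine tendsto_nhds_unique (intervalIntegral_tendsto_integral_Ioi x hF'
    (tendsto_id (x := atTop))) ?_
  exact (h0.sub_const (F x)).congr fun y => by rw [id, h.integral_eq]

/-- The derivative of an integrable function has integral zero. -/
theorem integral_eq_zero (h : IsPrim F F') (hF : Integrable F) (hF' : Integrable F') :
    ∫ x, F' x = 0 := by
  have e : ∀ x, F x = F 0 + ∫ t in (0 : ℝ)..x, F' t := fun x => by rw [h.integral_eq]; ring
  have hb : Tendsto F atBot (𝓝 (F 0 - ∫ t in Set.Iic 0, F' t)) := by
    refine ((intervalIntegral_tendsto_integral_Iic 0 hF'.integrableOn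
        (tendsto_id (x := atBot))).const_sub (F 0)).congr fun x => ?_
    rw [id, intervalIntegral.integral_symm, e x]; ring
  have ht : Tendsto F atTop (𝓝 (F 0 + ∫ t in Set.Ioi 0, F' t)) := by
    refine ((intervalIntegral_tendsto_integral_Ioi 0 hF'.integrableOn
        (tendsto_id (x := atTop))).const_add (F 0)).congr fun x => ?_
    rw [id, e x]
  -- Integrability of `F'` makes `F` converge at both ends; integrability of `F` leaves `0` as the
  -- only possible limit, because half-lines have infinite measure.
  have hb0 := IntegrableAtFilter.eq_zero_of_tendsto ⟨Set.univ, univ_mem, hF.integrableOn⟩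
    (fun s hs => by
      rcases mem_atBot_sets.1 hs with ⟨b, hb⟩
      rw [← top_le_iff, ← Real.volume_Iic (a := b)]
      exact measure_mono hb) hb
  have ht0 := IntegrableAtFilter.eq_zero_of_tendsto ⟨Set.univ, univ_mem, hF.integrableOn⟩
    (fun s hs => by
      rcases mem_atTop_sets.1 hs with ⟨b, hb⟩
      rw [← top_le_iff, ← Real.volume_Ici (a := b)]
      exact measure_mono hb) ht
  rw [← intervalIntegral.integral_Iic_add_Ioi (b := 0) hF'.integrableOn hF'.integrableOn]
  linarith

end IsPrim

/-! ### The half-line exponential averages -/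

/-- `∫_{y ≤ x} e^{y-x} f(y) dy`, the solution operator of `1 + ∂_x`. -/
noncomputable def avgLeft (f : ℝ → ℝ) (x : ℝ) : ℝ := ∫ y in Set.Iic x, Real.exp (y - x) * f y

/-- `∫_{y > x} e^{x-y} f(y) dy`, the solution operator of `1 - ∂_x`. -/
noncomputable def avgRight (f : ℝ → ℝ) (x : ℝ) : ℝ := ∫ y in Set.Ioi x, Real.exp (x - y) * f y

theorem expKer_left {x y : ℝ} (h : y ≤ x) : expKer 1 x y = Real.exp (y - x) := by
  unfold expKer; rw [abs_of_nonneg (by linarith)]; congr 1; ring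

theorem expKer_right {x y : ℝ} (h : x < y) : expKer 1 x y = Real.exp (x - y) := by
  unfold expKer; rw [abs_of_neg (by linarith)]; congr 1; ring

section

variable {f g : ℝ → ℝ}

theorem integrableOn_left {x : ℝ} (hf : Integrable fun y => expKer 1 x y * f y) :
    IntegrableOn (fun y => Real.exp (y - x) * f y) (Set.Iic x) :=
  hf.integrableOn.congr_fun (fun y hy => by simp only [expKer_left hy]) measurableSet_Iic

theorem integrableOn_right {x : ℝ} (hf : Integrable fun y => expKer 1 x y * f y) :
    IntegrableOn (fun y => Real.exp (x - y) * f y) (Set.Ioi x) :=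
  hf.integrableOn.congr_fun (fun y hy => by simp only [expKer_right hy]) measurableSet_Ioi

theorem avgLeft_eq (f : ℝ → ℝ) (x : ℝ) : avgLeft f x = ∫ y in Set.Iic x, expKer 1 x y * f y :=
  setIntegral_congr_fun measurableSet_Iic fun y hy => by simp only [expKer_left hy]

theorem avgRight_eq (f : ℝ → ℝ) (x : ℝ) : avgRight f x = ∫ y in Set.Ioi x, expKer 1 x y * f y :=
  setIntegral_congr_fun measurableSet_Ioi fun y hy => by simp only [expKer_right hy]

theorem avgLeft_congr (h : f =ᵐ[volume] g) : avgLeft f = avgLeft g := by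
  funext x
  exact integral_congr_ae (ae_restrict_of_ae (h.mono fun y hy => by simp only [hy]))

theorem avgRight_congr (h : f =ᵐ[volume] g) : avgRight f = avgRight g := by
  funext x
  exact integral_congr_ae (ae_restrict_of_ae (h.mono fun y hy => by simp only [hy]))

theorem enorm_avgLeft_le (f : ℝ → ℝ) (x : ℝ) :
    ‖avgLeft f x‖ₑ ≤ ∫⁻ y, ENNReal.ofReal (expKer 1 x y) * ‖f y‖ₑ := by
  rw [avgLeft_eq]
  refine (enorm_integral_le_lintegral_enorm _).trans ((setLIntegral_le_lintegral _ _).trans ?_)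
  refine lintegral_mono fun y => ?_
  rw [enorm_mul, Real.enorm_of_nonneg (expKer_pos _ _ _).le]

theorem enorm_avgRight_le (f : ℝ → ℝ) (x : ℝ) :
    ‖avgRight f x‖ₑ ≤ ∫⁻ y, ENNReal.ofReal (expKer 1 x y) * ‖f y‖ₑ := by
  rw [avgRight_eq]
  refine (enorm_integral_le_lintegral_enorm _).trans ((setLIntegral_le_lintegral _ _).trans ?_)
  refine lintegral_mono fun y => ?_
  rw [enorm_mul, Real.enorm_of_nonneg (expKer_pos _ _ _).le]

theorem isPrim_exp (c : ℝ) : IsPrim (fun y => Real.exp (c * y)) (fun y => c * Real.exp (c * y)) :=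
  IsPrim.of_hasDerivAt (fun x => by
    simpa [mul_comm] using ((hasDerivAt_id x).const_mul c).exp) (by fun_prop)

theorem locallyIntegrable_exp_mul (hf : MemLp f 2) (c : ℝ) :
    LocallyIntegrable (fun y => Real.exp (c * y) * f y) :=
  (hf.locallyIntegrable (by norm_num)).continuous_mul (by fun_prop)

/-- The kernel factors as `e^{y-x} = e^{-x} e^y`, so the operator is `e^{-x}` times a primitive and
the product rule yields `A' = f - A`. The derivative exists only almost everywhere because `f` is
merely in `L²`. -/
theorem isPrim_avgLeft (hf : MemLp f 2) : IsPrim (avgLeft f) (fun x => f x - avgLeft f x) := by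
  have hk := fun x => integrable_expKer_mul one_pos x hf
  have h0 : ∀ x, IntegrableOn (fun y => Real.exp (1 * y) * f y) (Set.Iic x) := fun x => by
    refine ((integrableOn_left (hk x)).const_mul (Real.exp x)).congr (ae_of_all _ fun y => ?_)
    simp only
    rw [← mul_assoc, ← Real.exp_add]; congr 2; ring
  have e : avgLeft f = fun x => Real.exp (-1 * x) *
      ((∫ y in Set.Iic 0, Real.exp (1 * y) * f y) + ∫ y in (0 : ℝ)..x, Real.exp (1 * y) * f y) := by
    funext x
    rw [← intervalIntegral.integral_Iic_sub_Iic (h0 0) (h0 x), add_sub_cancel,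
      ← integral_const_mul]
    refine integral_congr_ae (ae_of_all _ fun y => ?_)
    simp only
    rw [← mul_assoc, ← Real.exp_add]; congr 2; ring
  have h := (isPrim_exp (-1)).mul (IsPrim.of_integral (locallyIntegrable_exp_mul hf 1)
    (∫ y in Set.Iic 0, Real.exp (1 * y) * f y))
  rw [← e] at h
  refine h.congr (ae_of_all _ fun x => ?_)
  simp only
  rw [e]
  simp only
  have : Real.exp (-1 * x) * (Real.exp (1 * x) * f x) = f x := by
    rw [← mul_assoc, ← Real.exp_add]; simp
  rw [this]; ring

theorem isPrim_avgRight (hf : MemLp f 2) : IsPrim (avgRight f) (fun x => avgRight f x - f x) := by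
  have hk := fun x => integrable_expKer_mul one_pos x hf
  have h0 : ∀ x, IntegrableOn (fun y => Real.exp (-1 * y) * f y) (Set.Ioi x) := fun x => by
    refine ((integrableOn_right (hk x)).const_mul (Real.exp (-x))).congr (ae_of_all _ fun y => ?_)
    simp only
    rw [← mul_assoc, ← Real.exp_add]; congr 2; ring
  have e : avgRight f = fun x => Real.exp (1 * x) *
      ((∫ y in Set.Ioi 0, Real.exp (-1 * y) * f y)
        - (0 + ∫ y in (0 : ℝ)..x, Real.exp (-1 * y) * f y)) := by
    funext x
    rw [zero_add, intervalIntegral.integral_symm, sub_neg_eq_add, add_comm,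
      intervalIntegral.integral_interval_add_Ioi (h0 x) (h0 0),
      ← integral_const_mul]
    refine integral_congr_ae (ae_of_all _ fun y => ?_)
    simp only
    rw [← mul_assoc, ← Real.exp_add]; congr 2; ring
  have h := (isPrim_exp 1).mul ((IsPrim.const (∫ y in Set.Ioi 0, Real.exp (-1 * y) * f y)).sub
    (IsPrim.of_integral (locallyIntegrable_exp_mul hf (-1)) 0))
  rw [← e] at h
  refine h.congr (ae_of_all _ fun x => ?_)
  simp only
  rw [e]
  simp only
  have : Real.exp (1 * x) * (Real.exp (-1 * x) * f x) = f x := by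
    rw [← mul_assoc, ← Real.exp_add]; simp
  linear_combination -this

theorem eLpNorm_avgLeft_le (hf : MemLp f 2) :
    eLpNorm (avgLeft f) 2 volume ≤ 2 * eLpNorm f 2 volume := by
  simpa using eLpNorm_expKer_le one_pos hf.1 (enorm_avgLeft_le f)

theorem eLpNorm_avgRight_le (hf : MemLp f 2) :
    eLpNorm (avgRight f) 2 volume ≤ 2 * eLpNorm f 2 volume := by
  simpa using eLpNorm_expKer_le one_pos hf.1 (enorm_avgRight_le f)

theorem memLp_avgLeft (hf : MemLp f 2) : MemLp (avgLeft f) 2 :=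
  ⟨(isPrim_avgLeft hf).continuous.aestronglyMeasurable,
    (eLpNorm_avgLeft_le hf).trans_lt (ENNReal.mul_lt_top (by simp) hf.2)⟩

theorem memLp_avgRight (hf : MemLp f 2) : MemLp (avgRight f) 2 :=
  ⟨(isPrim_avgRight hf).continuous.aestronglyMeasurable,
    (eLpNorm_avgRight_le hf).trans_lt (ENNReal.mul_lt_top (by simp) hf.2)⟩

/-- The real `L²` norm. -/
noncomputable def l2norm (f : ℝ → ℝ) : ℝ := (eLpNorm f 2 volume).toReal

theorem l2norm_nonneg (f : ℝ → ℝ) : 0 ≤ l2norm f := ENNReal.toReal_nonneg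

theorem MeasureTheory.MemLp.ofReal_l2norm (hf : MemLp f 2) :
    ENNReal.ofReal (l2norm f) = eLpNorm f 2 volume := ENNReal.ofReal_toReal hf.2.ne

theorem lintegral_expKer_le_l2norm (hf : MemLp f 2) (x : ℝ) :
    ∫⁻ y, ENNReal.ofReal (expKer 1 x y) * ‖f y‖ₑ ≤ ENNReal.ofReal (2 * l2norm f) := by
  refine (lintegral_expKer_mul_le one_pos x hf.1).trans ?_
  rw [ENNReal.ofReal_mul (by norm_num), hf.ofReal_l2norm]
  norm_num

theorem abs_avgLeft_le (hf : MemLp f 2) (x : ℝ) : |avgLeft f x| ≤ 2 * l2norm f := by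
  have := (enorm_avgLeft_le f x).trans (lintegral_expKer_le_l2norm hf x)
  rwa [← ofReal_norm, ENNReal.ofReal_le_ofReal_iff (by have := l2norm_nonneg f; positivity)] at this

theorem abs_avgRight_le (hf : MemLp f 2) (x : ℝ) : |avgRight f x| ≤ 2 * l2norm f := by
  have := (enorm_avgRight_le f x).trans (lintegral_expKer_le_l2norm hf x)
  rwa [← ofReal_norm, ENNReal.ofReal_le_ofReal_iff (by have := l2norm_nonneg f; positivity)] at this

theorem avgLeft_add (hf : MemLp f 2) (hg : MemLp g 2) (x : ℝ) :
    avgLeft (fun y => f y + g y) x = avgLeft f x + avgLeft g x := by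
  unfold avgLeft
  rw [← integral_add (integrableOn_left (integrable_expKer_mul one_pos x hf))
    (integrableOn_left (integrable_expKer_mul one_pos x hg))]
  simp_rw [mul_add]

theorem avgRight_add (hf : MemLp f 2) (hg : MemLp g 2) (x : ℝ) :
    avgRight (fun y => f y + g y) x = avgRight f x + avgRight g x := by
  unfold avgRight
  rw [← integral_add (integrableOn_right (integrable_expKer_mul one_pos x hf))
    (integrableOn_right (integrable_expKer_mul one_pos x hg))]
  simp_rw [mul_add]

theorem avgLeft_const_mul (c : ℝ) (f : ℝ → ℝ) (x : ℝ) :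
    avgLeft (fun y => c * f y) x = c * avgLeft f x := by
  unfold avgLeft
  rw [← integral_const_mul]
  congr 1; funext y; ring

theorem avgRight_const_mul (c : ℝ) (f : ℝ → ℝ) (x : ℝ) :
    avgRight (fun y => c * f y) x = c * avgRight f x := by
  unfold avgRight
  rw [← integral_const_mul]
  congr 1; funext y; ring

/-- `avgLeft` and `avgRight` are transposes of each other. -/
theorem integral_avgLeft_mul (hf : MemLp f 2) (hg : MemLp g 2) :
    ∫ x, avgLeft f x * g x = ∫ x, f x * avgRight g x := by
  -- The product `avgLeft f · avgRight g` is integrable, and its derivative is exactly the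
  -- difference of the two integrands.
  have h := (isPrim_avgLeft hf).mul (isPrim_avgRight hg)
  have hi := fun {a b : ℝ → ℝ} (ha : MemLp a 2) (hb : MemLp b 2) => ha.integrable_mul hb
  have h1 := hi hf (memLp_avgRight hg)
  have h2 := hi (memLp_avgLeft hf) hg
  have e : (fun x => (f x - avgLeft f x) * avgRight g x + avgLeft f x * (avgRight g x - g x))
      = fun x => f x * avgRight g x - avgLeft f x * g x := by funext x; ring
  rw [e] at h
  have := h.integral_eq_zero (hi (memLp_avgLeft hf) (memLp_avgRight hg)) (h1.sub h2)
  have h3 := integral_sub h1 h2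
  simp only [Pi.mul_apply] at h3
  linarith

/-- `avgLeft` inverts `1 + ∂_x`. -/
theorem avgLeft_add_deriv (h : IsPrim f g) (hf : MemLp f 2) (hg : MemLp g 2) {B : ℝ}
    (hB : ∀ x, |f x| ≤ B) (x : ℝ) : avgLeft f x + avgLeft g x = f x := by
  rw [← avgLeft_add hf hg]
  have hp := (isPrim_exp 1).mul h
  have hint : IntegrableOn (fun y => Real.exp (y - x) * (f y + g y)) (Set.Iic x) :=
    integrableOn_left (integrable_expKer_mul one_pos x (hf.add hg))
  -- The integrand is an exact derivative; its primitive equals `f x` at `y = x`, and boundedness of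
  -- `f` removes the contribution of `-∞`.
  have hp' : IsPrim (fun y => Real.exp (y - x) * f y) fun y => Real.exp (y - x) * (f y + g y) := by
    have := hp.const_mul (Real.exp (-x))
    convert this using 2 with y y
    · rw [← mul_assoc, ← Real.exp_add]; congr 2; ring
    · have : Real.exp (y - x) = Real.exp (-x) * Real.exp (1 * y) := by
        rw [← Real.exp_add]; congr 1; ring
      rw [this]; ring
  have hlim : Tendsto (fun y => Real.exp (y - x) * f y) atBot (𝓝 0) := by
    have h1 : Tendsto (fun y => Real.exp (y - x)) atBot (𝓝 0) :=
      Real.tendsto_exp_atBot.comp (tendsto_atBot_add_const_right _ (-x) tendsto_id)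
    exact h1.zero_mul_isBoundedUnder_le (isBoundedUnder_of ⟨B, fun y => hB y⟩)
  unfold avgLeft
  rw [hp'.integral_Iic hint hlim]
  simp

/-- `avgRight` inverts `1 - ∂_x`. -/
theorem avgRight_sub_deriv (h : IsPrim f g) (hf : MemLp f 2) (hg : MemLp g 2) {B : ℝ}
    (hB : ∀ x, |f x| ≤ B) (x : ℝ) : avgRight f x - avgRight g x = f x := by
  have e : avgRight f x - avgRight g x = -avgRight (fun y => -1 * f y + g y) x := by
    rw [avgRight_add (hf.const_mul (-1)) hg, avgRight_const_mul]; ring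
  rw [e]
  have hp := (isPrim_exp (-1)).mul h
  have hint : IntegrableOn (fun y => Real.exp (x - y) * (-1 * f y + g y)) (Set.Ioi x) :=
    integrableOn_right (integrable_expKer_mul one_pos x ((hf.const_mul (-1)).add hg))
  have hp' : IsPrim (fun y => Real.exp (x - y) * f y)
      fun y => Real.exp (x - y) * (-1 * f y + g y) := by
    have := hp.const_mul (Real.exp x)
    convert this using 2 with y y
    · rw [← mul_assoc, ← Real.exp_add]; congr 2; ring
    · have : Real.exp (x - y) = Real.exp x * Real.exp (-1 * y) := by
        rw [← Real.exp_add]; congr 1; ring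
      rw [this]; ring
  have hlim : Tendsto (fun y => Real.exp (x - y) * f y) atTop (𝓝 0) := by
    have h1 : Tendsto (fun y => Real.exp (x - y)) atTop (𝓝 0) :=
      Real.tendsto_exp_atBot.comp (tendsto_atBot_add_const_left _ x tendsto_neg_atTop_atBot)
    exact h1.zero_mul_isBoundedUnder_le (isBoundedUnder_of ⟨B, fun y => hB y⟩)
  unfold avgRight
  rw [hp'.integral_Ioi hint hlim]
  simp

end

/-! ### The operators `p *` and `p' *` on `L²`, and the conservative form of the nonlocal term. -/

/-- Convolution with the Green function. -/
noncomputable def greenConv (f : ℝ → ℝ) (x : ℝ) : ℝ := (avgLeft f x + avgRight f x) / 2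

/-- Convolution with the derivative of the Green function. -/
noncomputable def greenConv' (f : ℝ → ℝ) (x : ℝ) : ℝ := (avgRight f x - avgLeft f x) / 2

/-- The derivative of the Green function. -/
noncomputable def greenDeriv (x : ℝ) : ℝ := -(SignType.sign x * Real.exp (-|x|) / 2)

theorem green_sub (x y : ℝ) : green (x - y) = expKer 1 x y / 2 := by
  unfold green expKer; simp

theorem abs_greenDeriv_le (x : ℝ) : |greenDeriv x| ≤ Real.exp (-|x|) / 2 := by
  unfold greenDeriv
  rcases lt_trichotomy x 0 with h | h | h <;>
  simp [h, abs_div, abs_of_pos (Real.exp_pos _)]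

theorem measurable_greenDeriv : Measurable greenDeriv := by
  unfold greenDeriv
  have : Measurable fun x : ℝ => ((SignType.sign x : SignType) : ℝ) := by
    have e : (fun x : ℝ => ((SignType.sign x : SignType) : ℝ)) =
        fun x => if 0 < x then 1 else if x < 0 then -1 else 0 := by
      funext x
      rw [sign_apply]; split_ifs <;> simp
    rw [e]
    exact Measurable.ite measurableSet_Ioi measurable_const
      (Measurable.ite measurableSet_Iio measurable_const measurable_const)
  fun_prop

section

variable {f g : ℝ → ℝ}

theorem greenConv_eq_integral_of_integrable {x : ℝ} (hf : Integrable fun y => expKer 1 x y * f y) :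
    greenConv f x = ∫ y, green (x - y) * f y := by
  unfold greenConv
  rw [avgLeft_eq, avgRight_eq,
    intervalIntegral.integral_Iic_add_Ioi hf.integrableOn hf.integrableOn, ← integral_div]
  congr 1; funext y; rw [green_sub]; ring

theorem greenConv_eq_integral (hf : MemLp f 2) (x : ℝ) :
    greenConv f x = ∫ y, green (x - y) * f y :=
  greenConv_eq_integral_of_integrable (integrable_expKer_mul one_pos x hf)

theorem convolution_green (hf : MemLp f 2) (x : ℝ) :
    (green ⋆[ContinuousLinearMap.mul ℝ ℝ] f) x = greenConv f x := by
  rw [greenConv_eq_integral hf, convolution_eq_swap]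
  simp

theorem integrable_greenDeriv_mul (hf : MemLp f 2) (x : ℝ) :
    Integrable fun y => greenDeriv (x - y) * f y := by
  refine (integrable_expKer_mul one_pos x hf).mono
    ((measurable_greenDeriv.comp (measurable_const.sub measurable_id)).aestronglyMeasurable.mul
      hf.1) (ae_of_all _ fun y => ?_)
  rw [norm_mul, norm_mul]
  gcongr
  rw [Real.norm_eq_abs, Real.norm_of_nonneg (expKer_pos _ _ _).le]
  refine (abs_greenDeriv_le _).trans ?_
  unfold expKer
  rw [one_mul]
  linarith [Real.exp_pos (-|x - y|)]

theorem integrable_green_mul (hf : MemLp f 2) (x : ℝ) :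
    Integrable fun y => green (x - y) * f y := by
  simp_rw [green_sub, div_mul_eq_mul_div]
  exact (integrable_expKer_mul one_pos x hf).div_const 2

theorem greenConv'_eq_integral (hf : MemLp f 2) (x : ℝ) :
    greenConv' f x = ∫ y, greenDeriv (x - y) * f y := by
  have hi := integrable_greenDeriv_mul hf x
  rw [← intervalIntegral.integral_Iic_add_Ioi (b := x) hi.integrableOn hi.integrableOn]
  have h1 : ∫ y in Set.Iic x, greenDeriv (x - y) * f y = -(avgLeft f x / 2) := by
    unfold avgLeft
    -- The point `y = x`, where the sign in `greenDeriv` is `0` and not `1`, is removed as a null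
    -- set.
    rw [integral_Iic_eq_integral_Iio, integral_Iic_eq_integral_Iio, ← integral_div,
      ← integral_neg]
    refine setIntegral_congr_fun measurableSet_Iio fun y hy => ?_
    have hy : 0 < x - y := sub_pos.2 hy
    simp only [greenDeriv, sign_pos hy, abs_of_pos hy, neg_sub, SignType.coe_one]
    ring
  have h2 : ∫ y in Set.Ioi x, greenDeriv (x - y) * f y = avgRight f x / 2 := by
    unfold avgRight
    rw [← integral_div]
    refine setIntegral_congr_fun measurableSet_Ioi fun y hy => ?_
    have hy : x - y < 0 := sub_neg.2 hy
    simp only [greenDeriv, sign_neg hy, abs_of_neg hy, neg_neg, SignType.coe_neg_one]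
    ring
  rw [h1, h2, greenConv']; ring

theorem greenConv_congr (h : f =ᵐ[volume] g) : greenConv f = greenConv g := by
  funext x; rw [greenConv, greenConv, avgLeft_congr h, avgRight_congr h]

theorem isPrim_greenConv (hf : MemLp f 2) : IsPrim (greenConv f) (greenConv' f) := by
  have := ((isPrim_avgLeft hf).add (isPrim_avgRight hf)).const_mul (1 / 2)
  convert this using 2
  · rw [greenConv]; ring
  · rw [greenConv']; ring

/-- This is `p - p'' = δ`: the momentum is recovered as `u - u_xx` from `u = p * m`, with a second
derivative that exists almost everywhere. -/
theorem isPrim_greenConv' (hf : MemLp f 2) :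
    IsPrim (greenConv' f) (fun x => greenConv f x - f x) := by
  have := ((isPrim_avgRight hf).sub (isPrim_avgLeft hf)).const_mul (1 / 2)
  convert this using 2
  · rw [greenConv']; ring
  · rw [greenConv]; ring

theorem continuous_greenConv (hf : MemLp f 2) : Continuous (greenConv f) :=
  (isPrim_greenConv hf).continuous

theorem continuous_greenConv' (hf : MemLp f 2) : Continuous (greenConv' f) :=
  (isPrim_greenConv' hf).continuous

theorem hasDerivAt_greenConv (hf : MemLp f 2) (x : ℝ) :
    HasDerivAt (greenConv f) (greenConv' f x) x :=
  (isPrim_greenConv hf).hasDerivAt (continuous_greenConv' hf) x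

theorem deriv_greenConv (hf : MemLp f 2) : deriv (greenConv f) = greenConv' f :=
  funext fun x => (hasDerivAt_greenConv hf x).deriv

theorem deriv_deriv_greenConv (hf : MemLp f 2) :
    deriv (deriv (greenConv f)) =ᵐ[volume] fun x => greenConv f x - f x := by
  rw [deriv_greenConv hf]
  exact (isPrim_greenConv' hf).ae.mono fun x hx => hx.deriv

theorem memLp_greenConv (hf : MemLp f 2) : MemLp (greenConv f) 2 := by
  have := ((memLp_avgLeft hf).add (memLp_avgRight hf)).const_mul (1 / 2)
  convert this using 2
  simp [greenConv]; ring

theorem memLp_greenConv' (hf : MemLp f 2) : MemLp (greenConv' f) 2 := by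
  have := ((memLp_avgRight hf).sub (memLp_avgLeft hf)).const_mul (1 / 2)
  convert this using 2
  simp [greenConv']; ring

theorem abs_greenConv_le (hf : MemLp f 2) (x : ℝ) : |greenConv f x| ≤ 2 * l2norm f := by
  have h1 := abs_le.1 (abs_avgLeft_le hf x)
  have h2 := abs_le.1 (abs_avgRight_le hf x)
  rw [greenConv, abs_le]; constructor <;> linarith

theorem abs_greenConv'_le (hf : MemLp f 2) (x : ℝ) : |greenConv' f x| ≤ 2 * l2norm f := by
  have h1 := abs_le.1 (abs_avgLeft_le hf x)
  have h2 := abs_le.1 (abs_avgRight_le hf x)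
  rw [greenConv', abs_le]; constructor <;> linarith

theorem l2norm_eq_toLp (hf : MemLp f 2) : l2norm f = ‖hf.toLp f‖ := (Lp.norm_toLp f hf).symm

theorem l2norm_add_le (hf : MemLp f 2) (hg : MemLp g 2) :
    l2norm (fun x => f x + g x) ≤ l2norm f + l2norm g := by
  have := l2norm_eq_toLp (hf.add hg)
  rw [l2norm_eq_toLp hf, l2norm_eq_toLp hg]
  change l2norm (f + g) ≤ _
  rw [this]
  exact norm_add_le (hf.toLp f) (hg.toLp g)

theorem l2norm_const_mul (c : ℝ) (f : ℝ → ℝ) : l2norm (fun x => c * f x) = |c| * l2norm f := by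
  have := eLpNorm_const_smul (p := 2) (μ := (volume : Measure ℝ)) c f
  unfold l2norm
  change (eLpNorm (c • f) 2 volume).toReal = _
  rw [this]; simp

theorem l2norm_avgLeft_le (hf : MemLp f 2) : l2norm (avgLeft f) ≤ 2 * l2norm f := by
  have := ENNReal.toReal_mono (ENNReal.mul_ne_top (by simp) hf.2.ne) (eLpNorm_avgLeft_le hf)
  simpa [l2norm] using this

theorem l2norm_avgRight_le (hf : MemLp f 2) : l2norm (avgRight f) ≤ 2 * l2norm f := by
  have := ENNReal.toReal_mono (ENNReal.mul_ne_top (by simp) hf.2.ne) (eLpNorm_avgRight_le hf)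
  simpa [l2norm] using this

theorem l2norm_greenConv_le (hf : MemLp f 2) : l2norm (greenConv f) ≤ 2 * l2norm f := by
  have e : greenConv f = fun x => (1 / 2) * (avgLeft f x + avgRight f x) := by
    funext x; rw [greenConv]; ring
  rw [e, l2norm_const_mul]
  have := l2norm_add_le (memLp_avgLeft hf) (memLp_avgRight hf)
  have h1 := l2norm_avgLeft_le hf
  have h2 := l2norm_avgRight_le hf
  rw [abs_of_pos (by norm_num)]
  linarith

theorem l2norm_greenConv'_le (hf : MemLp f 2) : l2norm (greenConv' f) ≤ 2 * l2norm f := by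
  have e : greenConv' f = fun x => (1 / 2) * (avgRight f x + -1 * avgLeft f x) := by
    funext x; rw [greenConv']; ring
  rw [e, l2norm_const_mul]
  have := l2norm_add_le (memLp_avgRight hf) ((memLp_avgLeft hf).const_mul (-1))
  have h0 := l2norm_const_mul (-1) (avgLeft f)
  have h1 := l2norm_avgLeft_le hf
  have h2 := l2norm_avgRight_le hf
  rw [abs_of_pos (by norm_num)]
  norm_num at h0
  norm_num at this ⊢
  linarith

theorem greenConv_add (hf : MemLp f 2) (hg : MemLp g 2) (x : ℝ) :
    greenConv (fun y => f y + g y) x = greenConv f x + greenConv g x := by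
  unfold greenConv; rw [avgLeft_add hf hg, avgRight_add hf hg]; ring

theorem greenConv'_add (hf : MemLp f 2) (hg : MemLp g 2) (x : ℝ) :
    greenConv' (fun y => f y + g y) x = greenConv' f x + greenConv' g x := by
  unfold greenConv'; rw [avgLeft_add hf hg, avgRight_add hf hg]; ring

theorem greenConv_const_mul (c : ℝ) (f : ℝ → ℝ) (x : ℝ) :
    greenConv (fun y => c * f y) x = c * greenConv f x := by
  unfold greenConv; rw [avgLeft_const_mul, avgRight_const_mul]; ring

theorem greenConv'_const_mul (c : ℝ) (f : ℝ → ℝ) (x : ℝ) :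
    greenConv' (fun y => c * f y) x = c * greenConv' f x := by
  unfold greenConv'; rw [avgLeft_const_mul, avgRight_const_mul]; ring

theorem greenConv_sub (hf : MemLp f 2) (hg : MemLp g 2) (x : ℝ) :
    greenConv (fun y => f y - g y) x = greenConv f x - greenConv g x := by
  have := greenConv_add hf (hg.const_mul (-1)) x
  rw [greenConv_const_mul] at this
  simp only [neg_mul, one_mul, ← sub_eq_add_neg] at this
  exact this

theorem greenConv'_sub (hf : MemLp f 2) (hg : MemLp g 2) (x : ℝ) :
    greenConv' (fun y => f y - g y) x = greenConv' f x - greenConv' g x := by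
  have := greenConv'_add hf (hg.const_mul (-1)) x
  rw [greenConv'_const_mul] at this
  simp only [neg_mul, one_mul, ← sub_eq_add_neg] at this
  exact this

theorem integral_greenConv_mul (hf : MemLp f 2) (hg : MemLp g 2) :
    ∫ x, greenConv f x * g x = ∫ x, f x * greenConv g x := by
  have h1 := integral_avgLeft_mul hf hg
  have h2 := integral_avgLeft_mul hg hf
  have i1 : Integrable fun x => avgLeft f x * g x := (memLp_avgLeft hf).integrable_mul hg
  have i2 : Integrable fun x => avgRight f x * g x := (memLp_avgRight hf).integrable_mul hg
  have i3 : Integrable fun x => f x * avgLeft g x := hf.integrable_mul (memLp_avgLeft hg)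
  have i4 : Integrable fun x => f x * avgRight g x := hf.integrable_mul (memLp_avgRight hg)
  have e1 : (fun x => greenConv f x * g x) = fun x => (avgLeft f x * g x + avgRight f x * g x) / 2 := by
    funext x; rw [greenConv]; ring
  have e2 : (fun x => f x * greenConv g x) = fun x => (f x * avgLeft g x + f x * avgRight g x) / 2 := by
    funext x; rw [greenConv]; ring
  rw [e1, e2, integral_div, integral_div, integral_add i1 i2, integral_add i3 i4, h1]
  simp_rw [mul_comm (avgLeft g _), mul_comm (g _) (avgRight f _)] at h2
  rw [h2]; ring

theorem integral_greenConv'_mul (hf : MemLp f 2) (hg : MemLp g 2) :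
    ∫ x, greenConv' f x * g x = -∫ x, f x * greenConv' g x := by
  have h1 := integral_avgLeft_mul hf hg
  have h2 := integral_avgLeft_mul hg hf
  have i1 : Integrable fun x => avgLeft f x * g x := (memLp_avgLeft hf).integrable_mul hg
  have i2 : Integrable fun x => avgRight f x * g x := (memLp_avgRight hf).integrable_mul hg
  have i3 : Integrable fun x => f x * avgLeft g x := hf.integrable_mul (memLp_avgLeft hg)
  have i4 : Integrable fun x => f x * avgRight g x := hf.integrable_mul (memLp_avgRight hg)
  have e1 : (fun x => greenConv' f x * g x) = fun x => (avgRight f x * g x - avgLeft f x * g x) / 2 := by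
    funext x; rw [greenConv']; ring
  have e2 : (fun x => f x * greenConv' g x) = fun x => (f x * avgRight g x - f x * avgLeft g x) / 2 := by
    funext x; rw [greenConv']; ring
  rw [e1, e2, integral_div, integral_div, integral_sub i2 i1, integral_sub i4 i3, h1]
  simp_rw [mul_comm (avgLeft g _), mul_comm (g _) (avgRight f _)] at h2
  rw [h2]; ring

theorem greenConv_deriv (h : IsPrim f g) (hf : MemLp f 2) (hg : MemLp g 2) {B : ℝ}
    (hB : ∀ x, |f x| ≤ B) (x : ℝ) : greenConv g x = greenConv' f x := by
  have h1 := avgLeft_add_deriv h hf hg hB x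
  have h2 := avgRight_sub_deriv h hf hg hB x
  rw [greenConv, greenConv']; linarith

/-- The identity `f = p * (f - f'')` with one derivative moved to the kernel, so that a single weak
derivative of `f` is enough. With `f = u` it also bounds the supremum of `u` by its `H¹` norm. -/
theorem greenConv_sub_deriv (h : IsPrim f g) (hf : MemLp f 2) (hg : MemLp g 2) {B : ℝ}
    (hB : ∀ x, |f x| ≤ B) (x : ℝ) : greenConv f x - greenConv' g x = f x := by
  have h1 := avgLeft_add_deriv h hf hg hB x
  have h2 := avgRight_sub_deriv h hf hg hB x
  rw [greenConv, greenConv']; linarith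

theorem memLp_bdd_mul (hg : MemLp g 2) (hf : Continuous f) {B : ℝ} (hB : ∀ x, |f x| ≤ B) :
    MemLp (fun x => f x * g x) 2 :=
  hg.mul (memLp_top_of_bound hf.aestronglyMeasurable B (ae_of_all _ hB))

theorem abs_mul_mul_le {a b c A B C : ℝ} (ha : |a| ≤ A) (hb : |b| ≤ B) (hc : |c| ≤ C) :
    |a * (b * c)| ≤ A * (B * C) := by
  rw [abs_mul, abs_mul]
  have := (abs_nonneg _).trans ha
  have := (abs_nonneg _).trans hb
  gcongr

set_option maxHeartbeats 1000000 in
/-- For `u = p * m`, `v = p * n` the nonlocal term of the system is in conservative form. -/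
theorem bForcing_identity (b : ℝ) {m n : ℝ → ℝ} (hm : MemLp m 2) (hn : MemLp n 2) :
    MemLp (bForcing b (greenConv m) (greenConv n)) 2 ∧
    ∀ x, greenConv m x * greenConv n x * greenConv' m x +
        greenConv (bForcing b (greenConv m) (greenConv n)) x =
      greenConv' (fun y => greenConv m y * greenConv n y * m y) x -
        greenConv (fun y => (greenConv' m y * greenConv n y + greenConv m y * greenConv' n y
          - b * (greenConv n y * greenConv' m y)) * m y) x := by
  have cu := continuous_greenConv hm
  have cv := continuous_greenConv hn
  have cu' := continuous_greenConv' hm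
  have cv' := continuous_greenConv' hn
  have bu := abs_greenConv_le hm
  have bv := abs_greenConv_le hn
  have bu' := abs_greenConv'_le hm
  have bv' := abs_greenConv'_le hn
  have lu := memLp_greenConv hm
  have lv := memLp_greenConv hn
  have lu' := memLp_greenConv' hm
  have lv' := memLp_greenConv' hn
  have lu2 : MemLp (fun x => greenConv m x - m x) 2 := lu.sub hm
  have lv2 : MemLp (fun x => greenConv n x - n x) 2 := lv.sub hn
  have pu := isPrim_greenConv hm
  have pv := isPrim_greenConv hn
  have pu' := isPrim_greenConv' hm
  have pv' := isPrim_greenConv' hn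
  have du := deriv_greenConv hm
  have dv := deriv_greenConv hn
  have ddu := deriv_deriv_greenConv hm
  have ddv := deriv_deriv_greenConv hn
  generalize greenConv m = u at *
  generalize greenConv n = v at *
  generalize greenConv' m = u' at *
  generalize greenConv' n = v' at *
  have L := fun {f g h : ℝ → ℝ} (hh : MemLp h 2) (cf : Continuous f) (cg : Continuous g)
    {A B : ℝ} (hA : ∀ x, |f x| ≤ A) (hB : ∀ x, |g x| ≤ B) =>
    memLp_bdd_mul (memLp_bdd_mul hh cg hB) cf hA
  -- the forcing, almost everywhere
  let F₀ : ℝ → ℝ := fun x => b * (u x * (v x * u' x)) + (3 - b) * (u' x * (v x * (u x - m x)))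
    + 2 * (u x * (v' x * (u x - m x))) + 2 * (u' x * (u' x * v' x)) + u x * (u' x * (v x - n x))
  have hF : bForcing b u v =ᵐ[volume] F₀ := by
    filter_upwards [ddu, ddv] with x h1 h2
    simp only [bForcing, F₀]
    rw [h1, h2, du, dv]
    ring
  have lF₀ : MemLp F₀ 2 :=
    (((((L lu' cu cv bu bv).const_mul b).add ((L lu2 cu' cv bu' bv).const_mul (3 - b))).add
      ((L lu2 cu cv' bu bv').const_mul 2)).add ((L lv' cu' cu' bu' bu').const_mul 2)).add
      (L lv2 cu cu' bu bu')
  have lF : MemLp (bForcing b u v) 2 := (memLp_congr_ae hF).2 lF₀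
  refine ⟨lF, fun x => ?_⟩
  rw [greenConv_congr hF]
  -- `R = u v u'` and `H = (u v)' u' + u² v`
  let R : ℝ → ℝ := fun x => u x * (v x * u' x)
  let R' : ℝ → ℝ := fun x => u' x * (v x * u' x) + u x * (v' x * u' x) + u x * (v x * (u x - m x))
  have pR : IsPrim R R' := (pu.mul (pv.mul pu')).congr (ae_of_all _ fun x => by simp only [R']; ring)
  have lR : MemLp R 2 := L lu' cu cv bu bv
  have lR' : MemLp R' 2 := ((L lu' cu' cv bu' bv).add (L lu' cu cv' bu bv')).add (L lu2 cu cv bu bv)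
  have bR : ∀ x, |R x| ≤ _ := fun x => abs_mul_mul_le (bu x) (bv x) (bu' x)
  let H : ℝ → ℝ := fun x => u' x * (v x * u' x) + u x * (v' x * u' x) + u x * (v x * u x)
  let H' : ℝ → ℝ := fun x => 2 * (u' x * (v x * (u x - m x))) + 2 * (u' x * (u' x * v' x))
    + u x * (u' x * (v x - n x)) + u x * (v' x * (u x - m x)) + 2 * (u x * (v x * u' x))
    + u x * (u x * v' x)
  have pH : IsPrim H H' := by
    refine (((pu'.mul (pv.mul pu')).add (pu.mul (pv'.mul pu'))).add (pu.mul (pv.mul pu))).congr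
      (ae_of_all _ fun x => ?_)
    simp only [H']; ring
  have lH : MemLp H 2 := ((L lu' cu' cv bu' bv).add (L lu' cu cv' bu bv')).add (L lu cu cv bu bv)
  have lH' : MemLp H' 2 :=
    ((((((L lu2 cu' cv bu' bv).const_mul 2).add ((L lv' cu' cu' bu' bu').const_mul 2)).add
      (L lv2 cu cu' bu bu')).add (L lu2 cu cv' bu bv')).add ((L lu' cu cv bu bv).const_mul 2)).add
      (L lv' cu cu bu bu)
  have bH : ∀ x, |H x| ≤ _ := fun x =>
    (abs_add_le _ _).trans (add_le_add ((abs_add_le _ _).trans (add_le_add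
      (abs_mul_mul_le (bu' x) (bv x) (bu' x)) (abs_mul_mul_le (bu x) (bv' x) (bu' x))))
      (abs_mul_mul_le (bu x) (bv x) (bu x)))
  -- `R = u v u_x` outside the convolution is rewritten as `p * R - p' * R'`. Since `R' = H - u v
  -- m`, the second term supplies `p' * (u v m)` and leaves `p' * H = p * H'`. In `R + F₀ - H'` all
  -- terms without `m`, and the terms with `v_xx`, cancel.
  have e1 := greenConv_sub_deriv pR lR lR' bR x
  have e2 := greenConv_deriv pH lH lH' bH x
  have e3 : u x * v x * u' x = R x := by simp only [R]; ring
  have lc : MemLp (fun y => u y * v y * m y) 2 := by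
    simpa only [mul_assoc] using L hm cu cv bu bv
  have lg : MemLp (fun y => (u' y * v y + u y * v' y - b * (v y * u' y)) * m y) 2 := by
    have := ((L hm cu' cv bu' bv).add (L hm cu cv' bu bv')).sub ((L hm cv cu' bv bu').const_mul b)
    refine this.ae_eq (ae_of_all _ fun y => ?_)
    simp only [Pi.add_apply, Pi.sub_apply]; ring
  -- pointwise algebra
  have a1 : greenConv' R' x = greenConv' H x - greenConv' (fun y => u y * v y * m y) x := by
    rw [← greenConv'_sub lH lc]
    congr 1; funext y; simp only [R', H]; ring
  have a2 : greenConv R x + greenConv F₀ x - greenConv H' x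
      = -greenConv (fun y => (u' y * v y + u y * v' y - b * (v y * u' y)) * m y) x := by
    rw [← greenConv_add lR lF₀, ← greenConv_sub (f := fun y => R y + F₀ y) (lR.add lF₀) lH', ← neg_one_mul (greenConv _ x),
      ← greenConv_const_mul]
    congr 1; funext y; simp only [R, F₀, H']; ring
  rw [e3]
  linarith

end

/-! ### Fourier multipliers on `L²(ℝ)` -/

/-- Complex square integrable functions on the line. -/
abbrev LpC : Type := Lp ℂ 2 (volume : Measure ℝ)

open Classical in
/-- The Fourier multiplier with an essentially bounded symbol, on `L²` (zero if the symbol is not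
essentially bounded). -/
noncomputable def fourierMul (φ : ℝ → ℂ) : LpC →L[ℂ] LpC :=
  if h : MemLp φ ∞ (volume : Measure ℝ) then
    ((Lp.fourierTransformₗᵢ ℝ ℂ).symm : LpC →L[ℂ] LpC) ∘L
      ((ContinuousLinearMap.mul ℂ ℂ).holderL volume ∞ 2 2 (h.toLp φ)) ∘L
      ((Lp.fourierTransformₗᵢ ℝ ℂ) : LpC →L[ℂ] LpC)
  else 0

section

variable {φ ψ : ℝ → ℂ} {f g : LpC}

theorem fourier_fourierMul (h : MemLp φ ∞) (f : LpC) :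
    (𝓕 (fourierMul φ f) : LpC) =ᵐ[volume] fun ξ => φ ξ * (𝓕 f : LpC) ξ := by
  have e : (𝓕 (fourierMul φ f) : LpC) =
      (ContinuousLinearMap.mul ℂ ℂ).holder 2 (h.toLp φ) (𝓕 f : LpC) := by
    rw [fourierMul, dif_pos h]
    exact (Lp.fourierTransformₗᵢ ℝ ℂ).apply_symm_apply _
  rw [e]
  filter_upwards [(ContinuousLinearMap.mul ℂ ℂ).coeFn_holder (r := 2) (h.toLp φ) (𝓕 f : LpC),
    h.coeFn_toLp] with ξ h1 h2
  rw [h1, h2]; rfl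

theorem fourier_injective_ae (h : (𝓕 f : LpC) =ᵐ[volume] (𝓕 g : LpC)) : f = g :=
  (Lp.fourierTransformₗᵢ ℝ ℂ).injective (Lp.ext h)

theorem fourierMul_norm_le_of_le (h : MemLp φ ∞) {c : ℝ} (hc : ∀ ξ, ‖φ ξ‖ ≤ c) (f : LpC) :
    ‖fourierMul φ f‖ ≤ c * ‖f‖ := by
  rw [← Lp.norm_fourier_eq (fourierMul φ f), ← Lp.norm_fourier_eq f]
  refine Lp.norm_le_mul_norm_of_ae_le_mul ?_
  filter_upwards [fourier_fourierMul h f] with ξ h1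
  rw [h1, norm_mul]
  gcongr
  exact hc ξ

theorem fourierMul_comp (h : MemLp φ ∞) (h' : MemLp ψ ∞) {ρ : ℝ → ℂ} (hρ : MemLp ρ ∞)
    (hr : ∀ ξ, φ ξ * ψ ξ = ρ ξ) (f : LpC) : fourierMul φ (fourierMul ψ f) = fourierMul ρ f := by
  refine fourier_injective_ae ?_
  filter_upwards [fourier_fourierMul h (fourierMul ψ f), fourier_fourierMul h' f,
    fourier_fourierMul hρ f] with ξ h1 h2 h3
  rw [h1, h2, h3, ← hr]; ring

theorem inner_fourierMul (h : MemLp φ ∞) (hr : ∀ ξ, (starRingEnd ℂ) (φ ξ) = φ ξ) (f g : LpC) :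
    ⟪fourierMul φ f, g⟫ = ⟪f, fourierMul φ g⟫ := by
  rw [← Lp.inner_fourier_eq, ← Lp.inner_fourier_eq f, L2.inner_def, L2.inner_def]
  refine integral_congr_ae ?_
  filter_upwards [fourier_fourierMul h f, fourier_fourierMul h g] with ξ h1 h2
  rw [h1, h2]
  simp only [RCLike.inner_apply, map_mul, hr]
  ring

theorem memLp_top_of_continuous {φ : ℝ → ℂ} (h : Continuous φ) {c : ℝ} (hc : ∀ ξ, ‖φ ξ‖ ≤ c) :
    MemLp φ ∞ (volume : Measure ℝ) :=
  memLp_top_of_bound h.aestronglyMeasurable c (ae_of_all _ hc)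

theorem toTemperedDistribution_injective {f g : LpC}
    (h : Lp.toTemperedDistribution f = Lp.toTemperedDistribution g) : f = g := by
  have := LinearMap.ker_eq_bot.1
    (Lp.ker_toTemperedDistributionCLM_eq_bot (F := ℂ) (p := 2) (μ := (volume : Measure ℝ)))
  exact this h

/-- The Besov norm is defined through multipliers on tempered distributions, whereas all estimates
are made on `L²`; this identity passes from one to the other. -/
theorem toTemperedDistribution_fourierMul (h : MemLp φ ∞) (hφ : φ.HasTemperateGrowth) (f : LpC) :
    Lp.toTemperedDistribution (fourierMul φ f) =
      TemperedDistribution.fourierMultiplierCLM ℂ φ (Lp.toTemperedDistribution f) := by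
  rw [TemperedDistribution.fourierMultiplierCLM_apply, Lp.fourier_toTemperedDistribution_eq,
    ← Lp.toTemperedDistribution_smul_eq (p := ∞) (q := 2) (r := 2) hφ h,
    Lp.fourierInv_toTemperedDistribution_eq]
  congr 1
  refine fourier_injective_ae ?_
  rw [FourierTransform.fourier_fourierInv_eq]
  filter_upwards [fourier_fourierMul h f, Lp.coeFn_lpSMul (r := 2) (h.toLp φ) (𝓕 f : LpC),
    h.coeFn_toLp] with ξ h1 h2 h3
  rw [h1, h2, Pi.smul_apply', h3, smul_eq_mul]

end

/-! ### Embedding of real functions and weak derivatives -/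

theorem MeasureTheory.MemLp.ofRealC {f : ℝ → ℝ} (hf : MemLp f 2) :
    MemLp (fun x => (f x : ℂ)) 2 (volume : Measure ℝ) := hf.ofReal

open Classical in
/-- The class of a real square integrable function in `LpC` (zero otherwise). -/
noncomputable def toLpC (f : ℝ → ℝ) : LpC :=
  if h : MemLp f 2 (volume : Measure ℝ) then h.ofRealC.toLp _ else 0

section

variable {f g f' : ℝ → ℝ}

theorem coeFn_toLpC (hf : MemLp f 2) : toLpC f =ᵐ[volume] fun x => (f x : ℂ) := by
  rw [toLpC, dif_pos hf]
  exact hf.ofRealC.coeFn_toLp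

theorem toLpC_sub (hf : MemLp f 2) (hg : MemLp g 2) :
    toLpC (fun x => f x - g x) = toLpC f - toLpC g := by
  refine Lp.ext ?_
  filter_upwards [coeFn_toLpC hf, coeFn_toLpC hg, coeFn_toLpC (hf.sub hg),
    Lp.coeFn_sub (toLpC f) (toLpC g)] with x h1 h2 h3 h4
  simp only [Pi.sub_apply] at h3 h4
  change (toLpC (f - g)) x = _
  rw [h3, h4, h1, h2]; simp

theorem norm_toLpC (hf : MemLp f 2) : ‖toLpC f‖ = l2norm f := by
  rw [toLpC, dif_pos hf, Lp.norm_toLp, l2norm]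
  congr 1
  exact eLpNorm_congr_norm_ae (ae_of_all _ fun x => by simp)

/-- Integration by parts against a Schwartz function. -/
theorem IsPrim.integral_schwartz (h : IsPrim f f') (hf : MemLp f 2) (hf' : MemLp f' 2)
    (θ : 𝓢(ℝ, ℂ)) : ∫ x, θ x * (f' x : ℂ) = -∫ x, deriv θ x * (f x : ℂ) := by
  have hθ : MemLp θ 2 (volume : Measure ℝ) := θ.memLp 2
  have eθ : deriv θ = SchwartzMap.derivCLM ℂ ℂ θ :=
    funext fun x => (SchwartzMap.derivCLM_apply ℂ θ x).symm
  have hθ' : MemLp (deriv θ) 2 (volume : Measure ℝ) := by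
    rw [eθ]; exact (SchwartzMap.derivCLM ℂ ℂ θ).memLp 2
  have i1 : Integrable fun x => θ x * (f' x : ℂ) := hθ.integrable_mul hf'.ofRealC
  have i2 : Integrable fun x => deriv θ x * (f x : ℂ) := hθ'.integrable_mul hf.ofRealC
  have i3 : Integrable fun x => θ x * (f x : ℂ) := hθ.integrable_mul hf.ofRealC
  -- `IsPrim` concerns real functions, so the complex identity is tested with real linear
  -- functionals; the real and the imaginary part are the two that are needed.
  have key : ∀ (L : ℂ →L[ℝ] ℝ), L (∫ x, (deriv θ x * (f x : ℂ) + θ x * (f' x : ℂ))) = 0 := by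
    intro L
    refine (L.integral_comp_comm (i2.add i1)).symm.trans ?_
    simp only [Pi.add_apply]
    have hd : ∀ x, HasDerivAt (fun y => L (θ y)) (L (deriv θ x)) x := fun x =>
      L.hasFDerivAt.comp_hasDerivAt x (θ.hasDerivAt x)
    have hp : IsPrim (fun y => L (θ y)) (fun y => L (deriv θ y)) :=
      IsPrim.of_hasDerivAt hd
        (L.continuous.comp (eθ ▸ (SchwartzMap.derivCLM ℂ ℂ θ).continuous))
    have hL : ∀ (z : ℂ) (r : ℝ), L (z * (r : ℂ)) = L z * r := fun z r => by
      have : z * (r : ℂ) = r • z := by rw [Complex.real_smul, mul_comm]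
      rw [this, map_smul, smul_eq_mul, mul_comm]
    have hm := hp.mul h
    have e : (fun x => L (deriv θ x * (f x : ℂ) + θ x * (f' x : ℂ)))
        = fun x => L (deriv θ x) * f x + L (θ x) * f' x := by
      funext x; rw [map_add, hL, hL]
    rw [e]
    refine hm.integral_eq_zero ?_ ?_
    · refine (L.integrable_comp i3).congr (ae_of_all _ fun x => ?_)
      simp only [hL]
    · have := L.integrable_comp (i2.add i1)
      rw [← e]; exact this
  have hz : ∫ x, (deriv θ x * (f x : ℂ) + θ x * (f' x : ℂ)) = 0 :=
    Complex.ext (key Complex.reCLM) (key Complex.imCLM)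
  rw [integral_add i2 i1] at hz
  linear_combination hz

theorem hasTemperateGrowth_ofReal_mul (c : ℂ) :
    (fun ξ : ℝ => c * (ξ : ℂ)).HasTemperateGrowth := by
  fun_prop

/-- The weak derivative has symbol `2π i ξ`. -/
theorem IsPrim.toTemperedDistribution_deriv (h : IsPrim f f') (hf : MemLp f 2)
    (hf' : MemLp f' 2) : Lp.toTemperedDistribution (toLpC f') =
      TemperedDistribution.fourierMultiplierCLM ℂ (fun ξ : ℝ => 2 * Real.pi * Complex.I * (ξ : ℂ))
        (Lp.toTemperedDistribution (toLpC f)) := by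
  have e1 := TemperedDistribution.lineDeriv_eq_fourierMultiplierCLM (1 : ℝ)
    (Lp.toTemperedDistribution (toLpC f))
  have e2 : (fun ξ : ℝ => 2 * Real.pi * Complex.I * (ξ : ℂ)) =
      (2 * Real.pi * Complex.I : ℂ) • fun ξ : ℝ => ((inner ℝ ξ (1 : ℝ) : ℝ) : ℂ) := by
    funext ξ; simp
  rw [e2, TemperedDistribution.fourierMultiplierCLM_smul (by fun_prop)]
  change _ = (2 * Real.pi * Complex.I : ℂ) •
    (TemperedDistribution.fourierMultiplierCLM ℂ (fun ξ : ℝ => ((inner ℝ ξ (1 : ℝ) : ℝ) : ℂ)))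
      (Lp.toTemperedDistribution (toLpC f))
  rw [← e1]
  ext θ
  rw [TemperedDistribution.lineDerivOp_apply_apply, Lp.toTemperedDistribution_apply,
    Lp.toTemperedDistribution_apply]
  have h1 : ∫ x, θ x • (toLpC f') x = ∫ x, θ x * (f' x : ℂ) := by
    refine integral_congr_ae ?_
    filter_upwards [coeFn_toLpC hf'] with x hx
    rw [hx, smul_eq_mul]
  rw [h1, h.integral_schwartz hf hf' θ, ← integral_neg]
  refine integral_congr_ae ?_
  filter_upwards [coeFn_toLpC hf] with x hx
  rw [hx, smul_eq_mul, _root_.neg_apply, SchwartzMap.lineDerivOp_apply_eq_fderiv, neg_mul]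
  rfl

/-- An identity of tempered distributions between a Fourier multiplier and square integrable
functions holds almost everywhere on the Fourier side. -/
theorem fourier_ae_eq_of_multiplier {φ : ℝ → ℂ} (hφ : φ.HasTemperateGrowth) {F G : LpC}
    (h : Lp.toTemperedDistribution G =
      TemperedDistribution.fourierMultiplierCLM ℂ φ (Lp.toTemperedDistribution F)) :
    (𝓕 G : LpC) =ᵐ[volume] fun ξ => φ ξ * (𝓕 F : LpC) ξ := by
  have h1 : Lp.toTemperedDistribution (𝓕 G : LpC) =
      TemperedDistribution.smulLeftCLM ℂ φ (Lp.toTemperedDistribution (𝓕 F : LpC)) := by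
    rw [← Lp.fourier_toTemperedDistribution_eq, h, TemperedDistribution.fourierMultiplierCLM_apply,
      FourierTransform.fourier_fourierInv_eq, Lp.fourier_toTemperedDistribution_eq]
  have cφ : Continuous φ := hφ.1.continuous
  -- The symbol may be unbounded, so the product is only locally integrable a priori; testing
  -- against smooth functions of compact support is enough to identify it.
  have lF : LocallyIntegrable (fun ξ => φ ξ * (𝓕 F : LpC) ξ) :=
    ((Lp.memLp (𝓕 F : LpC)).locallyIntegrable (by norm_num)).continuous_mul cφ
  refine ae_eq_of_integral_contDiff_smul_eq
    ((Lp.memLp (𝓕 G : LpC)).locallyIntegrable (by norm_num)) lF fun θ hθ hs => ?_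
  have s1 : HasCompactSupport (fun x => (θ x : ℂ)) := hs.comp_left (g := ((↑) : ℝ → ℂ)) (by simp)
  have s2 : ContDiff ℝ ((⊤ : ℕ∞) : WithTop ℕ∞) (fun x => (θ x : ℂ)) :=
    Complex.ofRealCLM.contDiff.comp hθ
  have h2 := DFunLike.congr_fun h1 (s1.toSchwartzMap s2)
  rw [TemperedDistribution.smulLeftCLM_apply_apply, Lp.toTemperedDistribution_apply,
    Lp.toTemperedDistribution_apply] at h2
  simpa [SchwartzMap.smulLeftCLM_apply_apply hφ, mul_assoc, mul_left_comm] using h2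

theorem IsPrim.fourier_deriv (h : IsPrim f f') (hf : MemLp f 2) (hf' : MemLp f' 2) :
    (𝓕 (toLpC f') : LpC) =ᵐ[volume]
      fun ξ => 2 * Real.pi * Complex.I * (ξ : ℂ) * (𝓕 (toLpC f) : LpC) ξ :=
  fourier_ae_eq_of_multiplier (hasTemperateGrowth_ofReal_mul _)
    (h.toTemperedDistribution_deriv hf hf')

end

/-! ### The dyadic blocks on `L²(ℝ)` -/

namespace Besov

theorem chi_nonneg (ξ : ℝ) : 0 ≤ chi ξ := lowBump.nonneg

theorem chi_le_one (ξ : ℝ) : chi ξ ≤ 1 := lowBump.le_one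

theorem chi_eq_one {ξ : ℝ} (h : |ξ| ≤ 3 / 4) : chi ξ = 1 :=
  lowBump.one_of_mem_closedBall (by simpa [lowBump] using h)

theorem chi_eq_zero {ξ : ℝ} (h : 4 / 3 ≤ |ξ|) : chi ξ = 0 :=
  lowBump.zero_of_le_dist (by simpa [lowBump] using h)

theorem abs_phi_le (ξ : ℝ) : |phi ξ| ≤ 1 := by
  unfold phi
  have := chi_nonneg ξ; have := chi_le_one ξ
  have := chi_nonneg (ξ / 2); have := chi_le_one (ξ / 2)
  rw [abs_le]; constructor <;> linarith

theorem phi_ne_zero {ξ : ℝ} (h : phi ξ ≠ 0) : 3 / 4 ≤ |ξ| ∧ |ξ| ≤ 8 / 3 := by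
  constructor
  · by_contra! h'
    refine h ?_
    have h2 : |ξ / 2| ≤ 3 / 4 := by
      rw [abs_div, abs_of_pos (by norm_num : (0 : ℝ) < 2)]
      have := abs_nonneg ξ
      linarith
    rw [phi, chi_eq_one h2, chi_eq_one h'.le, sub_self]
  · by_contra! h'
    refine h ?_
    have h2 : 4 / 3 ≤ |ξ / 2| := by
      rw [abs_div, abs_of_pos (by norm_num : (0 : ℝ) < 2)]; linarith
    rw [phi, chi_eq_zero h2, chi_eq_zero (by linarith), sub_self]

/-- The symbol of `Δ_{n-1}` in the frequency variable of Mathlib's Fourier transform. -/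
noncomputable def sym (n : ℕ) (ξ : ℝ) : ℝ := dyadicSymbol ((n : ℤ) - 1) (2 * Real.pi * ξ)

theorem sym_zero (ξ : ℝ) : sym 0 ξ = chi (2 * Real.pi * ξ) := by
  simp [sym, dyadicSymbol]

theorem sym_succ (n : ℕ) (ξ : ℝ) :
    sym (n + 1) ξ = phi ((2 : ℝ) ^ (-(n : ℤ)) * (2 * Real.pi * ξ)) := by
  have h1 : ¬ ((n : ℤ) = -1) := by omega
  simp [sym, dyadicSymbol, h1]

theorem abs_sym_le (n : ℕ) (ξ : ℝ) : |sym n ξ| ≤ 1 := by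
  rcases n with _ | n
  · rw [sym_zero, abs_of_nonneg (chi_nonneg _)]; exact chi_le_one _
  · rw [sym_succ]; exact abs_phi_le _

theorem abs_le_of_sym_ne_zero {n : ℕ} {ξ : ℝ} (h : sym n ξ ≠ 0) :
    |2 * Real.pi * ξ| ≤ 4 / 3 * 2 ^ n := by
  rcases n with _ | n
  · rw [sym_zero] at h
    by_contra! h'
    exact h (chi_eq_zero (by simpa using h'.le))
  · rw [sym_succ] at h
    have := (phi_ne_zero h).2
    rw [abs_mul, abs_of_pos (by positivity), zpow_neg, zpow_natCast, inv_mul_le_iff₀ (by positivity)]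
      at this
    refine this.trans (le_of_eq ?_)
    rw [pow_succ]; ring

theorem le_abs_of_sym_ne_zero {n : ℕ} {ξ : ℝ} (hn : n ≠ 0) (h : sym n ξ ≠ 0) :
    3 / 8 * 2 ^ n ≤ |2 * Real.pi * ξ| := by
  rcases n with _ | n
  · exact absurd rfl hn
  · rw [sym_succ] at h
    have := (phi_ne_zero h).1
    rw [abs_mul, abs_of_pos (by positivity), zpow_neg, zpow_natCast, le_inv_mul_iff₀ (by positivity)]
      at this
    refine le_trans (le_of_eq ?_) this
    rw [pow_succ]; ring

theorem sum_sym (N : ℕ) (ξ : ℝ) :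
    ∑ n ∈ Finset.range (N + 1), sym n ξ = chi ((2 : ℝ) ^ (-(N : ℤ)) * (2 * Real.pi * ξ)) := by
  rw [Finset.sum_range_succ', ← chi_add_sum_phi, sym_zero, add_comm]
  simp_rw [sym_succ]

theorem sym_hasTemperateGrowth (n : ℕ) : (fun ξ : ℝ => ((sym n ξ : ℝ) : ℂ)).HasTemperateGrowth :=
  dyadicSymbol_hasTemperateGrowth _

theorem memLp_sym (n : ℕ) : MemLp (fun ξ : ℝ => ((sym n ξ : ℝ) : ℂ)) ∞ (volume : Measure ℝ) :=
  memLp_top_of_continuous (sym_hasTemperateGrowth n).1.continuous (c := 1) fun ξ => by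
    simpa using abs_sym_le n ξ

/-- The block `Δ_{n-1}` on `L²`. -/
noncomputable def blk (n : ℕ) : LpC →L[ℂ] LpC := fourierMul fun ξ => ((sym n ξ : ℝ) : ℂ)

theorem fourier_blk (n : ℕ) (f : LpC) :
    (𝓕 (blk n f) : LpC) =ᵐ[volume] fun ξ => ((sym n ξ : ℝ) : ℂ) * (𝓕 f : LpC) ξ :=
  fourier_fourierMul (memLp_sym n) f

theorem norm_blk_le (n : ℕ) (f : LpC) : ‖blk n f‖ ≤ ‖f‖ := by
  rw [blk]
  simpa using fourierMul_norm_le_of_le (memLp_sym n) (c := 1)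
    (fun ξ => by simpa using abs_sym_le n ξ) f

theorem toTemperedDistribution_blk (n : ℕ) (f : LpC) :
    Lp.toTemperedDistribution (blk n f) = block ((n : ℤ) - 1) (Lp.toTemperedDistribution f) :=
  toTemperedDistribution_fourierMul (memLp_sym n) (sym_hasTemperateGrowth n) f

/-- The `B^0_{2,1}` norm of a square integrable function. -/
noncomputable def besovSum (f : LpC) : ℝ≥0∞ := ∑' n, ‖blk n f‖ₑ

theorem distLpNorm_toTemperedDistribution (f : LpC) :
    distLpNorm 2 (Lp.toTemperedDistribution f) = ‖f‖ₑ := by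
  rw [distLpNorm]
  refine le_antisymm (iInf_le_of_le f (iInf_le _ rfl)) (le_iInf₂ fun g hg => ?_)
  rw [toTemperedDistribution_injective hg]

theorem exists_of_distLpNorm_ne_top {S : 𝓢'(ℝ, ℂ)} (h : distLpNorm 2 S ≠ ∞) :
    ∃ f : LpC, Lp.toTemperedDistribution f = S := by
  by_contra! h'
  refine h ?_
  simp only [distLpNorm, iInf_eq_top]
  exact fun f hf => absurd hf (h' f)

/-- The index is shifted by `j = n - 1`, since the blocks with `j ≤ -2` vanish. The weight `2^{2j}`
becomes `4^n / 4`. -/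
theorem distNorm_eq (S : 𝓢'(ℝ, ℂ)) : distNorm 2 2 1 S =
    ∑' n : ℕ, ENNReal.ofReal (4 ^ n / 4) * distLpNorm 2 (block ((n : ℤ) - 1) S) := by
  rw [distNorm, eLpNorm_one_eq_lintegral_enorm, lintegral_count]
  have hinj : Function.Injective fun n : ℕ => (n : ℤ) - 1 := fun a b h => by
    simp only at h; omega
  simp only [enorm_eq_self]
  rw [← hinj.tsum_eq]
  · refine tsum_congr fun n => ?_
    congr 1
    rw [show (2 : ℝ≥0∞) = ENNReal.ofReal 2 by simp, ENNReal.ofReal_rpow_of_pos (by norm_num)]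
    congr 1
    have e : (((n : ℤ) - 1 : ℤ) : ℝ) * 2 = ((2 * n : ℕ) : ℝ) - ((2 : ℕ) : ℝ) := by
      push_cast; ring
    rw [e, Real.rpow_sub (by norm_num), Real.rpow_natCast, Real.rpow_natCast, pow_mul]
    norm_num
  · intro j hj
    by_contra hne
    refine hj ?_
    have hj1 : ¬ (j = -1) := fun h => hne ⟨0, by simp [h]⟩
    have hj2 : ¬ (0 ≤ j) := fun h => hne ⟨(j + 1).toNat, by
      simp only; rw [Int.toNat_of_nonneg (by omega)]; ring⟩
    have e : block j S = Lp.toTemperedDistribution (0 : LpC) := by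
      have : (fun ξ : ℝ => ((dyadicSymbol j (2 * Real.pi * ξ) : ℝ) : ℂ)) = fun _ => 0 := by
        funext ξ; simp [dyadicSymbol, hj1, hj2]
      rw [block, this]
      ext θ
      rw [← Lp.toTemperedDistributionCLM_apply]
      simp
    simp only
    rw [e, distLpNorm_toTemperedDistribution]
    simp

end Besov

/-! ### Fourier symbols of the Green function and of the half-line averages -/

section

variable {m : ℝ → ℝ}

theorem fourier_subC (f g : LpC) : (𝓕 (f - g) : LpC) = 𝓕 f - 𝓕 g :=
  (Lp.fourierTransformₗᵢ ℝ ℂ).map_sub f g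

/-- The symbol is read off from the equations `u' = p' * m` and `(p' * m)' = u - m`, which avoids
computing the transform of `e^{-|x|}`. -/
theorem fourier_greenConv (hm : MemLp m 2) :
    (𝓕 (toLpC (greenConv m)) : LpC) =ᵐ[volume]
      fun ξ => ((1 + (2 * Real.pi * ξ) ^ 2 : ℝ) : ℂ)⁻¹ * (𝓕 (toLpC m) : LpC) ξ := by
  have hu := memLp_greenConv hm
  have hu' := memLp_greenConv' hm
  have e1 := (isPrim_greenConv hm).fourier_deriv hu hu'
  have e2 := (isPrim_greenConv' hm).fourier_deriv hu' (hu.sub hm)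
  rw [toLpC_sub hu hm, fourier_subC] at e2
  filter_upwards [e1, e2, Lp.coeFn_sub (𝓕 (toLpC (greenConv m)) : LpC) (𝓕 (toLpC m) : LpC)]
    with ξ h1 h2 h3
  rw [h3, Pi.sub_apply, h1] at h2
  have hne : ((1 + (2 * Real.pi * ξ) ^ 2 : ℝ) : ℂ) ≠ 0 := by
    exact_mod_cast (by positivity : (1 + (2 * Real.pi * ξ) ^ 2 : ℝ) ≠ 0)
  rw [eq_inv_mul_iff_mul_eq₀ hne]
  have hI : Complex.I * Complex.I = -1 := Complex.I_mul_I
  push_cast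
  linear_combination h2 + 4 * Real.pi ^ 2 * (ξ : ℂ) ^ 2 * (𝓕 (toLpC (greenConv m)) : LpC) ξ * hI

theorem one_add_ne_zero_of_real (ξ : ℝ) : (1 + 2 * Real.pi * Complex.I * (ξ : ℂ)) ≠ 0 := by
  intro h
  have := congrArg Complex.re h
  simp at this

theorem fourier_avgLeft (hm : MemLp m 2) :
    (𝓕 (toLpC (avgLeft m)) : LpC) =ᵐ[volume]
      fun ξ => (1 + 2 * Real.pi * Complex.I * (ξ : ℂ))⁻¹ * (𝓕 (toLpC m) : LpC) ξ := by
  have hu := memLp_avgLeft hm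
  have e2 := (isPrim_avgLeft hm).fourier_deriv hu (hm.sub hu)
  rw [toLpC_sub hm hu, fourier_subC] at e2
  filter_upwards [e2, Lp.coeFn_sub (𝓕 (toLpC m) : LpC) (𝓕 (toLpC (avgLeft m)) : LpC)]
    with ξ h2 h3
  rw [h3, Pi.sub_apply] at h2
  rw [eq_inv_mul_iff_mul_eq₀ (one_add_ne_zero_of_real ξ)]
  linear_combination -h2

end

/-! ### Compactly supported functions are dense in the Schwartz space -/

namespace Besov

theorem exists_bound_iteratedFDeriv_chi (i : ℕ) :
    ∃ C, 0 ≤ C ∧ ∀ x, ‖iteratedFDeriv ℝ i (fun ξ : ℝ => ((chi ξ : ℝ) : ℂ)) x‖ ≤ C := by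
  have h1 : HasCompactSupport fun ξ : ℝ => ((chi ξ : ℝ) : ℂ) :=
    hasCompactSupport_chi.comp_left (g := ((↑) : ℝ → ℂ)) (by simp)
  have h2 : ContDiff ℝ ((⊤ : ℕ∞) : WithTop ℕ∞) fun ξ : ℝ => ((chi ξ : ℝ) : ℂ) :=
    Complex.ofRealCLM.contDiff.comp contDiff_chi
  obtain ⟨C, hC⟩ := (h1.iteratedFDeriv (𝕜 := ℝ) i).exists_bound_of_continuous
    (h2.continuous_iteratedFDeriv (by exact_mod_cast le_top))
  exact ⟨C, (norm_nonneg _).trans (hC 0), hC⟩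

theorem chi_mul_hasTemperateGrowth {c : ℝ} (hc : c ≠ 0) :
    (fun ξ : ℝ => ((chi (c * ξ) : ℝ) : ℂ)).HasTemperateGrowth := by
  have h1 : HasCompactSupport (fun ξ : ℝ => chi (c * ξ)) := by
    simpa using hasCompactSupport_chi.comp_smul hc
  exact (h1.comp_left (g := ((↑) : ℝ → ℂ)) (by simp)).hasTemperateGrowth
    (Complex.ofRealCLM.contDiff.comp (contDiff_chi.comp (contDiff_const.mul contDiff_id)))

/-- A factor `c` of smallness, uniform in `x`, is bought with a weight `1 + |x|`. For `i = 0` the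
function vanishes unless `c |x| ≥ 3/4`; for `i ≥ 1` differentiation produces `c^i ≤ c`. -/
theorem exists_bound_iteratedFDeriv_one_sub_chi (i : ℕ) :
    ∃ C, 0 ≤ C ∧ ∀ (c : ℝ), 0 < c → c ≤ 1 → ∀ x : ℝ,
      ‖iteratedFDeriv ℝ i (fun ξ : ℝ => 1 - ((chi (c * ξ) : ℝ) : ℂ)) x‖ ≤ C * c * (1 + ‖x‖) := by
  rcases i with _ | i
  · refine ⟨4, by norm_num, fun c hc hc1 x => ?_⟩
    rw [norm_iteratedFDeriv_zero]
    have e : (1 - ((chi (c * x) : ℝ) : ℂ)) = ((1 - chi (c * x) : ℝ) : ℂ) := by push_cast; ring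
    rw [e, Complex.norm_real, Real.norm_eq_abs,
      abs_of_nonneg (sub_nonneg.2 (chi_le_one _))]
    have h0 := norm_nonneg x
    rcases le_total |c * x| (3 / 4) with h | h
    · rw [chi_eq_one h, sub_self]; positivity
    · rw [abs_mul, abs_of_pos hc] at h
      have := chi_nonneg (c * x)
      rw [Real.norm_eq_abs]
      nlinarith
  · obtain ⟨C, hC, hb⟩ := exists_bound_iteratedFDeriv_chi (i + 1)
    refine ⟨C, hC, fun c hc hc1 x => ?_⟩
    have hs : ContDiff ℝ ((i + 1 : ℕ) : WithTop ℕ∞) (fun ξ : ℝ => ((chi ξ : ℝ) : ℂ)) :=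
      Complex.ofRealCLM.contDiff.comp ((contDiff_chi (n := ((i + 1 : ℕ) : ℕ∞))))
    have e1 : iteratedDeriv (i + 1) (fun ξ : ℝ => 1 - ((chi (c * ξ) : ℝ) : ℂ)) x =
        -(c ^ (i + 1) • iteratedDeriv (i + 1) (fun ξ : ℝ => ((chi ξ : ℝ) : ℂ)) (c * x)) := by
      have := congrFun (iteratedDeriv_comp_const_smul hs c) x
      rw [iteratedDeriv_const_sub (by omega), iteratedDeriv_neg, this]
    rw [norm_iteratedFDeriv_eq_norm_iteratedDeriv, e1, norm_neg, norm_smul,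
      ← norm_iteratedFDeriv_eq_norm_iteratedDeriv, norm_pow, Real.norm_of_nonneg hc.le]
    have h1 : c ^ (i + 1) ≤ c := by
      rw [pow_succ]
      exact mul_le_of_le_one_left hc.le (pow_le_one₀ hc.le hc1)
    calc c ^ (i + 1) * _ ≤ c * C := by gcongr; exact hb _
      _ ≤ C * c * (1 + ‖x‖) := by
        have := norm_nonneg x
        have := mul_nonneg (mul_nonneg hC hc.le) this
        linarith

/-- By Leibniz' rule each seminorm of `(1 - χ(c ·)) θ` is at most `c` times seminorms of `θ`, where
the extra weight `1 + |x|` raises the power `k` by one. -/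
theorem tendsto_chi_smul {c : ℕ → ℝ} (hc : ∀ N, 0 < c N) (hc1 : ∀ N, c N ≤ 1)
    (hl : Tendsto c atTop (𝓝 0)) (θ : 𝓢(ℝ, ℂ)) :
    Tendsto (fun N => SchwartzMap.smulLeftCLM ℂ (fun ξ : ℝ => ((chi (c N * ξ) : ℝ) : ℂ)) θ)
      atTop (𝓝 θ) := by
  rw [(schwartz_withSeminorms ℝ ℝ ℂ).tendsto_nhds]
  rintro ⟨k, l⟩ ε hε
  choose C hC hb using exists_bound_iteratedFDeriv_one_sub_chi
  set M : ℝ := ∑ i ∈ Finset.range (l + 1), (l.choose i : ℝ) * C i *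
    (SchwartzMap.seminorm ℝ k (l - i) θ + SchwartzMap.seminorm ℝ (k + 1) (l - i) θ) with hM
  have hM0 : 0 ≤ M := Finset.sum_nonneg fun i _ => by
    have := hC i
    have := apply_nonneg (SchwartzMap.seminorm ℝ k (l - i)) θ
    have := apply_nonneg (SchwartzMap.seminorm ℝ (k + 1) (l - i)) θ
    positivity
  have key : ∀ N, SchwartzMap.seminorm ℝ k l
      (SchwartzMap.smulLeftCLM ℂ (fun ξ : ℝ => ((chi (c N * ξ) : ℝ) : ℂ)) θ - θ) ≤ c N * M := by
    intro N
    refine SchwartzMap.seminorm_le_bound ℝ k l _ (mul_nonneg (hc N).le hM0) fun x => ?_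
    have e : ⇑(SchwartzMap.smulLeftCLM ℂ (fun ξ : ℝ => ((chi (c N * ξ) : ℝ) : ℂ)) θ - θ) =
        fun y => -((1 - ((chi (c N * y) : ℝ) : ℂ)) * θ y) := by
      funext y
      rw [_root_.sub_apply, SchwartzMap.smulLeftCLM_apply_apply
        (chi_mul_hasTemperateGrowth (hc N).ne'), smul_eq_mul]
      ring
    rw [e, show (fun y => -((1 - ((chi (c N * y) : ℝ) : ℂ)) * θ y)) =
      -(fun y => (1 - ((chi (c N * y) : ℝ) : ℂ)) * θ y) from rfl, iteratedFDeriv_neg_apply,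
      norm_neg]
    have hs : ContDiff ℝ l (fun y : ℝ => 1 - ((chi (c N * y) : ℝ) : ℂ)) :=
      contDiff_const.sub (Complex.ofRealCLM.contDiff.comp
        ((contDiff_chi (n := (l : ℕ∞))).comp (contDiff_const.mul contDiff_id)))
    have hm := norm_iteratedFDeriv_mul_le hs (θ.smooth l) x le_rfl
    calc ‖x‖ ^ k * _ ≤ ‖x‖ ^ k * _ := mul_le_mul_of_nonneg_left hm (by positivity)
      _ = ∑ i ∈ Finset.range (l + 1), (l.choose i : ℝ) *
          ‖iteratedFDeriv ℝ i (fun y : ℝ => 1 - ((chi (c N * y) : ℝ) : ℂ)) x‖ *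
          (‖x‖ ^ k * ‖iteratedFDeriv ℝ (l - i) θ x‖) := by
        rw [Finset.mul_sum]; exact Finset.sum_congr rfl fun i _ => by ring
      _ ≤ ∑ i ∈ Finset.range (l + 1), (l.choose i : ℝ) * (C i * c N * (1 + ‖x‖)) *
          (‖x‖ ^ k * ‖iteratedFDeriv ℝ (l - i) θ x‖) := by
        refine Finset.sum_le_sum fun i _ => ?_
        gcongr
        exact hb i (c N) (hc N) (hc1 N) x
      _ = ∑ i ∈ Finset.range (l + 1), c N * ((l.choose i : ℝ) * C i *
          (‖x‖ ^ k * ‖iteratedFDeriv ℝ (l - i) θ x‖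
            + ‖x‖ ^ (k + 1) * ‖iteratedFDeriv ℝ (l - i) θ x‖)) :=
        Finset.sum_congr rfl fun i _ => by ring
      _ ≤ c N * M := by
        rw [hM, Finset.mul_sum]
        refine Finset.sum_le_sum fun i _ => ?_
        have := hC i
        have := (hc N).le
        gcongr
        · exact SchwartzMap.le_seminorm ℝ k (l - i) θ x
        · exact SchwartzMap.le_seminorm ℝ (k + 1) (l - i) θ x
  have h0 : Tendsto (fun N => c N * M) atTop (𝓝 0) := by simpa using hl.mul_const M
  filter_upwards [h0.eventually_lt_const hε] with N hN
  exact (key N).trans_lt hN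

/-! ### Littlewood–Paley reconstruction -/

theorem tendsto_two_zpow_neg : Tendsto (fun N : ℕ => (2 : ℝ) ^ (-(N : ℤ))) atTop (𝓝 0) := by
  have := tendsto_pow_atTop_nhds_zero_of_lt_one (r := (1 / 2 : ℝ)) (by norm_num) (by norm_num)
  refine this.congr fun N => ?_
  rw [zpow_neg, zpow_natCast, one_div, inv_pow]

/-- The partial sums of the symbols telescope to a dilated `χ`; the cut-off is moved to the test
function, where it converges in the Schwartz topology. Thus a distribution is determined by its
blocks. -/
theorem tendsto_sum_block (S : 𝓢'(ℝ, ℂ)) (θ : 𝓢(ℝ, ℂ)) :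
    Tendsto (fun N : ℕ => ∑ n ∈ Finset.range (N + 1), block ((n : ℤ) - 1) S θ) atTop
      (𝓝 (S θ)) := by
  have h2 : ∀ N : ℕ, 0 < (2 : ℝ) ^ (-(N : ℤ)) := fun N => by positivity
  have hl : Tendsto (fun N : ℕ => 1 / 8 * (2 : ℝ) ^ (-(N : ℤ)) * (2 * Real.pi)) atTop (𝓝 0) := by
    have := (tendsto_two_zpow_neg.const_mul (1 / 8)).mul_const (2 * Real.pi)
    rwa [mul_zero, zero_mul] at this
  have hl' : Tendsto (fun N : ℕ => (2 : ℝ) ^ (-((N + 3 : ℕ) : ℤ)) * (2 * Real.pi)) atTop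
      (𝓝 0) := by
    refine hl.congr fun N => ?_
    have e : (-((N + 3 : ℕ) : ℤ)) = -(N : ℤ) + (-3) := by push_cast; ring
    rw [e, zpow_add₀ two_ne_zero]; norm_num; ring
  -- The shift by `3` compensates the factor `2π ≤ 8` of the frequency normalisation, because the
  -- dilation parameter has to be at most `1`.
  have h1 : ∀ N : ℕ, (2 : ℝ) ^ (-((N + 3 : ℕ) : ℤ)) * (2 * Real.pi) ≤ 1 := by
    intro N
    have a : (2 : ℝ) ^ (-((N + 3 : ℕ) : ℤ)) ≤ 1 / 8 := by
      rw [zpow_neg, zpow_natCast, one_div]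
      refine inv_anti₀ (by norm_num) ?_
      rw [pow_add]
      have := one_le_pow₀ (one_le_two : (1 : ℝ) ≤ 2) (n := N)
      linarith
    have := Real.pi_le_four
    nlinarith [Real.pi_pos]
  have t := tendsto_chi_smul (fun N => by positivity) h1 hl' (𝓕⁻ θ)
  have t2 : Tendsto (fun N : ℕ => S (𝓕 (SchwartzMap.smulLeftCLM ℂ (fun ξ : ℝ =>
      ((chi ((2 : ℝ) ^ (-((N + 3 : ℕ) : ℤ)) * (2 * Real.pi) * ξ) : ℝ) : ℂ)) (𝓕⁻ θ)))) atTop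
      (𝓝 (S (𝓕 (𝓕⁻ θ)))) :=
    ((S.continuous.comp (SchwartzMap.fourierTransformCLM ℂ).continuous).tendsto (𝓕⁻ θ)).comp t
  rw [FourierTransform.fourier_fourierInv_eq] at t2
  refine (tendsto_add_atTop_iff_nat 3).1 (t2.congr fun N => ?_)
  have e1 : ∀ ξ : ℝ, ((chi ((2 : ℝ) ^ (-((N + 3 : ℕ) : ℤ)) * (2 * Real.pi) * ξ) : ℝ) : ℂ) =
      ∑ n ∈ Finset.range (N + 3 + 1), ((sym n ξ : ℝ) : ℂ) := by
    intro ξ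
    rw [← Complex.ofReal_sum, sum_sym, mul_assoc _ (2 * Real.pi) ξ]
  rw [funext e1, SchwartzMap.smulLeftCLM_sum fun n _ => sym_hasTemperateGrowth n,
    sum_apply]
  change S (SchwartzMap.fourierTransformCLM ℂ (∑ i ∈ Finset.range (N + 3 + 1), _)) = _
  rw [map_sum, map_sum]
  refine Finset.sum_congr rfl fun n _ => ?_
  rw [block, TemperedDistribution.fourierMultiplierCLM_apply_apply]
  rfl

/-- Plancherel and dominated convergence on the Fourier side: the symbol of the error is `χ(2^{-N}
·) - 1`, bounded by `1` and eventually `0` at each frequency. -/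
theorem tendsto_sum_blk (f : LpC) :
    Tendsto (fun N : ℕ => ∑ n ∈ Finset.range (N + 1), blk n f) atTop (𝓝 f) := by
  rw [tendsto_iff_norm_sub_tendsto_zero]
  have hs : ∀ N : ℕ, (𝓕 ((∑ n ∈ Finset.range (N + 1), blk n f) - f) : LpC) =ᵐ[volume]
      fun ξ => (((chi ((2 : ℝ) ^ (-(N : ℤ)) * (2 * Real.pi * ξ)) - 1 : ℝ)) : ℂ) *
        (𝓕 f : LpC) ξ := by
    intro N
    have e : ∀ K : ℕ, (𝓕 (∑ n ∈ Finset.range K, blk n f) : LpC) =ᵐ[volume]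
        fun ξ => ((∑ n ∈ Finset.range K, sym n ξ : ℝ) : ℂ) * (𝓕 f : LpC) ξ := by
      intro K
      induction K with
      | zero =>
        have : (𝓕 (0 : LpC) : LpC) = 0 := (Lp.fourierTransformₗᵢ ℝ ℂ).map_zero
        simp only [Finset.range_zero, Finset.sum_empty, this]
        filter_upwards [Lp.coeFn_zero ℂ 2 (volume : Measure ℝ)] with ξ h
        rw [h]; simp
      | succ K ih =>
        have : (𝓕 (∑ n ∈ Finset.range (K + 1), blk n f) : LpC) =
            𝓕 (∑ n ∈ Finset.range K, blk n f) + 𝓕 (blk K f) := by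
          rw [Finset.sum_range_succ]
          exact (Lp.fourierTransformₗᵢ ℝ ℂ).map_add _ _
        rw [this]
        filter_upwards [ih, fourier_blk K f, Lp.coeFn_add
          (𝓕 (∑ n ∈ Finset.range K, blk n f) : LpC) (𝓕 (blk K f) : LpC)] with ξ h1 h2 h3
        rw [h3, Pi.add_apply, h1, h2, Finset.sum_range_succ]
        push_cast; ring
    rw [fourier_subC]
    filter_upwards [e (N + 1), Lp.coeFn_sub
      (𝓕 (∑ n ∈ Finset.range (N + 1), blk n f) : LpC) (𝓕 f : LpC)] with ξ h1 h2
    rw [h2, Pi.sub_apply, h1, sum_sym]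
    push_cast; ring
  have hn : ∀ N : ℕ, ‖(∑ n ∈ Finset.range (N + 1), blk n f) - f‖ₑ ^ 2 =
      ∫⁻ ξ, ‖(((chi ((2 : ℝ) ^ (-(N : ℤ)) * (2 * Real.pi * ξ)) - 1 : ℝ)) : ℂ) *
        (𝓕 f : LpC) ξ‖ₑ ^ 2 := by
    intro N
    have e1 : ‖(∑ n ∈ Finset.range (N + 1), blk n f) - f‖ₑ =
        ‖(𝓕 ((∑ n ∈ Finset.range (N + 1), blk n f) - f) : LpC)‖ₑ := by
      rw [← ofReal_norm, ← ofReal_norm, Lp.norm_fourier_eq]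
    rw [e1, Lp.enorm_def, eLpNorm_two_sq]
    refine lintegral_congr_ae ?_
    filter_upwards [hs N] with ξ h
    rw [h]
  have hlim : Tendsto (fun N : ℕ => ‖(∑ n ∈ Finset.range (N + 1), blk n f) - f‖ₑ ^ 2) atTop
      (𝓝 0) := by
    simp_rw [hn]
    have hfin : ∫⁻ ξ, ‖(𝓕 f : LpC) ξ‖ₑ ^ 2 ≠ ∞ := by
      rw [← eLpNorm_two_sq]
      exact ENNReal.pow_ne_top (Lp.eLpNorm_ne_top _)
    have := tendsto_lintegral_of_dominated_convergence' (μ := (volume : Measure ℝ))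
      (F := fun N ξ => ‖(((chi ((2 : ℝ) ^ (-(N : ℤ)) * (2 * Real.pi * ξ)) - 1 : ℝ)) : ℂ) *
        (𝓕 f : LpC) ξ‖ₑ ^ 2) (f := fun _ => 0) (fun ξ => ‖(𝓕 f : LpC) ξ‖ₑ ^ 2) ?_ ?_ hfin ?_
    · simpa using this
    · intro N
      have hc : Continuous fun ξ : ℝ =>
          (((chi ((2 : ℝ) ^ (-(N : ℤ)) * (2 * Real.pi * ξ)) - 1 : ℝ)) : ℂ) := by
        have : Continuous chi := (contDiff_chi (n := 0)).continuous
        fun_prop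
      exact ((hc.aestronglyMeasurable.mul (Lp.aestronglyMeasurable _)).enorm).pow_const 2
    · intro N
      refine ae_of_all _ fun ξ => ?_
      simp only [enorm_mul]
      gcongr
      refine mul_le_of_le_one_left' ?_
      rw [← ofReal_norm, Complex.norm_real, ENNReal.ofReal_le_one, Real.norm_eq_abs,
        abs_le]
      have := chi_nonneg ((2 : ℝ) ^ (-(N : ℤ)) * (2 * Real.pi * ξ))
      have := chi_le_one ((2 : ℝ) ^ (-(N : ℤ)) * (2 * Real.pi * ξ))
      constructor <;> linarith
    · refine ae_of_all _ fun ξ => ?_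
      have ht : Tendsto (fun N : ℕ => |(2 : ℝ) ^ (-(N : ℤ)) * (2 * Real.pi * ξ)|) atTop (𝓝 0) := by
        simpa using (tendsto_two_zpow_neg.mul_const (2 * Real.pi * ξ)).abs
      refine tendsto_const_nhds.congr' ?_
      filter_upwards [ht.eventually_le_const (by norm_num : (0 : ℝ) < 3 / 4)] with N hN
      rw [chi_eq_one hN]; simp
  have h3 : Tendsto (fun N : ℕ => (‖(∑ n ∈ Finset.range (N + 1), blk n f) - f‖ₑ ^ 2).toReal) atTop
      (𝓝 0) := (ENNReal.tendsto_toReal ENNReal.zero_ne_top).comp hlim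
  have h4 : ∀ N : ℕ, (‖(∑ n ∈ Finset.range (N + 1), blk n f) - f‖ₑ ^ 2).toReal =
      ‖(∑ n ∈ Finset.range (N + 1), blk n f) - f‖ ^ 2 := fun N => by
    rw [ENNReal.toReal_pow, toReal_enorm]
  simp_rw [h4] at h3
  have := h3.sqrt
  simpa [Real.sqrt_sq] using this

theorem enorm_le_besovSum (f : LpC) : ‖f‖ₑ ≤ besovSum f := by
  refine le_of_tendsto (tendsto_sum_blk f).enorm (Eventually.of_forall fun N => ?_)
  exact (enorm_sum_le _ _).trans (ENNReal.sum_le_tsum _)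

end Besov

/-! ### The Besov norm in terms of `u - u_xx` -/

namespace Besov

theorem represents_toLpC {f : ℝ → ℝ} (hf : MemLp f 2) :
    Represents f (Lp.toTemperedDistribution (toLpC f)) := by
  intro θ
  have hθ : MemLp θ 2 (volume : Measure ℝ) := θ.memLp 2
  refine ⟨hθ.integrable_mul hf.ofRealC, ?_⟩
  rw [Lp.toTemperedDistribution_apply]
  refine integral_congr_ae ?_
  filter_upwards [coeFn_toLpC hf] with x hx
  rw [hx, smul_eq_mul]

theorem Represents.unique {f : ℝ → ℝ} {S S' : 𝓢'(ℝ, ℂ)} (h : Represents f S)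
    (h' : Represents f S') : S = S' := by
  ext θ
  rw [(h θ).2, (h' θ).2]

theorem fnNorm_eq_of_represents {f : ℝ → ℝ} {S : 𝓢'(ℝ, ℂ)} (h : Represents f S) :
    fnNorm 2 2 1 f = distNorm 2 2 1 S := by
  rw [fnNorm]
  refine le_antisymm (iInf_le_of_le S (iInf_le _ h)) (le_iInf₂ fun S' h' => ?_)
  rw [h.unique h']

theorem fnNorm_eq {f : ℝ → ℝ} (hf : MemLp f 2) :
    fnNorm 2 2 1 f = ∑' n : ℕ, ENNReal.ofReal (4 ^ n / 4) * ‖blk n (toLpC f)‖ₑ := by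
  rw [fnNorm_eq_of_represents (represents_toLpC hf), distNorm_eq]
  simp_rw [← toTemperedDistribution_blk, distLpNorm_toTemperedDistribution]

theorem norm_le_of_fourier {f g : LpC} {c : ℝ}
    (h : ∀ᵐ ξ, ‖(𝓕 f : LpC) ξ‖ ≤ c * ‖(𝓕 g : LpC) ξ‖) : ‖f‖ ≤ c * ‖g‖ := by
  rw [← Lp.norm_fourier_eq f, ← Lp.norm_fourier_eq g]
  exact Lp.norm_le_mul_norm_of_ae_le_mul h

section

variable {m : ℝ → ℝ}

/-- On the support of block `n ≥ 1` the angular frequency is at least `(3/8) 2^n`, so `1 + η² ≥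
(9/64) 4^n`. For `n = 0` the trivial bound `1 + η² ≥ 1` is enough. -/
theorem norm_blk_greenConv_le (hm : MemLp m 2) (n : ℕ) :
    ‖blk n (toLpC (greenConv m))‖ ≤ 64 / 9 / 4 ^ n * ‖blk n (toLpC m)‖ := by
  refine norm_le_of_fourier ?_
  filter_upwards [fourier_blk n (toLpC (greenConv m)), fourier_blk n (toLpC m),
    fourier_greenConv hm] with ξ h1 h2 h3
  rw [h1, h2, h3]
  by_cases hs : sym n ξ = 0
  · simp [hs]
  rw [mul_left_comm, norm_mul]
  gcongr
  rw [norm_inv, Complex.norm_real, Real.norm_of_nonneg (by positivity),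
    inv_le_comm₀ (by positivity) (by positivity), inv_div]
  rcases eq_or_ne n 0 with rfl | hn
  · have := sq_nonneg (2 * Real.pi * ξ); norm_num; linarith
  · have h := le_abs_of_sym_ne_zero hn hs
    have h4 : (4 : ℝ) ^ n = (2 ^ n) ^ 2 := by rw [← pow_mul, mul_comm, pow_mul]; norm_num
    have h5 : (3 / 8 * 2 ^ n) ^ 2 ≤ (2 * Real.pi * ξ) ^ 2 := by
      rw [← sq_abs (2 * Real.pi * ξ)]; gcongr
    rw [h4]; nlinarith

/-- Here `|η| ≤ (4/3) 2^n` gives `1 + η² ≤ (1 + 16/9) 4^n ≤ 3 · 4^n`. Together with the reverse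
bound this makes the `B^2_{2,1}` norm of `p * m` equivalent to the `B^0_{2,1}` norm of `m`. -/
theorem norm_blk_le_greenConv (hm : MemLp m 2) (n : ℕ) :
    ‖blk n (toLpC m)‖ ≤ 3 * 4 ^ n * ‖blk n (toLpC (greenConv m))‖ := by
  refine norm_le_of_fourier ?_
  filter_upwards [fourier_blk n (toLpC (greenConv m)), fourier_blk n (toLpC m),
    fourier_greenConv hm] with ξ h1 h2 h3
  have hne : ((1 + (2 * Real.pi * ξ) ^ 2 : ℝ) : ℂ) ≠ 0 := by
    exact_mod_cast (by positivity : (1 + (2 * Real.pi * ξ) ^ 2 : ℝ) ≠ 0)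
  rw [eq_inv_mul_iff_mul_eq₀ hne] at h3
  rw [h1, h2, ← h3]
  by_cases hs : sym n ξ = 0
  · simp [hs]
  rw [mul_left_comm, norm_mul]
  gcongr
  rw [Complex.norm_real, Real.norm_of_nonneg (by positivity)]
  have h := abs_le_of_sym_ne_zero hs
  have h4 : (4 : ℝ) ^ n = (2 ^ n) ^ 2 := by rw [← pow_mul, mul_comm, pow_mul]; norm_num
  have h5 : (2 * Real.pi * ξ) ^ 2 ≤ (4 / 3 * 2 ^ n) ^ 2 := by
    rw [← sq_abs (2 * Real.pi * ξ)]; gcongr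
  have h6 : (1 : ℝ) ≤ 2 ^ n := one_le_pow₀ one_le_two
  rw [h4]; nlinarith

theorem fnNorm_greenConv_le (hm : MemLp m 2) :
    fnNorm 2 2 1 (greenConv m) ≤ 2 * besovSum (toLpC m) := by
  rw [fnNorm_eq (memLp_greenConv hm), besovSum, ← ENNReal.tsum_mul_left]
  refine ENNReal.tsum_le_tsum fun n => ?_
  have h4 : (0 : ℝ) < 4 ^ n := by positivity
  rw [← ofReal_norm, ← ofReal_norm, ← ENNReal.ofReal_mul (by positivity),
    show (2 : ℝ≥0∞) * ENNReal.ofReal ‖blk n (toLpC m)‖ = ENNReal.ofReal (2 * ‖blk n (toLpC m)‖) by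
      rw [ENNReal.ofReal_mul (by norm_num), ENNReal.ofReal_ofNat]]
  refine ENNReal.ofReal_le_ofReal ?_
  calc 4 ^ n / 4 * ‖blk n (toLpC (greenConv m))‖
      ≤ 4 ^ n / 4 * (64 / 9 / 4 ^ n * ‖blk n (toLpC m)‖) := by
        gcongr; exact norm_blk_greenConv_le hm n
    _ = 16 / 9 * ‖blk n (toLpC m)‖ := by field_simp; ring
    _ ≤ 2 * ‖blk n (toLpC m)‖ := by gcongr; norm_num

theorem besovSum_le_fnNorm (hm : MemLp m 2) :
    besovSum (toLpC m) ≤ 12 * fnNorm 2 2 1 (greenConv m) := by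
  rw [fnNorm_eq (memLp_greenConv hm), besovSum, ← ENNReal.tsum_mul_left]
  refine ENNReal.tsum_le_tsum fun n => ?_
  rw [← ofReal_norm, ← ofReal_norm, show (12 : ℝ≥0∞) = ENNReal.ofReal 12 by simp,
    ← ENNReal.ofReal_mul (by positivity), ← ENNReal.ofReal_mul (by positivity)]
  refine ENNReal.ofReal_le_ofReal ((norm_blk_le_greenConv hm n).trans (le_of_eq ?_))
  ring

theorem ofReal_l2norm_le_fnNorm (hm : MemLp m 2) :
    ENNReal.ofReal (l2norm m) ≤ 12 * fnNorm 2 2 1 (greenConv m) := by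
  rw [← norm_toLpC hm, ofReal_norm]
  exact (enorm_le_besovSum _).trans (besovSum_le_fnNorm hm)

/-- A function with summable blocks is square integrable. -/
theorem exists_eq_toTemperedDistribution {S : 𝓢'(ℝ, ℂ)} (h : distNorm 2 2 1 S < ∞) :
    ∃ F : LpC, S = Lp.toTemperedDistribution F ∧
      ∑' n : ℕ, ENNReal.ofReal (4 ^ n / 4) * ‖blk n F‖ₑ < ∞ := by
  have h0 := h
  rw [distNorm_eq] at h
  have hn : ∀ n : ℕ, distLpNorm 2 (block ((n : ℤ) - 1) S) ≠ ∞ := by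
    intro n hn
    have := (ENNReal.le_tsum n).trans_lt h
    rw [hn, ENNReal.mul_top (by positivity)] at this
    exact lt_irrefl _ this
  choose G hG using fun n => exists_of_distLpNorm_ne_top (hn n)
  -- The weights satisfy `4 · (4^n / 4) ≥ 1`, so the blocks are absolutely summable in `L²` already
  -- without the weights.
  have hfin : ∑' n, ‖G n‖ₑ ≠ ∞ := by
    refine ne_top_of_le_ne_top (ENNReal.mul_ne_top (by simp : (4 : ℝ≥0∞) ≠ ∞) h.ne) ?_
    rw [← ENNReal.tsum_mul_left]
    refine ENNReal.tsum_le_tsum fun n => ?_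
    rw [← hG n, distLpNorm_toTemperedDistribution, ← mul_assoc]
    refine le_mul_of_one_le_left' ?_
    rw [show (4 : ℝ≥0∞) = ENNReal.ofReal 4 by simp, ← ENNReal.ofReal_mul (by norm_num),
      ENNReal.one_le_ofReal]
    have : (1 : ℝ) ≤ 4 ^ n := one_le_pow₀ (by norm_num)
    linarith
  have hs : Summable G := by
    refine Summable.of_norm ?_
    have := ENNReal.summable_toReal hfin
    simpa using this
  -- Both sides are the limit of the same partial sums of blocks, tested against a Schwartz
  -- function.
  have e : S = Lp.toTemperedDistribution (∑' n, G n) := by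
    ext θ
    refine tendsto_nhds_unique (tendsto_sum_block S θ) ?_
    have t1 := (hs.hasSum.tendsto_sum_nat.comp (tendsto_add_atTop_nat 1))
    have hL : Continuous fun g : LpC => Lp.toTemperedDistribution g θ := by
      have h2 : MemLp θ 2 (volume : Measure ℝ) := θ.memLp 2
      have : (fun g : LpC => Lp.toTemperedDistribution g θ) = fun g : LpC =>
          ⟪(h2.star.toLp _ : LpC), g⟫ := by
        funext g
        rw [Lp.toTemperedDistribution_apply, L2.inner_def]
        refine integral_congr_ae ?_
        filter_upwards [h2.star.coeFn_toLp] with x hx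
        rw [hx]
        simp [RCLike.inner_apply, mul_comm]
      rw [this]
      fun_prop
    refine ((hL.tendsto _).comp t1).congr fun N => ?_
    simp only [Function.comp]
    rw [← Lp.toTemperedDistributionCLM_apply, map_sum, sum_apply]
    refine Finset.sum_congr rfl fun n _ => ?_
    rw [Lp.toTemperedDistributionCLM_apply, hG n]
  refine ⟨_, e, ?_⟩
  rw [e] at h
  simpa only [← toTemperedDistribution_blk, distLpNorm_toTemperedDistribution] using h

/-- The convolution with the Green function as a Fourier multiplier. -/
noncomputable def greenSymbol (ξ : ℝ) : ℂ := ((1 + (2 * Real.pi * ξ) ^ 2 : ℝ) : ℂ)⁻¹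

theorem one_add_sq_ne_zero (ξ : ℝ) : ((1 + (2 * Real.pi * ξ) ^ 2 : ℝ) : ℂ) ≠ 0 := by
  exact_mod_cast (by positivity : (1 + (2 * Real.pi * ξ) ^ 2 : ℝ) ≠ 0)

theorem memLp_greenSymbol : MemLp greenSymbol ∞ (volume : Measure ℝ) := by
  refine memLp_top_of_continuous (c := 1) ?_ fun ξ => ?_
  · unfold greenSymbol
    exact (by fun_prop : Continuous fun ξ : ℝ => ((1 + (2 * Real.pi * ξ) ^ 2 : ℝ) : ℂ)).inv₀
      one_add_sq_ne_zero
  · rw [greenSymbol, norm_inv, Complex.norm_real, Real.norm_of_nonneg (by positivity)]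
    refine inv_le_one_of_one_le₀ ?_
    have := sq_nonneg (2 * Real.pi * ξ); linarith

theorem fourierMul_greenSymbol (hm : MemLp m 2) :
    fourierMul greenSymbol (toLpC m) = toLpC (greenConv m) := by
  refine fourier_injective_ae ?_
  filter_upwards [fourier_fourierMul memLp_greenSymbol (toLpC m), fourier_greenConv hm]
    with ξ h1 h2
  rw [h1, h2, greenSymbol]

/-- A square integrable function with two derivatives in the Besov scale is a convolution with the
Green function. -/
theorem exists_fourierMul_greenSymbol {F : LpC}
    (h : ∑' n : ℕ, ENNReal.ofReal (4 ^ n / 4) * ‖blk n F‖ₑ < ∞) :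
    ∃ M : LpC, F = fourierMul greenSymbol M := by
  -- The multiplier `1 + η²`, cut off to a ball containing the support of block `n`, inverts the
  -- Green symbol on that block. Its size is at most `3 · 4^n`, which the weighted sum of the blocks
  -- absorbs, so `M = ∑ ψ_n(D) Δ_n F` converges in `L²`.
  set ψ : ℕ → ℝ → ℂ := fun n => {ξ : ℝ | |2 * Real.pi * ξ| ≤ 4 / 3 * 2 ^ n}.indicator
    fun ξ => ((1 + (2 * Real.pi * ξ) ^ 2 : ℝ) : ℂ) with hψ
  have hb : ∀ n ξ, ‖ψ n ξ‖ ≤ 3 * 4 ^ n := by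
    intro n ξ
    simp only [hψ]
    by_cases hξ : |2 * Real.pi * ξ| ≤ 4 / 3 * 2 ^ n
    · rw [Set.indicator_of_mem (by exact hξ), Complex.norm_real,
        Real.norm_of_nonneg (by positivity)]
      have h4 : (4 : ℝ) ^ n = (2 ^ n) ^ 2 := by rw [← pow_mul, mul_comm, pow_mul]; norm_num
      have h5 : (2 * Real.pi * ξ) ^ 2 ≤ (4 / 3 * 2 ^ n) ^ 2 := by
        rw [← sq_abs (2 * Real.pi * ξ)]; gcongr
      have h6 : (1 : ℝ) ≤ 2 ^ n := one_le_pow₀ one_le_two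
      rw [h4]; nlinarith
    · rw [Set.indicator_of_notMem (by exact hξ), norm_zero]; positivity
  have hm : ∀ n, MemLp (ψ n) ∞ (volume : Measure ℝ) := by
    intro n
    refine memLp_top_of_bound ?_ _ (ae_of_all _ (hb n))
    refine AEStronglyMeasurable.indicator ?_ ?_
    · exact (by fun_prop : Continuous fun ξ : ℝ =>
        ((1 + (2 * Real.pi * ξ) ^ 2 : ℝ) : ℂ)).aestronglyMeasurable
    · exact measurableSet_le (by fun_prop) measurable_const
  have hs : Summable fun n => fourierMul (ψ n) (blk n F) := by
    refine Summable.of_norm_bounded (g := fun n => 12 * (4 ^ n / 4 * ‖blk n F‖)) ?_ fun n => ?_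
    · have := (ENNReal.summable_toReal h.ne).mul_left 12
      refine this.congr fun n => ?_
      rw [ENNReal.toReal_mul, toReal_enorm, ENNReal.toReal_ofReal (by positivity)]
    · refine (fourierMul_norm_le_of_le (hm n) (hb n) _).trans (le_of_eq ?_)
      ring
  refine ⟨∑' n, fourierMul (ψ n) (blk n F), ?_⟩
  rw [ContinuousLinearMap.map_tsum _ hs]
  have hs' := hs.map (fourierMul greenSymbol) (fourierMul greenSymbol).continuous
  have t := hs'.hasSum.tendsto_sum_nat.comp (tendsto_add_atTop_nat 1)
  refine tendsto_nhds_unique (tendsto_sum_blk F) (t.congr fun N => ?_)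
  refine Finset.sum_congr rfl fun n _ => ?_
  refine fourier_injective_ae ?_
  filter_upwards [fourier_fourierMul memLp_greenSymbol (fourierMul (ψ n) (blk n F)),
    fourier_fourierMul (hm n) (blk n F), fourier_blk n F] with ξ h1 h2 h3
  simp only [Function.comp]
  rw [h1, h2, h3, greenSymbol]
  by_cases hs : sym n ξ = 0
  · simp [hs]
  · simp only [hψ]
    rw [Set.indicator_of_mem (by exact abs_le_of_sym_ne_zero hs), ← mul_assoc,
      inv_mul_cancel₀ (one_add_sq_ne_zero ξ), one_mul]

/-- The entry point for arbitrary solutions: each slice has a momentum in `L²`. The momentum found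
on the Fourier side is complex; its real part suffices because `f` is real and `p` is real, and
continuity turns almost everywhere equality into equality. -/
theorem exists_eq_greenConv {f : ℝ → ℝ} (hc : Continuous f) (h : Mem 2 2 1 f) :
    ∃ m : ℝ → ℝ, MemLp m 2 ∧ f = greenConv m := by
  rw [Mem, fnNorm] at h
  simp only [iInf_lt_iff] at h
  obtain ⟨S, hS, hlt⟩ := h
  obtain ⟨F, rfl, hF⟩ := exists_eq_toTemperedDistribution hlt
  have hae : F =ᵐ[volume] fun x => (f x : ℂ) := by
    refine ae_eq_of_integral_contDiff_smul_eq ((Lp.memLp F).locallyIntegrable (by norm_num))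
      (Complex.continuous_ofReal.comp hc).locallyIntegrable fun θ hθ hs => ?_
    have s1 : HasCompactSupport (fun x => (θ x : ℂ)) :=
      hs.comp_left (g := ((↑) : ℝ → ℂ)) (by simp)
    have s2 : ContDiff ℝ ((⊤ : ℕ∞) : WithTop ℕ∞) (fun x => (θ x : ℂ)) :=
      Complex.ofRealCLM.contDiff.comp hθ
    have := (hS (s1.toSchwartzMap s2)).2
    rw [Lp.toTemperedDistribution_apply] at this
    simpa using this
  obtain ⟨M, hM⟩ := exists_fourierMul_greenSymbol hF
  have hMm := Lp.memLp M
  have hre : MemLp (fun x => (M x).re) 2 (volume : Measure ℝ) := hMm.re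
  have him : MemLp (fun x => (M x).im) 2 (volume : Measure ℝ) := hMm.im
  refine ⟨_, hre, ?_⟩
  have e : M = toLpC (fun x => (M x).re) + Complex.I • toLpC (fun x => (M x).im) := by
    refine Lp.ext ?_
    filter_upwards [coeFn_toLpC hre, coeFn_toLpC him,
      Lp.coeFn_add (toLpC (fun x => (M x).re)) (Complex.I • toLpC (fun x => (M x).im)),
      Lp.coeFn_smul Complex.I (toLpC (fun x => (M x).im))] with x h1 h2 h3 h4
    rw [h3, Pi.add_apply, h4, Pi.smul_apply, h1, h2, smul_eq_mul, mul_comm, Complex.re_add_im]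
  have e2 : F = toLpC (greenConv fun x => (M x).re) +
      Complex.I • toLpC (greenConv fun x => (M x).im) := by
    rw [hM]
    conv_lhs => rw [e]
    rw [map_add, map_smul, fourierMul_greenSymbol hre, fourierMul_greenSymbol him]
  refine (hc.ae_eq_iff_eq volume (continuous_greenConv hre)).1 ?_
  filter_upwards [hae, coeFn_toLpC (memLp_greenConv hre), coeFn_toLpC (memLp_greenConv him),
    Lp.coeFn_add (toLpC (greenConv fun x => (M x).re))
      (Complex.I • toLpC (greenConv fun x => (M x).im)),
    Lp.coeFn_smul Complex.I (toLpC (greenConv fun x => (M x).im))] with x h0 h1 h2 h3 h4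
  have := h0
  rw [e2, h3, Pi.add_apply, h4, Pi.smul_apply, h1, h2] at this
  have h5 := congrArg Complex.re this
  simpa using h5.symm

end

end Besov

/-! ### Functions with a square integrable upper gradient -/

/-- `ρ` is a square integrable upper gradient of `f`. -/
structure HasUpperGradient {E : Type*} [NormedAddCommGroup E] (f : ℝ → E) (ρ : ℝ → ℝ) : Prop where
  memLp : MemLp ρ 2
  nonneg : ∀ x, 0 ≤ ρ x
  norm_sub_le : ∀ x y, x ≤ y → ‖f y - f x‖ ≤ ∫ t in x..y, ρ t

theorem MeasureTheory.MemLp.intervalIntegrable_of_two {ρ : ℝ → ℝ} (h : MemLp ρ 2) (a b : ℝ) :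
    IntervalIntegrable ρ volume a b :=
  ((h.locallyIntegrable (by norm_num)).integrableOn_isCompact isCompact_uIcc).intervalIntegrable

/-- On an interval of length at most `1` one has `p(x - t) ≥ e^{-1} / 2 ≥ 1/6`, so the integral is
at most `6 (p * ρ)(x) ≤ 12 ‖ρ‖`. -/
theorem intervalIntegral_le_l2norm {ρ : ℝ → ℝ} (h : MemLp ρ 2) (h0 : ∀ x, 0 ≤ ρ x) {x y : ℝ}
    (hxy : x ≤ y) (hy : y ≤ x + 1) : ∫ t in x..y, ρ t ≤ 12 * l2norm ρ := by
  have hi := integrable_green_mul h x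
  have e := greenConv_eq_integral h x
  have h1 : ∫ t in x..y, ρ t ≤ ∫ t in x..y, 6 * (green (x - t) * ρ t) := by
    refine intervalIntegral.integral_mono_on hxy (h.intervalIntegrable_of_two x y)
      (hi.const_mul 6).intervalIntegrable fun t ht => ?_
    have h3 : 1 / 6 ≤ green (x - t) := by
      have : Real.exp (-1) ≤ Real.exp (-|x - t|) := by
        refine Real.exp_le_exp.2 (neg_le_neg ?_)
        rw [abs_le]; constructor <;> linarith [ht.1, ht.2]
      have h4 : 1 / 3 ≤ Real.exp (-1) := by
        rw [Real.exp_neg, one_div]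
        exact inv_anti₀ (Real.exp_pos _) (by linarith [Real.exp_one_lt_d9])
      unfold green; linarith
    nlinarith [h0 t]
  have h2 : ∫ t in x..y, 6 * (green (x - t) * ρ t) ≤ ∫ t, 6 * (green (x - t) * ρ t) := by
    rw [intervalIntegral.integral_of_le hxy]
    refine setIntegral_le_integral (hi.const_mul 6) (ae_of_all _ fun t => ?_)
    have : 0 < green (x - t) := by unfold green; positivity
    have := h0 t
    simp only [Pi.zero_apply]; positivity
  rw [integral_const_mul, ← e] at h2
  have := (le_abs_self _).trans (abs_greenConv_le h x)
  linarith

namespace HasUpperGradient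

variable {E : Type*} [NormedAddCommGroup E] {f g : ℝ → E} {ρ σ : ℝ → ℝ}

theorem of_le (h : HasUpperGradient f ρ)
    {F : Type*} [NormedAddCommGroup F] {g : ℝ → F} (hg : ∀ x y, ‖g y - g x‖ ≤ ‖f y - f x‖) :
    HasUpperGradient g ρ :=
  ⟨h.memLp, h.nonneg, fun x y hxy => (hg x y).trans (h.norm_sub_le x y hxy)⟩

theorem norm_sub_le_abs (h : HasUpperGradient f ρ) (x y : ℝ) :
    ‖f y - f x‖ ≤ |∫ t in x..y, ρ t| := by
  rcases le_total x y with hxy | hxy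
  · exact (h.norm_sub_le x y hxy).trans (le_abs_self _)
  · rw [intervalIntegral.integral_symm, abs_neg, norm_sub_rev]
    exact (h.norm_sub_le y x hxy).trans (le_abs_self _)

theorem continuous (h : HasUpperGradient f ρ) : Continuous f := by
  rw [continuous_iff_continuousAt]
  intro x
  rw [ContinuousAt, tendsto_iff_norm_sub_tendsto_zero]
  have hc := intervalIntegral.continuous_primitive (fun a b => h.memLp.intervalIntegrable_of_two a b) x
  have := (hc.tendsto x).abs
  simp only [intervalIntegral.integral_same, abs_zero] at this
  exact squeeze_zero (fun _ => norm_nonneg _) (fun y => h.norm_sub_le_abs x y) this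

/-- Sobolev embedding: `|f(x)|` is at most `|f(y)|` plus the integral of `ρ` from `x` to `y`, and
this is averaged over `y ∈ [x, x + 1]`. -/
theorem norm_le (h : HasUpperGradient f ρ) (hf : MemLp (fun x => ‖f x‖) 2) (x : ℝ) :
    ‖f x‖ ≤ 12 * l2norm (fun x => ‖f x‖) + 12 * l2norm ρ := by
  have h1 : ∀ y ∈ Set.Icc x (x + 1), ‖f x‖ - 12 * l2norm ρ ≤ ‖f y‖ := by
    intro y hy
    have h2 := (h.norm_sub_le x y hy.1).trans
      (intervalIntegral_le_l2norm h.memLp h.nonneg hy.1 hy.2)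
    have := norm_le_norm_add_norm_sub (f y) (f x)
    linarith
  have h3 := intervalIntegral.integral_mono_on (by linarith : x ≤ x + 1)
    (intervalIntegrable_const (c := ‖f x‖ - 12 * l2norm ρ)) (hf.intervalIntegrable_of_two _ _) h1
  rw [intervalIntegral.integral_const] at h3
  have h4 := intervalIntegral_le_l2norm hf (fun _ => norm_nonneg _)
    (by linarith : x ≤ x + 1) le_rfl
  simp only [add_sub_cancel_left, one_smul] at h3
  linarith

theorem ac {f : ℝ → ℝ} (h : HasUpperGradient f ρ) (a b : ℝ) :
    AbsolutelyContinuousOnInterval f a b := by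
  have hρ := (IsPrim.of_integral (h.memLp.locallyIntegrable (by norm_num)) 0).ac a b
  rw [absolutelyContinuousOnInterval_iff] at hρ ⊢
  intro ε hε
  obtain ⟨δ, hδ, H⟩ := hρ ε hε
  refine ⟨δ, hδ, fun P hP hs => lt_of_le_of_lt (Finset.sum_le_sum fun i _ => ?_) (H P hP hs)⟩
  rw [dist_comm, dist_eq_norm, dist_comm, Real.dist_eq]
  refine (h.norm_sub_le_abs _ _).trans (le_of_eq ?_)
  congr 1
  have hi := fun a b => h.memLp.intervalIntegrable_of_two a b
  rw [add_sub_add_left_eq_sub, intervalIntegral.integral_interval_sub_left (hi _ _) (hi _ _)]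

/-- Domination of increments gives absolute continuity, hence a derivative almost everywhere. The
difference quotients of `f` are bounded by those of the primitive of `ρ`, so `|f'| ≤ ρ` almost
everywhere. -/
theorem exists_isPrim {f : ℝ → ℝ} (h : HasUpperGradient f ρ) :
    ∃ f', IsPrim f f' ∧ MemLp f' 2 ∧ l2norm f' ≤ l2norm ρ := by
  have hd : ∀ᵐ x, DifferentiableAt ℝ f x := by
    have h1 : ∀ n : ℕ, ∀ᵐ x, x ∈ Set.uIcc (-n : ℝ) n → DifferentiableAt ℝ f x := fun n =>
      (h.ac (-n) n).ae_differentiableAt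
    rw [← ae_all_iff] at h1
    filter_upwards [h1] with x hx
    obtain ⟨n, hn⟩ := exists_nat_ge |x|
    refine hx n ?_
    rw [Set.uIcc_of_le (by linarith [abs_nonneg x])]
    exact ⟨by linarith [neg_abs_le x], by linarith [le_abs_self x]⟩
  have hp : IsPrim f (deriv f) := ⟨h.ac, hd.mono fun x hx => hx.hasDerivAt⟩
  have hb : ∀ᵐ x, ‖deriv f x‖ ≤ ‖ρ x‖ := by
    filter_upwards [hd, (IsPrim.of_integral (h.memLp.locallyIntegrable (by norm_num)) 0).ae]
      with x h1 h2
    rw [hasDerivAt_iff_tendsto_slope] at h2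
    have h1 := hasDerivAt_iff_tendsto_slope.1 h1.hasDerivAt
    refine le_of_tendsto_of_tendsto h1.norm h2.norm (Eventually.of_forall fun y => ?_)
    simp only [slope_def_field, norm_div]
    gcongr
    rw [add_sub_add_left_eq_sub, intervalIntegral.integral_interval_sub_left
      (h.memLp.intervalIntegrable_of_two _ _) (h.memLp.intervalIntegrable_of_two _ _)]
    exact h.norm_sub_le_abs x y
  have hm : AEStronglyMeasurable (deriv f) volume :=
    (measurable_deriv f).aestronglyMeasurable
  refine ⟨_, hp, h.memLp.mono hm hb, ?_⟩
  exact ENNReal.toReal_mono h.memLp.2.ne (eLpNorm_mono_ae hb)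

theorem mul {f g : ℝ → ℂ} (hf : HasUpperGradient f ρ) (hg : HasUpperGradient g σ) {A B : ℝ}
    (hA : ∀ x, ‖f x‖ ≤ A) (hB : ∀ x, ‖g x‖ ≤ B) :
    HasUpperGradient (fun x => f x * g x) (fun x => B * ρ x + A * σ x) := by
  have hA0 := (norm_nonneg _).trans (hA 0)
  have hB0 := (norm_nonneg _).trans (hB 0)
  refine ⟨(hf.memLp.const_mul B).add (hg.memLp.const_mul A), fun x => ?_, fun x y hxy => ?_⟩
  · have := hf.nonneg x; have := hg.nonneg x; positivity
  · rw [intervalIntegral.integral_add ((hf.memLp.intervalIntegrable_of_two _ _).const_mul _)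
      ((hg.memLp.intervalIntegrable_of_two _ _).const_mul _),
      intervalIntegral.integral_const_mul, intervalIntegral.integral_const_mul]
    have e : f y * g y - f x * g x = g y * (f y - f x) + f x * (g y - g x) := by ring
    rw [e]
    refine (norm_add_le _ _).trans ?_
    rw [norm_mul, norm_mul]
    exact add_le_add (mul_le_mul (hB y) (hf.norm_sub_le x y hxy) (norm_nonneg _) hB0)
      (mul_le_mul (hA x) (hg.norm_sub_le x y hxy) (norm_nonneg _) hA0)

end HasUpperGradient

/-! ### Changes of variable on the line -/

/-- `Φ` is a `C¹` diffeomorphism of the line with inverse `Ψ` and derivative `Φ'` in `[1/2, 2]`. -/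
structure IsDiffeo (Φ Ψ Φ' : ℝ → ℝ) : Prop where
  hasDerivAt : ∀ x, HasDerivAt Φ (Φ' x) x
  continuous_deriv : Continuous Φ'
  half_le : ∀ x, 1 / 2 ≤ Φ' x
  le_two : ∀ x, Φ' x ≤ 2
  left_inv : ∀ x, Ψ (Φ x) = x
  right_inv : ∀ x, Φ (Ψ x) = x

namespace IsDiffeo

variable {Φ Ψ Φ' : ℝ → ℝ}

theorem pos (h : IsDiffeo Φ Ψ Φ') (x : ℝ) : 0 < Φ' x := by linarith [h.half_le x]

theorem continuous (h : IsDiffeo Φ Ψ Φ') : Continuous Φ :=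
  continuous_iff_continuousAt.2 fun x => (h.hasDerivAt x).continuousAt

theorem strictMono (h : IsDiffeo Φ Ψ Φ') : StrictMono Φ :=
  strictMono_of_hasDerivAt_pos h.hasDerivAt h.pos

theorem image_univ (h : IsDiffeo Φ Ψ Φ') : Φ '' Set.univ = Set.univ :=
  Set.eq_univ_of_forall fun x => ⟨Ψ x, trivial, h.right_inv x⟩

theorem injective (h : IsDiffeo Φ Ψ Φ') : Function.Injective Φ := h.strictMono.injective

theorem lintegral (h : IsDiffeo Φ Ψ Φ') (g : ℝ → ℝ≥0∞) :
    ∫⁻ x, ENNReal.ofReal (Φ' x) * g (Φ x) = ∫⁻ y, g y := by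
  have := lintegral_image_eq_lintegral_abs_deriv_mul (f := Φ) (f' := Φ') MeasurableSet.univ
    (fun x _ => (h.hasDerivAt x).hasDerivWithinAt) h.injective.injOn g
  rw [h.image_univ, Measure.restrict_univ] at this
  rw [this]
  exact lintegral_congr fun x => by rw [abs_of_pos (h.pos x)]

theorem integral {E : Type*} [NormedAddCommGroup E] [NormedSpace ℝ E] (h : IsDiffeo Φ Ψ Φ')
    (g : ℝ → E) : ∫ x, Φ' x • g (Φ x) = ∫ y, g y := by
  have := integral_image_eq_integral_abs_deriv_smul (f := Φ) (f' := Φ') MeasurableSet.univ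
    (fun x _ => (h.hasDerivAt x).hasDerivWithinAt) h.injective.injOn g
  rw [h.image_univ, Measure.restrict_univ] at this
  rw [this]
  exact integral_congr_ae (ae_of_all _ fun x => by simp only; rw [abs_of_pos (h.pos x)])

theorem lintegral_comp_le (h : IsDiffeo Φ Ψ Φ') (g : ℝ → ℝ≥0∞) :
    ∫⁻ x, g (Φ x) ≤ 2 * ∫⁻ y, g y := by
  rw [← h.lintegral g, ← lintegral_const_mul' _ _ (by simp)]
  refine lintegral_mono fun x => ?_
  rw [← mul_assoc]
  refine le_mul_of_one_le_left' ?_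
  rw [show (2 : ℝ≥0∞) = ENNReal.ofReal 2 by simp, ← ENNReal.ofReal_mul (by norm_num),
    ENNReal.one_le_ofReal]
  linarith [h.half_le x]

/-- Preimages of null sets are null, so composition with `Φ` is well defined on `L²` classes. -/
theorem quasiMeasurePreserving (h : IsDiffeo Φ Ψ Φ') :
    Measure.QuasiMeasurePreserving Φ volume volume := by
  refine ⟨h.continuous.measurable, Measure.AbsolutelyContinuous.mk fun s hs h0 => ?_⟩
  rw [Measure.map_apply h.continuous.measurable hs]
  have := h.lintegral_comp_le (s.indicator 1)
  rw [lintegral_indicator_one hs, h0, mul_zero] at this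
  rw [← lintegral_indicator_one (h.continuous.measurable hs)]
  exact le_antisymm this zero_le

theorem eLpNorm_comp_le {E : Type*} [NormedAddCommGroup E] (h : IsDiffeo Φ Ψ Φ') (f : ℝ → E) :
    eLpNorm (fun x => f (Φ x)) 2 volume ≤ 2 * eLpNorm f 2 volume := by
  rw [← ENNReal.pow_le_pow_left_iff two_ne_zero, mul_pow, eLpNorm_two_sq, eLpNorm_two_sq]
  refine (h.lintegral_comp_le fun y => ‖f y‖ₑ ^ 2).trans ?_
  gcongr
  norm_num

theorem memLp_comp {E : Type*} [NormedAddCommGroup E] (h : IsDiffeo Φ Ψ Φ') {f : ℝ → E}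
    (hf : MemLp f 2) : MemLp (fun x => f (Φ x)) 2 :=
  ⟨hf.1.comp_quasiMeasurePreserving h.quasiMeasurePreserving,
    (h.eLpNorm_comp_le f).trans_lt (ENNReal.mul_lt_top (by simp) hf.2)⟩

theorem symm (h : IsDiffeo Φ Ψ Φ') : IsDiffeo Ψ Φ fun y => (Φ' (Ψ y))⁻¹ := by
  let e : ℝ ≃o ℝ := h.strictMono.orderIsoOfRightInverse Φ Ψ h.right_inv
  have hc : Continuous Ψ := e.symm.continuous
  refine ⟨fun y => ?_, ?_, fun y => ?_, fun y => ?_, h.right_inv, h.left_inv⟩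
  · exact (h.hasDerivAt (Ψ y)).of_local_left_inverse hc.continuousAt (h.pos _).ne'
      (Eventually.of_forall h.right_inv)
  · exact (h.continuous_deriv.comp hc).inv₀ fun y => (h.pos _).ne'
  · rw [one_div]; exact inv_anti₀ (h.pos _) (h.le_two _)
  · rw [show (2 : ℝ) = (1 / 2)⁻¹ by norm_num]; exact inv_anti₀ (by norm_num) (h.half_le _)

theorem upperGradient_comp {E : Type*} [NormedAddCommGroup E] (h : IsDiffeo Φ Ψ Φ') {f : ℝ → E}
    {ρ : ℝ → ℝ} (hf : HasUpperGradient f ρ) :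
    HasUpperGradient (fun x => f (Φ x)) fun x => ρ (Φ x) * Φ' x := by
  have hm : MemLp (fun x => ρ (Φ x) * Φ' x) 2 := by
    refine ((h.memLp_comp hf.memLp).const_mul 2).mono
      ((h.memLp_comp hf.memLp).1.mul h.continuous_deriv.aestronglyMeasurable)
      (ae_of_all _ fun x => ?_)
    rw [norm_mul, norm_mul, mul_comm]
    gcongr
    rw [Real.norm_of_nonneg (h.pos x).le, Real.norm_of_nonneg (by norm_num)]
    exact h.le_two x
  refine ⟨hm, fun x => mul_nonneg (hf.nonneg _) (h.pos x).le, fun x y hxy => ?_⟩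
  refine (hf.norm_sub_le _ _ (h.strictMono.monotone hxy)).trans (le_of_eq ?_)
  rw [intervalIntegral.integral_of_le (h.strictMono.monotone hxy),
    intervalIntegral.integral_of_le hxy, ← MeasureTheory.integral_indicator measurableSet_Ioc,
    ← MeasureTheory.integral_indicator measurableSet_Ioc, ← h.integral]
  refine integral_congr_ae (ae_of_all _ fun t => ?_)
  simp only [Set.indicator, Set.mem_Ioc, h.strictMono.lt_iff_lt, h.strictMono.le_iff_le]
  split_ifs
  · rw [smul_eq_mul, mul_comm]
  · simp

theorem l2norm_comp_mul_le (h : IsDiffeo Φ Ψ Φ') {ρ : ℝ → ℝ} (hρ : MemLp ρ 2) :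
    l2norm (fun x => ρ (Φ x) * Φ' x) ≤ 4 * l2norm ρ := by
  have h1 : eLpNorm (fun x => ρ (Φ x) * Φ' x) 2 volume ≤
      ENNReal.ofReal 2 * eLpNorm (fun x => ρ (Φ x)) 2 volume := by
    refine eLpNorm_le_mul_eLpNorm_of_ae_le_mul (ae_of_all _ fun x => ?_) 2
    rw [norm_mul, mul_comm]
    gcongr
    rw [Real.norm_of_nonneg (h.pos x).le]; exact h.le_two x
  have h2 := h1.trans (mul_le_mul_right (h.eLpNorm_comp_le ρ) (ENNReal.ofReal 2))
  have h3 := ENNReal.toReal_mono (ENNReal.mul_ne_top (by simp)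
    (ENNReal.mul_ne_top (by simp) hρ.2.ne)) h2
  rw [ENNReal.toReal_mul, ENNReal.toReal_mul] at h3
  simp only [ENNReal.toReal_ofNat, ENNReal.toReal_ofReal (by norm_num : (0 : ℝ) ≤ 2)] at h3
  unfold l2norm
  linarith

end IsDiffeo

/-! ### Operators preserving upper gradients act on the Besov space -/

namespace Besov

/-- The class `f` has a representative with an upper gradient of norm at most `A`. -/
def UG (f : LpC) (A : ℝ) : Prop :=
  ∃ (f₀ : ℝ → ℂ) (ρ : ℝ → ℝ), f =ᵐ[volume] f₀ ∧ HasUpperGradient f₀ ρ ∧ l2norm ρ ≤ A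

theorem toLpC_re_add_im {F : LpC} {f : ℝ → ℂ} (h : F =ᵐ[volume] f) :
    MemLp (fun x => (f x).re) 2 ∧ MemLp (fun x => (f x).im) 2 ∧
    F = toLpC (fun x => (f x).re) + Complex.I • toLpC (fun x => (f x).im) := by
  have hm : MemLp f 2 (volume : Measure ℝ) := (memLp_congr_ae h).1 (Lp.memLp F)
  refine ⟨hm.re, hm.im, Lp.ext ?_⟩
  filter_upwards [h, coeFn_toLpC (f := fun x => (f x).re) hm.re,
    coeFn_toLpC (f := fun x => (f x).im) hm.im,
    Lp.coeFn_add (toLpC (fun x => (f x).re)) (Complex.I • toLpC (fun x => (f x).im)),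
    Lp.coeFn_smul Complex.I (toLpC (fun x => (f x).im))] with x h0 h1 h2 h3 h4
  rw [h0, h3, Pi.add_apply, h4, Pi.smul_apply, h1, h2, smul_eq_mul, mul_comm, Complex.re_add_im]

theorem fourier_add_I_smul (f g : LpC) :
    (𝓕 (f + Complex.I • g) : LpC) = 𝓕 f + Complex.I • (𝓕 g : LpC) := by
  have h := (Lp.fourierTransformₗᵢ ℝ ℂ).map_add f (Complex.I • g)
  have h' := (Lp.fourierTransformₗᵢ ℝ ℂ).map_smul Complex.I g
  rw [h'] at h
  exact h

theorem UG.exists_deriv {f : LpC} {A : ℝ} (h : UG f A) :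
    ∃ f' : LpC, ‖f'‖ ≤ 2 * A ∧
      (𝓕 f' : LpC) =ᵐ[volume] fun ξ => 2 * Real.pi * Complex.I * (ξ : ℂ) * (𝓕 f : LpC) ξ := by
  obtain ⟨f₀, ρ, hf, hu, hA⟩ := h
  obtain ⟨hr, hi, e⟩ := toLpC_re_add_im hf
  have ur : HasUpperGradient (fun x => (f₀ x).re) ρ := hu.of_le fun x y => by
    rw [← Complex.sub_re]; exact Complex.abs_re_le_norm _
  have ui : HasUpperGradient (fun x => (f₀ x).im) ρ := hu.of_le fun x y => by
    rw [← Complex.sub_im]; exact Complex.abs_im_le_norm _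
  obtain ⟨a, ha, ma, la⟩ := ur.exists_isPrim
  obtain ⟨b, hb, mb, lb⟩ := ui.exists_isPrim
  refine ⟨toLpC a + Complex.I • toLpC b, ?_, ?_⟩
  · refine (norm_add_le _ _).trans ?_
    rw [norm_smul, Complex.norm_I, one_mul, norm_toLpC ma, norm_toLpC mb]
    linarith
  · have h1 := ha.fourier_deriv hr ma
    have h2 := hb.fourier_deriv hi mb
    rw [e, fourier_add_I_smul, fourier_add_I_smul]
    filter_upwards [h1, h2,
      Lp.coeFn_add (𝓕 (toLpC a) : LpC) (Complex.I • (𝓕 (toLpC b) : LpC)),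
      Lp.coeFn_smul Complex.I (𝓕 (toLpC b) : LpC),
      Lp.coeFn_add (𝓕 (toLpC fun x => (f₀ x).re) : LpC)
        (Complex.I • (𝓕 (toLpC fun x => (f₀ x).im) : LpC)),
      Lp.coeFn_smul Complex.I (𝓕 (toLpC fun x => (f₀ x).im) : LpC)] with ξ e1 e2 e3 e4 e5 e6
    rw [e3, Pi.add_apply, e4, Pi.smul_apply, e1, e2, e5, Pi.add_apply, e6, Pi.smul_apply,
      smul_eq_mul, smul_eq_mul]
    ring

/-- High frequencies are controlled by the upper gradient. -/
theorem UG.norm_fourierMul_le {f : LpC} {A : ℝ} (h : UG f A) {φ : ℝ → ℂ} (hφ : MemLp φ ∞)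
    (h1 : ∀ ξ, ‖φ ξ‖ ≤ 1) {r : ℝ} (hr : 0 < r) (hs : ∀ ξ, φ ξ ≠ 0 → r ≤ |2 * Real.pi * ξ|) :
    ‖fourierMul φ f‖ ≤ r⁻¹ * (2 * A) := by
  obtain ⟨f', hf', e⟩ := h.exists_deriv
  refine le_trans ?_ (mul_le_mul_of_nonneg_left hf' (by positivity))
  refine norm_le_of_fourier ?_
  filter_upwards [e, fourier_fourierMul hφ f] with ξ e1 e2
  rw [e1, e2, norm_mul, norm_mul, ← mul_assoc]
  gcongr
  by_cases h0 : φ ξ = 0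
  · rw [h0, norm_zero]; positivity
  · rw [le_inv_mul_iff₀ hr]
    have e3 : ‖(2 * Real.pi * Complex.I * (ξ : ℂ))‖ = |2 * Real.pi * ξ| := by
      simp [abs_mul]
    rw [e3]
    have := hs ξ h0
    have := h1 ξ
    nlinarith [norm_nonneg (φ ξ)]

theorem UG.norm_blk_le {f : LpC} {A : ℝ} (h : UG f A) {n : ℕ} (hn : n ≠ 0) :
    ‖blk n f‖ ≤ (3 / 8 * 2 ^ n)⁻¹ * (2 * A) :=
  h.norm_fourierMul_le (memLp_sym n) (fun ξ => by simpa using abs_sym_le n ξ) (by positivity)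
    fun _ hξ => le_abs_of_sym_ne_zero hn (by exact_mod_cast hξ)

/-- Bernstein's inequality for a block. -/
theorem ug_blk (n : ℕ) (h : LpC) : UG (blk n h) (14 * 2 ^ n * ‖blk n h‖) := by
  set f := blk n h with hf
  -- `ψ` is the symbol of `1 + ∂_x`, cut off to the frequencies of the block. With `g = ψ(D) f` one
  -- recovers `f` as `avgLeft g`, which provides a representative that is absolutely continuous.
  set ψ : ℝ → ℂ := {ξ : ℝ | |2 * Real.pi * ξ| ≤ 4 / 3 * 2 ^ n}.indicator
    fun ξ => 1 + 2 * Real.pi * Complex.I * (ξ : ℂ) with hψ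
  have hb : ∀ ξ, ‖ψ ξ‖ ≤ 7 / 3 * 2 ^ n := by
    intro ξ
    simp only [hψ]
    by_cases hξ : |2 * Real.pi * ξ| ≤ 4 / 3 * 2 ^ n
    · rw [Set.indicator_of_mem (by exact hξ)]
      refine (norm_add_le _ _).trans ?_
      have e3 : ‖(2 * Real.pi * Complex.I * (ξ : ℂ))‖ = |2 * Real.pi * ξ| := by
        simp [abs_mul]
      rw [e3, norm_one]
      have h6 : (1 : ℝ) ≤ 2 ^ n := one_le_pow₀ one_le_two
      linarith
    · rw [Set.indicator_of_notMem (by exact hξ), norm_zero]; positivity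
  have hm : MemLp ψ ∞ (volume : Measure ℝ) := by
    refine memLp_top_of_bound ?_ _ (ae_of_all _ hb)
    refine AEStronglyMeasurable.indicator ?_ ?_
    · exact (by fun_prop : Continuous fun ξ : ℝ =>
        1 + 2 * Real.pi * Complex.I * (ξ : ℂ)).aestronglyMeasurable
    · exact measurableSet_le (by fun_prop) measurable_const
  set g := fourierMul ψ f with hg
  have hgn : ‖g‖ ≤ 7 / 3 * 2 ^ n * ‖f‖ := fourierMul_norm_le_of_le hm hb f
  obtain ⟨ma, mb, eg⟩ := toLpC_re_add_im (F := g) (f := g) (ae_eq_refl _)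
  set a : ℝ → ℝ := fun x => (g x).re
  set b : ℝ → ℝ := fun x => (g x).im
  have na : l2norm a ≤ ‖g‖ := by
    rw [← norm_toLpC ma]
    refine Lp.norm_le_norm_of_ae_le ?_
    filter_upwards [coeFn_toLpC ma] with x hx
    rw [hx, Complex.norm_real]; exact Complex.abs_re_le_norm _
  have nb : l2norm b ≤ ‖g‖ := by
    rw [← norm_toLpC mb]
    refine Lp.norm_le_norm_of_ae_le ?_
    filter_upwards [coeFn_toLpC mb] with x hx
    rw [hx, Complex.norm_real]; exact Complex.abs_im_le_norm _
  have key : f = toLpC (avgLeft a) + Complex.I • toLpC (avgLeft b) := by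
    refine fourier_injective_ae ?_
    have eg2 := congrArg (fun F : LpC => (𝓕 F : LpC)) eg
    rw [fourier_add_I_smul] at eg2
    rw [fourier_add_I_smul]
    filter_upwards [fourier_avgLeft ma, fourier_avgLeft mb,
      Lp.coeFn_add (𝓕 (toLpC (avgLeft a)) : LpC) (Complex.I • (𝓕 (toLpC (avgLeft b)) : LpC)),
      Lp.coeFn_smul Complex.I (𝓕 (toLpC (avgLeft b)) : LpC),
      Lp.coeFn_add (𝓕 (toLpC a) : LpC) (Complex.I • (𝓕 (toLpC b) : LpC)),
      Lp.coeFn_smul Complex.I (𝓕 (toLpC b) : LpC),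
      fourier_fourierMul hm f, fourier_blk n h] with ξ e1 e2 e3 e4 e5 e6 e7 e8
    rw [← hg, eg2, e5, Pi.add_apply, e6, Pi.smul_apply, smul_eq_mul] at e7
    rw [e3, Pi.add_apply, e4, Pi.smul_apply, e1, e2, smul_eq_mul]
    have e9 : (1 + 2 * Real.pi * Complex.I * (ξ : ℂ))⁻¹ * (ψ ξ * (𝓕 f : LpC) ξ) =
        (𝓕 f : LpC) ξ := by
      rw [e8]
      by_cases hs : sym n ξ = 0
      · simp [hs]
      · simp only [hψ]
        rw [Set.indicator_of_mem (by exact abs_le_of_sym_ne_zero hs), ← mul_assoc,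
          inv_mul_cancel₀ (one_add_ne_zero_of_real ξ), one_mul]
    rw [← e9, ← e7]
    ring
  have pa := isPrim_avgLeft ma
  have pb := isPrim_avgLeft mb
  have ma' := (ma.sub (memLp_avgLeft ma)).norm
  have mb' := (mb.sub (memLp_avgLeft mb)).norm
  have bound : ∀ {c : ℝ → ℝ}, MemLp c 2 → l2norm c ≤ ‖g‖ →
      l2norm (fun x => ‖(c - avgLeft c) x‖) ≤ 3 * ‖g‖ := by
    intro c hc hn
    have h1 := l2norm_add_le hc ((memLp_avgLeft hc).const_mul (-1))
    rw [l2norm_const_mul] at h1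
    have h2 := l2norm_avgLeft_le hc
    have e : l2norm (fun x => ‖(c - avgLeft c) x‖) = l2norm fun x => c x + -1 * avgLeft c x := by
      unfold l2norm
      rw [eLpNorm_norm]
      congr 2
      funext x; simp only [Pi.sub_apply]; ring
    rw [e]
    norm_num at h1
    simp only [neg_mul, one_mul]
    linarith
  -- The upper gradient adds the derivatives of the real and the imaginary part, each of norm at
  -- most `3 ‖g‖`. With `‖g‖ ≤ (7/3) 2^n ‖f‖` this gives `6 · 7/3 = 14`.
  refine ⟨fun x => (avgLeft a x : ℂ) + Complex.I * (avgLeft b x : ℂ),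
    fun x => ‖(a - avgLeft a) x‖ + ‖(b - avgLeft b) x‖, ?_, ⟨ma'.add mb', fun x => by positivity,
    fun x y hxy => ?_⟩, ?_⟩
  · rw [key]
    filter_upwards [coeFn_toLpC (memLp_avgLeft ma), coeFn_toLpC (memLp_avgLeft mb),
      Lp.coeFn_add (toLpC (avgLeft a)) (Complex.I • toLpC (avgLeft b)),
      Lp.coeFn_smul Complex.I (toLpC (avgLeft b))] with x e1 e2 e3 e4
    rw [e3, Pi.add_apply, e4, Pi.smul_apply, e1, e2, smul_eq_mul]
  · rw [intervalIntegral.integral_add (ma'.intervalIntegrable_of_two _ _)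
      (mb'.intervalIntegrable_of_two _ _)]
    have e : ((avgLeft a y : ℂ) + Complex.I * (avgLeft b y : ℂ)) -
        ((avgLeft a x : ℂ) + Complex.I * (avgLeft b x : ℂ)) =
        ((avgLeft a y - avgLeft a x : ℝ) : ℂ) +
          Complex.I * ((avgLeft b y - avgLeft b x : ℝ) : ℂ) := by push_cast; ring
    rw [e]
    refine (norm_add_le _ _).trans ?_
    rw [norm_mul, Complex.norm_I, one_mul, Complex.norm_real, Complex.norm_real,
      ← pa.integral_eq, ← pb.integral_eq]
    exact add_le_add (intervalIntegral.norm_integral_le_integral_norm hxy)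
      (intervalIntegral.norm_integral_le_integral_norm hxy)
  · refine (l2norm_add_le ma' mb').trans ?_
    have := bound ma na
    have := bound mb nb
    linarith

/-- `L` is a bounded operator with adjoint `L'`, and both act on functions with upper gradients. -/
structure PreservesUG (K : ℝ) (L L' : LpC →L[ℂ] LpC) : Prop where
  norm_le : ∀ f, ‖L f‖ ≤ K * ‖f‖
  inner_eq : ∀ f g, ⟪L f, g⟫ = ⟪f, L' g⟫
  ug : ∀ f A, 0 ≤ A → UG f A → UG (L f) (K * (‖f‖ + A))
  ug' : ∀ f A, 0 ≤ A → UG f A → UG (L' f) (K * (‖f‖ + A))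

/-- The off-diagonal decay `2^{-|j-k|}`. -/
noncomputable def decay (j k : ℕ) : ℝ := (1 / 2) ^ (j - k) * (1 / 2) ^ (k - j)

theorem decay_pos (j k : ℕ) : 0 < decay j k := by unfold decay; positivity

theorem decay_of_le {j k : ℕ} (h : k ≤ j) : decay j k = 2 ^ k / 2 ^ j := by
  obtain ⟨i, rfl⟩ := Nat.exists_eq_add_of_le h
  rw [decay, Nat.add_sub_cancel_left, Nat.sub_eq_zero_of_le h, pow_zero, mul_one, pow_add, one_div,
    inv_pow]
  field_simp

theorem decay_of_ge {j k : ℕ} (h : j ≤ k) : decay j k = 2 ^ j / 2 ^ k := by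
  obtain ⟨i, rfl⟩ := Nat.exists_eq_add_of_le h
  rw [decay, Nat.add_sub_cancel_left, Nat.sub_eq_zero_of_le h, pow_zero, one_mul, pow_add, one_div,
    inv_pow]
  field_simp

/-- For `k ≤ j`, Bernstein's inequality gives `Δ_k m` an upper gradient of size `2^k`, `L` preserves
it up to `K`, and `Δ_j` gains `2^{-j}`. For `j < k` the same argument is applied to the adjoint
acting on a block of frequency `2^j`. The constant is `2 · 15 · 8/3 = 80`. -/
theorem PreservesUG.norm_blk_le {K : ℝ} {L L' : LpC →L[ℂ] LpC} (hL : PreservesUG K L L')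
    (hK : 0 ≤ K) (j k : ℕ) (m : LpC) :
    ‖blk j (L (blk k m))‖ ≤ 80 * K * decay j k * ‖blk k m‖ := by
  have one_le : ∀ i : ℕ, (1 : ℝ) ≤ 2 ^ i := fun i => one_le_pow₀ one_le_two
  rcases le_or_gt k j with hkj | hjk
  · rw [decay_of_le hkj]
    rcases eq_or_ne j 0 with rfl | hj
    · obtain rfl : k = 0 := by omega
      refine (Besov.norm_blk_le _ _).trans ((hL.norm_le _).trans ?_)
      have := norm_nonneg (blk 0 m)
      have : 0 ≤ K * ‖blk 0 m‖ := by positivity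
      norm_num; linarith
    · have h1 := (hL.ug _ _ (by positivity) (ug_blk k m)).norm_blk_le hj
      refine h1.trans ?_
      rw [inv_mul_le_iff₀ (by positivity)]
      have e : 3 / 8 * 2 ^ j * (80 * K * ((2 : ℝ) ^ k / 2 ^ j) * ‖blk k m‖) =
          30 * (K * ‖blk k m‖ * 2 ^ k) := by field_simp; ring
      rw [e]
      have h2 : 0 ≤ K * ‖blk k m‖ := by positivity
      nlinarith [mul_le_mul_of_nonneg_left (one_le k) h2]
  · rw [decay_of_ge hjk.le]
    set h := blk k m with hh
    set g := blk j (L h) with hg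
    -- `Δ_k` is not a projection. A sharp high-frequency cut-off `q(D)` that fixes `Δ_k m` can be
    -- moved across the inner product, and its range of frequencies yields the gain `2^{-k}`; here
    -- `k > j` excludes `k = 0`.
    set q : ℝ → ℂ := {ξ : ℝ | 3 / 8 * 2 ^ k ≤ |2 * Real.pi * ξ|}.indicator fun _ => 1 with hq
    have hq1 : ∀ ξ, ‖q ξ‖ ≤ 1 := fun ξ => by
      simp only [hq, Set.indicator]; split_ifs <;> simp
    have hqm : MemLp q ∞ (volume : Measure ℝ) := by
      refine memLp_top_of_bound ?_ _ (ae_of_all _ hq1)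
      exact aestronglyMeasurable_const.indicator (measurableSet_le measurable_const (by fun_prop))
    have hqh : fourierMul q h = h := by
      rw [hh, blk]
      refine fourierMul_comp hqm (memLp_sym k) (memLp_sym k) (fun ξ => ?_) m
      by_cases hs : sym k ξ = 0
      · simp [hs]
      · rw [hq, Set.indicator_of_mem (by exact le_abs_of_sym_ne_zero (by omega) hs), one_mul]
    have h1 : ‖g‖ * ‖g‖ ≤ ‖h‖ * ‖fourierMul q (L' (blk j g))‖ := by
      have e : ⟪g, g⟫ = ⟪h, fourierMul q (L' (blk j g))⟫ := by
        conv_lhs => rw [hg]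
        rw [blk, inner_fourierMul (memLp_sym j) (fun ξ => Complex.conj_ofReal _), ← blk,
          hL.inner_eq, ← inner_fourierMul hqm (fun ξ => ?_), hqh]
        simp only [hq, Set.indicator]; split_ifs <;> simp
      rw [← inner_self_eq_norm_mul_norm (𝕜 := ℂ) g]
      refine (RCLike.re_le_norm _).trans ?_
      rw [e]
      exact norm_inner_le_norm _ _
    have h2 : ‖fourierMul q (L' (blk j g))‖ ≤ (3 / 8 * 2 ^ k)⁻¹ *
        (2 * (K * (‖blk j g‖ + 14 * 2 ^ j * ‖blk j g‖))) := by
      refine (hL.ug' _ _ (by positivity) (ug_blk j g)).norm_fourierMul_le hqm hq1 (by positivity)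
        fun ξ hξ => ?_
      by_contra hlt
      exact hξ (Set.indicator_of_notMem (by exact hlt) _)
    have h3 : (3 / 8 * (2 : ℝ) ^ k)⁻¹ * (2 * (K * (‖blk j g‖ + 14 * 2 ^ j * ‖blk j g‖))) ≤
        80 * K * (2 ^ j / 2 ^ k) * ‖g‖ := by
      rw [inv_mul_le_iff₀ (by positivity)]
      have e : 3 / 8 * 2 ^ k * (80 * K * ((2 : ℝ) ^ j / 2 ^ k) * ‖g‖) =
          2 * (K * (15 * 2 ^ j * ‖g‖)) := by field_simp; ring
      rw [e]
      have h5 := Besov.norm_blk_le j g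
      gcongr
      calc ‖blk j g‖ + 14 * 2 ^ j * ‖blk j g‖ = (1 + 14 * 2 ^ j) * ‖blk j g‖ := by ring
        _ ≤ (15 * 2 ^ j) * ‖g‖ := by
          gcongr
          linarith [one_le j]
    -- Duality bounds the square of `‖g‖` by a multiple of `‖g‖` itself, and one factor is divided
    -- out unless it vanishes.
    have h4 : ‖g‖ * ‖g‖ ≤ (80 * K * (2 ^ j / 2 ^ k) * ‖h‖) * ‖g‖ := by
      refine h1.trans ((mul_le_mul_of_nonneg_left (h2.trans h3) (norm_nonneg h)).trans
        (le_of_eq (by ring)))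
    rcases (norm_nonneg g).eq_or_lt with h0 | h0
    · rw [← h0]; positivity
    · exact le_of_mul_le_mul_right h4 h0

theorem tsum_decay_le (k : ℕ) : ∑' j, ENNReal.ofReal (decay j k) ≤ 4 := by
  have h1 : ∀ j, ENNReal.ofReal (decay j k) ≤ ∑' i : ℕ, ((if j = k + i then (2⁻¹ : ℝ≥0∞) ^ i else 0)
      + (if j + i = k then (2⁻¹ : ℝ≥0∞) ^ i else 0)) := by
    intro j
    have e : ∀ i : ℕ, ENNReal.ofReal ((1 / 2) ^ i) = (2⁻¹ : ℝ≥0∞) ^ i := fun i => by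
      rw [ENNReal.ofReal_pow (by norm_num), one_div, ENNReal.ofReal_inv_of_pos (by norm_num),
        ENNReal.ofReal_ofNat]
    rcases le_total k j with h | h
    · obtain ⟨i, rfl⟩ := Nat.exists_eq_add_of_le h
      refine le_trans ?_ (ENNReal.le_tsum i)
      rw [decay, Nat.add_sub_cancel_left, Nat.sub_eq_zero_of_le h, pow_zero, mul_one, e, if_pos rfl]
      exact le_self_add
    · obtain ⟨i, rfl⟩ := Nat.exists_eq_add_of_le h
      refine le_trans ?_ (ENNReal.le_tsum i)
      rw [decay, Nat.add_sub_cancel_left, Nat.sub_eq_zero_of_le h, pow_zero, one_mul, e]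
      simp
  refine (ENNReal.tsum_le_tsum h1).trans ?_
  rw [ENNReal.tsum_comm]
  have h2 : ∀ i : ℕ, ∑' j : ℕ, ((if j = k + i then (2⁻¹ : ℝ≥0∞) ^ i else 0)
      + (if j + i = k then (2⁻¹ : ℝ≥0∞) ^ i else 0)) ≤ 2 * (2⁻¹) ^ i := by
    intro i
    rw [ENNReal.tsum_add, tsum_ite_eq, two_mul]
    gcongr
    refine (ENNReal.tsum_le_tsum (g := fun j => if j = k - i then (2⁻¹ : ℝ≥0∞) ^ i else 0)
      fun j => ?_).trans (by rw [tsum_ite_eq])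
    split_ifs with h3 h4
    · exact le_rfl
    · omega
    · exact zero_le
    · exact le_rfl
  refine (ENNReal.tsum_le_tsum h2).trans ?_
  rw [ENNReal.tsum_mul_left, ENNReal.tsum_geometric, ENNReal.one_sub_inv_two, inv_inv]
  norm_num

theorem enorm_blk_le_tsum (D : LpC →L[ℂ] LpC) (j : ℕ) (m : LpC) :
    ‖blk j (D m)‖ₑ ≤ ∑' k, ‖blk j (D (blk k m))‖ₑ := by
  have t := (((blk j).continuous.comp D.continuous).tendsto m).comp (tendsto_sum_blk m)
  refine le_of_tendsto t.enorm (Eventually.of_forall fun N => ?_)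
  simp only [Function.comp, map_sum]
  exact (enorm_sum_le _ _).trans (ENNReal.sum_le_tsum _)

theorem PreservesUG.enorm_blk_le {K : ℝ} {L L' : LpC →L[ℂ] LpC} (hL : PreservesUG K L L')
    (hK : 0 ≤ K) (j k : ℕ) (m : LpC) :
    ‖blk j (L (blk k m))‖ₑ ≤
      ENNReal.ofReal (80 * K) * (ENNReal.ofReal (decay j k) * ‖blk k m‖ₑ) := by
  have := ENNReal.ofReal_le_ofReal (hL.norm_blk_le hK j k m)
  rwa [ENNReal.ofReal_mul (by have := decay_pos j k; positivity),
    ENNReal.ofReal_mul (by positivity), ofReal_norm, ofReal_norm, mul_assoc] at this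

/-- Summing first over the output index `j` removes the decay at the cost of a factor `4`, uniformly
in `k`, and leaves the `ℓ¹` sum of the blocks. -/
theorem tsum_decay_mul_le (m : LpC) :
    ∑' p : ℕ × ℕ, ENNReal.ofReal (decay p.1 p.2) * ‖blk p.2 m‖ₑ ≤ 4 * besovSum m := by
  rw [ENNReal.tsum_prod (f := fun j k => ENNReal.ofReal (decay j k) * ‖blk k m‖ₑ),
    ENNReal.tsum_comm, besovSum, ← ENNReal.tsum_mul_left]
  refine ENNReal.tsum_le_tsum fun k => ?_
  rw [ENNReal.tsum_mul_right]
  gcongr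
  exact tsum_decay_le k

theorem besovSum_le_tsum (D : LpC →L[ℂ] LpC) (m : LpC) :
    besovSum (D m) ≤ ∑' p : ℕ × ℕ, ‖blk p.1 (D (blk p.2 m))‖ₑ := by
  rw [ENNReal.tsum_prod (f := fun j k => ‖blk j (D (blk k m))‖ₑ)]
  exact ENNReal.tsum_le_tsum fun j => enorm_blk_le_tsum D j m

theorem PreservesUG.besovSum_lt_top {K : ℝ} {L L' : LpC →L[ℂ] LpC} (hL : PreservesUG K L L')
    (hK : 0 ≤ K) {m : LpC} (hm : besovSum m < ∞) : besovSum (L m) < ∞ := by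
  refine (besovSum_le_tsum L m).trans_lt ?_
  have h1 : ∑' p : ℕ × ℕ, ‖blk p.1 (L (blk p.2 m))‖ₑ ≤ ∑' p : ℕ × ℕ,
      ENNReal.ofReal (80 * K) * (ENNReal.ofReal (decay p.1 p.2) * ‖blk p.2 m‖ₑ) :=
    ENNReal.tsum_le_tsum fun p => hL.enorm_blk_le hK p.1 p.2 m
  refine h1.trans_lt ?_
  rw [ENNReal.tsum_mul_left]
  exact ENNReal.mul_lt_top ENNReal.ofReal_lt_top ((tsum_decay_mul_le m).trans_lt
    (ENNReal.mul_lt_top (by simp) hm))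

/-- Every entry `Δ_j (L_i - L₀) Δ_k m` tends to zero by strong `L²` convergence, and all are
dominated by the same summable double sequence. Dominated convergence for counting measure then
gives the limit, without convergence of `L_i` in operator norm. -/
theorem tendsto_besovSum {ι : Type*} {l : Filter ι} [l.IsCountablyGenerated] {K : ℝ} (hK : 0 ≤ K)
    {L L' : ι → LpC →L[ℂ] LpC} {L₀ L₀' : LpC →L[ℂ] LpC} (h₀ : PreservesUG K L₀ L₀')
    (h : ∀ᶠ i in l, PreservesUG K (L i) (L' i))
    (ht : ∀ f, Tendsto (fun i => L i f) l (𝓝 (L₀ f))) {m : LpC} (hm : besovSum m < ∞) :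
    Tendsto (fun i => besovSum (L i m - L₀ m)) l (𝓝 0) := by
  have e : ∀ i, L i m - L₀ m = (L i - L₀) m := fun i => rfl
  simp_rw [e]
  refine tendsto_of_tendsto_of_tendsto_of_le_of_le tendsto_const_nhds ?_ (fun _ => zero_le)
    (fun i => besovSum_le_tsum (L i - L₀) m)
  have hc : ∀ i, ∑' p : ℕ × ℕ, ‖blk p.1 ((L i - L₀) (blk p.2 m))‖ₑ =
      ∫⁻ p : ℕ × ℕ, ‖blk p.1 ((L i - L₀) (blk p.2 m))‖ₑ ∂Measure.count := fun i =>
    (lintegral_count _).symm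
  simp_rw [hc]
  have := tendsto_lintegral_filter_of_dominated_convergence (μ := (Measure.count : Measure (ℕ × ℕ)))
    (l := l) (F := fun i p => ‖blk p.1 ((L i - L₀) (blk p.2 m))‖ₑ) (f := fun _ => 0)
    (fun p => 2 * (ENNReal.ofReal (80 * K) * (ENNReal.ofReal (decay p.1 p.2) * ‖blk p.2 m‖ₑ)))
    (Eventually.of_forall fun i => Measurable.of_discrete) ?_ ?_ ?_
  · simpa using this
  · filter_upwards [h] with i hi
    refine ae_of_all _ fun p => ?_
    rw [_root_.sub_apply, map_sub, two_mul]
    exact (enorm_sub_le).trans (add_le_add (hi.enorm_blk_le hK _ _ _) (h₀.enorm_blk_le hK _ _ _))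
  · rw [lintegral_count, ENNReal.tsum_mul_left, ENNReal.tsum_mul_left]
    exact ENNReal.mul_ne_top (by simp) (ENNReal.mul_ne_top ENNReal.ofReal_ne_top
      ((tsum_decay_mul_le m).trans_lt (ENNReal.mul_lt_top (by simp) hm)).ne)
  · refine ae_of_all _ fun p => ?_
    have t := ((ht (blk p.2 m)).sub_const (L₀ (blk p.2 m)))
    rw [sub_self] at t
    have t2 : Tendsto (fun i => blk p.1 ((L i - L₀) (blk p.2 m))) l (𝓝 (blk p.1 0)) :=
      ((blk p.1).continuous.tendsto 0).comp t
    rw [map_zero] at t2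
    simpa using t2.enorm

end Besov

/-! ### Weighted composition operators -/

/-- The weight `a` is bounded by `K` and continuous, and `Φ` is a diffeomorphism. -/
structure IsWeightedDiffeo (a Φ Ψ Φ' : ℝ → ℝ) (K : ℝ) : Prop where
  isDiffeo : IsDiffeo Φ Ψ Φ'
  continuous : Continuous a
  abs_le : ∀ x, |a x| ≤ K

namespace IsWeightedDiffeo

variable {a Φ Ψ Φ' : ℝ → ℝ} {K : ℝ}

theorem nonneg (h : IsWeightedDiffeo a Φ Ψ Φ' K) : 0 ≤ K := (abs_nonneg _).trans (h.abs_le 0)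

theorem memLp (h : IsWeightedDiffeo a Φ Ψ Φ' K) {f : ℝ → ℂ} (hf : MemLp f 2) :
    MemLp (fun x => (a x : ℂ) * f (Φ x)) 2 := by
  refine ((h.isDiffeo.memLp_comp hf).const_mul (K : ℂ)).mono
    ((Complex.continuous_ofReal.comp h.continuous).aestronglyMeasurable.mul
      (h.isDiffeo.memLp_comp hf).1) (ae_of_all _ fun x => ?_)
  rw [norm_mul, norm_mul, Complex.norm_real, Complex.norm_real]
  gcongr
  exact (h.abs_le x).trans (le_abs_self K)

theorem eLpNorm_le (h : IsWeightedDiffeo a Φ Ψ Φ' K) (f : ℝ → ℂ) :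
    eLpNorm (fun x => (a x : ℂ) * f (Φ x)) 2 volume ≤
      ENNReal.ofReal K * (2 * eLpNorm f 2 volume) := by
  refine le_trans (eLpNorm_le_mul_eLpNorm_of_ae_le_mul (c := K) (g := fun x => f (Φ x))
    (ae_of_all _ fun x => ?_) 2) (mul_le_mul_right (h.isDiffeo.eLpNorm_comp_le f) _)
  rw [norm_mul, Complex.norm_real]
  gcongr
  exact h.abs_le x

end IsWeightedDiffeo

open Classical in
/-- The operator `f ↦ a · (f ∘ Φ)` (zero if `a` is not bounded continuous or `Φ` is not a
diffeomorphism). -/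
noncomputable def wcomp (a Φ : ℝ → ℝ) : LpC →L[ℂ] LpC :=
  if h : ∃ Ψ Φ' K, IsWeightedDiffeo a Φ Ψ Φ' K then
    LinearMap.mkContinuous
      { toFun := fun f => (h.choose_spec.choose_spec.choose_spec.memLp (Lp.memLp f)).toLp _
        map_add' := fun f g => by
          have H := h.choose_spec.choose_spec.choose_spec
          refine Lp.ext ?_
          filter_upwards [(H.memLp (Lp.memLp (f + g))).coeFn_toLp,
            (H.memLp (Lp.memLp f)).coeFn_toLp, (H.memLp (Lp.memLp g)).coeFn_toLp,
            Lp.coeFn_add ((H.memLp (Lp.memLp f)).toLp _) ((H.memLp (Lp.memLp g)).toLp _),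
            H.isDiffeo.quasiMeasurePreserving.ae (Lp.coeFn_add f g)] with x h1 h2 h3 h4 h5
          rw [h1, h4, Pi.add_apply, h2, h3, h5, Pi.add_apply, mul_add]
        map_smul' := fun c f => by
          have H := h.choose_spec.choose_spec.choose_spec
          refine Lp.ext ?_
          filter_upwards [(H.memLp (Lp.memLp (c • f))).coeFn_toLp,
            (H.memLp (Lp.memLp f)).coeFn_toLp,
            Lp.coeFn_smul c ((H.memLp (Lp.memLp f)).toLp _),
            H.isDiffeo.quasiMeasurePreserving.ae (Lp.coeFn_smul c f)] with x h1 h2 h4 h5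
          rw [h1, RingHom.id_apply, h4, Pi.smul_apply, h2, h5, Pi.smul_apply, smul_eq_mul,
            smul_eq_mul]
          ring }
      (h.choose_spec.choose_spec.choose * 2) fun f => by
        have H := h.choose_spec.choose_spec.choose_spec
        have := ENNReal.toReal_mono (ENNReal.mul_ne_top (by simp)
          (ENNReal.mul_ne_top (by simp) (Lp.eLpNorm_ne_top f))) (H.eLpNorm_le f)
        rw [ENNReal.toReal_mul, ENNReal.toReal_mul, ENNReal.toReal_ofReal H.nonneg,
          ENNReal.toReal_ofNat, ← mul_assoc] at this
        rw [Lp.norm_def f]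
        refine le_trans (le_of_eq ?_) this
        exact Lp.norm_toLp _ (H.memLp (Lp.memLp f))
  else 0

namespace IsWeightedDiffeo

variable {a b Φ Ψ Φ' : ℝ → ℝ} {K K' : ℝ}

theorem coeFn_wcomp (h : IsWeightedDiffeo a Φ Ψ Φ' K) (f : LpC) :
    wcomp a Φ f =ᵐ[volume] fun x => (a x : ℂ) * f (Φ x) := by
  have H : ∃ Ψ Φ' K, IsWeightedDiffeo a Φ Ψ Φ' K := ⟨_, _, _, h⟩
  rw [wcomp, dif_pos H]
  exact MemLp.coeFn_toLp (H.choose_spec.choose_spec.choose_spec.memLp (Lp.memLp f))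

theorem coeFn_wcomp' (h : IsWeightedDiffeo a Φ Ψ Φ' K) {f : LpC} {f₀ : ℝ → ℂ}
    (hf : f =ᵐ[volume] f₀) : wcomp a Φ f =ᵐ[volume] fun x => (a x : ℂ) * f₀ (Φ x) := by
  filter_upwards [h.coeFn_wcomp f, h.isDiffeo.quasiMeasurePreserving.ae hf] with x h1 h2
  rw [h1, h2]

theorem norm_wcomp_le (h : IsWeightedDiffeo a Φ Ψ Φ' K) (f : LpC) :
    ‖wcomp a Φ f‖ ≤ 2 * K * ‖f‖ := by
  have := ENNReal.toReal_mono (ENNReal.mul_ne_top (by simp)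
    (ENNReal.mul_ne_top (by simp) (Lp.eLpNorm_ne_top f))) (h.eLpNorm_le f)
  rw [ENNReal.toReal_mul, ENNReal.toReal_mul, ENNReal.toReal_ofReal h.nonneg,
    ENNReal.toReal_ofNat, ← eLpNorm_congr_ae (h.coeFn_wcomp f)] at this
  rw [Lp.norm_def, Lp.norm_def]
  linarith

/-- Change of variables: the adjoint composes with the inverse map, and the Jacobian enters its
weight. This keeps the adjoint within the same class of operators. -/
theorem inner_wcomp (h : IsWeightedDiffeo a Φ Ψ Φ' K) {Ψ' : ℝ → ℝ}
    (h' : IsWeightedDiffeo b Ψ Φ Ψ' K') (hab : ∀ y, b y = a (Ψ y) * Ψ' y) (f g : LpC) :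
    ⟪wcomp a Φ f, g⟫ = ⟪f, wcomp b Ψ g⟫ := by
  rw [L2.inner_def, L2.inner_def]
  have e1 : ∫ x, ⟪wcomp a Φ f x, g x⟫ = ∫ x, ⟪(a x : ℂ) * f (Φ x), g x⟫ := by
    refine integral_congr_ae ?_
    filter_upwards [h.coeFn_wcomp f] with x hx
    rw [hx]
  rw [e1, ← h'.isDiffeo.integral]
  refine integral_congr_ae ?_
  filter_upwards [h'.coeFn_wcomp g] with y hy
  rw [hy, hab, h.isDiffeo.right_inv y |> fun _ => h'.isDiffeo.left_inv y]
  simp only [RCLike.inner_apply, map_mul, Complex.conj_ofReal, Complex.real_smul]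
  push_cast
  ring

/-- The weight has only a square integrable upper gradient, so its product with `f ∘ Φ` is handled
as in the algebra `H¹`, using the bound `12 (‖f‖ + A)` for the supremum of `f`. The constant is `16
= 12 + 4`, the `4` coming from the change of variables in the gradient. -/
theorem ug_wcomp (h : IsWeightedDiffeo a Φ Ψ Φ' K) {σ : ℝ → ℝ} (hσ : HasUpperGradient a σ)
    (hσK : l2norm σ ≤ K) {f : LpC} {A : ℝ} (hA : 0 ≤ A) (hf : Besov.UG f A) :
    Besov.UG (wcomp a Φ f) (16 * K * (‖f‖ + A)) := by
  obtain ⟨f₀, ρ, e, hρ, hρA⟩ := hf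
  have hK := h.nonneg
  have hm : MemLp (fun x => ‖f₀ x‖) 2 := ((memLp_congr_ae e).1 (Lp.memLp f)).norm
  have hn : l2norm (fun x => ‖f₀ x‖) = ‖f‖ := by
    rw [l2norm, eLpNorm_norm, Lp.norm_def, eLpNorm_congr_ae e]
  have hb : ∀ x, ‖f₀ x‖ ≤ 12 * ‖f‖ + 12 * A := fun x => by
    have := hρ.norm_le hm x
    rw [hn] at this; linarith
  have hσ' : HasUpperGradient (fun x => (a x : ℂ)) σ := hσ.of_le fun x y => by
    rw [← Complex.ofReal_sub, Complex.norm_real]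
  have hρ' := h.isDiffeo.upperGradient_comp hρ
  have ha : ∀ x, ‖(a x : ℂ)‖ ≤ K := fun x => by rw [Complex.norm_real]; exact h.abs_le x
  have hmul := hσ'.mul hρ' ha (fun x => hb (Φ x))
  refine ⟨_, _, h.coeFn_wcomp' e, hmul, ?_⟩
  refine (l2norm_add_le (hσ'.memLp.const_mul _) (hρ'.memLp.const_mul _)).trans ?_
  rw [l2norm_const_mul, l2norm_const_mul, abs_of_nonneg hK,
    abs_of_nonneg (by positivity)]
  have h1 := h.isDiffeo.l2norm_comp_mul_le hρ.memLp
  calc (12 * ‖f‖ + 12 * A) * l2norm σ + K * l2norm (fun x => ρ (Φ x) * Φ' x)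
      ≤ (12 * ‖f‖ + 12 * A) * K + K * (4 * A) := by gcongr; linarith
    _ ≤ 16 * K * (‖f‖ + A) := by
      have := mul_nonneg hK (norm_nonneg f)
      nlinarith

theorem preservesUG (h : IsWeightedDiffeo a Φ Ψ Φ' K) {Ψ' : ℝ → ℝ}
    (h' : IsWeightedDiffeo b Ψ Φ Ψ' K) (hab : ∀ y, b y = a (Ψ y) * Ψ' y) {σ τ : ℝ → ℝ}
    (hσ : HasUpperGradient a σ) (hσK : l2norm σ ≤ K) (hτ : HasUpperGradient b τ)
    (hτK : l2norm τ ≤ K) : Besov.PreservesUG (16 * K) (wcomp a Φ) (wcomp b Ψ) := by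
  refine ⟨fun f => (h.norm_wcomp_le f).trans ?_, fun f g => h.inner_wcomp h' hab f g,
    fun f A hA hf => h.ug_wcomp hσ hσK hA hf, fun f A hA hf => h'.ug_wcomp hτ hτK hA hf⟩
  have := mul_nonneg h.nonneg (norm_nonneg f)
  linarith

theorem wcomp_toLpC (h : IsWeightedDiffeo a Φ Ψ Φ' K) {m : ℝ → ℝ} (hm : MemLp m 2) :
    MemLp (fun x => a x * m (Φ x)) 2 ∧
      wcomp a Φ (toLpC m) = toLpC (fun x => a x * m (Φ x)) := by
  have h1 : MemLp (fun x => a x * m (Φ x)) 2 := by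
    have := (h.memLp hm.ofRealC).re
    simpa using this
  refine ⟨h1, Lp.ext ?_⟩
  filter_upwards [h.coeFn_wcomp' (coeFn_toLpC hm), coeFn_toLpC h1] with x e1 e2
  rw [e1, e2, Complex.ofReal_mul]

end IsWeightedDiffeo

theorem tendsto_norm_of_lintegral {ι : Type*} {l : Filter ι} {F : ι → LpC}
    (h : Tendsto (fun i => ∫⁻ x, ‖F i x‖ₑ ^ 2) l (𝓝 0)) : Tendsto F l (𝓝 0) := by
  rw [tendsto_zero_iff_norm_tendsto_zero]
  have h3 : Tendsto (fun i => (∫⁻ x, ‖F i x‖ₑ ^ 2).toReal) l (𝓝 0) :=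
    (ENNReal.tendsto_toReal ENNReal.zero_ne_top).comp h
  have h4 : ∀ i, (∫⁻ x, ‖F i x‖ₑ ^ 2).toReal = ‖F i‖ ^ 2 := fun i => by
    rw [← eLpNorm_two_sq, ENNReal.toReal_pow, Lp.norm_def]
  simp_rw [h4] at h3
  have := h3.sqrt
  simpa [Real.sqrt_sq] using this

/-- Strong continuity of weighted composition operators. -/
theorem tendsto_wcomp {ι : Type*} {l : Filter ι} [l.IsCountablyGenerated] {a Φ Ψ Φ' : ι → ℝ → ℝ}
    {a₀ Φ₀ Ψ₀ Φ₀' : ℝ → ℝ} {K : ℝ} (h₀ : IsWeightedDiffeo a₀ Φ₀ Ψ₀ Φ₀' K)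
    (h : ∀ᶠ i in l, IsWeightedDiffeo (a i) (Φ i) (Ψ i) (Φ' i) K)
    (h1 : ∀ᶠ i in l, ∀ x, |Φ i x - x| ≤ 1)
    (ha : ∀ x, Tendsto (fun i => a i x) l (𝓝 (a₀ x)))
    (hΦ : ∀ x, Tendsto (fun i => Φ i x) l (𝓝 (Φ₀ x))) (f : LpC) :
    Tendsto (fun i => wcomp (a i) (Φ i) f) l (𝓝 (wcomp a₀ Φ₀ f)) := by
  have hK := h₀.nonneg
  -- For continuous functions of compact support the convergence is pointwise, and dominated:
  -- displacements of at most `1` keep the relevant supports in a common bounded interval.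
  have key : ∀ g : LpC, ∀ g₀ : ℝ → ℂ, g =ᵐ[volume] g₀ → Continuous g₀ → HasCompactSupport g₀ →
      Tendsto (fun i => wcomp (a i) (Φ i) g) l (𝓝 (wcomp a₀ Φ₀ g)) := by
    intro g g₀ hg hc hs
    obtain ⟨C, hC⟩ := hs.exists_bound_of_continuous hc
    obtain ⟨R, hR⟩ := hs.isCompact.isBounded.subset_closedBall 0
    have hz : ∀ x, R < |x| → g₀ x = 0 := fun x hx => by
      refine image_eq_zero_of_notMem_tsupport fun hx' => ?_
      have := hR hx'
      rw [mem_closedBall_zero_iff, Real.norm_eq_abs] at this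
      linarith
    have hC0 := (norm_nonneg _).trans (hC 0)
    rw [← tendsto_sub_nhds_zero_iff]
    refine tendsto_norm_of_lintegral ?_
    have hcong : ∀ᶠ i in l, ∫⁻ x, ‖(wcomp (a i) (Φ i) g - wcomp a₀ Φ₀ g : LpC) x‖ₑ ^ 2 =
        ∫⁻ x, ‖(a i x : ℂ) * g₀ (Φ i x) - (a₀ x : ℂ) * g₀ (Φ₀ x)‖ₑ ^ 2 := by
      filter_upwards [h] with i hi
      refine lintegral_congr_ae ?_
      filter_upwards [Lp.coeFn_sub (wcomp (a i) (Φ i) g) (wcomp a₀ Φ₀ g), hi.coeFn_wcomp' hg,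
        h₀.coeFn_wcomp' hg] with x e1 e2 e3
      rw [e1, Pi.sub_apply, e2, e3]
    refine Tendsto.congr' (hcong.mono fun _ hi => hi.symm) ?_
    obtain ⟨R', hR'⟩ : ∃ R', ∀ x, R' < |x| → g₀ (Φ₀ x) = 0 := by
      obtain ⟨R', hR'⟩ := (hs.isCompact.image h₀.isDiffeo.symm.continuous).isBounded.subset_closedBall 0
      refine ⟨R', fun x hx => image_eq_zero_of_notMem_tsupport fun hx' => ?_⟩
      have := hR' ⟨_, hx', h₀.isDiffeo.left_inv x⟩
      rw [mem_closedBall_zero_iff, Real.norm_eq_abs] at this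
      linarith
    set M := max (R + 1) R' with hM
    have hbound : ∀ᶠ i in l, ∀ᵐ x, ‖(a i x : ℂ) * g₀ (Φ i x) - (a₀ x : ℂ) * g₀ (Φ₀ x)‖ₑ ^ 2 ≤
        (Set.Icc (-M) M).indicator (fun _ => ENNReal.ofReal (K * C + K * C) ^ 2) x := by
      filter_upwards [h, h1] with i hi hi1
      refine ae_of_all _ fun x => ?_
      by_cases hx : x ∈ Set.Icc (-M) M
      · rw [Set.indicator_of_mem hx, ← ofReal_norm]
        gcongr
        refine (norm_sub_le _ _).trans ?_
        rw [norm_mul, norm_mul, Complex.norm_real, Complex.norm_real]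
        exact add_le_add (mul_le_mul (hi.abs_le x) (hC _) (norm_nonneg _) hK)
          (mul_le_mul (h₀.abs_le x) (hC _) (norm_nonneg _) hK)
      · have hx' : M < |x| := by
          by_contra! hle
          exact hx (abs_le.1 hle)
        have e1 : g₀ (Φ i x) = 0 := by
          refine hz _ ?_
          have h2 := hi1 x
          have h3 : |x| ≤ |Φ i x| + |Φ i x - x| := by
            have := abs_sub (Φ i x) (Φ i x - x)
            simpa using this
          have := le_max_left (R + 1) R'
          linarith
        have e2 : g₀ (Φ₀ x) = 0 := hR' x ((le_max_right _ _).trans_lt hx')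
        rw [e1, e2]; simp
    have := tendsto_lintegral_filter_of_dominated_convergence (μ := (volume : Measure ℝ)) (l := l)
      (F := fun i x => ‖(a i x : ℂ) * g₀ (Φ i x) - (a₀ x : ℂ) * g₀ (Φ₀ x)‖ₑ ^ 2) (f := fun _ => 0)
      _ ?_ hbound ?_ ?_
    · simpa using this
    · filter_upwards [h] with i hi
      have c1 := hi.continuous
      have c2 := hi.isDiffeo.continuous
      have c3 := h₀.continuous
      have c4 := h₀.isDiffeo.continuous
      have : Continuous fun x => (a i x : ℂ) * g₀ (Φ i x) - (a₀ x : ℂ) * g₀ (Φ₀ x) := by fun_prop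
      exact this.enorm.measurable.pow_const 2
    · rw [lintegral_indicator measurableSet_Icc, setLIntegral_const]
      exact ENNReal.mul_ne_top (ENNReal.pow_ne_top ENNReal.ofReal_ne_top) (by simp)
    · refine ae_of_all _ fun x => ?_
      have t : Tendsto (fun i => (a i x : ℂ) * g₀ (Φ i x) - (a₀ x : ℂ) * g₀ (Φ₀ x)) l (𝓝 0) := by
        have := (((Complex.continuous_ofReal.tendsto _).comp (ha x)).mul
          ((hc.tendsto _).comp (hΦ x))).sub_const ((a₀ x : ℂ) * g₀ (Φ₀ x))
        rw [sub_self] at this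
        exact this
      have t2 := (ENNReal.continuous_pow 2).tendsto _ |>.comp t.enorm
      simpa [Function.comp_def] using t2
  rw [Metric.tendsto_nhds]
  intro ε hε
  -- The operators have norm at most `2K`, so approximating `f` within `δ` costs `4 K δ` in total;
  -- this choice makes that cost less than `ε / 2`.
  set δ := ε / (8 * K + 4) with hδ
  have hδ0 : 0 < δ := by positivity
  obtain ⟨g₀, hs, hg, hc, hgm⟩ := (Lp.memLp f).exists_hasCompactSupport_eLpNorm_sub_le
    (by simp) (ε := ENNReal.ofReal δ) (by simpa using hδ0)
  set g : LpC := hgm.toLp g₀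
  have hfg : ‖f - g‖ ≤ δ := by
    rw [Lp.norm_def]
    refine ENNReal.toReal_le_of_le_ofReal hδ0.le (le_trans (le_of_eq ?_) hg)
    refine eLpNorm_congr_ae ?_
    filter_upwards [Lp.coeFn_sub f g, hgm.coeFn_toLp] with x e1 e2
    rw [e1, Pi.sub_apply, e2, Pi.sub_apply]
  have hk := key g g₀ hgm.coeFn_toLp hc hs
  filter_upwards [h, (Metric.tendsto_nhds.1 hk) (ε / 2) (by positivity)] with i hi hi2
  have e : wcomp (a i) (Φ i) f - wcomp a₀ Φ₀ f = wcomp (a i) (Φ i) (f - g) +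
      (wcomp (a i) (Φ i) g - wcomp a₀ Φ₀ g) - wcomp a₀ Φ₀ (f - g) := by
    rw [map_sub, map_sub]; abel
  rw [dist_eq_norm] at hi2 ⊢
  rw [e]
  have n1 := hi.norm_wcomp_le (f - g)
  have n2 := h₀.norm_wcomp_le (f - g)
  have n3 : 2 * K * ‖f - g‖ ≤ 2 * K * δ := by gcongr
  have n4 : 4 * K * δ ≤ ε / 2 - 2 * δ := by
    have : (8 * K + 4) * δ = ε := by rw [hδ]; field_simp
    linarith
  calc _ ≤ ‖wcomp (a i) (Φ i) (f - g)‖ + ‖wcomp (a i) (Φ i) g - wcomp a₀ Φ₀ g‖ +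
      ‖wcomp a₀ Φ₀ (f - g)‖ := (norm_sub_le _ _).trans (by gcongr; exact norm_add_le _ _)
    _ < ε := by linarith

/-! ### Green potentials in Lagrangian coordinates -/

/-- A kernel with exponential decay which is Lipschitz on both half-lines. -/
structure IsLagKernel (G : ℝ → ℝ) : Prop where
  measurable : Measurable G
  abs_le : ∀ z, |G z| ≤ Real.exp (-|z|)
  abs_sub_le : ∀ z w, 0 < z * w → ∀ a, a ≤ |z| → a ≤ |w| → |G z - G w| ≤ |z - w| * Real.exp (-a)

theorem abs_exp_sub_exp_le {x y c : ℝ} (hx : x ≤ c) (hy : y ≤ c) :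
    |Real.exp x - Real.exp y| ≤ |x - y| * Real.exp c := by
  wlog h : y ≤ x generalizing x y
  · rw [abs_sub_comm, abs_sub_comm x]; exact this hy hx (le_of_not_ge h)
  rw [abs_of_nonneg (sub_nonneg.2 (Real.exp_le_exp.2 h)), abs_of_nonneg (sub_nonneg.2 h)]
  have h1 := Real.add_one_le_exp (y - x)
  have h2 : Real.exp y = Real.exp x * Real.exp (y - x) := by rw [← Real.exp_add]; ring_nf
  have h3 : Real.exp x ≤ Real.exp c := Real.exp_le_exp.2 hx
  have h4 := Real.exp_pos x
  calc Real.exp x - Real.exp y ≤ (x - y) * Real.exp x := by rw [h2]; nlinarith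
    _ ≤ (x - y) * Real.exp c := by gcongr

theorem abs_exp_sub_exp_le_two {x y : ℝ} (hx : |x| ≤ 1 / 2) (hy : |y| ≤ 1 / 2) :
    |Real.exp x - Real.exp y| ≤ 2 * |x - y| := by
  have h := abs_exp_sub_exp_le (abs_le.1 hx).2 (abs_le.1 hy).2
  have h1 := Real.exp_one_lt_d9
  have h2 : Real.exp 1 = Real.exp (1 / 2) * Real.exp (1 / 2) := by rw [← Real.exp_add]; norm_num
  have h3 := Real.exp_pos (1 / 2)
  have : Real.exp (1 / 2) ≤ 2 := by nlinarith
  nlinarith [abs_nonneg (x - y)]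

/-- Together with `half_le_exp` this explains the threshold `1/2` in `IsSmall`: it places the
Jacobian `e^k` in `[1/2, 2]`, as `IsDiffeo` requires. -/
theorem exp_le_two {x : ℝ} (hx : |x| ≤ 1 / 2) : Real.exp x ≤ 2 := by
  have h := Real.exp_le_exp.2 (abs_le.1 hx).2
  have h1 := Real.exp_one_lt_d9
  have h2 : Real.exp 1 = Real.exp (1 / 2) * Real.exp (1 / 2) := by rw [← Real.exp_add]; norm_num
  have h3 := Real.exp_pos (1 / 2)
  nlinarith

theorem half_le_exp {x : ℝ} (hx : |x| ≤ 1 / 2) : 1 / 2 ≤ Real.exp x := by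
  have := Real.add_one_le_exp x
  linarith [(abs_le.1 hx).1]

theorem abs_exp_neg_abs_sub_le (z w : ℝ) {a : ℝ} (hz : a ≤ |z|) (hw : a ≤ |w|) :
    |Real.exp (-|z|) - Real.exp (-|w|)| ≤ |z - w| * Real.exp (-a) := by
  refine (abs_exp_sub_exp_le (neg_le_neg hz) (neg_le_neg hw)).trans
    (mul_le_mul_of_nonneg_right ?_ (Real.exp_pos _).le)
  rw [neg_sub_neg, abs_sub_comm z]
  exact abs_abs_sub_abs_le w z

theorem isLagKernel_green : IsLagKernel green := by
  refine ⟨by unfold green; fun_prop, fun z => ?_, fun z w _ a hz hw => ?_⟩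
  · have := Real.exp_pos (-|z|)
    rw [green, abs_of_pos (by positivity)]; linarith
  · have h := abs_exp_neg_abs_sub_le z w hz hw
    have e : green z - green w = (Real.exp (-|z|) - Real.exp (-|w|)) / 2 := by unfold green; ring
    rw [e, abs_div, abs_two]
    have := abs_nonneg (Real.exp (-|z|) - Real.exp (-|w|))
    linarith

theorem isLagKernel_greenDeriv : IsLagKernel greenDeriv := by
  refine ⟨measurable_greenDeriv, fun z => ?_, fun z w h a hz hw => ?_⟩
  · have := Real.exp_pos (-|z|)
    have := abs_greenDeriv_le z; linarith
  · have h := abs_exp_neg_abs_sub_le z w hz hw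
    have h0 := abs_nonneg (Real.exp (-|z|) - Real.exp (-|w|))
    have e : |greenDeriv z - greenDeriv w| = |Real.exp (-|z|) - Real.exp (-|w|)| / 2 := by
      rcases pos_and_pos_or_neg_and_neg_of_mul_pos ‹0 < z * w› with ⟨h1, h2⟩ | ⟨h1, h2⟩
      · have : greenDeriv z - greenDeriv w = -((Real.exp (-|z|) - Real.exp (-|w|)) / 2) := by
          rw [greenDeriv, greenDeriv, sign_pos h1, sign_pos h2, SignType.coe_one]; ring
        rw [this, abs_neg, abs_div, abs_two]
      · have : greenDeriv z - greenDeriv w = (Real.exp (-|z|) - Real.exp (-|w|)) / 2 := by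
          rw [greenDeriv, greenDeriv, sign_neg h1, sign_neg h2, SignType.coe_neg_one]; ring
        rw [this, abs_div, abs_two]
    rw [e]; linarith

/-- A continuous function with values in `[-1/2, 1/2]`. -/
structure IsSmall (k : ℝ → ℝ) : Prop where
  continuous : Continuous k
  abs_le : ∀ x, |k x| ≤ 1 / 2

/-- The signed length of `[s, ξ]` for the density `e^k`. -/
noncomputable def expDist (k : ℝ → ℝ) (s ξ : ℝ) : ℝ := ∫ r in s..ξ, Real.exp (k r)

section expDist

variable {k k' : ℝ → ℝ}

theorem IsSmall.intervalIntegrable (hk : IsSmall k) (s ξ : ℝ) :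
    IntervalIntegrable (fun r => Real.exp (k r)) volume s ξ :=
  (Real.continuous_exp.comp hk.continuous).intervalIntegrable _ _

theorem expDist_symm (k : ℝ → ℝ) (s ξ : ℝ) : expDist k ξ s = -expDist k s ξ :=
  intervalIntegral.integral_symm _ _

theorem IsSmall.le_expDist (hk : IsSmall k) {s ξ : ℝ} (h : s ≤ ξ) :
    1 / 2 * (ξ - s) ≤ expDist k s ξ := by
  have := intervalIntegral.integral_mono_on h (intervalIntegrable_const (c := (1 / 2 : ℝ)))
    (hk.intervalIntegrable s ξ) fun r _ => half_le_exp (hk.abs_le r)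
  rw [intervalIntegral.integral_const, smul_eq_mul] at this
  rw [expDist]; linarith

theorem IsSmall.le_abs_expDist (hk : IsSmall k) (s ξ : ℝ) :
    1 / 2 * |ξ - s| ≤ |expDist k s ξ| := by
  rcases le_total s ξ with h | h
  · rw [abs_of_nonneg (sub_nonneg.2 h)]
    exact (hk.le_expDist h).trans (le_abs_self _)
  · rw [expDist_symm, abs_neg, abs_sub_comm, abs_of_nonneg (sub_nonneg.2 h)]
    exact (hk.le_expDist h).trans (le_abs_self _)

/-- The order of two particles does not depend on `k`. Hence two configurations are never compared
across the jump of `p'` at `0`, where the kernel is not Lipschitz. -/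
theorem IsSmall.expDist_mul_pos (hk : IsSmall k) (hk' : IsSmall k') {s ξ : ℝ} (h : s ≠ ξ) :
    0 < expDist k s ξ * expDist k' s ξ := by
  rcases lt_or_gt_of_ne h with h | h
  · exact mul_pos (by linarith [hk.le_expDist h.le]) (by linarith [hk'.le_expDist h.le])
  · rw [expDist_symm, expDist_symm k', neg_mul_neg]
    exact mul_pos (by linarith [hk.le_expDist h.le]) (by linarith [hk'.le_expDist h.le])

theorem IsSmall.abs_expDist_sub_le (hk : IsSmall k) (hk' : IsSmall k') {ε : ℝ}
    (h : ∀ x, |k x - k' x| ≤ ε) (s ξ : ℝ) :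
    |expDist k s ξ - expDist k' s ξ| ≤ 2 * ε * |ξ - s| := by
  rw [expDist, expDist, ← intervalIntegral.integral_sub (hk.intervalIntegrable _ _)
    (hk'.intervalIntegrable _ _)]
  refine intervalIntegral.norm_integral_le_of_norm_le_const (f := fun r =>
    Real.exp (k r) - Real.exp (k' r)) fun r _ => ?_
  refine (abs_exp_sub_exp_le_two (hk.abs_le r) (hk'.abs_le r)).trans ?_
  linarith [h r]

theorem IsSmall.continuous_expDist (hk : IsSmall k) (ξ : ℝ) :
    Continuous fun s => expDist k s ξ := by
  have := intervalIntegral.continuous_primitive (fun a b => hk.intervalIntegrable a b) ξ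
  have e : (fun s => expDist k s ξ) = fun s => -∫ r in ξ..s, Real.exp (k r) :=
    funext fun s => expDist_symm k ξ s
  rw [e]; exact this.neg

end expDist

/-- The potential with kernel `G` in Lagrangian coordinates. -/
noncomputable def lag (G h k w : ℝ → ℝ) (ξ : ℝ) : ℝ :=
  ∫ s, G (expDist k s ξ) * (Real.exp (w s) * h s)

/-- The majorant of Lagrangian potentials. -/
noncomputable def lagBound (h : ℝ → ℝ) (ξ : ℝ) : ℝ := ∫ s, expKer (1 / 4) ξ s * |h s|

section lag

variable {G h k w k' w' : ℝ → ℝ}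

theorem exp_neg_half_le (ξ s : ℝ) : Real.exp (-(1 / 2 * |ξ - s|)) ≤ expKer (1 / 4) ξ s := by
  unfold expKer
  refine Real.exp_le_exp.2 ?_
  have := abs_nonneg (ξ - s); linarith

/-- Half of the decay rate is spent on absorbing the linear factor, through `1 + x ≤ e^x`. This is
why the majorant `lagBound` has rate `1/4`. -/
theorem mul_exp_neg_half_le (ξ s : ℝ) :
    |ξ - s| * Real.exp (-(1 / 2 * |ξ - s|)) ≤ 4 * expKer (1 / 4) ξ s := by
  unfold expKer
  have h1 := Real.add_one_le_exp (1 / 4 * |ξ - s|)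
  have e : Real.exp (-(1 / 4 * |ξ - s|)) =
      Real.exp (1 / 4 * |ξ - s|) * Real.exp (-(1 / 2 * |ξ - s|)) := by
    rw [← Real.exp_add]; congr 1; ring
  rw [e]
  have := Real.exp_pos (-(1 / 2 * |ξ - s|))
  nlinarith

theorem IsLagKernel.abs_comp_le (hG : IsLagKernel G) (hk : IsSmall k) (s ξ : ℝ) :
    |G (expDist k s ξ)| ≤ expKer (1 / 4) ξ s := by
  refine (hG.abs_le _).trans (le_trans ?_ (exp_neg_half_le ξ s))
  exact Real.exp_le_exp.2 (neg_le_neg (hk.le_abs_expDist s ξ))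

theorem IsLagKernel.abs_mul_le (hG : IsLagKernel G) (hk : IsSmall k) (hw : IsSmall w) (s ξ : ℝ) :
    |G (expDist k s ξ) * (Real.exp (w s) * h s)| ≤ 2 * (expKer (1 / 4) ξ s * |h s|) := by
  rw [abs_mul, abs_mul, abs_of_pos (Real.exp_pos _)]
  have h1 := hG.abs_comp_le hk s ξ
  have h2 := exp_le_two (hw.abs_le s)
  have h3 := (expKer_pos (1 / 4) ξ s).le
  calc _ ≤ expKer (1 / 4) ξ s * (2 * |h s|) := by gcongr
    _ = _ := by ring

theorem integrable_lagBound (hh : MemLp h 2) (ξ : ℝ) :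
    Integrable fun s => expKer (1 / 4) ξ s * |h s| :=
  integrable_expKer_mul (by norm_num) ξ hh.norm

theorem IsLagKernel.aestronglyMeasurable (hG : IsLagKernel G) (hk : IsSmall k)
    (hw : IsSmall w) (hh : AEStronglyMeasurable h) (ξ : ℝ) :
    AEStronglyMeasurable fun s => G (expDist k s ξ) * (Real.exp (w s) * h s) :=
  (hG.measurable.comp (hk.continuous_expDist ξ).measurable).aestronglyMeasurable.mul
    ((Real.continuous_exp.comp hw.continuous).aestronglyMeasurable.mul hh)

theorem IsLagKernel.integrable (hG : IsLagKernel G) (hk : IsSmall k) (hw : IsSmall w)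
    (hh : MemLp h 2) (ξ : ℝ) :
    Integrable fun s => G (expDist k s ξ) * (Real.exp (w s) * h s) :=
  ((integrable_lagBound hh ξ).const_mul 2).mono' (hG.aestronglyMeasurable hk hw hh.1 ξ)
    (ae_of_all _ fun s => hG.abs_mul_le hk hw s ξ)

theorem lagBound_nonneg (h : ℝ → ℝ) (ξ : ℝ) : 0 ≤ lagBound h ξ :=
  integral_nonneg fun _ => mul_nonneg (expKer_pos _ _ _).le (abs_nonneg _)

theorem enorm_lagBound_le (h : ℝ → ℝ) (ξ : ℝ) :
    ‖lagBound h ξ‖ₑ ≤ ∫⁻ s, ENNReal.ofReal (expKer (1 / 4) ξ s) * ‖h s‖ₑ := by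
  refine (enorm_integral_le_lintegral_enorm _).trans (le_of_eq (lintegral_congr fun s => ?_))
  rw [enorm_mul, Real.enorm_of_nonneg (expKer_pos _ _ _).le, Real.enorm_abs]

theorem lagBound_le (hh : MemLp h 2) (ξ : ℝ) : lagBound h ξ ≤ 5 * l2norm h := by
  have := (enorm_lagBound_le h ξ).trans
    (lintegral_expKer_mul_le (by norm_num : (0 : ℝ) < 1 / 4) ξ hh.1)
  rw [← hh.ofReal_l2norm, ← ENNReal.ofReal_mul (by norm_num), ← ofReal_norm,
    ENNReal.ofReal_le_ofReal_iff (by have := l2norm_nonneg h; positivity),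
    Real.norm_of_nonneg (lagBound_nonneg h ξ)] at this
  norm_num at this
  exact this

theorem continuous_lagBound (hh : MemLp h 2) : Continuous (lagBound h) := by
  rw [continuous_iff_continuousAt]
  intro ξ
  refine continuousAt_of_dominated (bound := fun s => 2 * (expKer (1 / 4) ξ s * |h s|)) ?_ ?_
    ((integrable_lagBound hh ξ).const_mul 2) ?_
  · exact Eventually.of_forall fun y => (integrable_lagBound hh y).1
  · filter_upwards [Metric.ball_mem_nhds ξ one_pos] with y hy
    refine ae_of_all _ fun s => ?_
    rw [norm_mul, Real.norm_of_nonneg (expKer_pos _ _ _).le, Real.norm_eq_abs, abs_abs, ← mul_assoc]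
    gcongr
    rw [Metric.mem_ball, Real.dist_eq] at hy
    have h1 : Real.exp (1 / 4) ≤ 2 := exp_le_two (by rw [abs_of_pos] <;> norm_num)
    have h2 : expKer (1 / 4) y s ≤ Real.exp (1 / 4) * expKer (1 / 4) ξ s := by
      unfold expKer
      rw [← Real.exp_add]
      refine Real.exp_le_exp.2 ?_
      have := abs_sub_abs_le_abs_sub (ξ - s) (y - s)
      rw [sub_sub_sub_cancel_right, abs_sub_comm ξ y] at this
      linarith
    have := expKer_pos (1 / 4) ξ s
    nlinarith
  · refine ae_of_all _ fun s => ?_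
    have : Continuous fun y => expKer (1 / 4) y s * |h s| := by unfold expKer; fun_prop
    exact this.continuousAt

theorem eLpNorm_lagBound_le (hh : MemLp h 2) :
    eLpNorm (lagBound h) 2 volume ≤ ENNReal.ofReal 8 * eLpNorm h 2 volume := by
  have := eLpNorm_expKer_le (by norm_num : (0 : ℝ) < 1 / 4) hh.1 (fun ξ => enorm_lagBound_le h ξ)
  norm_num at this ⊢
  exact this

theorem memLp_lagBound (hh : MemLp h 2) : MemLp (lagBound h) 2 :=
  ⟨(continuous_lagBound hh).aestronglyMeasurable,
    (eLpNorm_lagBound_le hh).trans_lt (ENNReal.mul_lt_top (by simp) hh.2)⟩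

theorem IsLagKernel.abs_lag_le_lagBound (hG : IsLagKernel G) (hk : IsSmall k) (hw : IsSmall w)
    (hh : MemLp h 2) (ξ : ℝ) : |lag G h k w ξ| ≤ 2 * lagBound h ξ := by
  rw [lag, lagBound, ← integral_const_mul, ← Real.norm_eq_abs]
  exact norm_integral_le_of_norm_le ((integrable_lagBound hh ξ).const_mul 2)
    (ae_of_all _ fun s => hG.abs_mul_le hk hw s ξ)

theorem IsLagKernel.abs_lag_le (hG : IsLagKernel G) (hk : IsSmall k) (hw : IsSmall w)
    (hh : MemLp h 2) (ξ : ℝ) : |lag G h k w ξ| ≤ 10 * l2norm h := by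
  have := hG.abs_lag_le_lagBound hk hw hh ξ
  have := lagBound_le hh ξ
  linarith

/-- The kernel changes by at most `8ε` times the majorant kernel and is multiplied by a weight of
size at most `2`; the weight changes by at most `2ε`. Thus `16 + 2 = 18`, and `lagBound h ≤ 5 ‖h‖`
gives `90`. The null set `s = ξ`, where the jump sits, is discarded. -/
theorem IsLagKernel.abs_lag_sub_le (hG : IsLagKernel G) (hk : IsSmall k) (hw : IsSmall w)
    (hk' : IsSmall k') (hw' : IsSmall w') (hh : MemLp h 2) {ε : ℝ}
    (hkk : ∀ x, |k x - k' x| ≤ ε) (hww : ∀ x, |w x - w' x| ≤ ε) (ξ : ℝ) :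
    |lag G h k w ξ - lag G h k' w' ξ| ≤ 90 * ε * l2norm h := by
  have hε : 0 ≤ ε := (abs_nonneg _).trans (hkk 0)
  rw [lag, lag, ← integral_sub (hG.integrable hk hw hh ξ) (hG.integrable hk' hw' hh ξ)]
  have hb : ∀ s, s ≠ ξ → ‖G (expDist k s ξ) * (Real.exp (w s) * h s) -
      G (expDist k' s ξ) * (Real.exp (w' s) * h s)‖ ≤
      18 * ε * (expKer (1 / 4) ξ s * |h s|) := by
    intro s hs
    have h1 := hG.abs_sub_le _ _ (hk.expDist_mul_pos hk' hs) _ (hk.le_abs_expDist s ξ)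
      (hk'.le_abs_expDist s ξ)
    have h2 := hk.abs_expDist_sub_le hk' hkk s ξ
    have h3 := hG.abs_comp_le hk' s ξ
    have h4 := abs_exp_sub_exp_le_two (hw.abs_le s) (hw'.abs_le s)
    have h5 := exp_le_two (hw.abs_le s)
    have h6 := mul_exp_neg_half_le ξ s
    have h7 := expKer_pos (1 / 4) ξ s
    have h8 : |G (expDist k s ξ) - G (expDist k' s ξ)| ≤ 8 * ε * expKer (1 / 4) ξ s := by
      refine h1.trans ?_
      calc _ ≤ 2 * ε * |ξ - s| * Real.exp (-(1 / 2 * |ξ - s|)) := by gcongr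
        _ = 2 * ε * (|ξ - s| * Real.exp (-(1 / 2 * |ξ - s|))) := by ring
        _ ≤ 2 * ε * (4 * expKer (1 / 4) ξ s) := by gcongr
        _ = _ := by ring
    have e : G (expDist k s ξ) * (Real.exp (w s) * h s) -
        G (expDist k' s ξ) * (Real.exp (w' s) * h s) =
        ((G (expDist k s ξ) - G (expDist k' s ξ)) * Real.exp (w s) +
          G (expDist k' s ξ) * (Real.exp (w s) - Real.exp (w' s))) * h s := by ring
    rw [e, norm_mul, Real.norm_eq_abs, Real.norm_eq_abs, ← mul_assoc]
    gcongr
    refine (abs_add_le _ _).trans ?_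
    rw [abs_mul, abs_mul, abs_of_pos (Real.exp_pos (w s))]
    have h9 := hww s
    calc _ ≤ 8 * ε * expKer (1 / 4) ξ s * 2 + expKer (1 / 4) ξ s * (2 * ε) := by
          gcongr; linarith
      _ = 18 * ε * expKer (1 / 4) ξ s := by ring
  have hae : ∀ᵐ s : ℝ, s ≠ ξ := by simp [ae_iff]
  refine (norm_integral_le_of_norm_le ((integrable_lagBound hh ξ).const_mul (18 * ε))
    (hae.mono hb)).trans ?_
  rw [integral_const_mul]
  have := lagBound_le hh ξ
  rw [lagBound] at this
  nlinarith

end lag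

/-! ### Passing to Eulerian coordinates -/

theorem IsSmall.isDiffeo {k Φ Ψ : ℝ → ℝ} (hk : IsSmall k)
    (hd : ∀ x, HasDerivAt Φ (Real.exp (k x)) x) (h1 : ∀ x, Ψ (Φ x) = x) (h2 : ∀ x, Φ (Ψ x) = x) :
    IsDiffeo Φ Ψ fun x => Real.exp (k x) :=
  ⟨hd, Real.continuous_exp.comp hk.continuous, fun x => half_le_exp (hk.abs_le x),
    fun x => exp_le_two (hk.abs_le x), h1, h2⟩

theorem IsDiffeo.expDist_eq {k X Y : ℝ → ℝ} (hX : IsDiffeo X Y fun x => Real.exp (k x))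
    (s ξ : ℝ) : expDist k s ξ = X ξ - X s :=
  intervalIntegral.integral_eq_sub_of_hasDerivAt (fun x _ => hX.hasDerivAt x)
    (hX.continuous_deriv.intervalIntegrable _ _)

/-- Every small `k` generates a diffeomorphism. -/
theorem IsSmall.exists_inverse {k X : ℝ → ℝ} (hk : IsSmall k)
    (hd : ∀ x, HasDerivAt X (Real.exp (k x)) x) :
    ∃ Y, IsDiffeo X Y fun x => Real.exp (k x) := by
  have hc : Continuous X := continuous_iff_continuousAt.2 fun x => (hd x).continuousAt
  have hm : StrictMono X := strictMono_of_hasDerivAt_pos hd fun x => Real.exp_pos _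
  have e : ∀ s ξ, expDist k s ξ = X ξ - X s := fun s ξ =>
    intervalIntegral.integral_eq_sub_of_hasDerivAt (fun x _ => hd x) (hk.intervalIntegrable _ _)
  have htop : Tendsto X atTop atTop := by
    have : Tendsto (fun x : ℝ => X 0 + 1 / 2 * x) atTop atTop :=
      tendsto_atTop_add_const_left _ _ (tendsto_id.const_mul_atTop (by norm_num))
    refine tendsto_atTop_mono' _ ?_ this
    filter_upwards [eventually_ge_atTop 0] with x hx
    have := hk.le_expDist hx
    rw [e] at this; linarith
  have hbot : Tendsto X atBot atBot := by
    have : Tendsto (fun x : ℝ => X 0 + 1 / 2 * x) atBot atBot :=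
      tendsto_atBot_add_const_left _ _ (tendsto_id.const_mul_atBot (by norm_num))
    refine tendsto_atBot_mono' _ ?_ this
    filter_upwards [eventually_le_atBot 0] with x hx
    have := hk.le_expDist hx
    rw [e] at this; linarith
  have hs := hc.surjective htop hbot
  exact ⟨Function.surjInv hs, hk.isDiffeo hd
    (fun x => hm.injective (Function.surjInv_eq hs _)) (Function.surjInv_eq hs)⟩

/-- The momentum in Eulerian coordinates. -/
noncomputable def pushMom (h k w Y : ℝ → ℝ) (y : ℝ) : ℝ := Real.exp (w (Y y) - k (Y y)) * h (Y y)

section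

variable {h k w X Y : ℝ → ℝ}

theorem pushMom_comp (hX : IsDiffeo X Y fun x => Real.exp (k x)) (s : ℝ) :
    Real.exp (k s) * pushMom h k w Y (X s) = Real.exp (w s) * h s := by
  rw [pushMom, hX.left_inv, ← mul_assoc, ← Real.exp_add]
  ring_nf

theorem memLp_pushMom (hX : IsDiffeo X Y fun x => Real.exp (k x)) (hk : IsSmall k)
    (hw : IsSmall w) (hh : MemLp h 2) : MemLp (pushMom h k w Y) 2 := by
  have hY := hX.symm
  have hc : Continuous fun y => Real.exp (w (Y y) - k (Y y)) := by
    exact ((hw.continuous.comp hY.continuous).sub (hk.continuous.comp hY.continuous)).rexp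
  refine ((hY.memLp_comp hh).const_mul (Real.exp 1)).mono
    (hc.aestronglyMeasurable.mul (hY.memLp_comp hh).1) (ae_of_all _ fun y => ?_)
  rw [pushMom, norm_mul, norm_mul]
  gcongr
  rw [Real.norm_of_nonneg (Real.exp_pos _).le, Real.norm_of_nonneg (Real.exp_pos _).le]
  refine Real.exp_le_exp.2 ?_
  linarith [(abs_le.1 (hw.abs_le (Y y))).2, (abs_le.1 (hk.abs_le (Y y))).1]

theorem integral_comp_pushMom (hX : IsDiffeo X Y fun x => Real.exp (k x)) (g : ℝ → ℝ) :
    ∫ s, g s * (Real.exp (w s) * h s) = ∫ y, g (Y y) * pushMom h k w Y y := by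
  rw [← hX.integral fun y => g (Y y) * pushMom h k w Y y]
  refine integral_congr_ae (ae_of_all _ fun s => ?_)
  simp only [smul_eq_mul]
  rw [← pushMom_comp hX, hX.left_inv]
  ring

/-- Under `y = X s` the signed length `expDist k s ξ` becomes `X ξ - X s`, and `e^w h ds` becomes
the Eulerian momentum. The Lagrangian potential is therefore `u ∘ X`; the companion for `greenDeriv`
gives `u_x ∘ X`. -/
theorem lag_green_eq (hX : IsDiffeo X Y fun x => Real.exp (k x)) (hk : IsSmall k)
    (hw : IsSmall w) (hh : MemLp h 2) (ξ : ℝ) :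
    lag green h k w ξ = greenConv (pushMom h k w Y) (X ξ) := by
  rw [greenConv_eq_integral (memLp_pushMom hX hk hw hh), lag, integral_comp_pushMom hX]
  refine integral_congr_ae (ae_of_all _ fun y => ?_)
  simp only
  rw [hX.expDist_eq, hX.right_inv]

theorem lag_greenDeriv_eq (hX : IsDiffeo X Y fun x => Real.exp (k x)) (hk : IsSmall k)
    (hw : IsSmall w) (hh : MemLp h 2) (ξ : ℝ) :
    lag greenDeriv h k w ξ = greenConv' (pushMom h k w Y) (X ξ) := by
  rw [greenConv'_eq_integral (memLp_pushMom hX hk hw hh), lag, integral_comp_pushMom hX]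
  refine integral_congr_ae (ae_of_all _ fun y => ?_)
  simp only
  rw [hX.expDist_eq, hX.right_inv]

/-- Every small `k` is the logarithmic Jacobian of some map `X`, so the chain rule for `u ∘ X`
applies even when `k` does not come from a flow. -/
theorem hasDerivAt_lag_green (hk : IsSmall k) (hw : IsSmall w) (hh : MemLp h 2) (ξ : ℝ) :
    HasDerivAt (lag green h k w) (lag greenDeriv h k w ξ * Real.exp (k ξ)) ξ := by
  have hd : ∀ x, HasDerivAt (fun x => ∫ r in (0 : ℝ)..x, Real.exp (k r)) (Real.exp (k x)) x := by
    intro x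
    have hc := Real.continuous_exp.comp hk.continuous
    exact intervalIntegral.integral_hasDerivAt_right (hc.intervalIntegrable 0 x)
      (hc.stronglyMeasurableAtFilter _ _) hc.continuousAt
  obtain ⟨Y, hX⟩ := hk.exists_inverse hd
  have hm := memLp_pushMom hX hk hw hh
  have e : lag green h k w = fun ξ => greenConv (pushMom h k w Y) (∫ r in (0 : ℝ)..ξ, Real.exp (k r)) :=
    funext fun ξ => lag_green_eq hX hk hw hh ξ
  rw [lag_greenDeriv_eq hX hk hw hh, e]
  exact (hasDerivAt_greenConv hm _).comp ξ (hd ξ)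

/-- The derivative of `u_x ∘ X` is `e^k (u - m) ∘ X = e^k (u ∘ X) - e^w h`. The resulting bound does
not involve `k` or `w`, so it serves all times of the flow at once. -/
theorem upperGradient_lag_greenDeriv (hk : IsSmall k) (hw : IsSmall w) (hh : MemLp h 2) {x y : ℝ}
    (hxy : x ≤ y) : |lag greenDeriv h k w y - lag greenDeriv h k w x| ≤
      ∫ s in x..y, (4 * lagBound h s + 2 * |h s|) := by
  have hd : ∀ x, HasDerivAt (fun x => ∫ r in (0 : ℝ)..x, Real.exp (k r)) (Real.exp (k x)) x := by
    intro x
    have hc := Real.continuous_exp.comp hk.continuous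
    exact intervalIntegral.integral_hasDerivAt_right (hc.intervalIntegrable 0 x)
      (hc.stronglyMeasurableAtFilter _ _) hc.continuousAt
  obtain ⟨Y, hX⟩ := hk.exists_inverse hd
  set X : ℝ → ℝ := fun x => ∫ r in (0 : ℝ)..x, Real.exp (k r)
  have hm := memLp_pushMom hX hk hw hh
  have hm2 := (memLp_greenConv hm).sub hm
  have hu : HasUpperGradient (greenConv' (pushMom h k w Y))
      fun y => ‖(greenConv (pushMom h k w Y) - pushMom h k w Y) y‖ := by
    refine ⟨hm2.norm, fun _ => norm_nonneg _, fun x y hxy => ?_⟩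
    rw [← (isPrim_greenConv' hm).integral_eq]
    exact intervalIntegral.norm_integral_le_integral_norm hxy
  have hu2 := hX.upperGradient_comp hu
  rw [lag_greenDeriv_eq hX hk hw hh, lag_greenDeriv_eq hX hk hw hh]
  refine (hu2.norm_sub_le x y hxy).trans ?_
  refine intervalIntegral.integral_mono_on hxy (hu2.memLp.intervalIntegrable_of_two _ _)
    ((((memLp_lagBound hh).const_mul 4).add
      (hh.norm.const_mul 2)).intervalIntegrable_of_two _ _) fun s _ => ?_
  have h1 := isLagKernel_green.abs_lag_le_lagBound hk hw hh s
  rw [lag_green_eq hX hk hw hh] at h1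
  have h2 := pushMom_comp (h := h) (w := w) hX s
  have h3 := exp_le_two (hk.abs_le s)
  have h4 := exp_le_two (hw.abs_le s)
  have h5 := Real.exp_pos (k s)
  rw [Pi.sub_apply, Real.norm_eq_abs]
  calc |greenConv (pushMom h k w Y) (X s) - pushMom h k w Y (X s)| * Real.exp (k s)
      = |Real.exp (k s) * greenConv (pushMom h k w Y) (X s) - Real.exp (w s) * h s| := by
        rw [← h2, ← mul_sub, abs_mul, abs_of_pos h5, mul_comm]
    _ ≤ Real.exp (k s) * |greenConv (pushMom h k w Y) (X s)| + Real.exp (w s) * |h s| := by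
        refine (abs_sub _ _).trans ?_
        rw [abs_mul, abs_mul, abs_of_pos h5, abs_of_pos (Real.exp_pos _)]
    _ ≤ 2 * (2 * lagBound h s) + 2 * |h s| := by gcongr
    _ = _ := by ring

theorem upperGradient_lag_green (hk : IsSmall k) (hw : IsSmall w) (hh : MemLp h 2) {x y : ℝ}
    (hxy : x ≤ y) : |lag green h k w y - lag green h k w x| ≤ ∫ s in x..y, 4 * lagBound h s := by
  have hd := hasDerivAt_lag_green hk hw hh
  have hb : ∀ s, ‖lag greenDeriv h k w s * Real.exp (k s)‖ ≤ 4 * lagBound h s := fun s => by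
    have h1 := isLagKernel_greenDeriv.abs_lag_le_lagBound hk hw hh s
    rw [norm_mul, Real.norm_of_nonneg (Real.exp_pos _).le, Real.norm_eq_abs]
    have h3 := exp_le_two (hk.abs_le s)
    have := lagBound_nonneg h s
    nlinarith [Real.exp_pos (k s), abs_nonneg (lag greenDeriv h k w s)]
  have hcont : Continuous (lag greenDeriv h k w) := by
    have hu : HasUpperGradient (lag greenDeriv h k w) fun s => 4 * lagBound h s + 2 * |h s| :=
      ⟨((memLp_lagBound hh).const_mul 4).add (hh.norm.const_mul 2),
        fun s => by have := lagBound_nonneg h s; positivity,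
        fun x y hxy => upperGradient_lag_greenDeriv hk hw hh hxy⟩
    exact hu.continuous
  have hc : Continuous fun s => lag greenDeriv h k w s * Real.exp (k s) :=
    hcont.mul (Real.continuous_exp.comp hk.continuous)
  rw [← intervalIntegral.integral_eq_sub_of_hasDerivAt (fun s _ => hd s) (hc.intervalIntegrable _ _)]
  exact (intervalIntegral.norm_integral_le_integral_norm hxy).trans
    (intervalIntegral.integral_mono_on hxy (hc.norm.intervalIntegrable _ _)
      (((continuous_lagBound hh).const_mul 4).intervalIntegrable _ _) fun s _ => hb s)

end

/-! ### The characteristic flow -/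

/-- The characteristic system on the time interval `(-δ, δ)`: `x = ξ + ζ` are the characteristics,
`e^k` is their derivative in `ξ`, and `e^θ m`, `e^κ n` are the momenta times `e^k`. -/
structure LagFlow (b δ : ℝ) (m n : ℝ → ℝ) (ζ k θ κ : ℝ → ℝ → ℝ) : Prop where
  memLp_m : MemLp m 2
  memLp_n : MemLp n 2
  pos : 0 < δ
  small_ζ : ∀ t ∈ Set.Ioo (-δ) δ, IsSmall (ζ t)
  small_k : ∀ t ∈ Set.Ioo (-δ) δ, IsSmall (k t)
  small_θ : ∀ t ∈ Set.Ioo (-δ) δ, IsSmall (θ t)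
  small_κ : ∀ t ∈ Set.Ioo (-δ) δ, IsSmall (κ t)
  zero_ζ : ∀ ξ, ζ 0 ξ = 0
  zero_k : ∀ ξ, k 0 ξ = 0
  zero_θ : ∀ ξ, θ 0 ξ = 0
  zero_κ : ∀ ξ, κ 0 ξ = 0
  hasDerivAt_ζ : ∀ t ∈ Set.Ioo (-δ) δ, ∀ ξ, HasDerivAt (fun s => ζ s ξ)
    (lag green m (k t) (θ t) ξ * lag green n (k t) (κ t) ξ) t
  hasDerivAt_k : ∀ t ∈ Set.Ioo (-δ) δ, ∀ ξ, HasDerivAt (fun s => k s ξ)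
    (lag greenDeriv m (k t) (θ t) ξ * lag green n (k t) (κ t) ξ
      + lag green m (k t) (θ t) ξ * lag greenDeriv n (k t) (κ t) ξ) t
  hasDerivAt_θ : ∀ t ∈ Set.Ioo (-δ) δ, ∀ ξ, HasDerivAt (fun s => θ s ξ)
    ((1 - b) * (lag greenDeriv m (k t) (θ t) ξ * lag green n (k t) (κ t) ξ)
      + lag green m (k t) (θ t) ξ * lag greenDeriv n (k t) (κ t) ξ) t
  hasDerivAt_κ : ∀ t ∈ Set.Ioo (-δ) δ, ∀ ξ, HasDerivAt (fun s => κ s ξ)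
    (lag greenDeriv m (k t) (θ t) ξ * lag green n (k t) (κ t) ξ
      + (1 - b) * (lag green m (k t) (θ t) ξ * lag greenDeriv n (k t) (κ t) ξ)) t

theorem LagFlow.symm {b δ : ℝ} {m n : ℝ → ℝ} {ζ k θ κ : ℝ → ℝ → ℝ}
    (h : LagFlow b δ m n ζ k θ κ) : LagFlow b δ n m ζ k κ θ where
  memLp_m := h.memLp_n
  memLp_n := h.memLp_m
  pos := h.pos
  small_ζ := h.small_ζ
  small_k := h.small_k
  small_θ := h.small_κ
  small_κ := h.small_θ
  zero_ζ := h.zero_ζ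
  zero_k := h.zero_k
  zero_θ := h.zero_κ
  zero_κ := h.zero_θ
  hasDerivAt_ζ t ht ξ := by
    convert h.hasDerivAt_ζ t ht ξ using 1; ring
  hasDerivAt_k t ht ξ := by
    convert h.hasDerivAt_k t ht ξ using 1; ring
  hasDerivAt_θ t ht ξ := by
    convert h.hasDerivAt_κ t ht ξ using 1; ring
  hasDerivAt_κ t ht ξ := by
    convert h.hasDerivAt_θ t ht ξ using 1; ring

/-! ### The vector field of the characteristic system: bounds and Lipschitz estimates. -/

section

variable {m n k θ κ : ℝ → ℝ} {k' θ' κ' : ℝ → ℝ} {R : ℝ}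

/-- The quadratic expressions in the Lagrangian potentials which drive the characteristic system. -/
noncomputable def lagQuad (m n : ℝ → ℝ) (c : Fin 3 → ℝ) (k θ κ : ℝ → ℝ) (ξ : ℝ) : ℝ :=
  c 0 * (lag green m k θ ξ * lag green n k κ ξ) + c 1 * (lag greenDeriv m k θ ξ * lag green n k κ ξ)
    + c 2 * (lag green m k θ ξ * lag greenDeriv n k κ ξ)

theorem continuous_lag_green {h k w : ℝ → ℝ} (hk : IsSmall k) (hw : IsSmall w) (hh : MemLp h 2) :
    Continuous (lag green h k w) :=
  continuous_iff_continuousAt.2 fun x => (hasDerivAt_lag_green hk hw hh x).continuousAt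

theorem continuous_lag_greenDeriv {h k w : ℝ → ℝ} (hk : IsSmall k) (hw : IsSmall w)
    (hh : MemLp h 2) : Continuous (lag greenDeriv h k w) := by
  have hu : HasUpperGradient (lag greenDeriv h k w) fun s => 4 * lagBound h s + 2 * |h s| :=
    ⟨((memLp_lagBound hh).const_mul 4).add (hh.norm.const_mul 2),
      fun s => by have := lagBound_nonneg h s; positivity,
      fun x y hxy => upperGradient_lag_greenDeriv hk hw hh hxy⟩
  exact hu.continuous

theorem abs_mul_le_of_le {a b A B : ℝ} (ha : |a| ≤ A) (hb : |b| ≤ B) : |a * b| ≤ A * B := by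
  rw [abs_mul]
  exact mul_le_mul ha hb (abs_nonneg _) ((abs_nonneg _).trans ha)

theorem abs_mul_sub_mul_le {a a' b b' A ε : ℝ} (hb : |b| ≤ A) (ha' : |a'| ≤ A)
    (hab : |a - a'| ≤ ε) (hbb : |b - b'| ≤ ε) : |a * b - a' * b'| ≤ 2 * A * ε := by
  have e : a * b - a' * b' = (a - a') * b + a' * (b - b') := by ring
  rw [e]
  refine (abs_add_le _ _).trans ?_
  have h1 := abs_mul_le_of_le hab hb
  have h2 := abs_mul_le_of_le ha' hbb
  linarith

theorem abs_three_le (c : Fin 3 → ℝ) {x y z A : ℝ} (hx : |x| ≤ A) (hy : |y| ≤ A) (hz : |z| ≤ A) :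
    |c 0 * x + c 1 * y + c 2 * z| ≤ (|c 0| + |c 1| + |c 2|) * A := by
  have h0 := abs_mul_le_of_le (le_refl |c 0|) hx
  have h1 := abs_mul_le_of_le (le_refl |c 1|) hy
  have h2 := abs_mul_le_of_le (le_refl |c 2|) hz
  have := abs_add_three (c 0 * x) (c 1 * y) (c 2 * z)
  linarith

theorem continuous_lagQuad (hm : MemLp m 2) (hn : MemLp n 2) (hk : IsSmall k) (hθ : IsSmall θ)
    (hκ : IsSmall κ) (c : Fin 3 → ℝ) : Continuous (lagQuad m n c k θ κ) := by
  have h1 := continuous_lag_green hk hθ hm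
  have h2 := continuous_lag_green hk hκ hn
  have h3 := continuous_lag_greenDeriv hk hθ hm
  have h4 := continuous_lag_greenDeriv hk hκ hn
  unfold lagQuad
  exact ((continuous_const.mul (h1.mul h2)).add (continuous_const.mul (h3.mul h2))).add
    (continuous_const.mul (h1.mul h4))

theorem abs_lagQuad_le (hm : MemLp m 2) (hn : MemLp n 2) (hmR : l2norm m ≤ R) (hnR : l2norm n ≤ R)
    (hk : IsSmall k) (hθ : IsSmall θ) (hκ : IsSmall κ) (c : Fin 3 → ℝ) (ξ : ℝ) :
    |lagQuad m n c k θ κ ξ| ≤ (|c 0| + |c 1| + |c 2|) * ((10 * R) * (10 * R)) := by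
  have h1 := (isLagKernel_green.abs_lag_le hk hθ hm ξ).trans (by linarith : _ ≤ 10 * R)
  have h2 := (isLagKernel_green.abs_lag_le hk hκ hn ξ).trans (by linarith : _ ≤ 10 * R)
  have h3 := (isLagKernel_greenDeriv.abs_lag_le hk hθ hm ξ).trans (by linarith : _ ≤ 10 * R)
  have h4 := (isLagKernel_greenDeriv.abs_lag_le hk hκ hn ξ).trans (by linarith : _ ≤ 10 * R)
  exact abs_three_le c (abs_mul_le_of_le h1 h2) (abs_mul_le_of_le h3 h2) (abs_mul_le_of_le h1 h4)

theorem abs_lagQuad_sub_le (hm : MemLp m 2) (hn : MemLp n 2) (hmR : l2norm m ≤ R)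
    (hnR : l2norm n ≤ R) (hk : IsSmall k) (hθ : IsSmall θ) (hκ : IsSmall κ)
    (hk' : IsSmall k') (hθ' : IsSmall θ') (hκ' : IsSmall κ') {ε : ℝ}
    (h1 : ∀ x, |k x - k' x| ≤ ε) (h2 : ∀ x, |θ x - θ' x| ≤ ε) (h3 : ∀ x, |κ x - κ' x| ≤ ε)
    (c : Fin 3 → ℝ) (ξ : ℝ) :
    |lagQuad m n c k θ κ ξ - lagQuad m n c k' θ' κ' ξ| ≤
      (|c 0| + |c 1| + |c 2|) * (2 * (10 * R) * (90 * ε * R)) := by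
  have hε : 0 ≤ ε := (abs_nonneg _).trans (h1 0)
  have hmε : 90 * ε * l2norm m ≤ 90 * ε * R := by gcongr
  have hnε : 90 * ε * l2norm n ≤ 90 * ε * R := by gcongr
  have b2 := (isLagKernel_green.abs_lag_le hk hκ hn ξ).trans (by linarith : _ ≤ 10 * R)
  have b4 := (isLagKernel_greenDeriv.abs_lag_le hk hκ hn ξ).trans (by linarith : _ ≤ 10 * R)
  have b1' := (isLagKernel_green.abs_lag_le hk' hθ' hm ξ).trans (by linarith : _ ≤ 10 * R)
  have b3' := (isLagKernel_greenDeriv.abs_lag_le hk' hθ' hm ξ).trans (by linarith : _ ≤ 10 * R)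
  have d1 := (isLagKernel_green.abs_lag_sub_le hk hθ hk' hθ' hm h1 h2 ξ).trans hmε
  have d2 := (isLagKernel_green.abs_lag_sub_le hk hκ hk' hκ' hn h1 h3 ξ).trans hnε
  have d3 := (isLagKernel_greenDeriv.abs_lag_sub_le hk hθ hk' hθ' hm h1 h2 ξ).trans hmε
  have d4 := (isLagKernel_greenDeriv.abs_lag_sub_le hk hκ hk' hκ' hn h1 h3 ξ).trans hnε
  have e : lagQuad m n c k θ κ ξ - lagQuad m n c k' θ' κ' ξ =
      c 0 * (lag green m k θ ξ * lag green n k κ ξ - lag green m k' θ' ξ * lag green n k' κ' ξ)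
      + c 1 * (lag greenDeriv m k θ ξ * lag green n k κ ξ -
        lag greenDeriv m k' θ' ξ * lag green n k' κ' ξ)
      + c 2 * (lag green m k θ ξ * lag greenDeriv n k κ ξ -
        lag green m k' θ' ξ * lag greenDeriv n k' κ' ξ) := by unfold lagQuad; ring
  rw [e]
  exact abs_three_le c (abs_mul_sub_mul_le b2 b1' d1 d2) (abs_mul_sub_mul_le b2 b3' d3 d2)
    (abs_mul_sub_mul_le b4 b1' d1 d4)

end

open scoped BoundedContinuousFunction NNReal

open Classical in
/-- The bundled version of a bounded continuous function. -/
noncomputable def toBC (g : ℝ → ℝ) : ℝ →ᵇ ℝ :=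
  if h : Continuous g ∧ ∃ C, ∀ x, ‖g x‖ ≤ C then
    BoundedContinuousFunction.ofNormedAddCommGroup g h.1 h.2.choose h.2.choose_spec
  else 0

theorem coe_toBC {g : ℝ → ℝ} (hg : Continuous g) {C : ℝ} (hC : ∀ x, |g x| ≤ C) : ⇑(toBC g) = g := by
  rw [toBC, dif_pos ⟨hg, C, hC⟩]; rfl

theorem isSmall_of_norm_le {f : ℝ →ᵇ ℝ} (h : ‖f‖ ≤ 1 / 2) : IsSmall f :=
  ⟨f.continuous, fun x => (f.norm_coe_le_norm x).trans h⟩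

/-- The state space of the characteristic system. -/
abbrev LagState : Type := (ℝ →ᵇ ℝ) × (ℝ →ᵇ ℝ) × (ℝ →ᵇ ℝ) × (ℝ →ᵇ ℝ)

/-- The vector field of the characteristic system, on states of norm at most `1/2`. -/
noncomputable def lagField (b : ℝ) (m n : ℝ → ℝ) (z : LagState) : LagState :=
  (toBC (lagQuad m n ![1, 0, 0] z.2.1 z.2.2.1 z.2.2.2),
    toBC (lagQuad m n ![0, 1, 1] z.2.1 z.2.2.1 z.2.2.2),
    toBC (lagQuad m n ![0, 1 - b, 1] z.2.1 z.2.2.1 z.2.2.2),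
    toBC (lagQuad m n ![0, 1, 1 - b] z.2.1 z.2.2.1 z.2.2.2))

theorem norm_le_of_state {z : LagState} {r : ℝ} (h : ‖z‖ ≤ r) :
    ‖z.1‖ ≤ r ∧ ‖z.2.1‖ ≤ r ∧ ‖z.2.2.1‖ ≤ r ∧ ‖z.2.2.2‖ ≤ r :=
  ⟨(norm_fst_le z).trans h, (norm_fst_le z.2).trans ((norm_snd_le z).trans h),
    (norm_fst_le z.2.2).trans ((norm_snd_le z.2).trans ((norm_snd_le z).trans h)),
    (norm_snd_le z.2.2).trans ((norm_snd_le z.2).trans ((norm_snd_le z).trans h))⟩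

theorem norm_state_le {z : LagState} {r : ℝ} (h1 : ‖z.1‖ ≤ r) (h2 : ‖z.2.1‖ ≤ r)
    (h3 : ‖z.2.2.1‖ ≤ r) (h4 : ‖z.2.2.2‖ ≤ r) : ‖z‖ ≤ r :=
  norm_prod_le_iff.2 ⟨h1, norm_prod_le_iff.2 ⟨h2, norm_prod_le_iff.2 ⟨h3, h4⟩⟩⟩

section

variable {m n : ℝ → ℝ} {R b : ℝ} {z z' : LagState}

theorem coe_toBC_lagQuad (hm : MemLp m 2) (hn : MemLp n 2) (hz : ‖z‖ ≤ 1 / 2) (c : Fin 3 → ℝ) :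
    ⇑(toBC (lagQuad m n c z.2.1 z.2.2.1 z.2.2.2)) = lagQuad m n c z.2.1 z.2.2.1 z.2.2.2 := by
  obtain ⟨-, h2, h3, h4⟩ := norm_le_of_state hz
  exact coe_toBC (continuous_lagQuad hm hn (isSmall_of_norm_le h2) (isSmall_of_norm_le h3)
    (isSmall_of_norm_le h4) c) (abs_lagQuad_le hm hn (le_max_left _ (l2norm n)) (le_max_right _ _)
      (isSmall_of_norm_le h2) (isSmall_of_norm_le h3) (isSmall_of_norm_le h4) c)

theorem norm_toBC_lagQuad_le (hm : MemLp m 2) (hn : MemLp n 2) (hmR : l2norm m ≤ R)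
    (hnR : l2norm n ≤ R) (hz : ‖z‖ ≤ 1 / 2) (c : Fin 3 → ℝ) {C : ℝ}
    (hc : |c 0| + |c 1| + |c 2| ≤ C) :
    ‖toBC (lagQuad m n c z.2.1 z.2.2.1 z.2.2.2)‖ ≤ C * (100 * R ^ 2) := by
  obtain ⟨-, h2, h3, h4⟩ := norm_le_of_state hz
  have hC : 0 ≤ C := le_trans (by positivity) hc
  rw [BoundedContinuousFunction.norm_le (by positivity), coe_toBC_lagQuad hm hn hz]
  intro x
  refine (abs_lagQuad_le hm hn hmR hnR (isSmall_of_norm_le h2) (isSmall_of_norm_le h3)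
    (isSmall_of_norm_le h4) c x).trans ?_
  rw [show (10 * R) * (10 * R) = 100 * R ^ 2 by ring]
  gcongr

theorem norm_toBC_lagQuad_sub_le (hm : MemLp m 2) (hn : MemLp n 2) (hmR : l2norm m ≤ R)
    (hnR : l2norm n ≤ R) (hz : ‖z‖ ≤ 1 / 2) (hz' : ‖z'‖ ≤ 1 / 2) (c : Fin 3 → ℝ) {C : ℝ}
    (hc : |c 0| + |c 1| + |c 2| ≤ C) :
    ‖toBC (lagQuad m n c z.2.1 z.2.2.1 z.2.2.2) - toBC (lagQuad m n c z'.2.1 z'.2.2.1 z'.2.2.2)‖ ≤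
      C * (1800 * R ^ 2) * ‖z - z'‖ := by
  obtain ⟨-, h2, h3, h4⟩ := norm_le_of_state hz
  obtain ⟨-, h2', h3', h4'⟩ := norm_le_of_state hz'
  obtain ⟨-, e2, e3, e4⟩ := norm_le_of_state (le_refl ‖z - z'‖)
  have hC : 0 ≤ C := le_trans (by positivity) hc
  rw [BoundedContinuousFunction.norm_le (by positivity), BoundedContinuousFunction.coe_sub,
    coe_toBC_lagQuad hm hn hz, coe_toBC_lagQuad hm hn hz']
  intro x
  have hd : ∀ {f g : ℝ →ᵇ ℝ}, ‖f - g‖ ≤ ‖z - z'‖ → ∀ x, |f x - g x| ≤ ‖z - z'‖ := fun {f g} h x =>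
    ((f - g).norm_coe_le_norm x).trans h
  refine (abs_lagQuad_sub_le hm hn hmR hnR (isSmall_of_norm_le h2) (isSmall_of_norm_le h3)
    (isSmall_of_norm_le h4) (isSmall_of_norm_le h2') (isSmall_of_norm_le h3')
    (isSmall_of_norm_le h4') (hd e2) (hd e3) (hd e4) c x).trans ?_
  rw [show 2 * (10 * R) * (90 * ‖z - z'‖ * R) = 1800 * R ^ 2 * ‖z - z'‖ by ring, mul_assoc C]
  gcongr

theorem norm_lagField_le (hm : MemLp m 2) (hn : MemLp n 2) (hmR : l2norm m ≤ R)
    (hnR : l2norm n ≤ R) (hz : ‖z‖ ≤ 1 / 2) :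
    ‖lagField b m n z‖ ≤ (2 + |b|) * (100 * R ^ 2) := by
  have hb := abs_nonneg b
  have hb' : |1 - b| ≤ 1 + |b| := (abs_sub _ _).trans (by simp)
  refine norm_state_le ?_ ?_ ?_ ?_ <;>
  · refine norm_toBC_lagQuad_le hm hn hmR hnR hz _ ?_
    simp
    try linarith

theorem norm_lagField_sub_le (hm : MemLp m 2) (hn : MemLp n 2) (hmR : l2norm m ≤ R)
    (hnR : l2norm n ≤ R) (hz : ‖z‖ ≤ 1 / 2) (hz' : ‖z'‖ ≤ 1 / 2) :
    ‖lagField b m n z - lagField b m n z'‖ ≤ (2 + |b|) * (1800 * R ^ 2) * ‖z - z'‖ := by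
  have hb := abs_nonneg b
  have hb' : |1 - b| ≤ 1 + |b| := (abs_sub _ _).trans (by simp)
  refine norm_state_le ?_ ?_ ?_ ?_ <;>
  · refine norm_toBC_lagQuad_sub_le hm hn hmR hnR hz hz' _ ?_
    simp
    try linarith

end

/-- Short time existence for the characteristic system, uniformly on bounded sets of `L²`. -/
theorem exists_lagFlow (b R : ℝ) : ∃ δ > 0, ∀ m n : ℝ → ℝ, MemLp m 2 → MemLp n 2 →
    l2norm m ≤ R → l2norm n ≤ R → ∃ ζ k θ κ : ℝ → ℝ → ℝ, LagFlow b δ m n ζ k θ κ := by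
  set B : ℝ := (2 + |b|) * (100 * R ^ 2) with hB
  have hB0 : 0 ≤ B := by positivity
  -- A speed of at most `B` during a time `δ` moves the state by at most `1/2`. As `B` depends only
  -- on `b` and `R`, so does the lifespan.
  set δ : ℝ := 1 / (2 * (B + 1)) with hδ
  have hδ0 : 0 < δ := by positivity
  have hBδ : B * δ ≤ 1 / 2 := by
    rw [hδ, mul_one_div, div_le_div_iff₀ (by positivity) (by norm_num)]; linarith
  refine ⟨δ, hδ0, fun m n hm hn hmR hnR => ?_⟩
  classical
  -- Setting the field to zero outside the ball makes it bounded everywhere. The bound then confines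
  -- the solution to the ball of radius `1/2`, where the truncation is inactive.
  set F : LagState → LagState := fun z => if ‖z‖ ≤ 1 / 2 then lagField b m n z else 0 with hF
  have hF1 : ∀ z, ‖F z‖ ≤ B := by
    intro z
    simp only [hF]
    split_ifs with h
    · exact norm_lagField_le hm hn hmR hnR h
    · simpa using hB0
  set K : ℝ≥0 := ⟨(2 + |b|) * (1800 * R ^ 2), by positivity⟩
  have hF2 : LipschitzOnWith K F (Metric.closedBall 0 ((1 / 2 : ℝ≥0) : ℝ)) := by
    refine LipschitzOnWith.of_dist_le_mul fun z hz z' hz' => ?_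
    have hz1 : ‖z‖ ≤ 1 / 2 := by simpa using hz
    have hz2 : ‖z'‖ ≤ 1 / 2 := by simpa using hz'
    rw [dist_eq_norm, dist_eq_norm]
    simp only [hF, if_pos hz1, if_pos hz2]
    exact norm_lagField_sub_le hm hn hmR hnR hz1 hz2
  have h0 : (0 : ℝ) ∈ Set.Icc (-δ) δ := ⟨by linarith, hδ0.le⟩
  have hP : IsPicardLindelof (fun _ => F) (⟨0, h0⟩ : Set.Icc (-δ) δ) (0 : LagState)
      (1 / 2 : ℝ≥0) 0 ⟨B, hB0⟩ K := by
    refine IsPicardLindelof.of_time_independent (fun z _ => hF1 z) hF2 ?_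
    simp only [sub_zero, zero_sub, neg_neg, max_self]
    have h2 : B * δ ≤ ((1 / 2 : ℝ≥0) : ℝ) := by simpa using hBδ
    exact h2.trans (by simp)
  obtain ⟨α, hα0, hα⟩ := hP.exists_eq_forall_mem_Icc_hasDerivWithinAt₀
  simp only at hα0
  have hsmall : ∀ t ∈ Set.Icc (-δ) δ, ‖α t‖ ≤ 1 / 2 := by
    intro t ht
    have h1 := (convex_Icc (-δ) δ).norm_image_sub_le_of_norm_hasDerivWithin_le hα
      (fun x _ => hF1 _) h0 ht
    rw [hα0, sub_zero, sub_zero] at h1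
    refine h1.trans (le_trans ?_ hBδ)
    gcongr
    exact abs_le.2 ht
  have hd : ∀ t ∈ Set.Ioo (-δ) δ, HasDerivAt α (lagField b m n (α t)) t := by
    intro t ht
    have := (hα t (Set.Ioo_subset_Icc_self ht)).hasDerivAt (Icc_mem_nhds ht.1 ht.2)
    simpa only [hF, if_pos (hsmall t (Set.Ioo_subset_Icc_self ht))] using this
  have hs := fun t (ht : t ∈ Set.Ioo (-δ) δ) =>
    norm_le_of_state (hsmall t (Set.Ioo_subset_Icc_self ht))
  have ev : ∀ (f : ℝ → ℝ →ᵇ ℝ) (c : Fin 3 → ℝ) (t : ℝ), t ∈ Set.Ioo (-δ) δ →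
      HasDerivAt f (toBC (lagQuad m n c (α t).2.1 (α t).2.2.1 (α t).2.2.2)) t → ∀ ξ,
      HasDerivAt (fun s => f s ξ) (lagQuad m n c (α t).2.1 (α t).2.2.1 (α t).2.2.2 ξ) t := by
    intro f c t ht h ξ
    have := (BoundedContinuousFunction.evalCLM ℝ ξ).hasFDerivAt.comp_hasDerivAt t h
    simp only [BoundedContinuousFunction.evalCLM_apply,
      coe_toBC_lagQuad hm hn (hsmall t (Set.Ioo_subset_Icc_self ht))] at this
    exact this
  refine ⟨fun t => (α t).1, fun t => (α t).2.1, fun t => (α t).2.2.1, fun t => (α t).2.2.2,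
    hm, hn, hδ0, fun t ht => isSmall_of_norm_le (hs t ht).1,
    fun t ht => isSmall_of_norm_le (hs t ht).2.1, fun t ht => isSmall_of_norm_le (hs t ht).2.2.1,
    fun t ht => isSmall_of_norm_le (hs t ht).2.2.2, fun ξ => by simp [hα0], fun ξ => by simp [hα0],
    fun ξ => by simp [hα0], fun ξ => by simp [hα0], fun t ht ξ => ?_, fun t ht ξ => ?_,
    fun t ht ξ => ?_, fun t ht ξ => ?_⟩
  · convert ev _ _ t ht (hd t ht).fst ξ using 1
    simp [lagQuad]
  · convert ev _ _ t ht (hd t ht).snd.fst ξ using 1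
    simp [lagQuad]
  · convert ev _ _ t ht (hd t ht).snd.snd.fst ξ using 1
    simp [lagQuad]
  · convert ev _ _ t ht (hd t ht).snd.snd.snd ξ using 1
    simp [lagQuad]

/-! ### Regularity of the characteristic flow -/

/-- An upper gradient for the coefficients of the characteristic system. -/
noncomputable def lagGrad (m n : ℝ → ℝ) (s : ℝ) : ℝ :=
  (4 * lagBound m s + 2 * |m s|) + (4 * lagBound n s + 2 * |n s|)

section

variable {m n k θ κ : ℝ → ℝ} {R : ℝ}

theorem lagGrad_nonneg (m n : ℝ → ℝ) (s : ℝ) : 0 ≤ lagGrad m n s := by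
  have := lagBound_nonneg m s
  have := lagBound_nonneg n s
  unfold lagGrad; positivity

theorem memLp_four_lagBound {h : ℝ → ℝ} (hh : MemLp h 2) :
    MemLp (fun s => 4 * lagBound h s + 2 * |h s|) 2 :=
  ((memLp_lagBound hh).const_mul 4).add (hh.norm.const_mul 2)

theorem memLp_lagGrad (hm : MemLp m 2) (hn : MemLp n 2) : MemLp (lagGrad m n) 2 :=
  (memLp_four_lagBound hm).add (memLp_four_lagBound hn)

theorem hasUpperGradient_lagQuad (hm : MemLp m 2) (hn : MemLp n 2) (hmR : l2norm m ≤ R)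
    (hnR : l2norm n ≤ R) (hk : IsSmall k) (hθ : IsSmall θ) (hκ : IsSmall κ) (c : Fin 3 → ℝ) :
    HasUpperGradient (lagQuad m n c k θ κ)
      fun s => (|c 0| + |c 1| + |c 2|) * (10 * R) * lagGrad m n s := by
  have hR : 0 ≤ R := (l2norm_nonneg m).trans hmR
  refine ⟨(memLp_lagGrad hm hn).const_mul _, fun x => mul_nonneg (by positivity)
    (lagGrad_nonneg m n x), fun x y hxy => ?_⟩
  have b2 := fun ξ => (isLagKernel_green.abs_lag_le hk hκ hn ξ).trans (by linarith : _ ≤ 10 * R)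
  have b4 := fun ξ => (isLagKernel_greenDeriv.abs_lag_le hk hκ hn ξ).trans
    (by linarith : _ ≤ 10 * R)
  have b1 := fun ξ => (isLagKernel_green.abs_lag_le hk hθ hm ξ).trans (by linarith : _ ≤ 10 * R)
  have b3 := fun ξ => (isLagKernel_greenDeriv.abs_lag_le hk hθ hm ξ).trans
    (by linarith : _ ≤ 10 * R)
  have im := (memLp_four_lagBound hm).intervalIntegrable_of_two x y
  have in' := (memLp_four_lagBound hn).intervalIntegrable_of_two x y
  have mono : ∀ {h : ℝ → ℝ}, MemLp h 2 → ∫ s in x..y, 4 * lagBound h s ≤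
      ∫ s in x..y, (4 * lagBound h s + 2 * |h s|) := fun {h} hh =>
    intervalIntegral.integral_mono_on hxy
      (((memLp_lagBound hh).const_mul 4).intervalIntegrable_of_two x y)
      ((memLp_four_lagBound hh).intervalIntegrable_of_two x y) fun s _ => by
        have := abs_nonneg (h s); linarith
  have g1 := (upperGradient_lag_green hk hθ hm hxy).trans (mono hm)
  have g2 := (upperGradient_lag_green hk hκ hn hxy).trans (mono hn)
  have g3 := upperGradient_lag_greenDeriv hk hθ hm hxy
  have g4 := upperGradient_lag_greenDeriv hk hκ hn hxy
  have e : ∫ s in x..y, (|c 0| + |c 1| + |c 2|) * (10 * R) * lagGrad m n s =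
      (|c 0| + |c 1| + |c 2|) * (10 * R * ((∫ s in x..y, (4 * lagBound m s + 2 * |m s|)) +
        ∫ s in x..y, (4 * lagBound n s + 2 * |n s|))) := by
    rw [intervalIntegral.integral_const_mul, ← intervalIntegral.integral_add im in', mul_assoc]
    rfl
  have prod : ∀ {a a' b b' α β : ℝ}, |b| ≤ 10 * R → |a'| ≤ 10 * R → |a - a'| ≤ α → |b - b'| ≤ β →
      |a * b - a' * b'| ≤ 10 * R * (α + β) := by
    intro a a' b b' α β hb ha' h1 h2
    have e : a * b - a' * b' = (a - a') * b + a' * (b - b') := by ring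
    rw [e]
    refine (abs_add_le _ _).trans ?_
    have h1 := abs_mul_le_of_le h1 hb
    have h2 := abs_mul_le_of_le ha' h2
    linarith
  rw [e, Real.norm_eq_abs]
  have := abs_three_le c (prod (b2 y) (b1 x) g1 g2) (prod (b2 y) (b3 x) g3 g2)
    (prod (b4 y) (b1 x) g1 g4)
  refine le_trans (le_of_eq ?_) this
  congr 1
  unfold lagQuad
  ring

end

namespace LagFlow

variable {b δ : ℝ} {m n : ℝ → ℝ} {ζ k θ κ : ℝ → ℝ → ℝ}

theorem quad_ζ (h : LagFlow b δ m n ζ k θ κ) : ∀ t ∈ Set.Ioo (-δ) δ, ∀ ξ,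
    HasDerivAt (fun s => ζ s ξ) (lagQuad m n ![1, 0, 0] (k t) (θ t) (κ t) ξ) t := fun t ht ξ => by
  convert h.hasDerivAt_ζ t ht ξ using 1
  simp [lagQuad]

theorem quad_k (h : LagFlow b δ m n ζ k θ κ) : ∀ t ∈ Set.Ioo (-δ) δ, ∀ ξ,
    HasDerivAt (fun s => k s ξ) (lagQuad m n ![0, 1, 1] (k t) (θ t) (κ t) ξ) t := fun t ht ξ => by
  convert h.hasDerivAt_k t ht ξ using 1
  simp [lagQuad]

theorem quad_θ (h : LagFlow b δ m n ζ k θ κ) : ∀ t ∈ Set.Ioo (-δ) δ, ∀ ξ,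
    HasDerivAt (fun s => θ s ξ) (lagQuad m n ![0, 1 - b, 1] (k t) (θ t) (κ t) ξ) t :=
  fun t ht ξ => by
  convert h.hasDerivAt_θ t ht ξ using 1
  simp [lagQuad]

theorem zero_mem (h : LagFlow b δ m n ζ k θ κ) : (0 : ℝ) ∈ Set.Ioo (-δ) δ :=
  ⟨by linarith [h.pos], h.pos⟩

theorem exists_lipschitz (h : LagFlow b δ m n ζ k θ κ) {f : ℝ → ℝ → ℝ} {c : Fin 3 → ℝ}
    (hf : ∀ t ∈ Set.Ioo (-δ) δ, ∀ ξ,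
      HasDerivAt (fun s => f s ξ) (lagQuad m n c (k t) (θ t) (κ t) ξ) t) :
    ∃ C, 0 ≤ C ∧ ∀ s ∈ Set.Ioo (-δ) δ, ∀ t ∈ Set.Ioo (-δ) δ, ∀ ξ,
      |f t ξ - f s ξ| ≤ C * |t - s| := by
  refine ⟨(|c 0| + |c 1| + |c 2|) * ((10 * max (l2norm m) (l2norm n)) *
    (10 * max (l2norm m) (l2norm n))), ?_, fun s hs t ht ξ => ?_⟩
  · have : 0 ≤ max (l2norm m) (l2norm n) := le_max_of_le_left (l2norm_nonneg m)
    positivity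
  · exact (convex_Ioo (-δ) δ).norm_image_sub_le_of_norm_hasDerivWithin_le
      (fun r hr => (hf r hr ξ).hasDerivWithinAt)
      (fun r hr => abs_lagQuad_le h.memLp_m h.memLp_n (le_max_left _ _) (le_max_right _ _)
        (h.small_k r hr) (h.small_θ r hr) (h.small_κ r hr) c ξ) hs ht

/-- The mean value inequality in time is applied to the increment `f(·, y) - f(·, x)`, which starts
at zero. Since the gradient of the right-hand side is bounded independently of time, a single `ρ`
works for all `t`. -/
theorem exists_upperGradient (h : LagFlow b δ m n ζ k θ κ) {f : ℝ → ℝ → ℝ} {c : Fin 3 → ℝ}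
    (hf : ∀ t ∈ Set.Ioo (-δ) δ, ∀ ξ,
      HasDerivAt (fun s => f s ξ) (lagQuad m n c (k t) (θ t) (κ t) ξ) t)
    (h0 : ∀ ξ, f 0 ξ = 0) :
    ∃ ρ, ∀ t ∈ Set.Ioo (-δ) δ, HasUpperGradient (f t) ρ := by
  have hq := fun r (hr : r ∈ Set.Ioo (-δ) δ) => hasUpperGradient_lagQuad h.memLp_m h.memLp_n
    (le_max_left _ (l2norm n)) (le_max_right (l2norm m) _)
    (h.small_k r hr) (h.small_θ r hr) (h.small_κ r hr) c
  refine ⟨fun s => δ * ((|c 0| + |c 1| + |c 2|) * (10 * max (l2norm m) (l2norm n)) *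
    lagGrad m n s), fun t ht => ⟨(hq t ht).memLp.const_mul δ, fun x => mul_nonneg h.pos.le
      ((hq t ht).nonneg x), fun x y hxy => ?_⟩⟩
  have := (convex_Ioo (-δ) δ).norm_image_sub_le_of_norm_hasDerivWithin_le
    (f := fun r => f r y - f r x)
    (fun r hr => ((hf r hr y).sub (hf r hr x)).hasDerivWithinAt)
    (fun r hr => (hq r hr).norm_sub_le x y hxy) h.zero_mem ht
  simp only [h0, sub_zero] at this
  refine this.trans ?_
  rw [intervalIntegral.integral_const_mul δ, mul_comm]
  refine mul_le_mul_of_nonneg_right (abs_lt.2 ht).le ?_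
  exact intervalIntegral.integral_nonneg hxy fun s _ => (hq t ht).nonneg s

/-- The characteristic map at time `t` has derivative `e^k`. -/
theorem expDist_eq (h : LagFlow b δ m n ζ k θ κ) {t : ℝ} (ht : t ∈ Set.Ioo (-δ) δ) (x y : ℝ) :
    expDist (k t) x y = (y + ζ t y) - (x + ζ t x) := by
  -- In the system `k` is an unknown of its own. Both sides have the same time derivative, because
  -- `e^k ((u v)_x ∘ X)` is the `ξ`-derivative of `(u v) ∘ X`, and they agree at time zero.
  have key : ∀ r ∈ Set.Ioo (-δ) δ,
      HasDerivAt (fun r => expDist (k r) x y - ((y + ζ r y) - (x + ζ r x))) 0 r := by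
    intro r hr
    have h1 : HasDerivAt (fun r => expDist (k r) x y)
        (∫ s in x..y, Real.exp (k r s) * lagQuad m n ![0, 1, 1] (k r) (θ r) (κ r) s) r := by
      have hb := fun q (hq : q ∈ Set.Ioo (-δ) δ) s => abs_lagQuad_le h.memLp_m h.memLp_n
        (le_max_left _ (l2norm n)) (le_max_right (l2norm m) _)
        (h.small_k q hq) (h.small_θ q hq) (h.small_κ q hq) ![0, 1, 1] s
      have hcont := fun q (hq : q ∈ Set.Ioo (-δ) δ) => continuous_lagQuad h.memLp_m h.memLp_n
        (h.small_k q hq) (h.small_θ q hq) (h.small_κ q hq) ![0, 1, 1]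
      have hcont' := fun q (hq : q ∈ Set.Ioo (-δ) δ) =>
        Real.continuous_exp.comp (h.small_k q hq).continuous
      refine (intervalIntegral.hasDerivAt_integral_of_dominated_loc_of_deriv_le
        (F := fun r s => Real.exp (k r s))
        (F' := fun r s => Real.exp (k r s) * lagQuad m n ![0, 1, 1] (k r) (θ r) (κ r) s)
        (bound := fun _ => 2 * ((|(![0, 1, 1] : Fin 3 → ℝ) 0| + |(![0, 1, 1] : Fin 3 → ℝ) 1| +
          |(![0, 1, 1] : Fin 3 → ℝ) 2|) * (10 * max (l2norm m) (l2norm n) *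
            (10 * max (l2norm m) (l2norm n))))) (isOpen_Ioo.mem_nhds hr) ?_ ?_ ?_ ?_
        intervalIntegrable_const ?_).2
      · filter_upwards [isOpen_Ioo.mem_nhds hr] with q hq
        exact (hcont' q hq).aestronglyMeasurable
      · exact (hcont' r hr).intervalIntegrable _ _
      · exact ((hcont' r hr).mul (hcont r hr)).aestronglyMeasurable
      · refine ae_of_all _ fun s _ q hq => ?_
        rw [norm_mul, Real.norm_of_nonneg (Real.exp_pos _).le]
        exact mul_le_mul (exp_le_two ((h.small_k q hq).abs_le s)) (hb q hq s) (abs_nonneg _)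
          (by norm_num)
      · exact ae_of_all _ fun s _ q hq => (h.quad_k q hq s).exp
    have h2 : ∫ s in x..y, Real.exp (k r s) * lagQuad m n ![0, 1, 1] (k r) (θ r) (κ r) s =
        lagQuad m n ![1, 0, 0] (k r) (θ r) (κ r) y - lagQuad m n ![1, 0, 0] (k r) (θ r) (κ r) x := by
      have hk := h.small_k r hr
      refine intervalIntegral.integral_eq_sub_of_hasDerivAt (fun s _ => ?_)
        (((Real.continuous_exp.comp hk.continuous).mul (continuous_lagQuad h.memLp_m h.memLp_n
        hk (h.small_θ r hr) (h.small_κ r hr) ![0, 1, 1])).intervalIntegrable _ _)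
      have := (hasDerivAt_lag_green hk (h.small_θ r hr) h.memLp_m s).mul
        (hasDerivAt_lag_green hk (h.small_κ r hr) h.memLp_n s)
      have e : lagQuad m n ![1, 0, 0] (k r) (θ r) (κ r) =
          lag green m (k r) (θ r) * lag green n (k r) (κ r) := by funext z; simp [lagQuad]
      rw [e]
      refine this.congr_deriv ?_
      simp [lagQuad]; ring
    rw [h2] at h1
    exact (h1.sub (((h.quad_ζ r hr y).const_add y).sub ((h.quad_ζ r hr x).const_add x))).congr_deriv
      (sub_self _)
  have hconst := (convex_Ioo (-δ) δ).is_const_of_fderivWithin_eq_zero (𝕜 := ℝ)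
    (f := fun r => expDist (k r) x y - ((y + ζ r y) - (x + ζ r x)))
    (fun r hr => (key r hr).differentiableAt.differentiableWithinAt)
    (fun r hr => by
      rw [((key r hr).hasFDerivAt.hasFDerivWithinAt).fderivWithin
        (isOpen_Ioo.uniqueDiffWithinAt hr)]
      ext; simp) ht h.zero_mem
  simp only [h.zero_ζ, expDist, h.zero_k, Real.exp_zero, intervalIntegral.integral_const,
    smul_eq_mul, mul_one, add_zero, sub_self] at hconst
  exact sub_eq_zero.1 hconst

/-- The characteristic map at time `t` and its inverse. -/
noncomputable def inverse (ζ : ℝ → ℝ → ℝ) (t : ℝ) : ℝ → ℝ :=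
  Function.invFun fun ξ => ξ + ζ t ξ

theorem isDiffeo (h : LagFlow b δ m n ζ k θ κ) {t : ℝ} (ht : t ∈ Set.Ioo (-δ) δ) :
    IsDiffeo (fun ξ => ξ + ζ t ξ) (inverse ζ t) fun ξ => Real.exp (k t ξ) := by
  have hk := h.small_k t ht
  have hd : ∀ x, HasDerivAt (fun ξ => ξ + ζ t ξ) (Real.exp (k t x)) x := by
    intro x
    have hc := Real.continuous_exp.comp hk.continuous
    have h1 := intervalIntegral.integral_hasDerivAt_right (hc.intervalIntegrable 0 x)
      (hc.stronglyMeasurableAtFilter _ _) hc.continuousAt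
    have e : (fun ξ => ξ + ζ t ξ) = fun ξ => (∫ r in (0 : ℝ)..ξ, Real.exp (k t r)) + ζ t 0 := by
      funext ξ
      have := h.expDist_eq ht 0 ξ
      rw [expDist] at this
      rw [this]; ring
    rw [e]
    exact h1.add_const _
  obtain ⟨Y, hY⟩ := hk.exists_inverse hd
  refine hk.isDiffeo hd (Function.leftInverse_invFun hY.injective) ?_
  have hs : Function.Surjective fun ξ => ξ + ζ t ξ := fun y => ⟨Y y, hY.right_inv y⟩
  exact Function.rightInverse_invFun hs

end LagFlow

theorem HasUpperGradient.sub {f g ρ σ : ℝ → ℝ} (hf : HasUpperGradient f ρ)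
    (hg : HasUpperGradient g σ) :
    HasUpperGradient (fun x => f x - g x) (fun x => ρ x + σ x) := by
  refine ⟨hf.memLp.add hg.memLp, fun x => add_nonneg (hf.nonneg x) (hg.nonneg x),
    fun x y hxy => ?_⟩
  rw [intervalIntegral.integral_add (hf.memLp.intervalIntegrable_of_two _ _)
    (hg.memLp.intervalIntegrable_of_two _ _)]
  have e : f y - g y - (f x - g x) = (f y - f x) - (g y - g x) := by ring
  rw [e]
  exact (_root_.norm_sub_le _ _).trans (add_le_add (hf.norm_sub_le x y hxy) (hg.norm_sub_le x y hxy))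

theorem HasUpperGradient.exp {f ρ : ℝ → ℝ} (hf : HasUpperGradient f ρ) (h : ∀ x, |f x| ≤ 1) :
    HasUpperGradient (fun x => Real.exp (f x)) (fun x => 3 * ρ x) := by
  refine ⟨hf.memLp.const_mul 3, fun x => mul_nonneg (by norm_num) (hf.nonneg x),
    fun x y hxy => ?_⟩
  rw [intervalIntegral.integral_const_mul]
  have h1 := abs_exp_sub_exp_le (abs_le.1 (h y)).2 (abs_le.1 (h x)).2
  have h2 := hf.norm_sub_le x y hxy
  have h3 := Real.exp_one_lt_d9
  rw [Real.norm_eq_abs] at h2 ⊢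
  nlinarith [abs_nonneg (f y - f x)]

/-! ### The momentum transported by the characteristic flow -/

/-- The momentum at time `t` in Eulerian coordinates. -/
noncomputable def lagMom (m : ℝ → ℝ) (ζ k θ : ℝ → ℝ → ℝ) (t : ℝ) : ℝ → ℝ :=
  pushMom m (k t) (θ t) (LagFlow.inverse ζ t)

namespace LagFlow

variable {b δ : ℝ} {m n : ℝ → ℝ} {ζ k θ κ : ℝ → ℝ → ℝ} {s t : ℝ}

theorem memLp_lagMom (h : LagFlow b δ m n ζ k θ κ) (ht : t ∈ Set.Ioo (-δ) δ) :
    MemLp (lagMom m ζ k θ t) 2 :=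
  memLp_pushMom (h.isDiffeo ht) (h.small_k t ht) (h.small_θ t ht) h.memLp_m

theorem inverse_add (h : LagFlow b δ m n ζ k θ κ) (ht : t ∈ Set.Ioo (-δ) δ) (y : ℝ) :
    inverse ζ t y + ζ t (inverse ζ t y) = y := (h.isDiffeo ht).right_inv y

theorem inverse_zero (h : LagFlow b δ m n ζ k θ κ) (y : ℝ) : inverse ζ 0 y = y := by
  have := h.inverse_add h.zero_mem y
  rwa [h.zero_ζ, add_zero] at this

theorem lagMom_zero (h : LagFlow b δ m n ζ k θ κ) : lagMom m ζ k θ 0 = m := by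
  funext y
  rw [lagMom, pushMom, h.inverse_zero, h.zero_θ, h.zero_k, sub_zero, Real.exp_zero, one_mul]

theorem abs_inverse_sub_le (h : LagFlow b δ m n ζ k θ κ) (ht : t ∈ Set.Ioo (-δ) δ) (y : ℝ) :
    |inverse ζ t y - y| ≤ 1 / 2 := by
  have h1 := h.inverse_add ht y
  have h2 := (h.small_ζ t ht).abs_le (inverse ζ t y)
  rw [abs_sub_comm]
  rwa [show y - inverse ζ t y = ζ t (inverse ζ t y) by linarith]

theorem abs_inverse_sub_inverse_le (h : LagFlow b δ m n ζ k θ κ) {C : ℝ}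
    (hC : ∀ s ∈ Set.Ioo (-δ) δ, ∀ t ∈ Set.Ioo (-δ) δ, ∀ ξ, |ζ t ξ - ζ s ξ| ≤ C * |t - s|)
    (hs : s ∈ Set.Ioo (-δ) δ) (ht : t ∈ Set.Ioo (-δ) δ) (y : ℝ) :
    |inverse ζ t y - inverse ζ s y| ≤ 2 * C * |t - s| := by
  have h1 := (h.small_k s hs).le_abs_expDist (inverse ζ s y) (inverse ζ t y)
  rw [h.expDist_eq hs, h.inverse_add hs] at h1
  have h2 := h.inverse_add ht y
  have h3 := hC t ht s hs (inverse ζ t y)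
  rw [abs_sub_comm s] at h3
  rw [show inverse ζ t y + ζ s (inverse ζ t y) - y =
    ζ s (inverse ζ t y) - ζ t (inverse ζ t y) by linarith] at h1
  linarith

theorem tendsto_inverse (h : LagFlow b δ m n ζ k θ κ) (ht : t ∈ Set.Ioo (-δ) δ) (y : ℝ) :
    Tendsto (fun s => inverse ζ s y) (𝓝 t) (𝓝 (inverse ζ t y)) := by
  obtain ⟨C, hC, hL⟩ := h.exists_lipschitz h.quad_ζ
  rw [tendsto_iff_norm_sub_tendsto_zero]
  have h0 : Tendsto (fun s => 2 * C * |s - t|) (𝓝 t) (𝓝 0) := by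
    have : Continuous fun s => 2 * C * |s - t| := by fun_prop
    simpa using this.tendsto t
  refine squeeze_zero' (Eventually.of_forall fun _ => norm_nonneg _) ?_ h0
  filter_upwards [isOpen_Ioo.mem_nhds ht] with s hs
  exact h.abs_inverse_sub_inverse_le hL ht hs y

theorem tendsto_comp_inverse (h : LagFlow b δ m n ζ k θ κ) {f : ℝ → ℝ → ℝ} {c : Fin 3 → ℝ}
    (hf : ∀ t ∈ Set.Ioo (-δ) δ, ∀ ξ,
      HasDerivAt (fun s => f s ξ) (lagQuad m n c (k t) (θ t) (κ t) ξ) t)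
    (hc : ∀ t ∈ Set.Ioo (-δ) δ, IsSmall (f t)) (ht : t ∈ Set.Ioo (-δ) δ) (y : ℝ) :
    Tendsto (fun s => f s (inverse ζ s y)) (𝓝 t) (𝓝 (f t (inverse ζ t y))) := by
  obtain ⟨C, hC, hL⟩ := h.exists_lipschitz hf
  have h1 := ((hc t ht).continuous.tendsto _).comp (h.tendsto_inverse ht y)
  have h2 : Tendsto (fun s => f s (inverse ζ s y) - f t (inverse ζ s y)) (𝓝 t) (𝓝 0) := by
    have h0 : Tendsto (fun s => C * |s - t|) (𝓝 t) (𝓝 0) := by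
      have : Continuous fun s => C * |s - t| := by fun_prop
      simpa using this.tendsto t
    refine squeeze_zero_norm' ?_ h0
    filter_upwards [isOpen_Ioo.mem_nhds ht] with s hs
    exact hL t ht s hs _
  have := h2.add h1
  simpa using this

/-- The weight of the transport operator at time `t`. -/
noncomputable def weight (ζ k θ : ℝ → ℝ → ℝ) (t y : ℝ) : ℝ :=
  Real.exp (θ t (inverse ζ t y) - k t (inverse ζ t y))

theorem abs_sub_le_one (h : LagFlow b δ m n ζ k θ κ) (ht : t ∈ Set.Ioo (-δ) δ) (ξ : ℝ) :
    |θ t ξ - k t ξ| ≤ 1 :=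
  (abs_sub _ _).trans (by linarith [(h.small_θ t ht).abs_le ξ, (h.small_k t ht).abs_le ξ])

/-- The transport has weight `e^{θ - k}` along the inverse flow; multiplication by the Jacobian
`e^k` turns this into the weight `e^θ` along the flow for the adjoint. In `K`, the term `3` bounds
`e`, while `4A` and `B` bound the gradients of the two weights uniformly in time. -/
theorem exists_preservesUG (h : LagFlow b δ m n ζ k θ κ) : ∃ K, 0 ≤ K ∧ ∀ t ∈ Set.Ioo (-δ) δ,
    IsWeightedDiffeo (weight ζ k θ t) (inverse ζ t) (fun ξ => ξ + ζ t ξ)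
      (fun y => (Real.exp (k t (inverse ζ t y)))⁻¹) K ∧
    Besov.PreservesUG (16 * K) (wcomp (weight ζ k θ t) (inverse ζ t))
      (wcomp (fun ξ => Real.exp (θ t ξ)) (fun ξ => ξ + ζ t ξ)) := by
  obtain ⟨ρ, hρ⟩ := h.exists_upperGradient h.quad_k h.zero_k
  obtain ⟨σ, hσ⟩ := h.exists_upperGradient h.quad_θ h.zero_θ
  set A := l2norm fun x => 3 * (σ x + ρ x)
  set B := l2norm fun x => 3 * σ x
  have hA : 0 ≤ A := l2norm_nonneg _
  have hB : 0 ≤ B := l2norm_nonneg _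
  refine ⟨3 + 4 * A + B, by positivity, fun t ht => ?_⟩
  have hX := h.isDiffeo ht
  have hσ1 : ∀ ξ, |θ t ξ| ≤ 1 := fun ξ => ((h.small_θ t ht).abs_le ξ).trans (by norm_num)
  have g1 := ((hσ t ht).sub (hρ t ht)).exp (h.abs_sub_le_one ht)
  have g2 := (hσ t ht).exp hσ1
  have bd : ∀ {x : ℝ}, |x| ≤ 1 → |Real.exp x| ≤ 3 + 4 * A + B := fun {x} hx => by
    have h3 := Real.exp_one_lt_d9
    have := Real.exp_le_exp.2 (abs_le.1 hx).2
    rw [abs_of_pos (Real.exp_pos _)]; linarith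
  have w1 : IsWeightedDiffeo (weight ζ k θ t) (inverse ζ t) (fun ξ => ξ + ζ t ξ)
      (fun y => (Real.exp (k t (inverse ζ t y)))⁻¹) (3 + 4 * A + B) :=
    ⟨hX.symm, g1.continuous.comp hX.symm.continuous, fun x => bd (h.abs_sub_le_one ht _)⟩
  have w2 : IsWeightedDiffeo (fun ξ => Real.exp (θ t ξ)) (fun ξ => ξ + ζ t ξ) (inverse ζ t)
      (fun ξ => Real.exp (k t ξ)) (3 + 4 * A + B) :=
    ⟨hX, g2.continuous, fun x => bd (hσ1 x)⟩
  refine ⟨w1, w1.preservesUG w2 (fun ξ => ?_) (hX.symm.upperGradient_comp g1) ?_ g2 ?_⟩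
  · have := hX.left_inv ξ
    rw [weight, this, ← Real.exp_add, sub_add_cancel]
  · have := hX.symm.l2norm_comp_mul_le g1.memLp
    linarith
  · linarith

theorem toLpC_lagMom (h : LagFlow b δ m n ζ k θ κ) (ht : t ∈ Set.Ioo (-δ) δ) :
    toLpC (lagMom m ζ k θ t) = wcomp (weight ζ k θ t) (inverse ζ t) (toLpC m) := by
  obtain ⟨K, -, hK⟩ := h.exists_preservesUG
  exact ((hK t ht).1.wcomp_toLpC h.memLp_m).2.symm

theorem besovSum_lagMom_lt_top (h : LagFlow b δ m n ζ k θ κ) (ht : t ∈ Set.Ioo (-δ) δ)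
    (hm : Besov.besovSum (toLpC m) < ∞) : Besov.besovSum (toLpC (lagMom m ζ k θ t)) < ∞ := by
  obtain ⟨K, hK0, hK⟩ := h.exists_preservesUG
  rw [h.toLpC_lagMom ht]
  exact (hK t ht).2.besovSum_lt_top (by positivity) hm

theorem tendsto_besovSum_lagMom (h : LagFlow b δ m n ζ k θ κ) (ht : t ∈ Set.Ioo (-δ) δ)
    (hm : Besov.besovSum (toLpC m) < ∞) :
    Tendsto (fun s => Besov.besovSum (toLpC (lagMom m ζ k θ s) - toLpC (lagMom m ζ k θ t)))
      (𝓝 t) (𝓝 0) := by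
  obtain ⟨K, hK0, hK⟩ := h.exists_preservesUG
  have hev := isOpen_Ioo.mem_nhds ht
  have := Besov.tendsto_besovSum (l := 𝓝 t) (by positivity : 0 ≤ 16 * K) (hK t ht).2
    (L := fun s => wcomp (weight ζ k θ s) (inverse ζ s))
    (L' := fun s => wcomp (fun ξ => Real.exp (θ s ξ)) (fun ξ => ξ + ζ s ξ))
    (by filter_upwards [hev] with s hs using (hK s hs).2)
    (fun f => tendsto_wcomp (hK t ht).1
      (by filter_upwards [hev] with s hs using (hK s hs).1)
      (by
        filter_upwards [hev] with s hs x
        exact (h.abs_inverse_sub_le hs x).trans (by norm_num))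
      (fun x => (Real.continuous_exp.tendsto _).comp
        ((h.tendsto_comp_inverse h.quad_θ h.small_θ ht x).sub
          (h.tendsto_comp_inverse h.quad_k h.small_k ht x)))
      (fun x => h.tendsto_inverse ht x) f) hm
  refine this.congr' ?_
  filter_upwards [hev] with s hs
  rw [h.toLpC_lagMom hs, h.toLpC_lagMom ht]

theorem mem_Ioo_of_timeInterval (ht : t ∈ timeInterval (ENNReal.ofReal δ)) :
    t ∈ Set.Ioo (-δ) δ := by
  obtain ⟨h0, h1⟩ := ht
  have := (ENNReal.ofReal_lt_ofReal_iff_of_nonneg h0).1 h1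
  exact ⟨by linarith, this⟩

theorem isBesovCurve (h : LagFlow b δ m n ζ k θ κ) (hm : Besov.besovSum (toLpC m) < ∞) :
    IsBesovCurve (ENNReal.ofReal δ) fun t => greenConv (lagMom m ζ k θ t) where
  continuous_space t ht := continuous_greenConv (h.memLp_lagMom (mem_Ioo_of_timeInterval ht))
  mem t ht := by
    have ht := mem_Ioo_of_timeInterval ht
    exact (Besov.fnNorm_greenConv_le (h.memLp_lagMom ht)).trans_lt
      (ENNReal.mul_lt_top (by simp) (h.besovSum_lagMom_lt_top ht hm))
  continuous_time t ht := by
    have ht := mem_Ioo_of_timeInterval ht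
    have h1 := ENNReal.Tendsto.const_mul (a := 2) (h.tendsto_besovSum_lagMom ht hm)
      (Or.inr (by simp))
    rw [mul_zero] at h1
    refine Tendsto.mono_left ?_ nhdsWithin_le_nhds
    refine tendsto_of_tendsto_of_tendsto_of_le_of_le' tendsto_const_nhds h1
      (Eventually.of_forall fun _ => zero_le) ?_
    filter_upwards [isOpen_Ioo.mem_nhds ht] with s hs
    have h2 := h.memLp_lagMom hs
    have h3 := h.memLp_lagMom ht
    rw [← toLpC_sub h2 h3]
    refine le_trans (le_of_eq ?_) (Besov.fnNorm_greenConv_le (h2.sub h3))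
    congr 1
    funext x
    exact (greenConv_sub h2 h3 x).symm

end LagFlow

/-! ### Time derivative of the potentials of the transported momenta. -/

theorem hasDerivAt_green {z : ℝ} (hz : z ≠ 0) : HasDerivAt green (greenDeriv z) z := by
  have h := ((hasDerivAt_abs hz).neg.exp).div_const 2
  refine h.congr_deriv ?_
  rw [greenDeriv, Pi.neg_apply]; ring

/-- Lipschitz bound for a translated and weighted Green function. -/
theorem abs_green_mul_exp_sub_le {x ξ z w α β C d : ℝ} (hz : |z| ≤ 1 / 2) (hw : |w| ≤ 1 / 2)
    (hα : |α| ≤ 1 / 2) (hβ : |β| ≤ 1 / 2) (hzw : |z - w| ≤ C * d) (hαβ : |α - β| ≤ C * d) :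
    |green (x - (ξ + z)) * Real.exp α - green (x - (ξ + w)) * Real.exp β| ≤
      8 * C * expKer 1 x ξ * d := by
  have hd : ∀ {z : ℝ}, |z| ≤ 1 / 2 → |x - ξ| - 1 / 2 ≤ |x - (ξ + z)| := fun {z} hz => by
    have := abs_sub_abs_le_abs_sub (x - ξ) z
    rw [show x - (ξ + z) = x - ξ - z by ring]; linarith
  have hker : Real.exp (-(|x - ξ| - 1 / 2)) ≤ 2 * expKer 1 x ξ := by
    have h2 : Real.exp (1 / 2) ≤ 2 := exp_le_two (by rw [abs_of_pos (by norm_num)])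
    rw [show -(|x - ξ| - 1 / 2) = 1 / 2 + -(1 * |x - ξ|) by ring, Real.exp_add]
    exact mul_le_mul_of_nonneg_right h2 (Real.exp_pos _).le
  have hK := expKer_pos 1 x ξ
  have hcd : 0 ≤ C * d := (abs_nonneg _).trans hzw
  have h1 : |green (x - (ξ + z)) - green (x - (ξ + w))| ≤ C * d * expKer 1 x ξ := by
    have h := abs_exp_neg_abs_sub_le _ _ (hd hz) (hd hw)
    have e : green (x - (ξ + z)) - green (x - (ξ + w)) =
        (Real.exp (-|x - (ξ + z)|) - Real.exp (-|x - (ξ + w)|)) / 2 := by unfold green; ring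
    have e2 : x - (ξ + z) - (x - (ξ + w)) = -(z - w) := by ring
    rw [e2, abs_neg] at h
    rw [e, abs_div, abs_two]
    have : |z - w| * Real.exp (-(|x - ξ| - 1 / 2)) ≤ (C * d) * (2 * expKer 1 x ξ) :=
      mul_le_mul hzw hker (Real.exp_pos _).le hcd
    linarith
  have h2 : |green (x - (ξ + w))| ≤ expKer 1 x ξ := by
    rw [green, abs_of_pos (by positivity)]
    have := (Real.exp_le_exp.2 (neg_le_neg (hd hw))).trans hker
    linarith
  have h3 := abs_exp_sub_exp_le_two hα hβ
  have h4 := exp_le_two hα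
  have e : green (x - (ξ + z)) * Real.exp α - green (x - (ξ + w)) * Real.exp β =
      (green (x - (ξ + z)) - green (x - (ξ + w))) * Real.exp α +
        green (x - (ξ + w)) * (Real.exp α - Real.exp β) := by ring
  rw [e]
  refine (abs_add_le _ _).trans ?_
  have h5 := abs_mul_le_of_le h1 (by rwa [abs_of_pos (Real.exp_pos α)] : |Real.exp α| ≤ 2)
  have h6 := abs_mul_le_of_le h2 (h3.trans (mul_le_mul_of_nonneg_left hαβ (by norm_num)))
  have : 0 ≤ C * d * expKer 1 x ξ := by positivity
  linarith

namespace LagFlow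

variable {b δ : ℝ} {m n : ℝ → ℝ} {ζ k θ κ : ℝ → ℝ → ℝ} {s t : ℝ}

theorem greenConv_lagMom_eq (h : LagFlow b δ m n ζ k θ κ) (ht : t ∈ Set.Ioo (-δ) δ) (x : ℝ) :
    greenConv (lagMom m ζ k θ t) x =
      ∫ ξ, green (x - (ξ + ζ t ξ)) * (Real.exp (θ t ξ) * m ξ) := by
  rw [greenConv_eq_integral (h.memLp_lagMom ht)]
  rw [integral_comp_pushMom (h.isDiffeo ht) (w := θ t) (h := m)
    fun ξ => green (x - (ξ + ζ t ξ))]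
  refine integral_congr_ae (ae_of_all _ fun y => ?_)
  simp only
  rw [h.inverse_add ht, lagMom]

/-- In Lagrangian form `u(t, x)` is the integral of `p(x - X(t, ξ)) e^{θ(t, ξ)} m(ξ)`, where time
enters only the kernel and the weight. Differentiation under the integral never touches `m`, and a
change of variables returns to Eulerian coordinates. -/
theorem hasDerivAt_greenConv_lagMom (h : LagFlow b δ m n ζ k θ κ) (ht : t ∈ Set.Ioo (-δ) δ)
    (x : ℝ) :
    HasDerivAt (fun s => greenConv (lagMom m ζ k θ s) x)
      (greenConv (fun y => (greenConv' (lagMom m ζ k θ t) y * greenConv (lagMom n ζ k κ t) y +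
          greenConv (lagMom m ζ k θ t) y * greenConv' (lagMom n ζ k κ t) y -
          b * (greenConv (lagMom n ζ k κ t) y * greenConv' (lagMom m ζ k θ t) y)) *
          lagMom m ζ k θ t y) x -
        greenConv' (fun y => greenConv (lagMom m ζ k θ t) y * greenConv (lagMom n ζ k κ t) y *
          lagMom m ζ k θ t y) x) t := by
  obtain ⟨C₁, hC₁, hL₁⟩ := h.exists_lipschitz h.quad_ζ
  obtain ⟨C₂, hC₂, hL₂⟩ := h.exists_lipschitz h.quad_θ
  set C := max C₁ C₂ with hC
  have hX := h.isDiffeo ht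
  have hcontθ := fun r (hr : r ∈ Set.Ioo (-δ) δ) =>
    Real.continuous_exp.comp (h.small_θ r hr).continuous
  have hcontg : Continuous green := by unfold green; fun_prop
  have hquad := fun c => continuous_lagQuad h.memLp_m h.memLp_n (h.small_k t ht) (h.small_θ t ht)
    (h.small_κ t ht) c
  have hm1 := h.memLp_m.1
  have hmeas : ∀ r ∈ Set.Ioo (-δ) δ, AEStronglyMeasurable
      fun ξ => green (x - (ξ + ζ r ξ)) * (Real.exp (θ r ξ) * m ξ) := fun r hr =>
    (hcontg.comp (continuous_const.sub
      (continuous_id.add (h.small_ζ r hr).continuous))).aestronglyMeasurable.mul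
      ((hcontθ r hr).aestronglyMeasurable.mul hm1)
  have hbi : Integrable fun ξ => 8 * C * (expKer 1 x ξ * |m ξ|) :=
    (integrable_expKer_mul one_pos x h.memLp_m.norm).const_mul (8 * C)
  have hint : Integrable fun ξ => green (x - (ξ + ζ t ξ)) * (Real.exp (θ t ξ) * m ξ) := by
    refine ((integrable_expKer_mul one_pos x h.memLp_m.norm).const_mul (8 : ℝ)).mono'
      (hmeas t ht) (ae_of_all _ fun ξ => ?_)
    have h1 : |green (x - (ξ + ζ t ξ))| ≤ expKer 1 x ξ := by
      have := (h.small_ζ t ht).abs_le ξ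
      have h2 := abs_sub_abs_le_abs_sub (x - ξ) (ζ t ξ)
      rw [green, abs_of_pos (by positivity)]
      have h3 : Real.exp (1 / 2) ≤ 2 := exp_le_two (by rw [abs_of_pos (by norm_num)])
      have h4 : Real.exp (-|x - (ξ + ζ t ξ)|) ≤ Real.exp (1 / 2) * expKer 1 x ξ := by
        rw [expKer, ← Real.exp_add]
        refine Real.exp_le_exp.2 ?_
        rw [show x - (ξ + ζ t ξ) = x - ξ - ζ t ξ by ring]; linarith
      have := expKer_pos 1 x ξ
      nlinarith
    have h2 := exp_le_two ((h.small_θ t ht).abs_le ξ)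
    rw [norm_mul, norm_mul, Real.norm_eq_abs, Real.norm_of_nonneg (Real.exp_pos _).le]
    have h3 := expKer_pos 1 x ξ
    have h4 := norm_nonneg (m ξ)
    calc _ ≤ expKer 1 x ξ * (2 * ‖m ξ‖) := by gcongr
      _ ≤ _ := by nlinarith [mul_nonneg h3.le h4]
  -- The kernel has a corner only for the single particle located at `x` at time `t`; the Lipschitz
  -- bound supplies the domination there.
  have hne : ∀ᵐ ξ, x - (ξ + ζ t ξ) ≠ 0 := by
    filter_upwards [compl_mem_ae_iff.2 (measure_singleton (μ := volume) (inverse ζ t x))] with ξ hξ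
    intro h0
    apply hξ
    have h1 : ξ + ζ t ξ = x := by linarith
    have h2 := hX.left_inv ξ
    rw [Set.mem_singleton_iff, ← h1]
    exact h2.symm
  set g' : ℝ → ℝ := fun ξ => greenDeriv (x - (ξ + ζ t ξ)) *
      (-lagQuad m n ![1, 0, 0] (k t) (θ t) (κ t) ξ) * (Real.exp (θ t ξ) * m ξ) +
      green (x - (ξ + ζ t ξ)) * (lagQuad m n ![0, 1 - b, 1] (k t) (θ t) (κ t) ξ *
        (Real.exp (θ t ξ) * m ξ)) with hg'
  have hmeas1 : AEStronglyMeasurable fun ξ => Real.exp (θ t ξ) * m ξ :=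
    (hcontθ t ht).aestronglyMeasurable.mul hm1
  have hmeas2 : AEStronglyMeasurable fun ξ => greenDeriv (x - (ξ + ζ t ξ)) :=
    (measurable_greenDeriv.comp (continuous_const.sub
      (continuous_id.add (h.small_ζ t ht).continuous)).measurable).aestronglyMeasurable
  have hmeas3 : AEStronglyMeasurable fun ξ => green (x - (ξ + ζ t ξ)) :=
    (hcontg.comp (continuous_const.sub
      (continuous_id.add (h.small_ζ t ht).continuous))).aestronglyMeasurable
  obtain ⟨-, hD⟩ := hasDerivAt_integral_of_dominated_loc_of_lip (𝕜 := ℝ) (μ := volume)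
    (F := fun s ξ => green (x - (ξ + ζ s ξ)) * (Real.exp (θ s ξ) * m ξ)) (x₀ := t)
    (F' := g') (bound := fun ξ => 8 * C * (expKer 1 x ξ * |m ξ|))
    (isOpen_Ioo.mem_nhds ht)
    (by filter_upwards [isOpen_Ioo.mem_nhds ht] with r hr using hmeas r hr) hint
    (((hmeas2.mul (hquad _).neg.aestronglyMeasurable).mul hmeas1).add
      (hmeas3.mul ((hquad _).aestronglyMeasurable.mul hmeas1)))
    (ae_of_all _ fun ξ => LipschitzOnWith.of_dist_le_mul fun r hr s hs => by
      have hb : 0 ≤ 8 * C * (expKer 1 x ξ * |m ξ|) := by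
        have := expKer_pos 1 x ξ
        have : 0 ≤ C := hC₁.trans (le_max_left _ _)
        positivity
      rw [Real.coe_nnabs, abs_of_nonneg hb, Real.dist_eq, Real.dist_eq]
      have := abs_green_mul_exp_sub_le (x := x) (ξ := ξ) (C := C) (d := |r - s|)
        ((h.small_ζ r hr).abs_le ξ) ((h.small_ζ s hs).abs_le ξ) ((h.small_θ r hr).abs_le ξ)
        ((h.small_θ s hs).abs_le ξ)
        ((hL₁ s hs r hr ξ).trans (mul_le_mul_of_nonneg_right (le_max_left _ _) (abs_nonneg _)))
        ((hL₂ s hs r hr ξ).trans (mul_le_mul_of_nonneg_right (le_max_right _ _) (abs_nonneg _)))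
      rw [← mul_assoc, ← mul_assoc, ← sub_mul, abs_mul]
      calc _ ≤ (8 * C * expKer 1 x ξ * |r - s|) * |m ξ| := by gcongr
        _ = _ := by ring)
    hbi (by
      filter_upwards [hne] with ξ hξ
      have h1 := (hasDerivAt_green hξ).comp t ((h.quad_ζ t ht ξ).const_add ξ |>.const_sub x)
      have h2 := h1.mul (((h.quad_θ t ht ξ).exp).mul_const (m ξ))
      refine h2.congr_deriv ?_
      simp only [hg', Function.comp]
      ring)
  have hu := h.memLp_lagMom ht
  have hv := h.symm.memLp_lagMom ht
  have hbu := abs_greenConv_le hu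
  have hbu' := abs_greenConv'_le hu
  have hbv := abs_greenConv_le hv
  have hbv' := abs_greenConv'_le hv
  have hcu := continuous_greenConv hu
  have hcu' := continuous_greenConv' hu
  have hcv := continuous_greenConv hv
  have hcv' := continuous_greenConv' hv
  set M := lagMom m ζ k θ t with hM
  set N := lagMom n ζ k κ t with hN
  have hUV : ∀ c ξ, lagQuad m n c (k t) (θ t) (κ t) ξ =
      c 0 * (greenConv M (ξ + ζ t ξ) * greenConv N (ξ + ζ t ξ)) +
      c 1 * (greenConv' M (ξ + ζ t ξ) * greenConv N (ξ + ζ t ξ)) +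
      c 2 * (greenConv M (ξ + ζ t ξ) * greenConv' N (ξ + ζ t ξ)) := fun c ξ => by
    rw [lagQuad, lag_green_eq hX (h.small_k t ht) (h.small_θ t ht) h.memLp_m,
      lag_green_eq hX (h.small_k t ht) (h.small_κ t ht) h.memLp_n,
      lag_greenDeriv_eq hX (h.small_k t ht) (h.small_θ t ht) h.memLp_m,
      lag_greenDeriv_eq hX (h.small_k t ht) (h.small_κ t ht) h.memLp_n]
    rfl
  have hc1 : MemLp (fun y => greenConv M y * greenConv N y * M y) 2 :=
    memLp_bdd_mul hu (hcu.mul hcv) fun x => abs_mul_le_of_le (hbu x) (hbv x)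
  have hc2 : MemLp (fun y => (greenConv' M y * greenConv N y +
          greenConv M y * greenConv' N y - b * (greenConv N y * greenConv' M y)) * M y) 2 := by
    refine memLp_bdd_mul hu (((hcu'.mul hcv).add (hcu.mul hcv')).sub
      (continuous_const.mul (hcv.mul hcu')))
      (B := 2 * l2norm M * (2 * l2norm N) + 2 * l2norm M * (2 * l2norm N) +
        |b| * (2 * l2norm N * (2 * l2norm M))) fun x => ?_
    exact (abs_sub _ _).trans (add_le_add ((abs_add_le _ _).trans (add_le_add
      (abs_mul_le_of_le (hbu' x) (hbv x)) (abs_mul_le_of_le (hbu x) (hbv' x))))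
      (abs_mul_le_of_le le_rfl (abs_mul_le_of_le (hbv x) (hbu' x))))
  have hval : ∫ ξ, g' ξ =
      greenConv (fun y => (greenConv' M y * greenConv N y +
          greenConv M y * greenConv' N y - b * (greenConv N y * greenConv' M y)) * M y) x -
        greenConv' (fun y => greenConv M y * greenConv N y * M y) x := by
    rw [greenConv_eq_integral hc2, greenConv'_eq_integral hc1,
      ← integral_sub (integrable_green_mul hc2 x) (integrable_greenDeriv_mul hc1 x)]
    have := integral_comp_pushMom hX (w := θ t) (h := m) fun ξ =>
      -(greenDeriv (x - (ξ + ζ t ξ)) * lagQuad m n ![1, 0, 0] (k t) (θ t) (κ t) ξ) +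
      green (x - (ξ + ζ t ξ)) * lagQuad m n ![0, 1 - b, 1] (k t) (θ t) (κ t) ξ
    rw [show g' = _ from rfl]
    refine Eq.trans (integral_congr_ae (ae_of_all _ fun ξ => ?_)) (this.trans
      (integral_congr_ae (ae_of_all _ fun y => ?_)))
    · ring
    · simp only [hUV, h.inverse_add ht]
      rw [← lagMom, ← hM]
      simp
      ring
  rw [← hval]
  refine hD.congr_of_eventuallyEq ?_
  filter_upwards [isOpen_Ioo.mem_nhds ht] with r hr
  exact h.greenConv_lagMom_eq hr x

theorem hasDerivAt_bForcing (h : LagFlow b δ m n ζ k θ κ) (ht : t ∈ Set.Ioo (-δ) δ) (x : ℝ) :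
    HasDerivAt (fun s => greenConv (lagMom m ζ k θ s) x)
      (-(greenConv (lagMom m ζ k θ t) x * greenConv (lagMom n ζ k κ t) x *
          deriv (greenConv (lagMom m ζ k θ t)) x +
        (green ⋆[ContinuousLinearMap.mul ℝ ℝ] bForcing b (greenConv (lagMom m ζ k θ t))
          (greenConv (lagMom n ζ k κ t))) x)) t := by
  have hu := h.memLp_lagMom ht
  have hv := h.symm.memLp_lagMom ht
  obtain ⟨h1, h2⟩ := bForcing_identity b hu hv
  rw [convolution_green h1, deriv_greenConv hu, h2 x, neg_sub]
  exact h.hasDerivAt_greenConv_lagMom ht x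

/-- A characteristic flow with Besov data is a solution of the Cauchy problem. -/
theorem isSolution (h : LagFlow b δ m n ζ k θ κ) (hm : Besov.besovSum (toLpC m) < ∞)
    (hn : Besov.besovSum (toLpC n) < ∞) :
    IsSolution (bForcing b) (greenConv m) (greenConv n) (ENNReal.ofReal δ)
      (fun t => greenConv (lagMom m ζ k θ t)) (fun t => greenConv (lagMom n ζ k κ t)) where
  curve_u := h.isBesovCurve hm
  curve_v := h.symm.isBesovCurve hn
  initial_u := by simp only [h.lagMom_zero]; rfl
  initial_v := by simp only [h.symm.lagMom_zero]; rfl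
  eq_u _ ht x := (h.hasDerivAt_bForcing (mem_Ioo_of_timeInterval ht) x).hasDerivWithinAt
  eq_v _ ht x := (h.symm.hasDerivAt_bForcing (mem_Ioo_of_timeInterval ht) x).hasDerivWithinAt

end LagFlow

/-- Growth of the `L²` norm of the momentum along the flow. -/
theorem LagFlow.exists_hasDerivAt_integral_sq {b δ : ℝ} {m n : ℝ → ℝ} {ζ k θ κ : ℝ → ℝ → ℝ}
    (h : LagFlow b δ m n ζ k θ κ) {A B : ℝ}
    (hA : ∀ x, |greenConv m x| ≤ A) (hA' : ∀ x, |greenConv' m x| ≤ A)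
    (hB : ∀ x, |greenConv n x| ≤ B) (hB' : ∀ x, |greenConv' n x| ≤ B) :
    ∃ D, HasDerivAt (fun s => ∫ y, lagMom m ζ k θ s y ^ 2) D 0 ∧
      D ≤ (2 + 2 * |b|) * (A * B) * ∫ y, m y ^ 2 := by
  have h0 := h.zero_mem
  have hm2 : Integrable fun ξ => m ξ ^ 2 := h.memLp_m.integrable_sq
  have hquad := fun r (hr : r ∈ Set.Ioo (-δ) δ) c => continuous_lagQuad h.memLp_m h.memLp_n
    (h.small_k r hr) (h.small_θ r hr) (h.small_κ r hr) c
  have hcont : ∀ r ∈ Set.Ioo (-δ) δ, Continuous fun ξ => Real.exp (2 * θ r ξ - k r ξ) :=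
    fun r hr => Real.continuous_exp.comp
      ((continuous_const.mul (h.small_θ r hr).continuous).sub (h.small_k r hr).continuous)
  have he : ∀ r ∈ Set.Ioo (-δ) δ, ∀ ξ, Real.exp (2 * θ r ξ - k r ξ) ≤ Real.exp 2 :=
    fun r hr ξ => Real.exp_le_exp.2 (by
      have h1 := abs_le.1 ((h.small_θ r hr).abs_le ξ)
      have h2 := abs_le.1 ((h.small_k r hr).abs_le ξ)
      linarith [h1.2, h2.1])
  set R := max (l2norm m) (l2norm n)
  have hb := fun r (hr : r ∈ Set.Ioo (-δ) δ) c ξ => abs_lagQuad_le h.memLp_m h.memLp_n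
    (le_max_left _ (l2norm n)) (le_max_right (l2norm m) _)
    (h.small_k r hr) (h.small_θ r hr) (h.small_κ r hr) c ξ
  -- After the change of variables `y = X(ξ)` the squared norm is the integral of `e^{2θ - k} m²`,
  -- and `q = 2 θ_t - k_t`.
  set q : ℝ → ℝ → ℝ := fun r ξ => 2 * lagQuad m n ![0, 1 - b, 1] (k r) (θ r) (κ r) ξ -
    lagQuad m n ![0, 1, 1] (k r) (θ r) (κ r) ξ with hq
  obtain ⟨Q, hQ0, hQ⟩ : ∃ Q, 0 ≤ Q ∧ ∀ r ∈ Set.Ioo (-δ) δ, ∀ ξ, |q r ξ| ≤ Q := by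
    refine ⟨_, ?_, fun r hr ξ => (abs_sub _ _).trans (add_le_add
      (abs_mul_le_of_le le_rfl (hb r hr _ ξ)) (hb r hr _ ξ))⟩
    have : 0 ≤ R := le_max_of_le_left (l2norm_nonneg m)
    positivity
  have hqc : ∀ r ∈ Set.Ioo (-δ) δ, Continuous (q r) := fun r hr =>
    (continuous_const.mul (hquad r hr _)).sub (hquad r hr _)
  obtain ⟨-, hD⟩ := hasDerivAt_integral_of_dominated_loc_of_deriv_le (𝕜 := ℝ) (μ := volume)
    (F := fun s ξ => Real.exp (2 * θ s ξ - k s ξ) * m ξ ^ 2) (x₀ := 0)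
    (F' := fun s ξ => Real.exp (2 * θ s ξ - k s ξ) * q s ξ * m ξ ^ 2)
    (bound := fun ξ => Real.exp 2 * Q * m ξ ^ 2)
    (isOpen_Ioo.mem_nhds h0)
    (by
      filter_upwards [isOpen_Ioo.mem_nhds h0] with r hr
      exact (hcont r hr).aestronglyMeasurable.mul hm2.1)
    (by simpa [h.zero_θ, h.zero_k] using hm2)
    (((hcont 0 h0).mul (hqc 0 h0)).aestronglyMeasurable.mul hm2.1)
    (ae_of_all _ fun ξ r hr => by
      rw [norm_mul, norm_mul, Real.norm_of_nonneg (Real.exp_pos _).le,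
        Real.norm_of_nonneg (sq_nonneg (m ξ))]
      gcongr
      · exact Real.exp_le_exp.1 (he r hr ξ)
      · exact hQ r hr ξ)
    (hm2.const_mul _)
    (ae_of_all _ fun ξ r hr =>
      ((((h.quad_θ r hr ξ).const_mul 2).sub (h.quad_k r hr ξ)).exp).mul_const (m ξ ^ 2))
  refine ⟨_, hD.congr_of_eventuallyEq ?_, ?_⟩
  · filter_upwards [isOpen_Ioo.mem_nhds h0] with r hr
    have hX := h.isDiffeo hr
    rw [← hX.integral]
    refine integral_congr_ae (ae_of_all _ fun ξ => ?_)
    have e := hX.left_inv ξ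
    simp only [smul_eq_mul, lagMom, pushMom, e]
    rw [mul_pow, ← mul_assoc, sq (Real.exp _), ← Real.exp_add, ← Real.exp_add]
    ring_nf
  -- At time zero the rate is `(1 - 2b) u_x v + u v_x`. It contains no second derivative and each
  -- term has one factor from `u` and one from `v`; this is where the product of `W^{1,∞}` norms in
  -- the criterion arises.
  · have hval : ∀ ξ, |q 0 ξ| ≤ (2 + 2 * |b|) * (A * B) := fun ξ => by
      have hX := h.isDiffeo h0
      have e0 := h.lagMom_zero
      have e1 := h.symm.lagMom_zero
      rw [lagMom] at e0 e1
      have eq : q 0 ξ = (1 - 2 * b) * (greenConv' m ξ * greenConv n ξ) +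
          greenConv m ξ * greenConv' n ξ := by
        simp only [hq, lagQuad]
        rw [lag_green_eq hX (h.small_k 0 h0) (h.small_θ 0 h0) h.memLp_m,
          lag_green_eq hX (h.small_k 0 h0) (h.small_κ 0 h0) h.memLp_n,
          lag_greenDeriv_eq hX (h.small_k 0 h0) (h.small_θ 0 h0) h.memLp_m,
          lag_greenDeriv_eq hX (h.small_k 0 h0) (h.small_κ 0 h0) h.memLp_n, e0, e1, h.zero_ζ,
          add_zero]
        simp
        ring
      rw [eq]
      refine (abs_add_le _ _).trans ?_
      have h1 : |1 - 2 * b| ≤ 1 + 2 * |b| := (abs_sub _ _).trans (by rw [abs_mul]; simp)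
      have := abs_mul_le_of_le h1 (abs_mul_le_of_le (hA' ξ) (hB ξ))
      have := abs_mul_le_of_le (hA ξ) (hB' ξ)
      linarith
    rw [← integral_const_mul]
    have hle : ∀ ξ, Real.exp (2 * θ 0 ξ - k 0 ξ) * q 0 ξ * m ξ ^ 2 ≤
        (2 + 2 * |b|) * (A * B) * m ξ ^ 2 := fun ξ => by
      rw [h.zero_θ, h.zero_k, mul_zero, sub_zero, Real.exp_zero, one_mul]
      exact mul_le_mul_of_nonneg_right ((le_abs_self _).trans (hval ξ)) (sq_nonneg _)
    refine integral_mono ?_ (hm2.const_mul _) hle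
    refine (hm2.const_mul Q).mono' (((hcont 0 h0).mul (hqc 0 h0)).aestronglyMeasurable.mul hm2.1)
      (ae_of_all _ fun ξ => ?_)
    rw [h.zero_θ, h.zero_k, mul_zero, sub_zero, Real.exp_zero, one_mul, norm_mul,
      Real.norm_of_nonneg (sq_nonneg (m ξ))]
    exact mul_le_mul_of_nonneg_right (hQ 0 h0 ξ) (sq_nonneg _)

/-! ### The momentum flux -/

theorem l2norm_sub_le {f g : ℝ → ℝ} (hf : MemLp f 2) (hg : MemLp g 2) :
    l2norm (fun x => f x - g x) ≤ l2norm f + l2norm g := by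
  have := l2norm_add_le hf (hg.const_mul (-1))
  rw [l2norm_const_mul, abs_neg, abs_one, one_mul] at this
  simpa [sub_eq_add_neg] using this

theorem l2norm_bdd_mul_le {f g : ℝ → ℝ} (hg : MemLp g 2) {B : ℝ} (hB : ∀ x, |f x| ≤ B) :
    l2norm (fun x => f x * g x) ≤ B * l2norm g := by
  have hB0 : 0 ≤ B := (abs_nonneg _).trans (hB 0)
  have h : eLpNorm (fun x => f x * g x) 2 volume ≤ ENNReal.ofReal B * eLpNorm g 2 volume := by
    refine eLpNorm_le_mul_eLpNorm_of_ae_le_mul (ae_of_all _ fun x => ?_) 2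
    rw [norm_mul]
    exact mul_le_mul_of_nonneg_right (hB x) (norm_nonneg _)
  have := ENNReal.toReal_mono (ENNReal.mul_ne_top (by simp) hg.2.ne) h
  rwa [ENNReal.toReal_mul, ENNReal.toReal_ofReal hB0] at this

theorem abs_integral_mul_le {f g : ℝ → ℝ} (hf : MemLp f 2) (hg : MemLp g 2) :
    |∫ x, f x * g x| ≤ l2norm f * l2norm g := by
  have h := abs_real_inner_le_norm (hf.toLp f) (hg.toLp g)
  rw [L2.inner_def, ← l2norm_eq_toLp, ← l2norm_eq_toLp] at h
  convert h using 2
  refine integral_congr_ae ?_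
  filter_upwards [hf.coeFn_toLp, hg.coeFn_toLp] with x h1 h2
  rw [h1, h2]
  simp [mul_comm]

theorem integral_sq_eq_l2norm {f : ℝ → ℝ} (hf : MemLp f 2) : ∫ x, f x ^ 2 = l2norm f ^ 2 := by
  have h := real_inner_self_eq_norm_sq (hf.toLp f)
  rw [L2.inner_def, ← l2norm_eq_toLp] at h
  rw [← h]
  refine integral_congr_ae ?_
  filter_upwards [hf.coeFn_toLp] with x h1
  rw [h1]
  simp [sq]

/-- The properties shared by convolution with the Green function and with its derivative. -/
structure IsPotential (J : (ℝ → ℝ) → ℝ → ℝ) : Prop where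
  continuous : ∀ {f}, MemLp f 2 → Continuous (J f)
  memLp : ∀ {f}, MemLp f 2 → MemLp (J f) 2
  abs_le : ∀ {f}, MemLp f 2 → ∀ x, |J f x| ≤ 2 * l2norm f
  l2norm_le : ∀ {f}, MemLp f 2 → l2norm (J f) ≤ 2 * l2norm f
  sub : ∀ {f g}, MemLp f 2 → MemLp g 2 → ∀ x, J (fun y => f y - g y) x = J f x - J g x

theorem isPotential_greenConv : IsPotential greenConv :=
  ⟨continuous_greenConv, memLp_greenConv, abs_greenConv_le, l2norm_greenConv_le, greenConv_sub⟩

theorem isPotential_greenConv' : IsPotential greenConv' :=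
  ⟨continuous_greenConv', memLp_greenConv', abs_greenConv'_le, l2norm_greenConv'_le,
    greenConv'_sub⟩

/-- A cubic expression in the momenta. -/
noncomputable def cubic (J₁ J₂ : (ℝ → ℝ) → ℝ → ℝ) (m n : ℝ → ℝ) (y : ℝ) : ℝ :=
  J₁ m y * J₂ n y * m y

section cubic

variable {J₁ J₂ : (ℝ → ℝ) → ℝ → ℝ} {m n m' n' : ℝ → ℝ} {R : ℝ}

theorem IsPotential.abs_mul_le (h₁ : IsPotential J₁) (h₂ : IsPotential J₂) (hm : MemLp m 2)
    (hn : MemLp n 2) (hmR : l2norm m ≤ R) (hnR : l2norm n ≤ R) (x : ℝ) :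
    |J₁ m x * J₂ n x| ≤ 4 * R ^ 2 := by
  have := abs_mul_le_of_le ((h₁.abs_le hm x).trans (by linarith : _ ≤ 2 * R))
    ((h₂.abs_le hn x).trans (by linarith : _ ≤ 2 * R))
  linarith

theorem memLp_cubic (h₁ : IsPotential J₁) (h₂ : IsPotential J₂) (hm : MemLp m 2)
    (hn : MemLp n 2) : MemLp (cubic J₁ J₂ m n) 2 :=
  memLp_bdd_mul hm ((h₁.continuous hm).mul (h₂.continuous hn))
    (h₁.abs_mul_le h₂ hm hn (le_max_left _ _) (le_max_right _ _))

theorem l2norm_cubic_le (h₁ : IsPotential J₁) (h₂ : IsPotential J₂) (hm : MemLp m 2)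
    (hn : MemLp n 2) (hmR : l2norm m ≤ R) (hnR : l2norm n ≤ R) :
    l2norm (cubic J₁ J₂ m n) ≤ 4 * R ^ 2 * R :=
  (l2norm_bdd_mul_le hm (h₁.abs_mul_le h₂ hm hn hmR hnR)).trans (by gcongr)

/-- Splitting of a difference of cubic expressions. -/
theorem cubic_sub_eq (h₁ : IsPotential J₁) (h₂ : IsPotential J₂) (hm : MemLp m 2)
    (hn : MemLp n 2) (hm' : MemLp m' 2) (hn' : MemLp n' 2) (y : ℝ) :
    cubic J₁ J₂ m n y - cubic J₁ J₂ m' n' y =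
      J₁ m y * J₂ n y * (m y - m' y) +
        (J₁ (fun y => m y - m' y) y * J₂ n y + J₁ m' y * J₂ (fun y => n y - n' y) y) * m' y := by
  rw [h₁.sub hm hm', h₂.sub hn hn', cubic, cubic]
  ring

theorem l2norm_cubic_sub_le (h₁ : IsPotential J₁) (h₂ : IsPotential J₂) (hm : MemLp m 2)
    (hn : MemLp n 2) (hm' : MemLp m' 2) (hn' : MemLp n' 2) (hmR : l2norm m ≤ R)
    (hnR : l2norm n ≤ R) (hmR' : l2norm m' ≤ R) :
    l2norm (fun y => cubic J₁ J₂ m n y - cubic J₁ J₂ m' n' y) ≤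
      8 * R ^ 2 * (l2norm (fun y => m y - m' y) + l2norm (fun y => n y - n' y)) := by
  set a := l2norm (fun y => m y - m' y)
  set c := l2norm (fun y => n y - n' y)
  have hμ := hm.sub hm'
  have hν := hn.sub hn'
  have ha : 0 ≤ a := l2norm_nonneg _
  have hc : 0 ≤ c := l2norm_nonneg _
  have hR : 0 ≤ R := (l2norm_nonneg m).trans hmR
  have hcm := memLp_bdd_mul hμ ((h₁.continuous hm).mul (h₂.continuous hn))
    (h₁.abs_mul_le h₂ hm hn hmR hnR)
  have hbd : ∀ x, |J₁ (fun y => m y - m' y) x * J₂ n x + J₁ m' x * J₂ (fun y => n y - n' y) x| ≤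
      4 * R * (a + c) := fun x => by
    refine (abs_add_le _ _).trans ?_
    have h1 := abs_mul_le_of_le (h₁.abs_le hμ x) ((h₂.abs_le hn x).trans
      (by linarith : _ ≤ 2 * R))
    have h2 := abs_mul_le_of_le ((h₁.abs_le hm' x).trans (by linarith : _ ≤ 2 * R))
      (h₂.abs_le hν x)
    calc _ ≤ 2 * a * (2 * R) + 2 * R * (2 * c) := add_le_add h1 h2
      _ = _ := by ring
  have hcm' := memLp_bdd_mul hm' (((h₁.continuous hμ).mul (h₂.continuous hn)).add
    ((h₁.continuous hm').mul (h₂.continuous hν))) hbd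
  have e : (fun y => cubic J₁ J₂ m n y - cubic J₁ J₂ m' n' y) = fun y => _ :=
    funext fun y => cubic_sub_eq h₁ h₂ hm hn hm' hn' y
  rw [e]
  refine (l2norm_add_le hcm hcm').trans ?_
  have h1 := l2norm_bdd_mul_le hμ (h₁.abs_mul_le h₂ hm hn hmR hnR)
  have h2 := l2norm_bdd_mul_le hm' hbd
  have h3 : 4 * R * (a + c) * l2norm m' ≤ 4 * R * (a + c) * R := by gcongr
  have h4 : 0 ≤ R ^ 2 * c := by positivity
  calc _ ≤ 4 * R ^ 2 * a + 4 * R * (a + c) * R := add_le_add h1 (h2.trans h3)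
    _ ≤ _ := by linarith

end cubic

/-- The time derivative of the first component in terms of the momenta. -/
noncomputable def flux (b : ℝ) (m n : ℝ → ℝ) (x : ℝ) : ℝ :=
  (1 - b) * greenConv (cubic greenConv' greenConv m n) x +
    greenConv (cubic greenConv greenConv' m n) x - greenConv' (cubic greenConv greenConv m n) x

section flux

variable {b : ℝ} {m n m' n' : ℝ → ℝ} {R : ℝ}

theorem memLp_cubic₁ (hm : MemLp m 2) (hn : MemLp n 2) :
    MemLp (cubic greenConv' greenConv m n) 2 :=
  memLp_cubic isPotential_greenConv' isPotential_greenConv hm hn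

theorem memLp_cubic₂ (hm : MemLp m 2) (hn : MemLp n 2) :
    MemLp (cubic greenConv greenConv' m n) 2 :=
  memLp_cubic isPotential_greenConv isPotential_greenConv' hm hn

theorem memLp_cubic₃ (hm : MemLp m 2) (hn : MemLp n 2) :
    MemLp (cubic greenConv greenConv m n) 2 :=
  memLp_cubic isPotential_greenConv isPotential_greenConv hm hn

theorem memLp_flux (b : ℝ) (hm : MemLp m 2) (hn : MemLp n 2) : MemLp (flux b m n) 2 :=
  (((memLp_greenConv (memLp_cubic₁ hm hn)).const_mul _).add
    (memLp_greenConv (memLp_cubic₂ hm hn))).sub (memLp_greenConv' (memLp_cubic₃ hm hn))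

theorem abs_flux_le (b : ℝ) (hm : MemLp m 2) (hn : MemLp n 2) (hmR : l2norm m ≤ R)
    (hnR : l2norm n ≤ R) (x : ℝ) : |flux b m n x| ≤ (3 + |b|) * (8 * R ^ 3) := by
  have hb : |1 - b| ≤ 1 + |b| := (abs_sub _ _).trans (by simp)
  have h1 := (abs_greenConv_le (memLp_cubic₁ hm hn) x).trans (mul_le_mul_of_nonneg_left
    (l2norm_cubic_le isPotential_greenConv' isPotential_greenConv hm hn hmR hnR) zero_le_two)
  have h2 := (abs_greenConv_le (memLp_cubic₂ hm hn) x).trans (mul_le_mul_of_nonneg_left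
    (l2norm_cubic_le isPotential_greenConv isPotential_greenConv' hm hn hmR hnR) zero_le_two)
  have h3 := (abs_greenConv'_le (memLp_cubic₃ hm hn) x).trans (mul_le_mul_of_nonneg_left
    (l2norm_cubic_le isPotential_greenConv isPotential_greenConv hm hn hmR hnR) zero_le_two)
  have h4 := abs_mul_le_of_le hb h1
  have h5 := (abs_sub ((1 - b) * greenConv (cubic greenConv' greenConv m n) x +
    greenConv (cubic greenConv greenConv' m n) x) (greenConv' (cubic greenConv greenConv m n) x))
  have h6 := abs_add_le ((1 - b) * greenConv (cubic greenConv' greenConv m n) x)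
    (greenConv (cubic greenConv greenConv' m n) x)
  rw [flux]
  linarith

theorem flux_sub_eq (b : ℝ) (hm : MemLp m 2) (hn : MemLp n 2) (hm' : MemLp m' 2)
    (hn' : MemLp n' 2) (x : ℝ) : flux b m n x - flux b m' n' x =
      (1 - b) * greenConv (fun y => cubic greenConv' greenConv m n y -
        cubic greenConv' greenConv m' n' y) x +
      greenConv (fun y => cubic greenConv greenConv' m n y - cubic greenConv greenConv' m' n' y) x -
      greenConv' (fun y => cubic greenConv greenConv m n y - cubic greenConv greenConv m' n' y) x := by
  rw [greenConv_sub (memLp_cubic₁ hm hn) (memLp_cubic₁ hm' hn'),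
    greenConv_sub (memLp_cubic₂ hm hn) (memLp_cubic₂ hm' hn'),
    greenConv'_sub (memLp_cubic₃ hm hn) (memLp_cubic₃ hm' hn'), flux, flux]
  ring

theorem l2norm_flux_sub_le (b : ℝ) (hm : MemLp m 2) (hn : MemLp n 2) (hm' : MemLp m' 2)
    (hn' : MemLp n' 2) (hmR : l2norm m ≤ R) (hnR : l2norm n ≤ R) (hmR' : l2norm m' ≤ R) :
    l2norm (fun x => flux b m n x - flux b m' n' x) ≤
      (3 + |b|) * (16 * R ^ 2) * (l2norm (fun y => m y - m' y) + l2norm (fun y => n y - n' y)) := by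
  have hb : |1 - b| ≤ 1 + |b| := (abs_sub _ _).trans (by simp)
  have c1 := (memLp_cubic₁ hm hn).sub (memLp_cubic₁ hm' hn')
  have c2 := (memLp_cubic₂ hm hn).sub (memLp_cubic₂ hm' hn')
  have c3 := (memLp_cubic₃ hm hn).sub (memLp_cubic₃ hm' hn')
  have d1 := (l2norm_greenConv_le c1).trans (mul_le_mul_of_nonneg_left (l2norm_cubic_sub_le
    isPotential_greenConv' isPotential_greenConv hm hn hm' hn' hmR hnR hmR') zero_le_two)
  have d2 := (l2norm_greenConv_le c2).trans (mul_le_mul_of_nonneg_left (l2norm_cubic_sub_le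
    isPotential_greenConv isPotential_greenConv' hm hn hm' hn' hmR hnR hmR') zero_le_two)
  have d3 := (l2norm_greenConv'_le c3).trans (mul_le_mul_of_nonneg_left (l2norm_cubic_sub_le
    isPotential_greenConv isPotential_greenConv hm hn hm' hn' hmR hnR hmR') zero_le_two)
  have e : (fun x => flux b m n x - flux b m' n' x) = fun x => _ :=
    funext fun x => flux_sub_eq b hm hn hm' hn' x
  rw [e]
  have p1 := (memLp_greenConv c1).const_mul (1 - b)
  have p2 := memLp_greenConv c2
  have p3 := memLp_greenConv' c3
  refine (l2norm_sub_le (p1.add p2) p3).trans ?_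
  have q1 := l2norm_add_le p1 p2
  rw [l2norm_const_mul] at q1
  have q2 := mul_le_mul hb d1 (l2norm_nonneg _) (by positivity)
  refine (add_le_add (q1.trans (add_le_add q2 d2)) d3).trans (le_of_eq ?_)
  ring

end flux

/-! ### Differentiation in `L²` of curves with a pointwise derivative -/

open Classical in
/-- The class of a real function in `L²(ℝ; ℝ)` (zero if it is not square integrable). -/
noncomputable def toLpR (f : ℝ → ℝ) : Lp ℝ 2 (volume : Measure ℝ) :=
  if h : MemLp f 2 then h.toLp f else 0

section toLpR

variable {f g : ℝ → ℝ}

theorem toLpR_eq (hf : MemLp f 2) : toLpR f = hf.toLp f := dif_pos hf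

theorem norm_toLpR (hf : MemLp f 2) : ‖toLpR f‖ = l2norm f := by
  rw [toLpR_eq hf, l2norm_eq_toLp hf]

theorem toLpR_sub (hf : MemLp f 2) (hg : MemLp g 2) :
    toLpR (fun x => f x - g x) = toLpR f - toLpR g := by
  have h : MemLp (fun x => f x - g x) 2 := hf.sub hg
  rw [toLpR_eq h, toLpR_eq hf, toLpR_eq hg]
  exact (MemLp.toLp_sub hf hg)

theorem inner_toLpR (hf : MemLp f 2) (hg : MemLp g 2) :
    inner ℝ (toLpR f) (toLpR g) = ∫ x, f x * g x := by
  rw [toLpR_eq hf, toLpR_eq hg, L2.inner_def]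
  refine integral_congr_ae ?_
  filter_upwards [hf.coeFn_toLp, hg.coeFn_toLp] with x h1 h2
  rw [h1, h2]
  simp [mul_comm]

theorem toLpR_coeFn (F : Lp ℝ 2 (volume : Measure ℝ)) : toLpR F = F := by
  rw [toLpR_eq (Lp.memLp F), Lp.toLp_coeFn]

theorem memLp_green (x : ℝ) : MemLp (fun y => green (x - y)) 2 := by
  have e : (fun y => green (x - y)) = fun y => 2⁻¹ * expKer 1 x y := by
    funext y; rw [green_sub]; ring
  rw [e]
  exact (memLp_expKer one_pos x).const_mul _

theorem inner_green (hf : MemLp f 2) (x : ℝ) :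
    inner ℝ (toLpR fun y => green (x - y)) (toLpR f) = greenConv f x := by
  rw [inner_toLpR (memLp_green x) hf, greenConv_eq_integral hf]

/-- The translates of `p` are total in `L²`: if `p * F = 0`, then `F = p * F - (p * F)'' = 0`. -/
theorem eq_zero_of_inner_green {F : Lp ℝ 2 (volume : Measure ℝ)}
    (h : ∀ x, inner ℝ (toLpR fun y => green (x - y)) F = 0) : F = 0 := by
  have hF := Lp.memLp F
  have h0 : greenConv F = fun _ => 0 := funext fun x => by
    rw [← inner_green hF, toLpR_coeFn]; exact h x
  have h1 := deriv_deriv_greenConv hF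
  rw [h0] at h1
  refine Lp.ext ?_
  filter_upwards [h1, Lp.coeFn_zero ℝ 2 (volume : Measure ℝ)] with x hx hx0
  rw [hx0]
  simp at hx
  simpa using hx

end toLpR

/-- A pointwise derivative with a uniform bound need not control an `L²` difference quotient, but
after pairing with the integrable function `p(x - ·)` dominated differentiation applies. -/
theorem hasDerivAt_greenConv_of_pointwise {w r : ℝ → ℝ → ℝ} {a c C : ℝ}
    (hw : ∀ t ∈ Set.Ioo a c, MemLp (w t) 2) (hr : ∀ t ∈ Set.Ioo a c, MemLp (r t) 2)
    (hb : ∀ t ∈ Set.Ioo a c, ∀ x, |r t x| ≤ C)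
    (hd : ∀ t ∈ Set.Ioo a c, ∀ x, HasDerivAt (fun s => w s x) (r t x) t)
    {t : ℝ} (ht : t ∈ Set.Ioo a c) (x : ℝ) :
    HasDerivAt (fun s => greenConv (w s) x) (greenConv (r t) x) t := by
  have hn := isOpen_Ioo.mem_nhds ht
  have hi : Integrable fun y => green (x - y) := by
    have e : (fun y => green (x - y)) = fun y => 2⁻¹ * expKer 1 x y := by
      funext y; rw [green_sub]; ring
    rw [e]
    exact (integrable_expKer one_pos x).const_mul _
  obtain ⟨-, h⟩ := hasDerivAt_integral_of_dominated_loc_of_deriv_le (𝕜 := ℝ) (μ := volume)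
    (F := fun s y => green (x - y) * w s y) (F' := fun s y => green (x - y) * r s y)
    (bound := fun y => C * green (x - y)) hn
    (by filter_upwards [hn] with s hs using (integrable_green_mul (hw s hs) x).1)
    (integrable_green_mul (hw t ht) x) (integrable_green_mul (hr t ht) x).1
    (ae_of_all _ fun y s hs => by
      have h0 : 0 ≤ green (x - y) := by unfold green; positivity
      rw [norm_mul, Real.norm_of_nonneg h0, mul_comm]
      exact mul_le_mul_of_nonneg_right (hb s hs y) h0)
    (hi.const_mul C)
    (ae_of_all _ fun y s hs => (hd s hs y).const_mul _)
  rw [greenConv_eq_integral (hr t ht)]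
  refine h.congr_of_eventuallyEq ?_
  filter_upwards [hn] with s hs using greenConv_eq_integral (hw s hs) x

/-- The pointwise equation is upgraded to one in `L²`: the curve is compared with the `L²`-valued
integral of `r`, and the two agree because they agree when paired with all translates of `p`. -/
theorem hasDerivAt_toLpR_of_pointwise {w r : ℝ → ℝ → ℝ} {a c C : ℝ}
    (hw : ∀ t ∈ Set.Ioo a c, MemLp (w t) 2) (hr : ∀ t ∈ Set.Ioo a c, MemLp (r t) 2)
    (hrc : ContinuousOn (fun t => toLpR (r t)) (Set.Ioo a c))
    (hb : ∀ t ∈ Set.Ioo a c, ∀ x, |r t x| ≤ C)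
    (hd : ∀ t ∈ Set.Ioo a c, ∀ x, HasDerivAt (fun s => w s x) (r t x) t)
    {t : ℝ} (ht : t ∈ Set.Ioo a c) :
    HasDerivAt (fun s => toLpR (w s)) (toLpR (r t)) t := by
  set B : ℝ → Lp ℝ 2 (volume : Measure ℝ) := fun s => ∫ τ in t..s, toLpR (r τ) with hB
  have hBd : ∀ s ∈ Set.Ioo a c, HasDerivAt B (toLpR (r s)) s := fun s hs => by
    refine intervalIntegral.integral_hasDerivAt_right ?_
      (hrc.stronglyMeasurableAtFilter isOpen_Ioo s hs) (hrc.continuousAt (isOpen_Ioo.mem_nhds hs))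
    exact (hrc.mono ((convex_Ioo a c).ordConnected.uIcc_subset ht hs)).intervalIntegrable
  have key : ∀ s ∈ Set.Ioo a c, toLpR (w s) = toLpR (w t) + B s := by
    intro s hs
    rw [← sub_eq_zero]
    refine eq_zero_of_inner_green fun x => ?_
    have hf : ∀ q ∈ Set.Ioo a c, HasDerivAt (fun s => greenConv (w s) x -
        inner ℝ (toLpR fun y => green (x - y)) (B s)) 0 q := fun q hq => by
      have h1 := hasDerivAt_greenConv_of_pointwise hw hr hb hd hq x
      have h2 := (innerSL ℝ (toLpR fun y => green (x - y))).hasFDerivAt.comp_hasDerivAt q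
        (hBd q hq)
      refine (h1.sub h2).congr_deriv ?_
      rw [innerSL_apply_apply, inner_green (hr q hq), sub_self]
    have hconst := (convex_Ioo a c).is_const_of_fderivWithin_eq_zero (𝕜 := ℝ)
      (f := fun s => greenConv (w s) x - inner ℝ (toLpR fun y => green (x - y)) (B s))
      (fun q hq => (hf q hq).differentiableAt.differentiableWithinAt)
      (fun q hq => by
        rw [((hf q hq).hasFDerivAt.hasFDerivWithinAt).fderivWithin
          (isOpen_Ioo.uniqueDiffWithinAt hq)]
        ext; simp) hs ht
    have hBt : B t = 0 := by simp [hB]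
    simp only [hBt, inner_zero_right, sub_zero] at hconst
    rw [inner_sub_right, inner_add_right, inner_green (hw s hs), inner_green (hw t ht)]
    linarith
  refine ((hBd t ht).const_add (toLpR (w t))).congr_of_eventuallyEq ?_
  filter_upwards [isOpen_Ioo.mem_nhds ht] with s hs using key s hs

/-- Derivative of a quadratic form along a curve which is only continuous. -/
theorem hasDerivAt_inner_of_symm {H : Type*} [NormedAddCommGroup H] [InnerProductSpace ℝ H]
    {A M : ℝ → H} {D : H} {t : ℝ} (hA : HasDerivAt A D t) (hM : ContinuousAt M t)
    (hs : ∀ᶠ s in 𝓝 t, inner ℝ (A t) (M s) = inner ℝ (A s) (M t)) :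
    HasDerivAt (fun s => inner ℝ (A s) (M s)) (2 * inner ℝ D (M t)) t := by
  rw [hasDerivAt_iff_tendsto_slope] at hA ⊢
  -- Symmetry gives `⟨A_s, M_s⟩ - ⟨A_t, M_t⟩ = ⟨A_s - A_t, M_s + M_t⟩`, so `M` itself is never
  -- differentiated.
  have h1 : Tendsto (fun s => inner ℝ (slope A t s) (M s + M t)) (𝓝[≠] t)
      (𝓝 (inner ℝ D (M t + M t))) :=
    hA.inner ((hM.tendsto.mono_left nhdsWithin_le_nhds).add_const _)
  rw [inner_add_right, ← two_mul] at h1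
  refine h1.congr' ?_
  filter_upwards [nhdsWithin_le_nhds hs] with s hs
  rw [slope_def_module, slope_def_field, inner_smul_left, inner_sub_left, inner_add_right,
    inner_add_right, hs]
  simp
  ring

/-! ### Energy estimate for the difference of two momenta -/

section

variable {a a' μ : ℝ → ℝ} {A A' : ℝ}

/-- With `w = p * μ` and `μ = w - w''`, this is the integral of `(w w')'`. The pairing is thus the
squared `H¹` norm of `w`, the energy used for uniqueness. -/
theorem integral_greenConv_mul_self (hμ : MemLp μ 2) :
    ∫ x, greenConv μ x * μ x = l2norm (greenConv μ) ^ 2 + l2norm (greenConv' μ) ^ 2 := by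
  have hw := memLp_greenConv hμ
  have hw' := memLp_greenConv' hμ
  have hp := (isPrim_greenConv hμ).mul (isPrim_greenConv' hμ)
  have i1 : Integrable fun x => greenConv' μ x ^ 2 := hw'.integrable_sq
  have i2 : Integrable fun x => greenConv μ x ^ 2 := hw.integrable_sq
  have i3 : Integrable fun x => greenConv μ x * μ x := hw.integrable_mul hμ
  have e : (fun x => greenConv' μ x * greenConv' μ x + greenConv μ x * (greenConv μ x - μ x)) =
      fun x => greenConv' μ x ^ 2 + greenConv μ x ^ 2 - greenConv μ x * μ x := by
    funext x; ring
  rw [e] at hp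
  have i12 : Integrable fun x => greenConv' μ x ^ 2 + greenConv μ x ^ 2 := i1.add i2
  have h0 := hp.integral_eq_zero (hw.integrable_mul hw') (i12.sub i3)
  rw [integral_sub i12 i3, integral_add i1 i2, integral_sq_eq_l2norm hw,
    integral_sq_eq_l2norm hw'] at h0
  linarith

theorem abs_greenConv_le_energy (hμ : MemLp μ 2) (x : ℝ) :
    |greenConv μ x| ≤ 2 * (l2norm (greenConv μ) + l2norm (greenConv' μ)) := by
  have hw := memLp_greenConv hμ
  have hw' := memLp_greenConv' hμ
  rw [← greenConv_sub_deriv (isPrim_greenConv hμ) hw hw' (abs_greenConv_le hμ) x]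
  have := abs_sub (greenConv (greenConv μ) x) (greenConv' (greenConv' μ) x)
  have := abs_greenConv_le hw x
  have := abs_greenConv'_le hw' x
  linarith

/-- Substituting `μ = w - w''` and integrating by parts leaves `∫ a w² + ∫ a w'² + ∫ a' w w'`. As
`a'` is only in `L²`, the factor `w` in the last term is taken in the supremum norm, which the
energy controls. -/
theorem abs_integral_mul_greenConv_le (hμ : MemLp μ 2) (ha : IsPrim a a') (hA : ∀ x, |a x| ≤ A)
    (ha' : MemLp a' 2) (hA' : l2norm a' ≤ A') :
    |∫ x, a x * μ x * greenConv μ x| ≤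
      (A + 2 * A') * (l2norm (greenConv μ) + l2norm (greenConv' μ)) ^ 2 := by
  have hw := memLp_greenConv hμ
  have hw' := memLp_greenConv' hμ
  have hsup := abs_greenConv_le_energy hμ
  set p := l2norm (greenConv μ) with hp
  set q := l2norm (greenConv' μ) with hq
  have hp0 : 0 ≤ p := l2norm_nonneg _
  have hq0 : 0 ≤ q := l2norm_nonneg _
  have hA0 : 0 ≤ A := (abs_nonneg _).trans (hA 0)
  have haw := memLp_bdd_mul hw ha.continuous hA
  have haw' := memLp_bdd_mul hw' ha.continuous hA
  have hwa' := memLp_bdd_mul ha' (continuous_greenConv hμ) hsup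
  have hprim := ha.mul ((isPrim_greenConv hμ).mul (isPrim_greenConv' hμ))
  have i1 : Integrable fun x => greenConv μ x * a' x * greenConv' μ x := hwa'.integrable_mul hw'
  have i2 : Integrable fun x => a x * greenConv' μ x * greenConv' μ x := haw'.integrable_mul hw'
  have i3 : Integrable fun x => a x * greenConv μ x * greenConv μ x := haw.integrable_mul hw
  have i4 : Integrable fun x => a x * μ x * greenConv μ x :=
    (memLp_bdd_mul hμ ha.continuous hA).integrable_mul hw
  have e : (fun x => a' x * (greenConv μ x * greenConv' μ x) + a x *
      (greenConv' μ x * greenConv' μ x + greenConv μ x * (greenConv μ x - μ x))) =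
      fun x => greenConv μ x * a' x * greenConv' μ x + a x * greenConv' μ x * greenConv' μ x +
        a x * greenConv μ x * greenConv μ x - a x * μ x * greenConv μ x := by
    funext x; ring
  rw [e] at hprim
  have i0 : Integrable fun x => a x * (greenConv μ x * greenConv' μ x) := by
    have : Integrable fun x => a x * greenConv μ x * greenConv' μ x := haw.integrable_mul hw'
    simpa only [mul_assoc] using this
  have i12 : Integrable fun x => greenConv μ x * a' x * greenConv' μ x +
      a x * greenConv' μ x * greenConv' μ x := i1.add i2
  have i123 : Integrable fun x => greenConv μ x * a' x * greenConv' μ x +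
      a x * greenConv' μ x * greenConv' μ x + a x * greenConv μ x * greenConv μ x := i12.add i3
  have h0 := hprim.integral_eq_zero i0 (i123.sub i4)
  rw [integral_sub i123 i4, integral_add i12 i3, integral_add i1 i2] at h0
  have h1 := abs_integral_mul_le hwa' hw'
  have h2 := abs_integral_mul_le haw' hw'
  have h3 := abs_integral_mul_le haw hw
  have g1 : l2norm (fun x => greenConv μ x * a' x) ≤ 2 * (p + q) * A' :=
    (l2norm_bdd_mul_le ha' hsup).trans (by gcongr)
  have g2 := l2norm_bdd_mul_le hw' hA
  have g3 := l2norm_bdd_mul_le hw hA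
  have hA'0 : 0 ≤ A' := (l2norm_nonneg a').trans hA'
  have k1 : l2norm (fun x => greenConv μ x * a' x) * q ≤ 2 * (p + q) * A' * (p + q) := by
    gcongr; linarith
  have k2 : l2norm (fun x => a x * greenConv' μ x) * q ≤ A * q * q := by gcongr
  have k3 : l2norm (fun x => a x * greenConv μ x) * p ≤ A * p * p := by gcongr
  have e0 : ∫ x, a x * μ x * greenConv μ x = (∫ x, greenConv μ x * a' x * greenConv' μ x) +
      (∫ x, a x * greenConv' μ x * greenConv' μ x) + ∫ x, a x * greenConv μ x * greenConv μ x := by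
    linarith
  rw [e0]
  refine (abs_add_three _ _ _).trans ?_
  have : 0 ≤ A * (p * q) := by positivity
  calc _ ≤ 2 * (p + q) * A' * (p + q) + A * q * q + A * p * p :=
        add_le_add (add_le_add (h1.trans k1) (h2.trans k2)) (h3.trans k3)
    _ ≤ _ := by nlinarith

/-- Here `μ w' = (w² - w'²)' / 2`, so one integration by parts removes `μ` altogether and leaves
`a'` against `w'²` and `w²`. Now `a'` must be bounded. -/
theorem abs_integral_mul_greenConv'_le (hμ : MemLp μ 2) (ha : IsPrim a a')
    (hA : ∀ x, |a x| ≤ A) (hca' : Continuous a') (hA' : ∀ x, |a' x| ≤ A') :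
    |∫ x, a x * μ x * greenConv' μ x| ≤
      A' * (l2norm (greenConv μ) + l2norm (greenConv' μ)) ^ 2 := by
  have hw := memLp_greenConv hμ
  have hw' := memLp_greenConv' hμ
  set p := l2norm (greenConv μ) with hp
  set q := l2norm (greenConv' μ) with hq
  have hp0 : 0 ≤ p := l2norm_nonneg _
  have hq0 : 0 ≤ q := l2norm_nonneg _
  have hA'0 : 0 ≤ A' := (abs_nonneg _).trans (hA' 0)
  have hw1 := isPrim_greenConv hμ
  have hw2 := isPrim_greenConv' hμ
  have hprim := ha.mul ((hw1.mul hw1).sub (hw2.mul hw2))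
  have haw := memLp_bdd_mul hw hca' hA'
  have haw' := memLp_bdd_mul hw' hca' hA'
  have i1 : Integrable fun x => a' x * greenConv μ x * greenConv μ x := haw.integrable_mul hw
  have i2 : Integrable fun x => a' x * greenConv' μ x * greenConv' μ x := haw'.integrable_mul hw'
  have i3 : Integrable fun x => a x * μ x * greenConv' μ x :=
    (memLp_bdd_mul hμ ha.continuous hA).integrable_mul hw'
  have e : (fun x => a' x * (greenConv μ x * greenConv μ x - greenConv' μ x * greenConv' μ x) +
      a x * (greenConv' μ x * greenConv μ x + greenConv μ x * greenConv' μ x -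
        ((greenConv μ x - μ x) * greenConv' μ x + greenConv' μ x * (greenConv μ x - μ x)))) =
      fun x => a' x * greenConv μ x * greenConv μ x - a' x * greenConv' μ x * greenConv' μ x +
        2 * (a x * μ x * greenConv' μ x) := by
    funext x; ring
  rw [e] at hprim
  have i0 : Integrable fun x =>
      a x * (greenConv μ x * greenConv μ x - greenConv' μ x * greenConv' μ x) := by
    have : Integrable fun x => a x * greenConv μ x * greenConv μ x -
        a x * greenConv' μ x * greenConv' μ x :=
      ((memLp_bdd_mul hw ha.continuous hA).integrable_mul hw).sub
        ((memLp_bdd_mul hw' ha.continuous hA).integrable_mul hw')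
    refine this.congr (ae_of_all _ fun x => ?_)
    ring
  have i12 : Integrable fun x => a' x * greenConv μ x * greenConv μ x -
      a' x * greenConv' μ x * greenConv' μ x := i1.sub i2
  have h0 := hprim.integral_eq_zero i0 (i12.add (i3.const_mul 2))
  rw [integral_add i12 (i3.const_mul 2), integral_sub i1 i2, integral_const_mul] at h0
  have h1 := abs_integral_mul_le haw hw
  have h2 := abs_integral_mul_le haw' hw'
  have k1 : l2norm (fun x => a' x * greenConv μ x) * p ≤ A' * p * p := by
    gcongr; exact l2norm_bdd_mul_le hw hA'
  have k2 : l2norm (fun x => a' x * greenConv' μ x) * q ≤ A' * q * q := by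
    gcongr; exact l2norm_bdd_mul_le hw' hA'
  have e0 : ∫ x, a x * μ x * greenConv' μ x = ((∫ x, a' x * greenConv' μ x * greenConv' μ x) -
      ∫ x, a' x * greenConv μ x * greenConv μ x) / 2 := by linarith
  rw [e0, abs_div, abs_two]
  have h3 := abs_sub (∫ x, a' x * greenConv' μ x * greenConv' μ x)
    (∫ x, a' x * greenConv μ x * greenConv μ x)
  have : 0 ≤ A' * (p * q) := by positivity
  have : 0 ≤ A' * (p * p) := by positivity
  have : 0 ≤ A' * (q * q) := by positivity
  nlinarith

end

/-! ### Differences of cubic terms and the energy estimate. -/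

section

variable {J₁ J₂ : (ℝ → ℝ) → ℝ → ℝ} {m n m' n' : ℝ → ℝ} {R S : ℝ} {f : ℝ → ℝ}

/-- Reduction of the pairing with a difference of cubic terms to its leading part. -/
theorem abs_integral_cubic_sub_le (h₁ : IsPotential J₁) (h₂ : IsPotential J₂) (hm : MemLp m 2)
    (hn : MemLp n 2) (hm' : MemLp m' 2) (hn' : MemLp n' 2) (hmR : l2norm m ≤ R)
    (hnR : l2norm n ≤ R) (hmR' : l2norm m' ≤ R) (hf : MemLp f 2) {L : ℝ}
    (hL : |∫ x, J₁ m x * J₂ n x * (m x - m' x) * f x| ≤ L)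
    (hQ : MemLp (fun x => (J₁ (fun y => m y - m' y) x * J₂ n x +
      J₁ m' x * J₂ (fun y => n y - n' y) x) * f x) 2)
    (hQS : l2norm (fun x => (J₁ (fun y => m y - m' y) x * J₂ n x +
      J₁ m' x * J₂ (fun y => n y - n' y) x) * f x) ≤ 8 * R * S ^ 2) :
    |∫ x, (cubic J₁ J₂ m n x - cubic J₁ J₂ m' n' x) * f x| ≤ L + 8 * R ^ 2 * S ^ 2 := by
  have hμ := hm.sub hm'
  have hR : 0 ≤ R := (l2norm_nonneg m).trans hmR
  have hcm := memLp_bdd_mul hμ ((h₁.continuous hm).mul (h₂.continuous hn))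
    (h₁.abs_mul_le h₂ hm hn hmR hnR)
  have i1 : Integrable fun x => J₁ m x * J₂ n x * (m x - m' x) * f x := hcm.integrable_mul hf
  have i2 : Integrable fun x => ((J₁ (fun y => m y - m' y) x * J₂ n x +
      J₁ m' x * J₂ (fun y => n y - n' y) x) * f x) * m' x := hQ.integrable_mul hm'
  have e : ∫ x, (cubic J₁ J₂ m n x - cubic J₁ J₂ m' n' x) * f x =
      (∫ x, J₁ m x * J₂ n x * (m x - m' x) * f x) +
        ∫ x, ((J₁ (fun y => m y - m' y) x * J₂ n x +
          J₁ m' x * J₂ (fun y => n y - n' y) x) * f x) * m' x := by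
    rw [← integral_add i1 i2]
    refine integral_congr_ae (ae_of_all _ fun x => ?_)
    simp only
    rw [cubic_sub_eq h₁ h₂ hm hn hm' hn']
    ring
  rw [e]
  refine (abs_add_le _ _).trans (add_le_add hL ((abs_integral_mul_le hQ hm').trans ?_))
  calc _ ≤ 8 * R * S ^ 2 * R := mul_le_mul hQS hmR' (l2norm_nonneg _) (by positivity)
    _ = _ := by ring

/-- In the remainder one difference factor multiplies the test function `f`, and one of the two must
be bounded by the energy. This version takes `f` bounded and the differences in `L²`, for `f = w`;
`lowerOrder_of_memLp` exchanges the roles, for `f = w'`. -/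
theorem lowerOrder_of_bounded (h₁ : IsPotential J₁) (h₂ : IsPotential J₂) (hm : MemLp m 2)
    (hn : MemLp n 2) (hm' : MemLp m' 2) (hn' : MemLp n' 2)
    (hnR : l2norm n ≤ R) (hmR' : l2norm m' ≤ R) (hfc : Continuous f)
    (hfS : ∀ x, |f x| ≤ 2 * S) (hμ : l2norm (J₁ fun y => m y - m' y) ≤ S)
    (hν : l2norm (J₂ fun y => n y - n' y) ≤ S) :
    MemLp (fun x => (J₁ (fun y => m y - m' y) x * J₂ n x +
      J₁ m' x * J₂ (fun y => n y - n' y) x) * f x) 2 ∧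
    l2norm (fun x => (J₁ (fun y => m y - m' y) x * J₂ n x +
      J₁ m' x * J₂ (fun y => n y - n' y) x) * f x) ≤ 8 * R * S ^ 2 := by
  have hb1 : ∀ x, |f x * J₂ n x| ≤ 2 * S * (2 * R) := fun x =>
    abs_mul_le_of_le (hfS x) ((h₂.abs_le hn x).trans (by linarith))
  have hb2 : ∀ x, |f x * J₁ m' x| ≤ 2 * S * (2 * R) := fun x =>
    abs_mul_le_of_le (hfS x) ((h₁.abs_le hm' x).trans (by linarith))
  have p1 := memLp_bdd_mul (h₁.memLp (hm.sub hm')) (hfc.mul (h₂.continuous hn)) hb1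
  have p2 := memLp_bdd_mul (h₂.memLp (hn.sub hn')) (hfc.mul (h₁.continuous hm')) hb2
  have e : (fun x => (J₁ (fun y => m y - m' y) x * J₂ n x +
      J₁ m' x * J₂ (fun y => n y - n' y) x) * f x) =
      fun x => f x * J₂ n x * J₁ (fun y => m y - m' y) x +
        f x * J₁ m' x * J₂ (fun y => n y - n' y) x := by funext x; ring
  rw [e]
  have hS : 0 ≤ S := (l2norm_nonneg _).trans hμ
  have hR : 0 ≤ R := (l2norm_nonneg n).trans hnR
  refine ⟨p1.add p2, (l2norm_add_le p1 p2).trans ?_⟩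
  have q1 := l2norm_bdd_mul_le (h₁.memLp (hm.sub hm')) hb1
  have q2 := l2norm_bdd_mul_le (h₂.memLp (hn.sub hn')) hb2
  calc _ ≤ 2 * S * (2 * R) * S + 2 * S * (2 * R) * S :=
        add_le_add (q1.trans (mul_le_mul_of_nonneg_left hμ (by positivity)))
          (q2.trans (mul_le_mul_of_nonneg_left hν (by positivity)))
    _ = _ := by ring

theorem lowerOrder_of_memLp (h₁ : IsPotential J₁) (h₂ : IsPotential J₂) (hm : MemLp m 2)
    (hn : MemLp n 2) (hm' : MemLp m' 2) (hn' : MemLp n' 2)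
    (hnR : l2norm n ≤ R) (hmR' : l2norm m' ≤ R) (hf : MemLp f 2)
    (hfS : l2norm f ≤ S) (hμ : ∀ x, |J₁ (fun y => m y - m' y) x| ≤ 2 * S)
    (hν : ∀ x, |J₂ (fun y => n y - n' y) x| ≤ 2 * S) :
    MemLp (fun x => (J₁ (fun y => m y - m' y) x * J₂ n x +
      J₁ m' x * J₂ (fun y => n y - n' y) x) * f x) 2 ∧
    l2norm (fun x => (J₁ (fun y => m y - m' y) x * J₂ n x +
      J₁ m' x * J₂ (fun y => n y - n' y) x) * f x) ≤ 8 * R * S ^ 2 := by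
  have hS : 0 ≤ S := (l2norm_nonneg _).trans hfS
  have hR : 0 ≤ R := (l2norm_nonneg n).trans hnR
  have hb : ∀ x, |J₁ (fun y => m y - m' y) x * J₂ n x +
      J₁ m' x * J₂ (fun y => n y - n' y) x| ≤ 8 * R * S := fun x => by
    refine (abs_add_le _ _).trans ?_
    have h1 := abs_mul_le_of_le (hμ x) ((h₂.abs_le hn x).trans (by linarith : _ ≤ 2 * R))
    have h2 := abs_mul_le_of_le ((h₁.abs_le hm' x).trans (by linarith : _ ≤ 2 * R)) (hν x)
    linarith
  refine ⟨memLp_bdd_mul hf (((h₁.continuous (hm.sub hm')).mul (h₂.continuous hn)).add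
    ((h₁.continuous hm').mul (h₂.continuous (hn.sub hn')))) hb,
    (l2norm_bdd_mul_le hf hb).trans ?_⟩
  calc _ ≤ 8 * R * S * S := mul_le_mul_of_nonneg_left hfS (by positivity)
    _ = _ := by ring

/-- The energy estimate behind uniqueness. -/
theorem abs_integral_flux_sub_le (b : ℝ) (hm : MemLp m 2) (hn : MemLp n 2) (hm' : MemLp m' 2)
    (hn' : MemLp n' 2) (hmR : l2norm m ≤ R) (hnR : l2norm n ≤ R) (hmR' : l2norm m' ≤ R)
    (hμS : l2norm (greenConv fun y => m y - m' y) + l2norm (greenConv' fun y => m y - m' y) ≤ S)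
    (hνS : l2norm (greenConv fun y => n y - n' y) + l2norm (greenConv' fun y => n y - n' y) ≤ S) :
    |∫ x, (flux b m n x - flux b m' n' x) * (m x - m' x)| ≤ (3 + |b|) * (32 * R ^ 2) * S ^ 2 := by
  have hμ : MemLp (fun y => m y - m' y) 2 := hm.sub hm'
  have hν : MemLp (fun y => n y - n' y) 2 := hn.sub hn'
  set μ : ℝ → ℝ := fun y => m y - m' y with hμdef
  set ν : ℝ → ℝ := fun y => n y - n' y with hνdef
  have hw := memLp_greenConv hμ
  have hw' := memLp_greenConv' hμ
  have n1 := l2norm_nonneg (greenConv μ)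
  have n2 := l2norm_nonneg (greenConv' μ)
  have n3 := l2norm_nonneg (greenConv ν)
  have n4 := l2norm_nonneg (greenConv' ν)
  have hsμ : ∀ x, |greenConv μ x| ≤ 2 * S := fun x =>
    (abs_greenConv_le_energy hμ x).trans (by linarith)
  have hsν : ∀ x, |greenConv ν x| ≤ 2 * S := fun x =>
    (abs_greenConv_le_energy hν x).trans (by linarith)
  have hR : 0 ≤ R := (l2norm_nonneg m).trans hmR
  have P := isPotential_greenConv
  have P' := isPotential_greenConv'
  have hsq : (l2norm (greenConv μ) + l2norm (greenConv' μ)) ^ 2 ≤ S ^ 2 := by gcongr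
  -- The derivative of `(p * f)(p' * g)`. It contains `(p * g) - g`, the second derivative of `p *
  -- g`, and is therefore only square integrable; the coefficient `u v` in `t3` has a bounded
  -- derivative.
  have grad : ∀ {f g : ℝ → ℝ}, MemLp f 2 → MemLp g 2 → l2norm f ≤ R → l2norm g ≤ R →
      MemLp (fun x => greenConv' f x * greenConv' g x +
        greenConv f x * (greenConv g x - g x)) 2 ∧
      l2norm (fun x => greenConv' f x * greenConv' g x +
        greenConv f x * (greenConv g x - g x)) ≤ 10 * R ^ 2 := by
    intro f g hf hg hfR hgR
    have b1 : ∀ x, |greenConv' f x| ≤ 2 * R := fun x => (abs_greenConv'_le hf x).trans (by linarith)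
    have b2 : ∀ x, |greenConv f x| ≤ 2 * R := fun x => (abs_greenConv_le hf x).trans (by linarith)
    have g2 : MemLp (fun x => greenConv g x - g x) 2 := (memLp_greenConv hg).sub hg
    have q1 := memLp_bdd_mul (memLp_greenConv' hg) (continuous_greenConv' hf) b1
    have q2 := memLp_bdd_mul g2 (continuous_greenConv hf) b2
    refine ⟨q1.add q2, (l2norm_add_le q1 q2).trans ?_⟩
    have c1 := l2norm_greenConv'_le hg
    have c2 := (l2norm_sub_le (memLp_greenConv hg) hg).trans
      (add_le_add_left (l2norm_greenConv_le hg) _)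
    calc _ ≤ 2 * R * (2 * R) + 2 * R * (3 * R) := add_le_add
          ((l2norm_bdd_mul_le (memLp_greenConv' hg) b1).trans
            (mul_le_mul_of_nonneg_left (by linarith) (by positivity)))
          ((l2norm_bdd_mul_le g2 b2).trans
            (mul_le_mul_of_nonneg_left (by linarith) (by positivity)))
      _ = _ := by ring
  have t1 : |∫ x, (cubic greenConv' greenConv m n x - cubic greenConv' greenConv m' n' x) *
      greenConv μ x| ≤ 24 * R ^ 2 * S ^ 2 + 8 * R ^ 2 * S ^ 2 := by
    obtain ⟨l1, l2⟩ := lowerOrder_of_bounded P' P hm hn hm' hn' hnR hmR'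
      (continuous_greenConv hμ) hsμ (by linarith) (by linarith)
    refine abs_integral_cubic_sub_le P' P hm hn hm' hn' hmR hnR hmR' hw ?_ l1 l2
    obtain ⟨d1, d2⟩ := grad hn hm hnR hmR
    have hp := (isPrim_greenConv' hm).mul (isPrim_greenConv hn)
    have e : (fun x => (greenConv m x - m x) * greenConv n x + greenConv' m x * greenConv' n x) =
        fun x => greenConv' n x * greenConv' m x + greenConv n x * (greenConv m x - m x) := by
      funext x; ring
    rw [e] at hp
    refine (abs_integral_mul_greenConv_le hμ hp (P'.abs_mul_le P hm hn hmR hnR) d1 d2).trans ?_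
    calc _ ≤ (4 * R ^ 2 + 2 * (10 * R ^ 2)) * S ^ 2 := by gcongr
      _ = _ := by ring
  have t2 : |∫ x, (cubic greenConv greenConv' m n x - cubic greenConv greenConv' m' n' x) *
      greenConv μ x| ≤ 24 * R ^ 2 * S ^ 2 + 8 * R ^ 2 * S ^ 2 := by
    obtain ⟨l1, l2⟩ := lowerOrder_of_bounded P P' hm hn hm' hn' hnR hmR'
      (continuous_greenConv hμ) hsμ (by linarith) (by linarith)
    refine abs_integral_cubic_sub_le P P' hm hn hm' hn' hmR hnR hmR' hw ?_ l1 l2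
    obtain ⟨d1, d2⟩ := grad hm hn hmR hnR
    have hp := (isPrim_greenConv hm).mul (isPrim_greenConv' hn)
    refine (abs_integral_mul_greenConv_le hμ hp (P.abs_mul_le P' hm hn hmR hnR) d1 d2).trans ?_
    calc _ ≤ (4 * R ^ 2 + 2 * (10 * R ^ 2)) * S ^ 2 := by gcongr
      _ = _ := by ring
  have t3 : |∫ x, (cubic greenConv greenConv m n x - cubic greenConv greenConv m' n' x) *
      greenConv' μ x| ≤ 8 * R ^ 2 * S ^ 2 + 8 * R ^ 2 * S ^ 2 := by
    obtain ⟨l1, l2⟩ := lowerOrder_of_memLp P P hm hn hm' hn' hnR hmR' hw' (by linarith) hsμ hsν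
    refine abs_integral_cubic_sub_le P P hm hn hm' hn' hmR hnR hmR' hw' ?_ l1 l2
    have hp := (isPrim_greenConv hm).mul (isPrim_greenConv hn)
    refine (abs_integral_mul_greenConv'_le hμ hp (P.abs_mul_le P hm hn hmR hnR)
      (((continuous_greenConv' hm).mul (continuous_greenConv hn)).add
        ((continuous_greenConv hm).mul (continuous_greenConv' hn)))
      (fun x => (abs_add_le _ _).trans (add_le_add (P'.abs_mul_le P hm hn hmR hnR x)
        (P.abs_mul_le P' hm hn hmR hnR x)))).trans ?_
    calc _ ≤ (4 * R ^ 2 + 4 * R ^ 2) * S ^ 2 := by gcongr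
      _ = _ := by ring
  have c1 : MemLp (fun y => cubic greenConv' greenConv m n y - cubic greenConv' greenConv m' n' y) 2 :=
    (memLp_cubic₁ hm hn).sub (memLp_cubic₁ hm' hn')
  have c2 : MemLp (fun y => cubic greenConv greenConv' m n y - cubic greenConv greenConv' m' n' y) 2 :=
    (memLp_cubic₂ hm hn).sub (memLp_cubic₂ hm' hn')
  have c3 : MemLp (fun y => cubic greenConv greenConv m n y - cubic greenConv greenConv m' n' y) 2 :=
    (memLp_cubic₃ hm hn).sub (memLp_cubic₃ hm' hn')
  have j1 : Integrable fun x => greenConv (fun y => cubic greenConv' greenConv m n y -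
      cubic greenConv' greenConv m' n' y) x * μ x := (memLp_greenConv c1).integrable_mul hμ
  have j2 : Integrable fun x => greenConv (fun y => cubic greenConv greenConv' m n y -
      cubic greenConv greenConv' m' n' y) x * μ x := (memLp_greenConv c2).integrable_mul hμ
  have j3 : Integrable fun x => greenConv' (fun y => cubic greenConv greenConv m n y -
      cubic greenConv greenConv m' n' y) x * μ x := (memLp_greenConv' c3).integrable_mul hμ
  have e : ∫ x, (flux b m n x - flux b m' n' x) * μ x =
      (1 - b) * (∫ x, (cubic greenConv' greenConv m n x - cubic greenConv' greenConv m' n' x) *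
        greenConv μ x) +
      (∫ x, (cubic greenConv greenConv' m n x - cubic greenConv greenConv' m' n' x) *
        greenConv μ x) +
      ∫ x, (cubic greenConv greenConv m n x - cubic greenConv greenConv m' n' x) *
        greenConv' μ x := by
    -- Symmetry of `p *` and antisymmetry of `p' *` move the convolutions onto `μ`, so the cubic
    -- differences are tested against `w` and `w'`.
    have s3 := integral_greenConv'_mul c3 hμ
    have j12 : Integrable fun x => (1 - b) * (greenConv (fun y => cubic greenConv' greenConv m n y -
        cubic greenConv' greenConv m' n' y) x * μ x) + greenConv (fun y =>
        cubic greenConv greenConv' m n y - cubic greenConv greenConv' m' n' y) x * μ x :=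
      (j1.const_mul _).add j2
    rw [← integral_greenConv_mul c1 hμ, ← integral_greenConv_mul c2 hμ,
      ← neg_eq_iff_eq_neg.2 s3, ← sub_eq_add_neg, ← integral_const_mul,
      ← integral_add (j1.const_mul _) j2, ← integral_sub j12 j3]
    refine integral_congr_ae (ae_of_all _ fun x => ?_)
    simp only
    rw [flux_sub_eq b hm hn hm' hn']
    ring
  rw [e]
  have hb : |1 - b| ≤ 1 + |b| := (abs_sub _ _).trans (by simp)
  refine (abs_add_three _ _ _).trans ?_
  have u1 := abs_mul_le_of_le hb t1
  have : 0 ≤ R ^ 2 * S ^ 2 := by positivity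
  calc _ ≤ (1 + |b|) * (24 * R ^ 2 * S ^ 2 + 8 * R ^ 2 * S ^ 2) +
        (24 * R ^ 2 * S ^ 2 + 8 * R ^ 2 * S ^ 2) + (8 * R ^ 2 * S ^ 2 + 8 * R ^ 2 * S ^ 2) :=
        add_le_add (add_le_add u1 t2) t3
    _ ≤ _ := by nlinarith

end

/-! ### Solutions in terms of their momenta, and uniqueness -/

theorem ContinuousOn.of_norm_sub_le {E F G : Type*} [NormedAddCommGroup E] [NormedAddCommGroup F]
    [NormedAddCommGroup G] {f : ℝ → E} {g : ℝ → F} {h : ℝ → G} {s : Set ℝ} {C : ℝ}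
    (hg : ContinuousOn g s) (hh : ContinuousOn h s)
    (H : ∀ x ∈ s, ∀ y ∈ s, ‖f x - f y‖ ≤ C * (‖g x - g y‖ + ‖h x - h y‖)) : ContinuousOn f s := by
  intro y hy
  rw [ContinuousWithinAt, tendsto_iff_norm_sub_tendsto_zero]
  have h1 := tendsto_iff_norm_sub_tendsto_zero.1 (hg y hy)
  have h2 := tendsto_iff_norm_sub_tendsto_zero.1 (hh y hy)
  have h3 := (h1.add h2).const_mul C
  rw [add_zero, mul_zero] at h3
  refine squeeze_zero' (Eventually.of_forall fun _ => norm_nonneg _) ?_ h3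
  filter_upwards [self_mem_nhdsWithin] with x hx using H x hx y hy

theorem norm_toLpR_sub {f g : ℝ → ℝ} (hf : MemLp f 2) (hg : MemLp g 2) :
    ‖toLpR f - toLpR g‖ = l2norm fun x => f x - g x := by
  rw [← toLpR_sub hf hg]
  exact norm_toLpR (hf.sub hg)

theorem flux_eq (b : ℝ) {m n : ℝ → ℝ} (hm : MemLp m 2) (hn : MemLp n 2) (x : ℝ) :
    -(greenConv m x * greenConv n x * deriv (greenConv m) x +
      (green ⋆[ContinuousLinearMap.mul ℝ ℝ] bForcing b (greenConv m) (greenConv n)) x) =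
      flux b m n x := by
  obtain ⟨h1, h2⟩ := bForcing_identity b hm hn
  have e : (fun y => (greenConv' m y * greenConv n y + greenConv m y * greenConv' n y
      - b * (greenConv n y * greenConv' m y)) * m y) =
      fun y => (1 - b) * cubic greenConv' greenConv m n y + cubic greenConv greenConv' m n y := by
    funext y; simp only [cubic]; ring
  rw [convolution_green h1, deriv_greenConv hm, h2 x, neg_sub, e,
    greenConv_add ((memLp_cubic₁ hm hn).const_mul _) (memLp_cubic₂ hm hn), greenConv_const_mul]
  rfl

/-- The equations for the momenta `m = u - u_xx`, `n = v - v_xx`, in `C([0, T); L²)`. -/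
structure IsMomentumCurve (b : ℝ) (T : ℝ≥0∞) (m n : ℝ → ℝ → ℝ) : Prop where
  memLp_m : ∀ t ∈ timeInterval T, MemLp (m t) 2
  memLp_n : ∀ t ∈ timeInterval T, MemLp (n t) 2
  continuousOn_m : ContinuousOn (fun t => toLpR (m t)) (timeInterval T)
  continuousOn_n : ContinuousOn (fun t => toLpR (n t)) (timeInterval T)
  hasDeriv_m : ∀ t ∈ timeInterval T, ∀ x, HasDerivWithinAt (fun s => greenConv (m s) x)
    (flux b (m t) (n t) x) (timeInterval T) t
  hasDeriv_n : ∀ t ∈ timeInterval T, ∀ x, HasDerivWithinAt (fun s => greenConv (n s) x)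
    (flux b (n t) (m t) x) (timeInterval T) t

/-- A momentum is chosen separately for each time. Continuity in `L²` survives because the `L²` norm
of a difference of momenta is bounded by the `B^2_{2,1}` norm of the difference of the potentials.
-/
theorem GengXue.IsBesovCurve.exists_momentum {T : ℝ≥0∞} {u : ℝ → ℝ → ℝ} (h : IsBesovCurve T u) :
    ∃ m : ℝ → ℝ → ℝ, (∀ t ∈ timeInterval T, MemLp (m t) 2 ∧ u t = greenConv (m t)) ∧
      ContinuousOn (fun t => toLpR (m t)) (timeInterval T) := by
  have H : ∀ t, ∃ m : ℝ → ℝ, t ∈ timeInterval T → MemLp m 2 ∧ u t = greenConv m := fun t => by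
    by_cases ht : t ∈ timeInterval T
    · obtain ⟨m, hm⟩ := Besov.exists_eq_greenConv (h.continuous_space t ht) (h.mem t ht)
      exact ⟨m, fun _ => hm⟩
    · exact ⟨0, fun h => absurd h ht⟩
  choose m hm using H
  refine ⟨m, fun t ht => hm t ht, fun t ht => ?_⟩
  rw [ContinuousWithinAt, tendsto_iff_norm_sub_tendsto_zero]
  have h1 := ENNReal.Tendsto.const_mul (a := 12) (h.continuous_time t ht) (Or.inr (by simp))
  rw [mul_zero] at h1
  have h2 := (ENNReal.tendsto_toReal ENNReal.zero_ne_top).comp h1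
  rw [ENNReal.toReal_zero] at h2
  refine squeeze_zero' (Eventually.of_forall fun _ => norm_nonneg _) ?_ h2
  have hfin := h1.eventually (gt_mem_nhds ENNReal.zero_lt_top)
  filter_upwards [self_mem_nhdsWithin, hfin] with s hs hlt
  obtain ⟨hs1, hs2⟩ := hm s hs
  obtain ⟨ht1, ht2⟩ := hm t ht
  rw [norm_toLpR_sub hs1 ht1]
  have h3 := Besov.ofReal_l2norm_le_fnNorm (hs1.sub ht1)
  have e : greenConv (m s - m t) = fun x => u s x - u t x := by
    funext x
    rw [hs2, ht2]
    exact greenConv_sub hs1 ht1 x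
  rw [e] at h3
  have h4 := ENNReal.toReal_mono hlt.ne h3
  rwa [ENNReal.toReal_ofReal (l2norm_nonneg _)] at h4

theorem GengXue.IsSolution.exists_momentum {b : ℝ} {u₀ v₀ : ℝ → ℝ} {T : ℝ≥0∞} {u v : ℝ → ℝ → ℝ}
    (h : IsSolution (bForcing b) u₀ v₀ T u v) :
    ∃ m n : ℝ → ℝ → ℝ, IsMomentumCurve b T m n ∧
      ∀ t ∈ timeInterval T, u t = greenConv (m t) ∧ v t = greenConv (n t) := by
  obtain ⟨m, hm, hmc⟩ := h.curve_u.exists_momentum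
  obtain ⟨n, hn, hnc⟩ := h.curve_v.exists_momentum
  refine ⟨m, n, ⟨fun t ht => (hm t ht).1, fun t ht => (hn t ht).1, hmc, hnc, fun t ht x => ?_,
    fun t ht x => ?_⟩, fun t ht => ⟨(hm t ht).2, (hn t ht).2⟩⟩
  · rw [← flux_eq b (hm t ht).1 (hn t ht).1, ← (hm t ht).2, ← (hn t ht).2]
    refine (h.eq_u t ht x).congr_of_mem (fun s hs => ?_) ht
    rw [(hm s hs).2]
  · rw [← flux_eq b (hn t ht).1 (hm t ht).1, ← (hm t ht).2, ← (hn t ht).2]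
    refine (h.eq_v t ht x).congr_of_mem (fun s hs => ?_) ht
    rw [(hn s hs).2]

theorem Icc_subset_timeInterval {T : ℝ≥0∞} {t : ℝ} (ht : t ∈ timeInterval T) :
    Set.Icc 0 t ⊆ timeInterval T := fun _ hs =>
  ⟨hs.1, (ENNReal.ofReal_le_ofReal hs.2).trans_lt ht.2⟩

theorem timeInterval_mem_nhds {T : ℝ≥0∞} {t : ℝ} (h0 : 0 < t) (ht : t ∈ timeInterval T) :
    timeInterval T ∈ 𝓝 t := by
  have h1 : ContinuousAt ENNReal.ofReal t := ENNReal.continuous_ofReal.continuousAt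
  filter_upwards [lt_mem_nhds h0, h1.eventually (gt_mem_nhds ht.2)] with s hs hs'
  exact ⟨hs.le, hs'⟩

namespace IsMomentumCurve

variable {b : ℝ} {T : ℝ≥0∞} {m n m' n' : ℝ → ℝ → ℝ}

theorem symm (h : IsMomentumCurve b T m n) : IsMomentumCurve b T n m :=
  ⟨h.memLp_n, h.memLp_m, h.continuousOn_n, h.continuousOn_m, h.hasDeriv_n, h.hasDeriv_m⟩

theorem exists_bound (h : IsMomentumCurve b T m n) {t : ℝ} (ht : t ∈ timeInterval T) :
    ∃ R, ∀ s ∈ Set.Icc 0 t, l2norm (m s) ≤ R ∧ l2norm (n s) ≤ R := by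
  have hsub := Icc_subset_timeInterval ht
  obtain ⟨R₁, h1⟩ := isCompact_Icc.exists_bound_of_continuousOn (h.continuousOn_m.mono hsub)
  obtain ⟨R₂, h2⟩ := isCompact_Icc.exists_bound_of_continuousOn (h.continuousOn_n.mono hsub)
  refine ⟨max R₁ R₂, fun s hs => ⟨?_, ?_⟩⟩
  · rw [← norm_toLpR (h.memLp_m s (hsub hs))]
    exact (h1 s hs).trans (le_max_left _ _)
  · rw [← norm_toLpR (h.memLp_n s (hsub hs))]
    exact (h2 s hs).trans (le_max_right _ _)

/-- The derivative of the energy of the difference of two solutions. -/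
theorem hasDerivAt_energy (h : IsMomentumCurve b T m n) (h' : IsMomentumCurve b T m' n') {R t : ℝ}
    (ht : t ∈ timeInterval T)
    (hR : ∀ s ∈ Set.Icc 0 t, l2norm (m s) ≤ R ∧ l2norm (n s) ≤ R)
    (hR' : ∀ s ∈ Set.Icc 0 t, l2norm (m' s) ≤ R ∧ l2norm (n' s) ≤ R) {s : ℝ}
    (hs : s ∈ Set.Ioo 0 t) :
    HasDerivAt (fun s => ∫ x, greenConv (fun y => m s y - m' s y) x * (m s x - m' s x))
      (2 * ∫ x, (flux b (m s) (n s) x - flux b (m' s) (n' s) x) * (m s x - m' s x)) s := by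
  have hsub := Icc_subset_timeInterval ht
  have hsub' : Set.Ioo 0 t ⊆ timeInterval T := Set.Ioo_subset_Icc_self.trans hsub
  have hμ : ∀ q ∈ timeInterval T, MemLp (fun y => m q y - m' q y) 2 := fun q hq =>
    (h.memLp_m q hq).sub (h'.memLp_m q hq)
  have hr : ∀ q ∈ timeInterval T, MemLp (fun x => flux b (m q) (n q) x - flux b (m' q) (n' q) x) 2 :=
    fun q hq => (memLp_flux b (h.memLp_m q hq) (h.memLp_n q hq)).sub
      (memLp_flux b (h'.memLp_m q hq) (h'.memLp_n q hq))
  have hMc : ContinuousOn (fun q => toLpR fun y => m q y - m' q y) (timeInterval T) :=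
    (h.continuousOn_m.sub h'.continuousOn_m).congr fun q hq =>
      toLpR_sub (h.memLp_m q hq) (h'.memLp_m q hq)
  have hflux : ∀ {m n : ℝ → ℝ → ℝ}, IsMomentumCurve b T m n →
      (∀ s ∈ Set.Icc 0 t, l2norm (m s) ≤ R ∧ l2norm (n s) ≤ R) →
      ContinuousOn (fun q => toLpR (flux b (m q) (n q))) (Set.Ioo 0 t) := by
    intro m n h hR
    refine ContinuousOn.of_norm_sub_le (C := (3 + |b|) * (16 * R ^ 2))
      (h.continuousOn_m.mono hsub') (h.continuousOn_n.mono hsub') fun x hx y hy => ?_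
    have a1 := h.memLp_m x (hsub' hx)
    have a2 := h.memLp_n x (hsub' hx)
    have a3 := h.memLp_m y (hsub' hy)
    have a4 := h.memLp_n y (hsub' hy)
    rw [norm_toLpR_sub (memLp_flux b a1 a2) (memLp_flux b a3 a4), norm_toLpR_sub a1 a3,
      norm_toLpR_sub a2 a4]
    have b1 := hR x (Set.Ioo_subset_Icc_self hx)
    have b2 := hR y (Set.Ioo_subset_Icc_self hy)
    exact l2norm_flux_sub_le b a1 a2 a3 a4 b1.1 b1.2 b2.1
  have hA := hasDerivAt_toLpR_of_pointwise
    (w := fun q => greenConv fun y => m q y - m' q y)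
    (r := fun q x => flux b (m q) (n q) x - flux b (m' q) (n' q) x)
    (C := (3 + |b|) * (8 * R ^ 3) + (3 + |b|) * (8 * R ^ 3))
    (fun q hq => memLp_greenConv (hμ q (hsub' hq))) (fun q hq => hr q (hsub' hq))
    (((hflux h hR).sub (hflux h' hR')).congr fun q hq => toLpR_sub
      (memLp_flux b (h.memLp_m q (hsub' hq)) (h.memLp_n q (hsub' hq)))
      (memLp_flux b (h'.memLp_m q (hsub' hq)) (h'.memLp_n q (hsub' hq))))
    (fun q hq x => (abs_sub _ _).trans (add_le_add
      (abs_flux_le b (h.memLp_m q (hsub' hq)) (h.memLp_n q (hsub' hq))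
        (hR q (Set.Ioo_subset_Icc_self hq)).1 (hR q (Set.Ioo_subset_Icc_self hq)).2 x)
      (abs_flux_le b (h'.memLp_m q (hsub' hq)) (h'.memLp_n q (hsub' hq))
        (hR' q (Set.Ioo_subset_Icc_self hq)).1 (hR' q (Set.Ioo_subset_Icc_self hq)).2 x)))
    (fun q hq x => by
      have hn := timeInterval_mem_nhds hq.1 (hsub' hq)
      refine (((h.hasDeriv_m q (hsub' hq) x).hasDerivAt hn).sub
        ((h'.hasDeriv_m q (hsub' hq) x).hasDerivAt hn)).congr_of_eventuallyEq ?_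
      filter_upwards [hn] with p hp using greenConv_sub (h.memLp_m p hp) (h'.memLp_m p hp) x) hs
  have hn := timeInterval_mem_nhds hs.1 (hsub' hs)
  -- The momentum difference is only continuous in `L²`, while its potential is differentiable
  -- there; symmetry of `p *` is what the product rule for such a pair requires.
  have key := hasDerivAt_inner_of_symm hA (hMc.continuousAt hn) (by
    filter_upwards [hn] with q hq
    rw [inner_toLpR (memLp_greenConv (hμ s (hsub' hs))) (hμ q hq),
      inner_toLpR (memLp_greenConv (hμ q hq)) (hμ s (hsub' hs)),
      integral_greenConv_mul (hμ s (hsub' hs)) (hμ q hq)]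
    exact integral_congr_ae (ae_of_all _ fun x => mul_comm _ _))
  rw [inner_toLpR (hr s (hsub' hs)) (hμ s (hsub' hs))] at key
  refine key.congr_of_eventuallyEq ?_
  filter_upwards [hn] with q hq
  rw [inner_toLpR (memLp_greenConv (hμ q hq)) (hμ q hq)]

theorem continuousOn_energy (h : IsMomentumCurve b T m n) (h' : IsMomentumCurve b T m' n') :
    ContinuousOn (fun s => ∫ x, greenConv (fun y => m s y - m' s y) x * (m s x - m' s x))
      (timeInterval T) := by
  have hμ : ∀ q ∈ timeInterval T, MemLp (fun y => m q y - m' q y) 2 := fun q hq =>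
    (h.memLp_m q hq).sub (h'.memLp_m q hq)
  have hMc : ContinuousOn (fun q => toLpR fun y => m q y - m' q y) (timeInterval T) :=
    (h.continuousOn_m.sub h'.continuousOn_m).congr fun q hq =>
      toLpR_sub (h.memLp_m q hq) (h'.memLp_m q hq)
  have hAc : ContinuousOn (fun q => toLpR (greenConv fun y => m q y - m' q y)) (timeInterval T) := by
    refine ContinuousOn.of_norm_sub_le (C := 2) hMc hMc fun x hx y hy => ?_
    have hd : MemLp (fun z => (m x z - m' x z) - (m y z - m' y z)) 2 := (hμ x hx).sub (hμ y hy)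
    rw [norm_toLpR_sub (memLp_greenConv (hμ x hx)) (memLp_greenConv (hμ y hy)),
      norm_toLpR_sub (hμ x hx) (hμ y hy)]
    have e : (fun z => greenConv (fun y => m x y - m' x y) z -
        greenConv (fun z => m y z - m' y z) z) =
        greenConv fun z => (m x z - m' x z) - (m y z - m' y z) :=
      funext fun z => (greenConv_sub (hμ x hx) (hμ y hy) z).symm
    rw [e]
    have := l2norm_greenConv_le hd
    have := l2norm_nonneg fun z => (m x z - m' x z) - (m y z - m' y z)
    linarith
  refine (hAc.inner (𝕜 := ℝ) hMc).congr fun q hq => ?_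
  exact (inner_toLpR (memLp_greenConv (hμ q hq)) (hμ q hq)).symm

/-- Uniqueness for the Cauchy problem. -/
theorem unique (h : IsMomentumCurve b T m n) (h' : IsMomentumCurve b T m' n')
    (hm0 : greenConv (m 0) = greenConv (m' 0)) (hn0 : greenConv (n 0) = greenConv (n' 0)) {t : ℝ}
    (ht : t ∈ timeInterval T) :
    greenConv (m t) = greenConv (m' t) ∧ greenConv (n t) = greenConv (n' t) := by
  obtain ⟨R₁, hR₁⟩ := h.exists_bound ht
  obtain ⟨R₂, hR₂⟩ := h'.exists_bound ht
  set R := max R₁ R₂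
  have hR : ∀ s ∈ Set.Icc 0 t, l2norm (m s) ≤ R ∧ l2norm (n s) ≤ R := fun s hs =>
    ⟨(hR₁ s hs).1.trans (le_max_left _ _), (hR₁ s hs).2.trans (le_max_left _ _)⟩
  have hR' : ∀ s ∈ Set.Icc 0 t, l2norm (m' s) ≤ R ∧ l2norm (n' s) ≤ R := fun s hs =>
    ⟨(hR₂ s hs).1.trans (le_max_right _ _), (hR₂ s hs).2.trans (le_max_right _ _)⟩
  have hsub := Icc_subset_timeInterval ht
  have hμ : ∀ q ∈ timeInterval T, MemLp (fun y => m q y - m' q y) 2 := fun q hq =>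
    (h.memLp_m q hq).sub (h'.memLp_m q hq)
  have hν : ∀ q ∈ timeInterval T, MemLp (fun y => n q y - n' q y) 2 := fun q hq =>
    (h.memLp_n q hq).sub (h'.memLp_n q hq)
  set E : ℝ → ℝ := fun s => (∫ x, greenConv (fun y => m s y - m' s y) x * (m s x - m' s x)) +
    ∫ x, greenConv (fun y => n s y - n' s y) x * (n s x - n' s x) with hE
  have hEeq : ∀ s ∈ timeInterval T, E s =
      (l2norm (greenConv fun y => m s y - m' s y) ^ 2 +
        l2norm (greenConv' fun y => m s y - m' s y) ^ 2) +
      (l2norm (greenConv fun y => n s y - n' s y) ^ 2 +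
        l2norm (greenConv' fun y => n s y - n' s y) ^ 2) := fun s hs => by
    rw [hE, ← integral_greenConv_mul_self (hμ s hs), ← integral_greenConv_mul_self (hν s hs)]
  -- Each component contributes `2 · 32 R²` times `S²`, with `S` the sum of all four norms; two
  -- components and `S² ≤ 4 E` give `512`.
  set K := (3 + |b|) * (512 * R ^ 2) with hK
  set E' : ℝ → ℝ := fun s =>
    2 * (∫ x, (flux b (m s) (n s) x - flux b (m' s) (n' s) x) * (m s x - m' s x)) +
    2 * ∫ x, (flux b (n s) (m s) x - flux b (n' s) (m' s) x) * (n s x - n' s x) with hE'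
  have hd : ∀ s ∈ Set.Ioo 0 t, HasDerivAt E (E' s) s := fun s hs =>
    (h.hasDerivAt_energy h' ht hR hR' hs).add (h.symm.hasDerivAt_energy h'.symm ht
      (fun s hs => (hR s hs).symm) (fun s hs => (hR' s hs).symm) hs)
  have hle : ∀ s ∈ Set.Ioo 0 t, E' s ≤ K * E s := by
    intro s hs
    have hs1 := Set.Ioo_subset_Icc_self hs
    have hs2 := hsub hs1
    have n1 := l2norm_nonneg (greenConv fun y => m s y - m' s y)
    have n2 := l2norm_nonneg (greenConv' fun y => m s y - m' s y)
    have n3 := l2norm_nonneg (greenConv fun y => n s y - n' s y)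
    have n4 := l2norm_nonneg (greenConv' fun y => n s y - n' s y)
    have b1 := (le_abs_self _).trans (abs_integral_flux_sub_le b (h.memLp_m s hs2)
      (h.memLp_n s hs2) (h'.memLp_m s hs2) (h'.memLp_n s hs2) (hR s hs1).1 (hR s hs1).2
      (hR' s hs1).1
      (by linarith : _ ≤ l2norm (greenConv fun y => m s y - m' s y) +
        l2norm (greenConv' fun y => m s y - m' s y) +
        (l2norm (greenConv fun y => n s y - n' s y) +
          l2norm (greenConv' fun y => n s y - n' s y))) (by linarith))
    have b2 := (le_abs_self _).trans (abs_integral_flux_sub_le b (h.memLp_n s hs2)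
      (h.memLp_m s hs2) (h'.memLp_n s hs2) (h'.memLp_m s hs2) (hR s hs1).2 (hR s hs1).1
      (hR' s hs1).2
      (by linarith : _ ≤ l2norm (greenConv fun y => m s y - m' s y) +
        l2norm (greenConv' fun y => m s y - m' s y) +
        (l2norm (greenConv fun y => n s y - n' s y) +
          l2norm (greenConv' fun y => n s y - n' s y))) (by linarith))
    rw [hEeq s hs2]
    set p₁ := l2norm (greenConv fun y => m s y - m' s y)
    set p₂ := l2norm (greenConv' fun y => m s y - m' s y)
    set p₃ := l2norm (greenConv fun y => n s y - n' s y)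
    set p₄ := l2norm (greenConv' fun y => n s y - n' s y)
    have hsq : (p₁ + p₂ + (p₃ + p₄)) ^ 2 ≤ 4 * ((p₁ ^ 2 + p₂ ^ 2) + (p₃ ^ 2 + p₄ ^ 2)) := by
      nlinarith [sq_nonneg (p₁ - p₂), sq_nonneg (p₁ - p₃), sq_nonneg (p₁ - p₄),
        sq_nonneg (p₂ - p₃), sq_nonneg (p₂ - p₄), sq_nonneg (p₃ - p₄)]
    have hc : 0 ≤ (3 + |b|) * (32 * R ^ 2) := by positivity
    have := mul_le_mul_of_nonneg_left hsq hc
    simp only [hE', hK]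
    linarith
  have hcE : ContinuousOn E (Set.Icc 0 t) :=
    ((h.continuousOn_energy h').add (h.symm.continuousOn_energy h'.symm)).mono hsub
  -- Gronwall's inequality with an integrating factor. The function starts at zero, so the
  -- nonnegative energy vanishes at time `t`.
  have hanti : AntitoneOn (fun s => E s * Real.exp (-(K * s))) (Set.Icc 0 t) := by
    have hd2 : ∀ s ∈ Set.Ioo 0 t, HasDerivAt (fun s => E s * Real.exp (-(K * s)))
        (E' s * Real.exp (-(K * s)) + E s * (Real.exp (-(K * s)) * -(K * 1))) s := fun s hs =>
      (hd s hs).mul ((((hasDerivAt_id s).const_mul K).neg).exp)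
    refine antitoneOn_of_deriv_nonpos (convex_Icc 0 t) ?_ ?_ ?_
    · exact hcE.mul (by fun_prop)
    · rw [interior_Icc]
      exact fun s hs => (hd2 s hs).differentiableAt.differentiableWithinAt
    · rw [interior_Icc]
      intro s hs
      rw [(hd2 s hs).deriv]
      have := hle s hs
      have := Real.exp_pos (-(K * s))
      nlinarith
  have h0 : (0 : ℝ) ∈ timeInterval T := hsub ⟨le_rfl, ht.1⟩
  have hE0 : E 0 = 0 := by
    have e1 : greenConv (fun y => m 0 y - m' 0 y) = fun _ => 0 := funext fun x => by
      rw [greenConv_sub (h.memLp_m 0 h0) (h'.memLp_m 0 h0), hm0, sub_self]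
    have e2 : greenConv (fun y => n 0 y - n' 0 y) = fun _ => 0 := funext fun x => by
      rw [greenConv_sub (h.memLp_n 0 h0) (h'.memLp_n 0 h0), hn0, sub_self]
    simp [hE, e1, e2]
  have hfin := hanti ⟨le_rfl, ht.1⟩ ⟨ht.1, le_rfl⟩ ht.1
  simp only [hE0, zero_mul] at hfin
  have hEt : E t ≤ 0 := by
    have := Real.exp_pos (-(K * t))
    by_contra hcon
    push Not at hcon
    have := mul_pos hcon this
    linarith
  rw [hEeq t ht] at hEt
  have z : ∀ {a b c d : ℝ}, (a ^ 2 + b ^ 2) + (c ^ 2 + d ^ 2) ≤ 0 →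
      a = 0 ∧ b = 0 ∧ c = 0 ∧ d = 0 := fun {a b c d} H => by
    have := sq_nonneg a
    have := sq_nonneg b
    have := sq_nonneg c
    have := sq_nonneg d
    exact ⟨pow_eq_zero_iff two_ne_zero |>.1 (by linarith),
      pow_eq_zero_iff two_ne_zero |>.1 (by linarith),
      pow_eq_zero_iff two_ne_zero |>.1 (by linarith),
      pow_eq_zero_iff two_ne_zero |>.1 (by linarith)⟩
  obtain ⟨z1, z2, z3, z4⟩ := z hEt
  constructor <;> funext x
  · have := abs_greenConv_le_energy (hμ t ht) x
    rw [z1, z2, greenConv_sub (h.memLp_m t ht) (h'.memLp_m t ht)] at this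
    exact sub_eq_zero.1 (abs_nonpos_iff.1 (by linarith))
  · have := abs_greenConv_le_energy (hν t ht) x
    rw [z3, z4, greenConv_sub (h.memLp_n t ht) (h'.memLp_n t ht)] at this
    exact sub_eq_zero.1 (abs_nonpos_iff.1 (by linarith))

end IsMomentumCurve

/-! ### The `W^{1,∞}` norm in terms of the momentum -/

/-- The set on which the essential bound holds is dense, having full measure, and closed by
continuity, so it is the whole line. -/
theorem Continuous.enorm_le_eLpNorm_top {f : ℝ → ℝ} (hf : Continuous f) (x : ℝ) :
    ‖f x‖ₑ ≤ eLpNorm f ∞ volume := by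
  rw [eLpNorm_exponent_top]
  have h1 := Measure.dense_of_ae (ae_le_eLpNormEssSup (f := f) (μ := (volume : Measure ℝ)))
  have h2 : IsClosed {y | ‖f y‖ₑ ≤ eLpNormEssSup f volume} :=
    isClosed_le hf.enorm continuous_const
  have h3 := h1.closure_eq
  rw [h2.closure_eq] at h3
  exact Set.eq_univ_iff_forall.1 h3 x

theorem eLpNorm_top_le {f : ℝ → ℝ} {C : ℝ} (h : ∀ x, |f x| ≤ C) :
    eLpNorm f ∞ volume ≤ ENNReal.ofReal C := by
  rw [eLpNorm_exponent_top]
  exact eLpNormEssSup_le_of_ae_bound (ae_of_all _ h)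

/-- The `W^{1,∞}` norm of the potential of `m`, as a real number. -/
noncomputable def supNorm (m : ℝ → ℝ) : ℝ := (W1InftyNorm (greenConv m)).toReal

section supNorm

variable {m n : ℝ → ℝ}

theorem W1InftyNorm_greenConv (hm : MemLp m 2) : W1InftyNorm (greenConv m) =
    eLpNorm (greenConv m) ∞ volume + eLpNorm (greenConv' m) ∞ volume := by
  rw [W1InftyNorm, deriv_greenConv hm]

theorem W1InftyNorm_le (hm : MemLp m 2) :
    W1InftyNorm (greenConv m) ≤ ENNReal.ofReal (4 * l2norm m) := by
  have h0 := l2norm_nonneg m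
  rw [W1InftyNorm_greenConv hm, show 4 * l2norm m = 2 * l2norm m + 2 * l2norm m by ring,
    ENNReal.ofReal_add (by positivity) (by positivity)]
  exact add_le_add (eLpNorm_top_le (abs_greenConv_le hm)) (eLpNorm_top_le (abs_greenConv'_le hm))

theorem W1InftyNorm_ne_top (hm : MemLp m 2) : W1InftyNorm (greenConv m) ≠ ∞ :=
  ((W1InftyNorm_le hm).trans_lt ENNReal.ofReal_lt_top).ne

theorem supNorm_nonneg (m : ℝ → ℝ) : 0 ≤ supNorm m := ENNReal.toReal_nonneg

theorem abs_greenConv_le_supNorm (hm : MemLp m 2) (x : ℝ) : |greenConv m x| ≤ supNorm m := by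
  have h1 := ((continuous_greenConv hm).enorm_le_eLpNorm_top x).trans
    (le_self_add (b := eLpNorm (greenConv' m) ∞ volume))
  rw [← W1InftyNorm_greenConv hm] at h1
  simpa [supNorm] using ENNReal.toReal_mono (W1InftyNorm_ne_top hm) h1

theorem abs_greenConv'_le_supNorm (hm : MemLp m 2) (x : ℝ) : |greenConv' m x| ≤ supNorm m := by
  have h1 := ((continuous_greenConv' hm).enorm_le_eLpNorm_top x).trans
    (le_add_self (b := eLpNorm (greenConv m) ∞ volume))
  rw [← W1InftyNorm_greenConv hm] at h1
  simpa [supNorm] using ENNReal.toReal_mono (W1InftyNorm_ne_top hm) h1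

theorem supNorm_le_add (hm : MemLp m 2) (hn : MemLp n 2) :
    supNorm m ≤ supNorm n + 4 * l2norm fun x => m x - n x := by
  have hd : MemLp (fun x => m x - n x) 2 := hm.sub hn
  have e1 : greenConv m = greenConv n + greenConv fun x => m x - n x := by
    funext x; rw [Pi.add_apply, greenConv_sub hm hn]; ring
  have e2 : greenConv' m = greenConv' n + greenConv' fun x => m x - n x := by
    funext x; rw [Pi.add_apply, greenConv'_sub hm hn]; ring
  have h : W1InftyNorm (greenConv m) ≤ W1InftyNorm (greenConv n) +
      W1InftyNorm (greenConv fun x => m x - n x) := by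
    rw [W1InftyNorm_greenConv hm, W1InftyNorm_greenConv hn, W1InftyNorm_greenConv hd,
      add_add_add_comm, e1, e2]
    exact add_le_add
      (eLpNorm_add_le (continuous_greenConv hn).aestronglyMeasurable
        (continuous_greenConv hd).aestronglyMeasurable le_top)
      (eLpNorm_add_le (continuous_greenConv' hn).aestronglyMeasurable
        (continuous_greenConv' hd).aestronglyMeasurable le_top)
  have h0 : 0 ≤ 4 * l2norm fun x => m x - n x := mul_nonneg (by norm_num) (l2norm_nonneg _)
  have h2 := h.trans (add_le_add_right (W1InftyNorm_le hd) _)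
  have h3 := ENNReal.toReal_mono
    (ENNReal.add_ne_top.2 ⟨W1InftyNorm_ne_top hn, ENNReal.ofReal_ne_top⟩) h2
  rwa [ENNReal.toReal_add (W1InftyNorm_ne_top hn) ENNReal.ofReal_ne_top,
    ENNReal.toReal_ofReal h0] at h3

theorem abs_supNorm_sub_le (hm : MemLp m 2) (hn : MemLp n 2) :
    |supNorm m - supNorm n| ≤ 4 * l2norm fun x => m x - n x := by
  have h1 := supNorm_le_add hm hn
  have h2 := supNorm_le_add hn hm
  have e : l2norm (fun x => n x - m x) = l2norm fun x => m x - n x := by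
    rw [← norm_toLpR_sub hn hm, ← norm_toLpR_sub hm hn, norm_sub_rev]
  rw [e] at h2
  exact abs_sub_le_iff.2 ⟨by linarith, by linarith⟩

theorem ae_eq_of_greenConv_eq (hm : MemLp m 2) (hn : MemLp n 2)
    (h : greenConv m = greenConv n) : m =ᵐ[volume] n := by
  have h1 := deriv_deriv_greenConv hm
  rw [h] at h1
  filter_upwards [h1, deriv_deriv_greenConv hn] with x hx hx'
  rw [hx] at hx'
  linarith

end supNorm

/-! ### Growth of the momenta -/

namespace IsMomentumCurve

variable {b : ℝ} {T : ℝ≥0∞} {m n : ℝ → ℝ → ℝ}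

theorem mono (h : IsMomentumCurve b T m n) {S : ℝ≥0∞} (hS : S ≤ T) : IsMomentumCurve b S m n := by
  have hsub : timeInterval S ⊆ timeInterval T := fun s hs => ⟨hs.1, hs.2.trans_le hS⟩
  exact ⟨fun t ht => h.memLp_m t (hsub ht), fun t ht => h.memLp_n t (hsub ht),
    h.continuousOn_m.mono hsub, h.continuousOn_n.mono hsub,
    fun t ht x => (h.hasDeriv_m t (hsub ht) x).mono hsub,
    fun t ht x => (h.hasDeriv_n t (hsub ht) x).mono hsub⟩

theorem shift (h : IsMomentumCurve b T m n) {t₀ : ℝ} (h0 : 0 ≤ t₀) :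
    IsMomentumCurve b (T - ENNReal.ofReal t₀) (fun s => m (t₀ + s)) fun s => n (t₀ + s) := by
  have hmaps : Set.MapsTo (fun s => t₀ + s) (timeInterval (T - ENNReal.ofReal t₀))
      (timeInterval T) := fun s hs => ⟨add_nonneg h0 hs.1, by
    rw [ENNReal.ofReal_add h0 hs.1]
    exact lt_tsub_iff_left.1 hs.2⟩
  have hc : ContinuousOn (fun s => t₀ + s) (timeInterval (T - ENNReal.ofReal t₀)) := by fun_prop
  have hd : ∀ s, HasDerivWithinAt (fun s => t₀ + s) 1 (timeInterval (T - ENNReal.ofReal t₀)) s :=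
    fun s => ((hasDerivAt_id s).const_add t₀).hasDerivWithinAt
  refine ⟨fun t ht => h.memLp_m _ (hmaps ht), fun t ht => h.memLp_n _ (hmaps ht),
    h.continuousOn_m.comp hc hmaps, h.continuousOn_n.comp hc hmaps, fun t ht x => ?_,
    fun t ht x => ?_⟩
  · exact ((h.hasDeriv_m _ (hmaps ht) x).comp t (hd t) hmaps).congr_deriv (mul_one _)
  · exact ((h.hasDeriv_n _ (hmaps ht) x).comp t (hd t) hmaps).congr_deriv (mul_one _)

/-- A solution agrees with the characteristic flow started at any of its times. -/
theorem eq_lagMom (h : IsMomentumCurve b T m n) {t δ : ℝ} (ht : t ∈ timeInterval T)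
    {ζ k θ κ : ℝ → ℝ → ℝ} (hf : LagFlow b δ (m t) (n t) ζ k θ κ)
    (hm : Besov.besovSum (toLpC (m t)) < ∞) (hn : Besov.besovSum (toLpC (n t)) < ∞) {s : ℝ}
    (hs : s ∈ timeInterval (T - ENNReal.ofReal t)) (hs' : s ∈ timeInterval (ENNReal.ofReal δ)) :
    greenConv (m (t + s)) = greenConv (lagMom (m t) ζ k θ s) ∧
      greenConv (n (t + s)) = greenConv (lagMom (n t) ζ k κ s) := by
  obtain ⟨m', n', hM, he⟩ := (hf.isSolution hm hn).exists_momentum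
  have h0 : (0 : ℝ) ∈ timeInterval (ENNReal.ofReal δ) := ⟨le_rfl, by simpa using hf.pos⟩
  have e0 := he 0 h0
  simp only [hf.lagMom_zero, hf.symm.lagMom_zero] at e0
  obtain ⟨e1, e2⟩ := he s hs'
  -- Uniqueness compares two curves on the same interval, so both are restricted to the shorter of
  -- the two lifetimes.
  have := ((h.shift ht.1).mono (min_le_left _ (ENNReal.ofReal δ))).unique
    (hM.mono (min_le_right _ _)) (by simpa using e0.1) (by simpa using e0.2)
    (t := s) ⟨hs.1, lt_min hs.2 hs'.2⟩
  exact ⟨this.1.trans e1.symm, this.2.trans e2.symm⟩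

/-- A solution is not known to be differentiable in `L²` at the level of the momentum. To the right
of `t`, however, it coincides with the characteristic flow started at `t`, whose `L²` norms have a
computable derivative at the starting time. -/
theorem exists_hasDerivWithinAt_l2norm (h : IsMomentumCurve b T m n) {t : ℝ}
    (ht : t ∈ timeInterval T)
    (hm : Besov.besovSum (toLpC (m t)) < ∞) (hn : Besov.besovSum (toLpC (n t)) < ∞) :
    ∃ D, HasDerivWithinAt (fun s => l2norm (m s) ^ 2 + l2norm (n s) ^ 2) D (Set.Ici t) t ∧
      D ≤ (2 + 2 * |b|) * (supNorm (m t) * supNorm (n t)) *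
        (l2norm (m t) ^ 2 + l2norm (n t) ^ 2) := by
  have m2 := h.memLp_m t ht
  have n2 := h.memLp_n t ht
  obtain ⟨δ, hδ, H⟩ := exists_lagFlow b (max (l2norm (m t)) (l2norm (n t)))
  obtain ⟨ζ, k, θ, κ, hf⟩ := H (m t) (n t) m2 n2 (le_max_left _ _) (le_max_right _ _)
  obtain ⟨D₁, hD₁, hD₁'⟩ := hf.exists_hasDerivAt_integral_sq (abs_greenConv_le_supNorm m2)
    (abs_greenConv'_le_supNorm m2) (abs_greenConv_le_supNorm n2) (abs_greenConv'_le_supNorm n2)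
  obtain ⟨D₂, hD₂, hD₂'⟩ := hf.symm.exists_hasDerivAt_integral_sq (abs_greenConv_le_supNorm n2)
    (abs_greenConv'_le_supNorm n2) (abs_greenConv_le_supNorm m2) (abs_greenConv'_le_supNorm m2)
  rw [integral_sq_eq_l2norm m2] at hD₁'
  rw [integral_sq_eq_l2norm n2, mul_comm (supNorm (n t))] at hD₂'
  refine ⟨D₁ + D₂, ?_, by linarith⟩
  have hD : HasDerivAt (fun s => (∫ y, lagMom (m t) ζ k θ (s - t) y ^ 2) +
      ∫ y, lagMom (n t) ζ k κ (s - t) y ^ 2) (D₁ + D₂) t := by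
    refine HasDerivAt.comp_sub_const (f := fun s => (∫ y, lagMom (m t) ζ k θ s y ^ 2) +
      ∫ y, lagMom (n t) ζ k κ s y ^ 2) t t ?_
    rw [sub_self]
    exact hD₁.add hD₂
  have key : ∀ s, t ≤ s → s < t + δ → s ∈ timeInterval T →
      l2norm (m s) ^ 2 + l2norm (n s) ^ 2 = (∫ y, lagMom (m t) ζ k θ (s - t) y ^ 2) +
      ∫ y, lagMom (n t) ζ k κ (s - t) y ^ 2 := by
    intro s hts hsδ hsT
    have hs0 : 0 ≤ s - t := sub_nonneg.2 hts
    have hs1 : s - t ∈ timeInterval (T - ENNReal.ofReal t) := ⟨hs0, by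
      rw [lt_tsub_iff_left, ← ENNReal.ofReal_add ht.1 hs0, add_sub_cancel]; exact hsT.2⟩
    have hs2 : s - t ∈ timeInterval (ENNReal.ofReal δ) :=
      ⟨hs0, (ENNReal.ofReal_lt_ofReal_iff_of_nonneg hs0).2 (by linarith)⟩
    obtain ⟨e1, e2⟩ := h.eq_lagMom ht hf hm hn hs1 hs2
    rw [add_sub_cancel] at e1 e2
    have hI := LagFlow.mem_Ioo_of_timeInterval hs2
    have a1 := ae_eq_of_greenConv_eq (h.memLp_m s hsT) (hf.memLp_lagMom hI) e1
    have a2 := ae_eq_of_greenConv_eq (h.memLp_n s hsT) (hf.symm.memLp_lagMom hI) e2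
    rw [← integral_sq_eq_l2norm (h.memLp_m s hsT), ← integral_sq_eq_l2norm (h.memLp_n s hsT)]
    congr 1
    · exact integral_congr_ae (a1.mono fun x hx => by simp only [hx])
    · exact integral_congr_ae (a2.mono fun x hx => by simp only [hx])
  refine (hD.hasDerivWithinAt (s := Set.Ici t)).congr_of_eventuallyEq ?_
    (key t le_rfl (by linarith) ht)
  have h1 : ContinuousAt ENNReal.ofReal t := ENNReal.continuous_ofReal.continuousAt
  filter_upwards [self_mem_nhdsWithin, nhdsWithin_le_nhds (gt_mem_nhds (by linarith : t < t + δ)),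
    nhdsWithin_le_nhds (h1.eventually (gt_mem_nhds ht.2))] with s hs1 hs2 hs3
  exact key s hs1 hs2 ⟨ht.1.trans hs1, hs3⟩

theorem continuousOn_supNorm (h : IsMomentumCurve b T m n) :
    ContinuousOn (fun t => supNorm (m t)) (timeInterval T) :=
  ContinuousOn.of_norm_sub_le (C := 4) h.continuousOn_m h.continuousOn_m fun x hx y hy => by
    rw [norm_toLpR_sub (h.memLp_m x hx) (h.memLp_m y hy)]
    have h1 := abs_supNorm_sub_le (h.memLp_m x hx) (h.memLp_m y hy)
    have := l2norm_nonneg fun z => m x z - m y z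
    rw [Real.norm_eq_abs]
    linarith

theorem continuousOn_l2norm (h : IsMomentumCurve b T m n) :
    ContinuousOn (fun t => l2norm (m t)) (timeInterval T) :=
  h.continuousOn_m.norm.congr fun t ht => (norm_toLpR (h.memLp_m t ht)).symm

/-- Gronwall's inequality from right derivatives only: `H e^{-K Λ}` has nonpositive right
derivative, where `Λ` is the primitive of the product of the two `W^{1,∞}` norms. -/
theorem l2norm_sq_le (h : IsMomentumCurve b T m n)
    (hm : ∀ t ∈ timeInterval T, Besov.besovSum (toLpC (m t)) < ∞)
    (hn : ∀ t ∈ timeInterval T, Besov.besovSum (toLpC (n t)) < ∞) {I : ℝ}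
    (hI : ∀ t ∈ timeInterval T, ∫ s in (0 : ℝ)..t, supNorm (m s) * supNorm (n s) ≤ I) {t : ℝ}
    (ht : t ∈ timeInterval T) : l2norm (m t) ^ 2 + l2norm (n t) ^ 2 ≤
      (l2norm (m 0) ^ 2 + l2norm (n 0) ^ 2) * Real.exp ((2 + 2 * |b|) * I) := by
  have hsub := Icc_subset_timeInterval ht
  set K := 2 + 2 * |b| with hK
  have hK0 : 0 ≤ K := by positivity
  set N : ℝ → ℝ := fun s => supNorm (m s) * supNorm (n s) with hN
  have hNc : ContinuousOn N (Set.Icc 0 t) :=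
    (h.continuousOn_supNorm.mul h.symm.continuousOn_supNorm).mono hsub
  -- The product of norms is continuous on `[0, t]` only; extending it by its end values makes the
  -- primitive differentiable everywhere, including at the end points.
  set N' : ℝ → ℝ := Set.IccExtend ht.1 ((Set.Icc 0 t).domRestrict N) with hN'
  have hN'c : Continuous N' := hNc.domRestrict.Icc_extend'
  have hN'eq : ∀ s ∈ Set.Icc 0 t, N' s = N s := fun s hs =>
    Set.IccExtend_of_mem ht.1 ((Set.Icc 0 t).domRestrict N) hs
  set Λ : ℝ → ℝ := fun s => ∫ r in (0 : ℝ)..s, N' r with hΛ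
  have hΛd : ∀ s, HasDerivAt Λ (N' s) s := fun s =>
    intervalIntegral.integral_hasDerivAt_right (hN'c.intervalIntegrable _ _)
      (hN'c.stronglyMeasurableAtFilter _ _) hN'c.continuousAt
  have hΛt : Λ t ≤ I := by
    refine le_trans (le_of_eq ?_) (hI t ht)
    refine intervalIntegral.integral_congr fun s hs => ?_
    rw [Set.uIcc_of_le ht.1] at hs
    exact hN'eq s hs
  set H : ℝ → ℝ := fun s => l2norm (m s) ^ 2 + l2norm (n s) ^ 2 with hH
  have hHc : ContinuousOn H (Set.Icc 0 t) :=
    ((h.continuousOn_l2norm.pow 2).add (h.symm.continuousOn_l2norm.pow 2)).mono hsub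
  have hD : ∀ s, ∃ D, s ∈ Set.Ico 0 t → HasDerivWithinAt H D (Set.Ici s) s ∧
      D ≤ K * N' s * H s := fun s => by
    by_cases hs : s ∈ Set.Ico 0 t
    · have hs1 := Set.Ico_subset_Icc_self hs
      obtain ⟨D, h1, h2⟩ := h.exists_hasDerivWithinAt_l2norm (hsub hs1) (hm s (hsub hs1))
        (hn s (hsub hs1))
      exact ⟨D, fun _ => ⟨h1, by rw [hN'eq s hs1]; exact h2⟩⟩
    · exact ⟨0, fun h => absurd h hs⟩
  choose D hD using hD
  have hΛ0 : Λ 0 = 0 := intervalIntegral.integral_same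
  have key := image_le_of_deriv_right_le_deriv_boundary
    (f := fun s => H s * Real.exp (-(K * Λ s)))
    (f' := fun s => D s * Real.exp (-(K * Λ s)) + H s * (Real.exp (-(K * Λ s)) * -(K * N' s)))
    (a := 0) (b := t) (B := fun _ => H 0) (B' := fun _ => 0)
    (hHc.mul (Real.continuous_exp.comp (continuous_const.mul (continuous_iff_continuousAt.2
      fun s => (hΛd s).continuousAt)).neg).continuousOn)
    (fun s hs => (hD s hs).1.mul ((((hΛd s).const_mul K).neg).exp).hasDerivWithinAt)
    (by simp [hΛ0]) continuousOn_const (fun s _ => hasDerivWithinAt_const _ _ _)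
    (fun s hs => by
      have h1 := (hD s hs).2
      have h2 := Real.exp_pos (-(K * Λ s))
      have h3 := mul_le_mul_of_nonneg_right h1 h2.le
      linarith) (x := t) ⟨ht.1, le_rfl⟩
  have hH0 : 0 ≤ H 0 := by positivity
  have e : H t = H t * Real.exp (-(K * Λ t)) * Real.exp (K * Λ t) := by
    rw [mul_assoc, ← Real.exp_add, neg_add_cancel, Real.exp_zero, mul_one]
  calc H t = _ := e
    _ ≤ H 0 * Real.exp (K * Λ t) := mul_le_mul_of_nonneg_right key (Real.exp_pos _).le
    _ ≤ H 0 * Real.exp (K * I) := by gcongr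

end IsMomentumCurve

/-! ### Continuation of solutions -/

section glue

variable {T T' S : ℝ≥0∞} {t₀ t s d : ℝ}

theorem nhdsWithin_timeInterval (hT : T ≤ T') (ht : t ∈ timeInterval T) :
    𝓝[timeInterval T'] t = 𝓝[timeInterval T] t := by
  have h1 : ContinuousAt ENNReal.ofReal t := ENNReal.continuous_ofReal.continuousAt
  have h2 : timeInterval T = timeInterval T' ∩ {s | ENNReal.ofReal s < T} := by
    ext s
    exact ⟨fun h => ⟨⟨h.1, h.2.trans_le hT⟩, h.2⟩, fun h => ⟨h.1.1, h.2⟩⟩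
  rw [h2, nhdsWithin_inter_of_mem' (nhdsWithin_le_nhds (h1.eventually (gt_mem_nhds ht.2)))]

/-- A time not covered by the first solution lies at a positive time `s` of the second. The strict
sign makes it an interior point there, so one-sided limits and derivatives become two-sided before
being shifted by `t₀`. -/
theorem timeInterval_cases (h0 : 0 ≤ t₀) (hT : ENNReal.ofReal t₀ < T)
    (ht : t ∈ timeInterval (ENNReal.ofReal t₀ + S)) :
    t ∈ timeInterval T ∨ ∃ s ∈ timeInterval S, 0 < s ∧ t = t₀ + s := by
  by_cases h : ENNReal.ofReal t < T
  · exact Or.inl ⟨ht.1, h⟩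
  · have h1 : t₀ < t := (ENNReal.ofReal_lt_ofReal_iff'.1 (hT.trans_le (not_lt.1 h))).1
    have h2 : 0 ≤ t - t₀ := by linarith
    refine Or.inr ⟨t - t₀, ⟨h2, ?_⟩, by linarith, by ring⟩
    have h3 := ht.2
    rw [show t = t₀ + (t - t₀) by ring, ENNReal.ofReal_add h0 h2] at h3
    exact (ENNReal.add_lt_add_iff_left ENNReal.ofReal_ne_top).1 h3

theorem eventually_sub_mem_timeInterval (hs : s ∈ timeInterval S) (h0 : 0 < s) :
    ∀ᶠ q in 𝓝 (t₀ + s), q - t₀ ∈ timeInterval S := by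
  have h : Tendsto (fun q => q - t₀) (𝓝 (t₀ + s)) (𝓝 s) := by
    have : Continuous fun q : ℝ => q - t₀ := by fun_prop
    simpa using this.tendsto (t₀ + s)
  exact h.eventually (timeInterval_mem_nhds h0 hs)

theorem HasDerivWithinAt.glue_left {f g : ℝ → ℝ} (hT : T ≤ T') (ht : t ∈ timeInterval T)
    (h : HasDerivWithinAt f d (timeInterval T) t) (e : ∀ s ∈ timeInterval T, g s = f s) :
    HasDerivWithinAt g d (timeInterval T') t := by
  have h1 := h.congr_of_mem e ht
  rwa [HasDerivWithinAt, ← nhdsWithin_timeInterval hT ht] at h1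

theorem HasDerivWithinAt.glue_right {f g : ℝ → ℝ} {A : Set ℝ} (hs : s ∈ timeInterval S)
    (h0 : 0 < s) (h : HasDerivWithinAt f d (timeInterval S) s)
    (e : ∀ q ∈ timeInterval S, g (t₀ + q) = f q) : HasDerivWithinAt g d A (t₀ + s) := by
  have h1 := h.hasDerivAt (timeInterval_mem_nhds h0 hs)
  rw [← add_sub_cancel_left t₀ s] at h1
  have h2 := HasDerivAt.comp_sub_const (t₀ + s) t₀ h1
  refine (h2.congr_of_eventuallyEq ?_).hasDerivWithinAt
  filter_upwards [eventually_sub_mem_timeInterval hs h0] with q hq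
  rw [← e _ hq, add_sub_cancel]

theorem GengXue.IsBesovCurve.glue {w z w' : ℝ → ℝ → ℝ} (hw : IsBesovCurve T w)
    (hz : IsBesovCurve S z) (h0 : 0 ≤ t₀) (hT : ENNReal.ofReal t₀ < T)
    (hTS : T ≤ ENNReal.ofReal t₀ + S) (h1 : ∀ t ∈ timeInterval T, w' t = w t)
    (h2 : ∀ s ∈ timeInterval S, w' (t₀ + s) = z s) :
    IsBesovCurve (ENNReal.ofReal t₀ + S) w' where
  continuous_space t ht := by
    rcases timeInterval_cases h0 hT ht with h | ⟨s, hs, -, rfl⟩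
    · rw [h1 t h]; exact hw.continuous_space t h
    · rw [h2 s hs]; exact hz.continuous_space s hs
  mem t ht := by
    rcases timeInterval_cases h0 hT ht with h | ⟨s, hs, -, rfl⟩
    · rw [h1 t h]; exact hw.mem t h
    · rw [h2 s hs]; exact hz.mem s hs
  continuous_time t ht := by
    rcases timeInterval_cases h0 hT ht with h | ⟨s, hs, hs0, rfl⟩
    · rw [nhdsWithin_timeInterval hTS h]
      refine (hw.continuous_time t h).congr' ?_
      filter_upwards [self_mem_nhdsWithin] with q hq
      rw [h1 q hq, h1 t h]
    · have hc := hz.continuous_time s hs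
      rw [nhdsWithin_eq_nhds.2 (timeInterval_mem_nhds hs0 hs)] at hc
      have h : Tendsto (fun q => q - t₀) (𝓝 (t₀ + s)) (𝓝 s) := by
        have : Continuous fun q : ℝ => q - t₀ := by fun_prop
        simpa using this.tendsto (t₀ + s)
      refine Tendsto.mono_left ((hc.comp h).congr' ?_) nhdsWithin_le_nhds
      filter_upwards [eventually_sub_mem_timeInterval hs hs0] with q hq
      have e := h2 _ hq
      rw [add_sub_cancel] at e
      rw [h2 s hs, e, Function.comp]

/-- Two solutions which agree on an overlap define a solution on the union. -/
theorem GengXue.IsSolution.glue {F : (ℝ → ℝ) → (ℝ → ℝ) → ℝ → ℝ} {u₀ v₀ u₁ v₁ : ℝ → ℝ}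
    {u v p q u' v' : ℝ → ℝ → ℝ} (h : IsSolution F u₀ v₀ T u v) (h' : IsSolution F u₁ v₁ S p q)
    (h0 : 0 ≤ t₀) (hT : ENNReal.ofReal t₀ < T) (hTS : T ≤ ENNReal.ofReal t₀ + S)
    (hu : ∀ t ∈ timeInterval T, u' t = u t) (hv : ∀ t ∈ timeInterval T, v' t = v t)
    (hp : ∀ s ∈ timeInterval S, u' (t₀ + s) = p s)
    (hq : ∀ s ∈ timeInterval S, v' (t₀ + s) = q s) :
    IsSolution F u₀ v₀ (ENNReal.ofReal t₀ + S) u' v' where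
  curve_u := h.curve_u.glue h'.curve_u h0 hT hTS hu hp
  curve_v := h.curve_v.glue h'.curve_v h0 hT hTS hv hq
  initial_u := by
    rw [hu 0 ⟨le_rfl, by simpa using bot_lt_of_lt hT⟩]; exact h.initial_u
  initial_v := by
    rw [hv 0 ⟨le_rfl, by simpa using bot_lt_of_lt hT⟩]; exact h.initial_v
  eq_u t ht x := by
    rcases timeInterval_cases h0 hT ht with ht' | ⟨s, hs, hs0, rfl⟩
    · rw [hu t ht', hv t ht']
      exact (h.eq_u t ht' x).glue_left hTS ht' fun s hs => by rw [hu s hs]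
    · rw [hp s hs, hq s hs]
      exact (h'.eq_u s hs x).glue_right hs hs0 fun r hr => by rw [hp r hr]
  eq_v t ht x := by
    rcases timeInterval_cases h0 hT ht with ht' | ⟨s, hs, hs0, rfl⟩
    · rw [hu t ht', hv t ht']
      exact (h.eq_v t ht' x).glue_left hTS ht' fun s hs => by rw [hv s hs]
    · rw [hp s hs, hq s hs]
      exact (h'.eq_v s hs x).glue_right hs hs0 fun r hr => by rw [hq r hr]

end glue

/-- If the momenta stay bounded in `L²` on a bounded time interval, the solution extends. -/
theorem GengXue.IsMaximalSolution.eq_top_of_l2norm_le {b : ℝ} {u₀ v₀ : ℝ → ℝ} {T : ℝ≥0∞}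
    {u v m n : ℝ → ℝ → ℝ} (h : IsMaximalSolution (bForcing b) u₀ v₀ T u v)
    (hM : IsMomentumCurve b T m n)
    (he : ∀ t ∈ timeInterval T, u t = greenConv (m t) ∧ v t = greenConv (n t))
    (hm : ∀ t ∈ timeInterval T, Besov.besovSum (toLpC (m t)) < ∞)
    (hn : ∀ t ∈ timeInterval T, Besov.besovSum (toLpC (n t)) < ∞) {R : ℝ}
    (hR : ∀ t ∈ timeInterval T, l2norm (m t) ≤ R ∧ l2norm (n t) ≤ R) : T = ∞ := by
  by_contra hT
  obtain ⟨δ, hδ, H⟩ := exists_lagFlow b R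
  have hTpos : 0 < T.toReal := ENNReal.toReal_pos h.pos.ne' hT
  -- The lifespan `δ` was fixed from `R` and `b` before the restarting time is chosen, so a restart
  -- within `δ / 2` of `T` survives beyond `T`. The maximum with `0` covers the case `T < δ / 2`.
  set t₀ := max 0 (T.toReal - δ / 2)
  have h0 : 0 ≤ t₀ := le_max_left _ _
  have hlt : t₀ < T.toReal := max_lt hTpos (by linarith)
  have hge : T.toReal < t₀ + δ := by
    have := le_max_right 0 (T.toReal - δ / 2)
    linarith
  have hT0 : ENNReal.ofReal t₀ < T := (ENNReal.ofReal_lt_iff_lt_toReal h0 hT).2 hlt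
  have hmem : t₀ ∈ timeInterval T := ⟨h0, hT0⟩
  have hTS : T < ENNReal.ofReal t₀ + ENNReal.ofReal δ := by
    rw [← ENNReal.ofReal_add h0 hδ.le]
    exact (ENNReal.lt_ofReal_iff_toReal_lt hT).2 hge
  obtain ⟨ζ, k, θ, κ, hf⟩ := H (m t₀) (n t₀) (hM.memLp_m t₀ hmem) (hM.memLp_n t₀ hmem)
    (hR t₀ hmem).1 (hR t₀ hmem).2
  have hsol := hf.isSolution (hm t₀ hmem) (hn t₀ hmem)
  have hkey : ∀ s ∈ timeInterval (ENNReal.ofReal δ), t₀ + s ∈ timeInterval T →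
      u (t₀ + s) = greenConv (lagMom (m t₀) ζ k θ s) ∧
      v (t₀ + s) = greenConv (lagMom (n t₀) ζ k κ s) := fun s hs hts => by
    rw [(he _ hts).1, (he _ hts).2]
    refine hM.eq_lagMom hmem hf (hm t₀ hmem) (hn t₀ hmem) ⟨hs.1, ?_⟩ hs
    rw [lt_tsub_iff_left, ← ENNReal.ofReal_add h0 hs.1]
    exact hts.2
  classical
  -- The old solution is kept on all of `[0, T)`, as maximality demands of an extension; on the
  -- overlap the restarted flow agrees with it by uniqueness.
  set u' : ℝ → ℝ → ℝ := fun t => if t ∈ timeInterval T then u t else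
    greenConv (lagMom (m t₀) ζ k θ (t - t₀))
  set v' : ℝ → ℝ → ℝ := fun t => if t ∈ timeInterval T then v t else
    greenConv (lagMom (n t₀) ζ k κ (t - t₀))
  have hu : ∀ t ∈ timeInterval T, u' t = u t := fun t ht => if_pos ht
  have hv : ∀ t ∈ timeInterval T, v' t = v t := fun t ht => if_pos ht
  refine absurd (h.maximal _ u' v' (h.isSolution.glue hsol h0 hT0 hTS.le hu hv
    (fun s hs => ?_) (fun s hs => ?_)) fun t ht => ⟨hu t ht, hv t ht⟩) (not_le.2 hTS)
  · by_cases hts : t₀ + s ∈ timeInterval T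
    · rw [hu _ hts, (hkey s hs hts).1]
    · refine (if_neg hts).trans ?_
      rw [add_sub_cancel_left]
  · by_cases hts : t₀ + s ∈ timeInterval T
    · rw [hv _ hts, (hkey s hs hts).2]
    · refine (if_neg hts).trans ?_
      rw [add_sub_cancel_left]

/-- The blow-up criterion for the two-component `b`-family. -/
theorem GengXue.IsMaximalSolution.lintegral_eq_top {b : ℝ} {u₀ v₀ : ℝ → ℝ} {T : ℝ≥0∞}
    {u v : ℝ → ℝ → ℝ} (h : IsMaximalSolution (bForcing b) u₀ v₀ T u v) (hT : T < ∞) :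
    ∫⁻ t in timeInterval T, W1InftyNorm (u t) * W1InftyNorm (v t) = ∞ := by
  by_contra hfin
  obtain ⟨m, n, hM, he⟩ := h.isSolution.exists_momentum
  have hm : ∀ t ∈ timeInterval T, Besov.besovSum (toLpC (m t)) < ∞ := fun t ht => by
    have h1 := h.isSolution.curve_u.mem t ht
    rw [(he t ht).1] at h1
    exact (Besov.besovSum_le_fnNorm (hM.memLp_m t ht)).trans_lt (ENNReal.mul_lt_top (by simp) h1)
  have hn : ∀ t ∈ timeInterval T, Besov.besovSum (toLpC (n t)) < ∞ := fun t ht => by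
    have h1 := h.isSolution.curve_v.mem t ht
    rw [(he t ht).2] at h1
    exact (Besov.besovSum_le_fnNorm (hM.memLp_n t ht)).trans_lt (ENNReal.mul_lt_top (by simp) h1)
  set I := (∫⁻ t in timeInterval T, W1InftyNorm (u t) * W1InftyNorm (v t)).toReal
  have hI : ∀ t ∈ timeInterval T, ∫ s in (0 : ℝ)..t, supNorm (m s) * supNorm (n s) ≤ I := by
    intro t ht
    have hsub := Set.Ioc_subset_Icc_self.trans (Icc_subset_timeInterval ht)
    have hc : ContinuousOn (fun s => supNorm (m s) * supNorm (n s)) (Set.Ioc 0 t) :=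
      (hM.continuousOn_supNorm.mul hM.symm.continuousOn_supNorm).mono hsub
    rw [intervalIntegral.integral_of_le ht.1, integral_eq_lintegral_of_nonneg_ae
      (ae_of_all _ fun s => mul_nonneg (supNorm_nonneg _) (supNorm_nonneg _))
      (hc.aestronglyMeasurable measurableSet_Ioc)]
    refine ENNReal.toReal_mono hfin (le_trans ?_ (lintegral_mono_set hsub))
    refine setLIntegral_mono' measurableSet_Ioc fun s hs => ?_
    have hs := hsub hs
    rw [ENNReal.ofReal_mul (supNorm_nonneg _), supNorm, supNorm,
      ENNReal.ofReal_toReal (W1InftyNorm_ne_top (hM.memLp_m s hs)),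
      ENNReal.ofReal_toReal (W1InftyNorm_ne_top (hM.memLp_n s hs)), (he s hs).1, (he s hs).2]
  -- A finite integral bounds both momenta in `L²` by the square root of `Q` up to time `T`; this
  -- would force `T = ∞`.
  set Q := (l2norm (m 0) ^ 2 + l2norm (n 0) ^ 2) * Real.exp ((2 + 2 * |b|) * I)
  have hQ0 : 0 ≤ Q := by positivity
  refine hT.ne (h.eq_top_of_l2norm_le hM he hm hn (R := Real.sqrt Q) fun t ht => ?_)
  have h1 := hM.l2norm_sq_le hm hn hI ht
  exact ⟨Real.le_sqrt_of_sq_le (by linarith [sq_nonneg (l2norm (n t))]),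
    Real.le_sqrt_of_sq_le (by linarith [sq_nonneg (l2norm (m t))])⟩

/-- The Geng–Xue system is the member `b = 3` of the family. -/
theorem forcing_eq_bForcing : forcing = bForcing 3 := by
  funext u v x
  rw [forcing, bForcing]
  ring

theorem theorem1p1 :
    (∀ (u₀ v₀ : ℝ → ℝ) (T : ℝ≥0∞) (u v : ℝ → ℝ → ℝ),
      Besov.Mem 2 2 1 u₀ → Besov.Mem 2 2 1 v₀ →
      GengXue.IsMaximalSolution GengXue.forcing u₀ v₀ T u v → T < ∞ →
      ∫⁻ t in GengXue.timeInterval T,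
        GengXue.W1InftyNorm (u t) * GengXue.W1InftyNorm (v t) = ∞) ∧
    (∀ (b : ℝ) (u₀ v₀ : ℝ → ℝ) (T : ℝ≥0∞) (u v : ℝ → ℝ → ℝ),
      Besov.Mem 2 2 1 u₀ → Besov.Mem 2 2 1 v₀ →
      GengXue.IsMaximalSolution (GengXue.bForcing b) u₀ v₀ T u v → T < ∞ →
      ∫⁻ t in GengXue.timeInterval T,
        GengXue.W1InftyNorm (u t) * GengXue.W1InftyNorm (v t) = ∞) := by
  refine ⟨fun u₀ v₀ T u v _ _ h hT => ?_, fun b u₀ v₀ T u v _ _ h hT => h.lintegral_eq_top hT⟩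
  rw [forcing_eq_bForcing] at h
  exact h.lintegral_eq_top hT
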